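/- A \emph{polygon} $P$ is a finite, pure, connected simplicial 2-complex in which the link of every vertex is a path, realized with non-degenerate Euclidean triangles so that its interior isometrically embeds into the plane (for instance, a simple polygon, convex or not). Its boundary edges, i.e. the edges contained in exactly one triangle, are labeled by pairwise different letters of an alphabet $\mathcal A$. A billiard trajectory on $P$ moves along straight lines at unit speed in the interior of $P$ and undergoes optical reflection at the boundary edges; a bi-infinite (respectively forward) trajectory is \emph{singular} if it ever hits a vertex of $P$. The \emph{bounce spectrum} $\mathsf B(P)\subseteq \mathcal A^{\mathbb Z}$ is the set of the bi-infinite sequences of labels of the edges successively hit by $\tau(p,\theta)$, over all $(p,\theta)\in P\times S^1$ whose bi-infinite trajectory $\tau(p,\theta)$ is nonsingular. The \emph{forward bounce spectrum} $\mathsf B_+(P)\subseteq\mathcal A^{\mathbb N}$ is the set of the sequences of labels of the edges successively hit by the forward trajectory $\tau_+(p,\theta)$, over all $(p,\theta)\in P\times S^1$ for which $\tau_+(p,\theta)$ is nonsingular; if $p$ lies on a boundary edge, that edge is not recorded as the first bounce. Let $P$ and $P'$ be polygons whose edges are labeled by the same alphabet $\mathcal A$. Then $$\mathsf B(P)=\mathsf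 B(P')\quad\text{if and only if}\quad \mathsf B_+(P)=\mathsf B_+(P').$$ -/

import Mathlib

/-- The Euclidean plane. -/
abbrev Plane : Type := EuclideanSpace ℝ (Fin 2)

/-- A marked polygonal billiard table in the plane: a finite, pure, connected simplicial
2-complex on the vertex set `V` in which the link of every vertex is a path, with a Euclidean
realization whose interior isometrically embeds into the plane, and whose boundary edges carry
pairwise different labels from the alphabet `𝒜`.

The realization is given by the positions `pos` of the vertices in the plane. Vertices of the
complex all lie on its boundary, so its interior consists of the open triangles and of the open
edges shared by two triangles; the map to the plane is injective there exactly when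
distinct triangles have disjoint interiors. The boundary need not be embedded. Simple polygons
and polygons with polygonal holes, convex or not, are examples. -/
structure PolygonalTable (V 𝒜 : Type*) where
  /-- the triangles of the complex -/
  faces : Finset (Finset V)
  card_face : ∀ f ∈ faces, f.card = 3
  /-- the complex is pure: every vertex lies in a triangle -/
  pure_complex : ∀ v : V, ∃ f ∈ faces, v ∈ f
  /-- the complex is connected (and nonempty): its `1`-skeleton is a connected graph -/
  connected_complex :
    (SimpleGraph.fromRel fun v w : V => ∃ f ∈ faces, v ∈ f ∧ w ∈ f).Connected
  /-- the link of every vertex is a path -/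
  link_path : ∀ v : V, ∃ n : ℕ, Nonempty
    ((SimpleGraph.fromRel fun a b : {a : V // a ≠ v ∧ ∃ f ∈ faces, v ∈ f ∧ a ∈ f} =>
      ∃ f ∈ faces, v ∈ f ∧ a.1 ∈ f ∧ b.1 ∈ f) ≃g SimpleGraph.pathGraph n)
  /-- the position of the vertices in the plane -/
  pos : V → Plane
  /-- the triangles are non-degenerate -/
  nondegenerate : ∀ f ∈ faces, AffineIndependent ℝ fun v : f => pos v
  /-- the interior of the complex is mapped injectively into the plane -/
  interior_embedded : ∀ f ∈ faces, ∀ g ∈ faces, f ≠ g →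
    Disjoint (interior (convexHull ℝ (pos '' (f : Set V))))
      (interior (convexHull ℝ (pos '' (g : Set V))))
  /-- boundary edges (those contained in exactly one triangle) have pairwise different labels -/
  label : {e : Finset V // e.card = 2 ∧ ∃! f, f ∈ faces ∧ e ⊆ f} ↪ 𝒜

namespace PolygonalTable

variable {V 𝒜 : Type*} (P : PolygonalTable V 𝒜)

/-- The boundary edges of the table: the edges contained in exactly one triangle. -/
abbrev BoundaryEdge : Type _ := {e : Finset V // e.card = 2 ∧ ∃! f, f ∈ P.faces ∧ e ⊆ f}

/-- The edge `e` without its endpoints, as a subset of the plane. -/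
def openEdge (e : Finset V) : Set Plane :=
  {x | ∃ a ∈ e, ∃ b ∈ e, a ≠ b ∧ x ∈ openSegment ℝ (P.pos a) (P.pos b)}

/-- The interior of the table: the points in an open triangle, or in an open edge that is
shared by two triangles. -/
def region : Set Plane :=
  {x | (∃ f ∈ P.faces, x ∈ interior (convexHull ℝ (P.pos '' (f : Set V)))) ∨
    ∃ e : Finset V, e.card = 2 ∧ (∃ f ∈ P.faces, ∃ g ∈ P.faces, f ≠ g ∧ e ⊆ f ∧ e ⊆ g) ∧
      x ∈ P.openEdge e}

/-- `x` lies strictly on the inner side of the line through the boundary edge `e`, i.e. on the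
side of the triangle that contains `e`. -/
def InnerSide (e : P.BoundaryEdge) (x : Plane) : Prop :=
  ∃ f ∈ P.faces, e.1 ⊆ f ∧ ∃ c ∈ f, c ∉ e.1 ∧
    (affineSpan ℝ (P.pos '' (e.1 : Set V))).SSameSide x (P.pos c)

/-- Starting at `x` in direction `u`, the straight motion stays in the interior of the table until
it hits the boundary for the first time, which happens at the point `y`, in the relative interior
of the edge `e` and from the inner side of `e`. -/
def Flies (x u : Plane) (e : P.BoundaryEdge) (y : Plane) : Prop :=
  (∃ t : ℝ, 0 < t ∧ y = x + t • u) ∧ openSegment ℝ x y ⊆ P.region ∧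
    y ∈ P.openEdge e.1 ∧ P.InnerSide e x

/-- The direction after optical reflection, at the edge `e`, of a motion in direction `u`. -/
noncomputable def reflect (e : P.BoundaryEdge) (u : Plane) : Plane :=
  (vectorSpan ℝ (P.pos '' (e.1 : Set V))).reflection u

/-- The forward trajectory of the point `p` (in the interior of the table, or in the relative
interior of a boundary edge, and then with `u` pointing into the table) in direction `u` is
nonsingular, and `E` is its forward bounce sequence. Here `q k` is the `k`-th bounce point, on the
edge `e k`, and `d k` is the direction in which it is reached. If `p` is on a boundary edge, that
edge is not recorded as a bounce. -/
def IsForwardBounceSeq (p u : Plane) (E : ℕ → 𝒜) : Prop :=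
  ‖u‖ = 1 ∧
  (p ∈ P.region ∨ ∃ a : P.BoundaryEdge, p ∈ P.openEdge a.1 ∧ P.InnerSide a (p + u)) ∧
  ∃ (e : ℕ → P.BoundaryEdge) (q d : ℕ → Plane),
    d 0 = u ∧ P.Flies p (d 0) (e 0) (q 0) ∧
    (∀ k, d (k + 1) = P.reflect (e k) (d k) ∧ P.Flies (q k) (d (k + 1)) (e (k + 1)) (q (k + 1))) ∧
    ∀ k, E k = P.label (e k)

/-- The bi-infinite trajectory of the point `p` in direction `u` is nonsingular, and `E` is its
full bounce sequence. Here `q i` is the `i`-th bounce point, on the edge `e i`, and `d i` is the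
direction in which it is reached. Indices are such that `p` lies between the bounces number `0`
(included, when `p` is on the boundary) and `1` (excluded). -/
def IsBounceSeq (p u : Plane) (E : ℤ → 𝒜) : Prop :=
  ‖u‖ = 1 ∧
  ∃ (e : ℤ → P.BoundaryEdge) (q d : ℤ → Plane),
    d 1 = u ∧ p ∈ segment ℝ (q 0) (q 1) ∧ p ≠ q 1 ∧
    (∀ i, d (i + 1) = P.reflect (e i) (d i) ∧ P.Flies (q i) (d (i + 1)) (e (i + 1)) (q (i + 1))) ∧
    ∀ i, E i = P.label (e i)

/-- The (bi-infinite) bounce spectrum. -/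
def bounceSpectrum : Set (ℤ → 𝒜) := {E | ∃ p u : Plane, P.IsBounceSeq p u E}

/-- The forward bounce spectrum. -/
def forwardBounceSpectrum : Set (ℕ → 𝒜) := {E | ∃ p u : Plane, P.IsForwardBounceSeq p u E}

end PolygonalTable

open Filter Topology
-- Determinants and affine functions in the plane
/-- The determinant of two vectors of the plane. -/
def cross (u v : Plane) : ℝ := u 0 * v 1 - u 1 * v 0

/-- Rotation by a quarter turn. -/
noncomputable def quarter (u : Plane) : Plane := !₂[-u 1, u 0]

@[simp] theorem quarter_zero (u : Plane) : quarter u 0 = -u 1 := rfl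
@[simp] theorem quarter_one (u : Plane) : quarter u 1 = u 0 := rfl

theorem cross_add (u v w : Plane) : cross u (v + w) = cross u v + cross u w := by
  simp [cross]; ring

theorem cross_sub (u v w : Plane) : cross u (v - w) = cross u v - cross u w := by
  simp [cross]; ring

theorem cross_smul (u v : Plane) (r : ℝ) : cross u (r • v) = r * cross u v := by
  simp [cross]; ring

theorem cross_same (u : Plane) : cross u u = 0 := by
  simp [cross]; ring

theorem cross_neg_left (u v : Plane) : cross (-u) v = -cross u v := by
  simp [cross]; ring

theorem smul_cross (u v : Plane) (r : ℝ) : cross (r • u) v = r * cross u v := by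
  simp [cross]; ring

theorem add_cross (u v w : Plane) : cross (u + v) w = cross u w + cross v w := by
  simp [cross]; ring

theorem Plane.norm_sq (u : Plane) : ‖u‖ ^ 2 = u 0 ^ 2 + u 1 ^ 2 := by
  rw [EuclideanSpace.real_norm_sq_eq, Fin.sum_univ_two]

theorem Plane.inner_eq (u v : Plane) : inner ℝ u v = u 0 * v 0 + u 1 * v 1 := by
  simp [PiLp.inner_apply, Fin.sum_univ_two, mul_comm]

theorem Plane.ext' {u v : Plane} (h0 : u 0 = v 0) (h1 : u 1 = v 1) : u = v := by
  ext i; fin_cases i <;> assumption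

theorem cross_quarter (u : Plane) : cross u (quarter u) = ‖u‖ ^ 2 := by
  rw [Plane.norm_sq]; simp [cross]; ring

theorem Continuous.cross {X : Type*} [TopologicalSpace X] {f g : X → Plane}
    (hf : Continuous f) (hg : Continuous g) : Continuous fun x => cross (f x) (g x) := by
  unfold _root_.cross; fun_prop

theorem Filter.Tendsto.cross {X : Type*} {F : Filter X} {f g : X → Plane} {u v : Plane}
    (hf : Tendsto f F (𝓝 u)) (hg : Tendsto g F (𝓝 v)) :
    Tendsto (fun x => _root_.cross (f x) (g x)) F (𝓝 (_root_.cross u v)) := by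
  have : Continuous fun z : Plane × Plane => _root_.cross z.1 z.2 :=
    Continuous.cross continuous_fst continuous_snd
  exact (this.tendsto (u, v)).comp (hf.prodMk_nhds hg)

theorem exists_smul_of_cross_eq_zero {u v : Plane} (hu : u ≠ 0) (h : cross u v = 0) :
    ∃ r : ℝ, v = r • u := by
  have hn : ‖u‖ ^ 2 ≠ 0 := by positivity
  rw [Plane.norm_sq] at hn
  refine ⟨(u 0 * v 0 + u 1 * v 1) / (u 0 ^ 2 + u 1 ^ 2), Plane.ext' ?_ ?_⟩ <;>
  · simp only [cross] at h
    simp only [PiLp.smul_apply, smul_eq_mul]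
    field_simp
    first | linear_combination u 1 * h | linear_combination -u 1 * h |
      linear_combination u 0 * h

theorem abs_cross_le (u v : Plane) : |cross u v| ≤ ‖u‖ * ‖v‖ := by
  refine abs_le_of_sq_le_sq ?_ (by positivity)
  rw [mul_pow, Plane.norm_sq, Plane.norm_sq, cross]
  nlinarith [sq_nonneg (u 0 * v 0 + u 1 * v 1)]

theorem mem_openSegment_iff {x y z : Plane} :
    z ∈ openSegment ℝ x y ↔ ∃ t : ℝ, 0 < t ∧ t < 1 ∧ z = x + t • (y - x) := by
  rw [openSegment_eq_image']
  constructor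
  · rintro ⟨t, ⟨h0, h1⟩, rfl⟩; exact ⟨t, h0, h1, rfl⟩
  · rintro ⟨t, h0, h1, rfl⟩; exact ⟨t, ⟨h0, h1⟩, rfl⟩

theorem mem_segment_iff {x y z : Plane} :
    z ∈ segment ℝ x y ↔ ∃ t : ℝ, 0 ≤ t ∧ t ≤ 1 ∧ z = x + t • (y - x) := by
  rw [segment_eq_image']
  constructor
  · rintro ⟨t, ⟨h0, h1⟩, rfl⟩; exact ⟨t, h0, h1, rfl⟩
  · rintro ⟨t, h0, h1, rfl⟩; exact ⟨t, ⟨h0, h1⟩, rfl⟩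

theorem AffineMap.apply_lineMap' (f : Plane →ᵃ[ℝ] ℝ) (x y : Plane) (t : ℝ) :
    f (x + t • (y - x)) = (1 - t) * f x + t * f y := by
  have := f.apply_lineMap x y t
  rw [AffineMap.lineMap_apply, AffineMap.lineMap_apply] at this
  simp only [vsub_eq_sub, vadd_eq_add, smul_eq_mul] at this
  rw [add_comm, this]; ring

theorem AffineMap.apply_add_smul (f : Plane →ᵃ[ℝ] ℝ) (x v : Plane) (t : ℝ) :
    f (x + t • v) = f x + t * f.linear v := by
  have := f.map_vadd x (t • v)
  simp only [vadd_eq_add, map_smul, smul_eq_mul] at this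
  rw [add_comm x, this]; ring

/-! ### The abstract billiard table and its flights -/

/-- A polygonal billiard table in the plane, as seen by the billiard flow: an open bounded region,
whose frontier is covered by finitely many segments (the edges). Each edge comes with an affine
function vanishing on it and positive on its inner side, and with the reflection in its line. -/
structure Billiard (ι : Type*) where
  region : Set Plane
  A : ι → Plane
  B : ι → Plane
  l : ι → Plane →ᵃ[ℝ] ℝ
  refl : ι → Plane ≃ᵃⁱ[ℝ] Plane
  ne : ∀ a, A a ≠ B a
  l_A : ∀ a, l a (A a) = 0
  l_B : ∀ a, l a (B a) = 0
  l_zero : ∀ a y, l a y = 0 → ∃ r : ℝ, y = A a + r • (B a - A a)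
  refl_A : ∀ a, refl a (A a) = A a
  refl_B : ∀ a, refl a (B a) = B a
  refl_sq : ∀ a, refl a * refl a = 1
  l_refl : ∀ a y, l a (refl a y) = -l a y
  isOpen : IsOpen region
  bounded : Bornology.IsBounded region
  -- Only the inner side of an edge is required to lie in the region near it. Two edges may coincide
  -- in the plane and face opposite sides; this is why `exit` and `uniq` distinguish edges by the
  -- sign of `l`.
  half : ∀ a, ∀ x ∈ openSegment ℝ (A a) (B a), ∃ ε > 0, ∀ y, dist y x < ε → 0 < l a y → y ∈ region
  disj : ∀ a, ∀ y ∈ segment ℝ (A a) (B a), y ∉ region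
  frontier : ∀ y ∈ closure region, y ∉ region → ∃ a, y ∈ segment ℝ (A a) (B a)
  exit : ∀ x y, openSegment ℝ x y ⊆ region → y ∉ region → x ≠ y →
    (∃ a, y = A a ∨ y = B a) ∨ ∃ a, y ∈ openSegment ℝ (A a) (B a) ∧ 0 < l a x
  uniq : ∀ a b, ∀ x ∈ openSegment ℝ (A a) (B a), x ∈ openSegment ℝ (A b) (B b) →
    (∀ y, 0 < l a y → 0 < l b y) → a = b

namespace Billiard

variable {ι : Type*} (T : Billiard ι)

/-- The relative interior of an edge. -/
abbrev E (a : ι) : Set Plane := openSegment ℝ (T.A a) (T.B a)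

/-- A straight flight inside the table from a point of the edge `e` to a point of the edge `a`. -/
def Chord (e a : ι) (x y : Plane) : Prop :=
  x ∈ T.E e ∧ y ∈ T.E a ∧ openSegment ℝ x y ⊆ T.region ∧ 0 < T.l a x ∧ 0 < T.l e y

/-- The oriented lines that contain a flight from the edge `e` to the edge `a`. A line is given by
a point and a direction. -/
def C (e a : ι) : Set (Plane × Plane) :=
  {x | ∃ s t : ℝ, s < t ∧ T.Chord e a (x.1 + s • x.2) (x.1 + t • x.2)}

variable {T}

theorem l_of_segment {a : ι} {x : Plane} (hx : x ∈ segment ℝ (T.A a) (T.B a)) : T.l a x = 0 := by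
  obtain ⟨t, -, -, rfl⟩ := mem_segment_iff.1 hx
  rw [AffineMap.apply_lineMap', T.l_A, T.l_B]; ring

theorem l_of_mem {a : ι} {x : Plane} (hx : x ∈ T.E a) : T.l a x = 0 :=
  l_of_segment (openSegment_subset_segment _ _ _ hx)

theorem not_mem_region {a : ι} {x : Plane} (hx : x ∈ T.E a) : x ∉ T.region :=
  T.disj a x (openSegment_subset_segment _ _ _ hx)

/-- Edges do not cross transversally. -/
theorem noncross {a b : ι} {x : Plane} (ha : x ∈ T.E a) (hb : x ∈ T.E b) :
    T.l b (T.A a) = 0 ∧ T.l b (T.B a) = 0 := by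
  obtain ⟨t, h0, h1, hx⟩ := mem_openSegment_iff.1 ha
  have hl : (1 - t) * T.l b (T.A a) + t * T.l b (T.B a) = 0 := by
    rw [← AffineMap.apply_lineMap', ← hx, l_of_mem hb]
  suffices h : T.l b (T.B a) = T.l b (T.A a) by
    rw [h] at hl
    have : T.l b (T.A a) = 0 := by linarith
    exact ⟨this, by rw [h, this]⟩
  by_contra hne
  obtain ⟨ε, hε, hr⟩ := T.half b x hb
  have key : ∀ᶠ r : ℝ in 𝓝 t, dist (T.A a + r • (T.B a - T.A a)) x < ε := by
    have hc : Tendsto (fun r : ℝ => dist (T.A a + r • (T.B a - T.A a)) x) (𝓝 t)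
        (𝓝 (dist (T.A a + t • (T.B a - T.A a)) x)) :=
      Continuous.tendsto (by fun_prop) t
    rw [← hx, dist_self] at hc
    exact hc.eventually (gt_mem_nhds hε)
  have k2 : ∀ᶠ r : ℝ in 𝓝 t, 0 < r ∧ r < 1 := (lt_mem_nhds h0).and (gt_mem_nhds h1)
  -- Points of `a` near `x` on the inner side of `b` would lie in the region by `half`, which `disj`
  -- forbids. So `l b` is nonpositive along `a` on both sides of its zero `x`, and being affine it
  -- is constant there.
  have contra : ∀ r : ℝ, dist (T.A a + r • (T.B a - T.A a)) x < ε → 0 < r → r < 1 →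
      (1 - r) * T.l b (T.A a) + r * T.l b (T.B a) ≤ 0 := by
    intro r h1 h2 h3
    by_contra h4
    push Not at h4
    rw [← AffineMap.apply_lineMap'] at h4
    exact not_mem_region (mem_openSegment_iff.2 ⟨r, h2, h3, rfl⟩) (hr _ h1 h4)
  obtain ⟨δ, hδ, hb⟩ := Metric.eventually_nhds_iff.1 (key.and k2)
  have hp := hb (y := t + δ / 2) (by rw [Real.dist_eq]; simp; rw [abs_of_pos (by positivity)]; linarith)
  have hm := hb (y := t - δ / 2) (by rw [Real.dist_eq]; simp; rw [abs_of_pos (by positivity)]; linarith)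
  have c1 := contra _ hp.1 hp.2.1 hp.2.2
  have c2 := contra _ hm.1 hm.2.1 hm.2.2
  apply hne
  have : δ / 2 * (T.l b (T.B a) - T.l b (T.A a)) = 0 := by nlinarith
  rcases mul_eq_zero.1 this with h | h <;> linarith

theorem l_eq_zero_of_noncross {a b : ι} {x y : Plane} (ha : x ∈ T.E a) (hb : x ∈ T.E b)
    (hy : T.l a y = 0) : T.l b y = 0 := by
  obtain ⟨r, rfl⟩ := T.l_zero a y hy
  rw [AffineMap.apply_lineMap', (noncross ha hb).1, (noncross ha hb).2]; ring

/-- By `noncross` the two edges lie on one line, and the common point `z` on the inner side of both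
makes the open half planes agree: if `l b` were nonpositive at some `y` with `l a y > 0`, the
segment from `z` to `y` would meet the common line at a point where `l a` is positive. Then `uniq`
applies. -/
theorem eq_of_mem {a b : ι} {x z : Plane} (ha : x ∈ T.E a) (hb : x ∈ T.E b)
    (hza : 0 < T.l a z) (hzb : 0 < T.l b z) : a = b := by
  refine T.uniq a b x ha hb fun y hy => ?_
  by_contra h
  push Not at h
  set r := T.l b z / (T.l b z - T.l b y) with hr
  have hpos : 0 < T.l b z - T.l b y := by linarith
  have hr0 : 0 ≤ r := by positivity
  have hr1 : r ≤ 1 := by rw [hr, div_le_one hpos]; linarith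
  have h1 : T.l b (z + r • (y - z)) = 0 := by
    rw [AffineMap.apply_lineMap', hr]; field_simp; ring
  have h2 := l_eq_zero_of_noncross hb ha h1
  rw [AffineMap.apply_lineMap'] at h2
  rcases hr0.eq_or_lt with h3 | h3
  · rw [← h3] at h2; linarith
  · nlinarith [mul_pos h3 hy, mul_nonneg (sub_nonneg.2 hr1) hza.le]

theorem Chord.symm {e a : ι} {x y : Plane} (h : T.Chord e a x y) : T.Chord a e y x :=
  ⟨h.2.1, h.1, by rw [openSegment_symm]; exact h.2.2.1, h.2.2.2.2, h.2.2.2.1⟩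

theorem mem_C_reverse {e a : ι} {p u : Plane} : (p, u) ∈ T.C e a ↔ (p, -u) ∈ T.C a e := by
  constructor <;>
  · rintro ⟨s, t, hst, h⟩
    refine ⟨-t, -s, by linarith, ?_⟩
    simpa using h.symm

theorem mem_C_slide {e a : ι} {p u : Plane} {s r : ℝ} (hr : 0 < r) :
    (p + s • u, r • u) ∈ T.C e a ↔ (p, u) ∈ T.C e a := by
  constructor
  · rintro ⟨s', t', h, hc⟩
    refine ⟨s + s' * r, s + t' * r, by nlinarith, ?_⟩
    simpa only [add_smul, mul_smul, add_assoc] using hc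
  · rintro ⟨s', t', h, hc⟩
    refine ⟨(s' - s) / r, (t' - s) / r, by gcongr, ?_⟩
    have : ∀ q : ℝ, p + s • u + ((q - s) / r) • r • u = p + q • u := by
      intro q; rw [smul_smul, div_mul_cancel₀ _ hr.ne', add_assoc, ← add_smul]; congr 2; ring
    simpa only [this] using hc

theorem mem_openSegment_line {p u : Plane} {s t r : ℝ} (h1 : s < r) (h2 : r < t) :
    p + r • u ∈ openSegment ℝ (p + s • u) (p + t • u) := by
  rw [mem_openSegment_iff]
  have h : 0 < t - s := by linarith
  refine ⟨(r - s) / (t - s), by apply div_pos <;> linarith, by rw [div_lt_one h]; linarith, ?_⟩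
  have e : p + t • u - (p + s • u) = (t - s) • u := by rw [sub_smul]; abel
  rw [e, smul_smul, div_mul_cancel₀ _ h.ne', sub_smul]; abel

theorem openSegment_line {p u z : Plane} {s t : ℝ} (hst : s < t)
    (h : z ∈ openSegment ℝ (p + s • u) (p + t • u)) : ∃ r, s < r ∧ r < t ∧ z = p + r • u := by
  obtain ⟨τ, h0, h1, rfl⟩ := mem_openSegment_iff.1 h
  have h : 0 < t - s := by linarith
  refine ⟨s + τ * (t - s), by nlinarith, by nlinarith, ?_⟩
  have e : p + t • u - (p + s • u) = (t - s) • u := by rw [sub_smul]; abel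
  rw [e, smul_smul, add_smul, add_assoc]

/-- A flight is determined by its line and its first edge. -/
theorem C_determ {e a b : ι} {x : Plane × Plane} (ha : x ∈ T.C e a) (hb : x ∈ T.C e b) :
    a = b := by
  obtain ⟨p, u⟩ := x
  obtain ⟨s, t, hst, h⟩ := ha
  obtain ⟨s', t', hst', h'⟩ := hb
  dsimp only at h h'
  -- Both starting parameters are zeros of `l e` along the line, where it is not constant since it
  -- is positive at the end of the flight.
  have hs : s = s' := by
    have h1 := l_of_mem h.1
    have h2 := l_of_mem h'.1
    have h3 := h.2.2.2.2
    rw [AffineMap.apply_add_smul] at h1 h2 h3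
    have h4 : (T.l e).linear u ≠ 0 := by rintro h4; rw [h4] at h1 h3; linarith
    exact mul_right_cancel₀ h4 (by linarith)
  subst hs
  -- If one flight ended earlier, its end, a point of an edge, would lie inside the other flight and
  -- hence in the region.
  have ht : t = t' := by
    rcases lt_trichotomy t t' with h1 | h1 | h1
    · exact absurd (h'.2.2.1 (mem_openSegment_line hst h1)) (not_mem_region h.2.1)
    · exact h1
    · exact absurd (h.2.2.1 (mem_openSegment_line hst' h1)) (not_mem_region h'.2.1)
  subst ht
  exact eq_of_mem h.2.1 h'.2.1 h.2.2.2.1 h'.2.2.2.1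

theorem C_determ' {e a b : ι} {x : Plane × Plane} (ha : x ∈ T.C a e) (hb : x ∈ T.C b e) :
    a = b :=
  C_determ (mem_C_reverse.1 ha) (mem_C_reverse.1 hb)

end Billiard

/-! ### Flights form open sets of lines; limits of flights -/

namespace Billiard

variable {ι : Type*} {T : Billiard ι}

theorem coord_continuous (f : Plane →ᵃ[ℝ] ℝ) : Continuous f := f.continuous_of_finiteDimensional

theorem linear_continuous (f : Plane →ᵃ[ℝ] ℝ) : Continuous f.linear :=
  f.linear.continuous_of_finiteDimensional

/-- The orthogonal projection `f` onto the edge is continuous and recovers the parameter on the line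
of the edge; being strictly between 0 and 1 is an open condition. -/
theorem mem_E_of_near {a : ι} {x : Plane} (hx : x ∈ T.E a) :
    ∀ᶠ y in 𝓝 x, T.l a y = 0 → y ∈ T.E a := by
  obtain ⟨t, h0, h1, hx⟩ := mem_openSegment_iff.1 hx
  set v := T.B a - T.A a with hv
  have hn : ‖v‖ ^ 2 ≠ 0 := by
    have : v ≠ 0 := sub_ne_zero.2 (T.ne a).symm
    positivity
  let f : Plane → ℝ := fun y => inner ℝ (y - T.A a) v / ‖v‖ ^ 2
  have hf : Continuous f := by fun_prop
  have hfl : ∀ r : ℝ, f (T.A a + r • v) = r := by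
    intro r
    simp only [f, add_sub_cancel_left, inner_smul_left, real_inner_self_eq_norm_sq]
    simp [hn]
  have hft : Tendsto f (𝓝 x) (𝓝 t) := by
    have := hf.tendsto x
    rw [hx, hfl] at this
    rw [hx]; exact this
  filter_upwards [hft.eventually (lt_mem_nhds h0), hft.eventually (gt_mem_nhds h1)] with y h0 h1 hy
  obtain ⟨r, rfl⟩ := T.l_zero a y hy
  rw [← hv, hfl] at h0 h1
  exact mem_openSegment_iff.2 ⟨r, h0, h1, rfl⟩

/-- Flights persist under small perturbations. -/
theorem Chord.near {e a : ι} {x y : Plane} (h : T.Chord e a x y) :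
    ∀ᶠ z : Plane × Plane in 𝓝 (x, y), T.l e z.1 = 0 → T.l a z.2 = 0 → T.Chord e a z.1 z.2 := by
  obtain ⟨hx, hy, hr, hax, hey⟩ := h
  have e1 : ∀ᶠ z : Plane × Plane in 𝓝 (x, y), T.l e z.1 = 0 → z.1 ∈ T.E e :=
    (continuous_fst.tendsto (x, y)).eventually (mem_E_of_near hx)
  have e2 : ∀ᶠ z : Plane × Plane in 𝓝 (x, y), T.l a z.2 = 0 → z.2 ∈ T.E a :=
    (continuous_snd.tendsto (x, y)).eventually (mem_E_of_near hy)
  have e3 : ∀ᶠ z : Plane × Plane in 𝓝 (x, y), 0 < T.l a z.1 :=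
    (((coord_continuous (T.l a)).comp continuous_fst).tendsto (x, y)).eventually (lt_mem_nhds hax)
  have e4 : ∀ᶠ z : Plane × Plane in 𝓝 (x, y), 0 < T.l e z.2 :=
    (((coord_continuous (T.l e)).comp continuous_snd).tendsto (x, y)).eventually (lt_mem_nhds hey)
  let w : (Plane × Plane) × ℝ → Plane := fun q => q.1.1 + q.2 • (q.1.2 - q.1.1)
  have hw : Continuous w := by fun_prop
  -- Compactness of the parameter interval: at interior parameters the region is open, and at the
  -- two ends the half discs given by `half` contain the perturbed flight because it starts and ends
  -- on the right sides.
  have e5 : ∀ᶠ z : Plane × Plane in 𝓝 (x, y), ∀ τ ∈ Set.Icc (0 : ℝ) 1,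
      T.l e z.1 = 0 → T.l a z.2 = 0 → 0 < T.l a z.1 → 0 < T.l e z.2 → 0 < τ → τ < 1 →
        z.1 + τ • (z.2 - z.1) ∈ T.region := by
    apply isCompact_Icc.eventually_forall_of_forall_eventually
    intro τ hτ
    have hwt := hw.tendsto ((x, y), τ)
    rcases hτ.1.eq_or_lt with h0 | h0
    · subst h0
      obtain ⟨ε, hε, hb⟩ := T.half e x hx
      have h1 : w ((x, y), 0) = x := by simp [w]
      rw [h1] at hwt
      filter_upwards [hwt.eventually (Metric.ball_mem_nhds x hε)] with q hq z1 z2 z3 z4 z5 z6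
      refine hb _ hq ?_
      show 0 < T.l e (w q)
      simp only [w]
      rw [AffineMap.apply_lineMap', z1]
      nlinarith [mul_pos z5 z4]
    rcases hτ.2.eq_or_lt with h1 | h1
    · subst h1
      obtain ⟨ε, hε, hb⟩ := T.half a y hy
      have h1 : w ((x, y), 1) = y := by simp [w]
      rw [h1] at hwt
      filter_upwards [hwt.eventually (Metric.ball_mem_nhds y hε)] with q hq z1 z2 z3 z4 z5 z6
      refine hb _ hq ?_
      show 0 < T.l a (w q)
      simp only [w]
      rw [AffineMap.apply_lineMap', z2]
      nlinarith [mul_pos (sub_pos.2 z6) z3]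
    · have hm : w ((x, y), τ) ∈ T.region := hr (mem_openSegment_iff.2 ⟨τ, h0, h1, rfl⟩)
      filter_upwards [hwt.eventually (T.isOpen.mem_nhds hm)] with q hq _ _ _ _ _ _
      exact hq
  filter_upwards [e1, e2, e3, e4, e5] with z f1 f2 f3 f4 f5 z1 z2
  refine ⟨f1 z1, f2 z2, ?_, f3, f4⟩
  intro q hq
  obtain ⟨τ, h0, h1, rfl⟩ := mem_openSegment_iff.1 hq
  exact f5 τ ⟨h0.le, h1.le⟩ z1 z2 f3 f4 h0 h1

/-- The parameter at which a line meets the line of an edge. -/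
noncomputable def param (T : Billiard ι) (a : ι) (x : Plane × Plane) : ℝ :=
  -T.l a x.1 / (T.l a).linear x.2

theorem l_param {a : ι} {x : Plane × Plane} (h : (T.l a).linear x.2 ≠ 0) :
    T.l a (x.1 + T.param a x • x.2) = 0 := by
  rw [AffineMap.apply_add_smul, param, div_mul_cancel₀ _ h]; ring

theorem param_eq {a : ι} {x : Plane × Plane} {s : ℝ} (h : (T.l a).linear x.2 ≠ 0)
    (hs : T.l a (x.1 + s • x.2) = 0) : T.param a x = s := by
  rw [AffineMap.apply_add_smul] at hs
  rw [param, div_eq_iff h]; linarith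

theorem param_tendsto {a : ι} {x : Plane × Plane} (h : (T.l a).linear x.2 ≠ 0) :
    Tendsto (T.param a) (𝓝 x) (𝓝 (T.param a x)) := by
  have h1 : Continuous fun x : Plane × Plane => T.l a x.1 := (coord_continuous _).comp continuous_fst
  have h2 : Continuous fun x : Plane × Plane => (T.l a).linear x.2 :=
    (linear_continuous _).comp continuous_snd
  exact (h1.neg.tendsto x).div (h2.tendsto x) h

theorem linear_near {a : ι} {x : Plane × Plane} (h : (T.l a).linear x.2 ≠ 0) :
    ∀ᶠ x' : Plane × Plane in 𝓝 x, (T.l a).linear x'.2 ≠ 0 := by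
  have h2 : Continuous fun x : Plane × Plane => (T.l a).linear x.2 :=
    (linear_continuous _).comp continuous_snd
  exact (h2.tendsto x).eventually (isOpen_ne.mem_nhds h)

theorem point_tendsto {a : ι} {x : Plane × Plane} (h : (T.l a).linear x.2 ≠ 0) :
    Tendsto (fun x' : Plane × Plane => x'.1 + T.param a x' • x'.2) (𝓝 x)
      (𝓝 (x.1 + T.param a x • x.2)) :=
  (continuous_fst.tendsto x).add ((param_tendsto h).smul (continuous_snd.tendsto x))

theorem Chord.linear_ne {e a : ι} {p u : Plane} {s t : ℝ}
    (h : T.Chord e a (p + s • u) (p + t • u)) :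
    (T.l e).linear u ≠ 0 ∧ (T.l a).linear u ≠ 0 := by
  have h1 := l_of_mem h.1
  have h2 := l_of_mem h.2.1
  have h3 := h.2.2.2.1
  have h4 := h.2.2.2.2
  rw [AffineMap.apply_add_smul] at h1 h2 h3 h4
  constructor <;> intro h5 <;> simp only [h5, mul_zero, add_zero] at h1 h2 h3 h4 <;> linarith

/-- A line containing a flight from `e` to `a`, with its parameters made explicit. -/
theorem mem_C_iff {e a : ι} {x : Plane × Plane} : x ∈ T.C e a ↔
    T.param e x < T.param a x ∧ (T.l e).linear x.2 ≠ 0 ∧ (T.l a).linear x.2 ≠ 0 ∧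
      T.Chord e a (x.1 + T.param e x • x.2) (x.1 + T.param a x • x.2) := by
  constructor
  · rintro ⟨s, t, hst, h⟩
    obtain ⟨h1, h2⟩ := h.linear_ne
    rw [param_eq h1 (l_of_mem h.1), param_eq h2 (l_of_mem h.2.1)]
    exact ⟨hst, h1, h2, h⟩
  · rintro ⟨h, -, -, h'⟩
    exact ⟨_, _, h, h'⟩

/-- The points where a line meets the lines of the two edges depend continuously on it, so
`Chord.near` applies. -/
theorem isOpen_C (e a : ι) : IsOpen (T.C e a) := by
  rw [isOpen_iff_mem_nhds]
  intro x hx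
  obtain ⟨hst, h1, h2, h⟩ := mem_C_iff.1 hx
  have hz := ((point_tendsto h1).prodMk_nhds (point_tendsto h2)).eventually h.near
  filter_upwards [hz, linear_near h1, linear_near h2,
    (param_tendsto h1).eventually_lt (param_tendsto h2) hst] with x' f1 f2 f3 f4
  exact ⟨_, _, f4, f1 (l_param f2) (l_param f3)⟩

/-- The endpoints of the edge lie strictly on different sides of the line. -/
def Strict (T : Billiard ι) (x : Plane × Plane) (a : ι) : Prop :=
  cross x.2 (T.A a - x.1) * cross x.2 (T.B a - x.1) < 0

theorem cross_lineMap (u p x y : Plane) (t : ℝ) :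
    cross u (x + t • (y - x) - p) = (1 - t) * cross u (x - p) + t * cross u (y - p) := by
  simp [cross]; ring

theorem cross_on_line (p u : Plane) (r : ℝ) : cross u (p + r • u - p) = 0 := by
  rw [add_sub_cancel_left, cross_smul, cross_same, mul_zero]

theorem Strict.ne_zero {a : ι} {x : Plane × Plane} (h : T.Strict x a) : x.2 ≠ 0 := by
  intro h0
  simp [Strict, h0, cross] at h

/-- The height above the line changes sign along the edge, so it vanishes at an inner point of the
edge. The line is not parallel to the edge, since otherwise both endpoints would have equal heights
and the product would be a square. -/
theorem Strict.exists {a : ι} {x : Plane × Plane} (h : T.Strict x a) :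
    (T.l a).linear x.2 ≠ 0 ∧ x.1 + T.param a x • x.2 ∈ T.E a := by
  have hu := h.ne_zero
  unfold Strict at h
  set α := cross x.2 (T.A a - x.1) with hα
  set β := cross x.2 (T.B a - x.1) with hβ
  obtain ⟨τ, h0, h1, hτ⟩ : ∃ τ : ℝ, 0 < τ ∧ τ < 1 ∧ (1 - τ) * α + τ * β = 0 := by
    have hne : α - β ≠ 0 := by intro h2; have : α = β := by linarith
                               rw [this] at h; nlinarith [mul_self_nonneg β]
    refine ⟨α / (α - β), ?_, ?_, by field_simp; ring⟩
    · rcases mul_neg_iff.1 h with ⟨h2, h3⟩ | ⟨h2, h3⟩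
      · apply div_pos <;> linarith
      · apply div_pos_of_neg_of_neg <;> linarith
    · rcases mul_neg_iff.1 h with ⟨h2, h3⟩ | ⟨h2, h3⟩
      · rw [div_lt_one (by linarith)]; linarith
      · rw [div_lt_one_of_neg (by linarith)]; linarith
  have hz : T.A a + τ • (T.B a - T.A a) ∈ T.E a := mem_openSegment_iff.2 ⟨τ, h0, h1, rfl⟩
  have hc : cross x.2 (T.A a + τ • (T.B a - T.A a) - x.1) = 0 := by
    rw [cross_lineMap, ← hα, ← hβ, hτ]
  obtain ⟨s, hs⟩ := exists_smul_of_cross_eq_zero hu hc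
  have hs' : T.A a + τ • (T.B a - T.A a) = x.1 + s • x.2 := by rw [← hs]; abel
  have hl : (T.l a).linear x.2 ≠ 0 := by
    intro hl
    have h2 : T.l a x.1 = 0 := by
      have h3 := l_of_mem hz
      rw [hs', AffineMap.apply_add_smul, hl] at h3
      linarith
    have h4 : T.l a (x.1 + (1 : ℝ) • x.2) = 0 := by rw [AffineMap.apply_add_smul, h2, hl]; ring
    obtain ⟨r, hr⟩ := T.l_zero a _ h2
    obtain ⟨r', hr'⟩ := T.l_zero a _ h4
    have h5 : x.2 = (r' - r) • (T.B a - T.A a) := by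
      rw [sub_smul]; rw [one_smul, hr] at hr'
      calc x.2 = (T.A a + r • (T.B a - T.A a) + x.2) - T.A a - r • (T.B a - T.A a) := by abel
        _ = _ := by rw [hr']; abel
    have h6 : α = β := by
      have : β - α = cross x.2 (T.B a - T.A a) := by
        rw [hα, hβ, ← cross_sub]; congr 1; abel
      rw [h5, smul_cross, cross_same] at this
      linarith
    rw [h6] at h; nlinarith [mul_self_nonneg β]
  refine ⟨hl, ?_⟩
  rw [hs'] at hz
  rwa [param_eq hl (l_of_mem hz)]

theorem isOpen_strict (a : ι) : IsOpen {x : Plane × Plane | T.Strict x a} := by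
  apply isOpen_lt _ continuous_const
  exact (Continuous.cross continuous_snd (by fun_prop)).mul
    (Continuous.cross continuous_snd (by fun_prop))

theorem strict_of_mem {a : ι} {x : Plane × Plane} (hl : (T.l a).linear x.2 ≠ 0)
    (hm : x.1 + T.param a x • x.2 ∈ T.E a) : T.Strict x a := by
  obtain ⟨τ, h0, h1, hτ⟩ := mem_openSegment_iff.1 hm
  have hc := cross_on_line x.1 x.2 (T.param a x)
  rw [hτ, cross_lineMap] at hc
  unfold Strict
  set α := cross x.2 (T.A a - x.1) with hα
  set β := cross x.2 (T.B a - x.1) with hβ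
  have hu : x.2 ≠ 0 := by intro h; rw [h, map_zero] at hl; exact hl rfl
  have hβ0 : β ≠ 0 := by
    intro hb
    have ha : α = 0 := by
      rw [hb] at hc
      rcases mul_eq_zero.1 (by linarith : (1 - τ) * α = 0) with h | h
      · linarith
      · exact h
    have : cross x.2 (T.B a - T.A a) = 0 := by
      have : cross x.2 (T.B a - T.A a) = β - α := by rw [hα, hβ, ← cross_sub]; congr 1; abel
      rw [this, ha, hb, sub_zero]
    obtain ⟨r, hr⟩ := exists_smul_of_cross_eq_zero hu this
    have h5 : (T.l a).linear (T.B a - T.A a) = 0 := by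
      have := (T.l a).linearMap_vsub (T.B a) (T.A a)
      rw [vsub_eq_sub] at this
      rw [this, T.l_A, T.l_B]; simp
    rw [hr, map_smul, smul_eq_mul] at h5
    rcases mul_eq_zero.1 h5 with h6 | h6
    · rw [h6, zero_smul, sub_eq_zero] at hr; exact T.ne a hr.symm
    · exact hl h6
  have : α = -(τ / (1 - τ)) * β := by
    have : 1 - τ ≠ 0 := by linarith
    field_simp; linarith
  rw [this]
  have h2 : 0 < τ / (1 - τ) := by apply div_pos <;> linarith
  have h3 : 0 < β * β := mul_self_pos.2 hβ0
  nlinarith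

theorem strict_of_mem_C {e a : ι} {x : Plane × Plane} (h : x ∈ T.C e a) :
    T.Strict x e ∧ T.Strict x a := by
  obtain ⟨-, h1, h2, h3⟩ := mem_C_iff.1 h
  exact ⟨strict_of_mem h1 h3.1, strict_of_mem h2 h3.2.1⟩

/-- A limit of flights, along a line which crosses both edges strictly. -/
theorem closure_chord {e a : ι} {x : Plane × Plane} (hx : x ∈ closure (T.C e a))
    (he : T.Strict x e) (ha : T.Strict x a) :
    T.param e x < T.param a x ∧ 0 < T.l a (x.1 + T.param e x • x.2) ∧
      0 < T.l e (x.1 + T.param a x • x.2) ∧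
      ∀ r, T.param e x < r → r < T.param a x → x.1 + r • x.2 ∈ closure T.region ∧
        ∃ V ∈ 𝓝 x, ∃ W ∈ 𝓝 (x.1 + r • x.2), ∀ x' ∈ V, x' ∈ T.C e a → ∀ y' ∈ W,
          (∃ r' : ℝ, y' = x'.1 + r' • x'.2) → y' ∈ T.region := by
  obtain ⟨hle, hme⟩ := he.exists
  obtain ⟨hla, hma⟩ := ha.exists
  have hu := he.ne_zero
  have hne : (𝓝[T.C e a] x).NeBot := mem_closure_iff_nhdsWithin_neBot.1 hx
  have te : Tendsto (T.param e) (𝓝[T.C e a] x) (𝓝 (T.param e x)) :=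
    (param_tendsto hle).mono_left nhdsWithin_le_nhds
  have ta : Tendsto (T.param a) (𝓝[T.C e a] x) (𝓝 (T.param a x)) :=
    (param_tendsto hla).mono_left nhdsWithin_le_nhds
  have hle' : T.param e x ≤ T.param a x := by
    refine le_of_tendsto_of_tendsto te ta ?_
    filter_upwards [self_mem_nhdsWithin] with x' hx'
    exact (mem_C_iff.1 hx').1.le
  have tl : ∀ b c : ι, (T.l c).linear x.2 ≠ 0 →
      Tendsto (fun x' : Plane × Plane => T.l b (x'.1 + T.param c x' • x'.2)) (𝓝[T.C e a] x)
      (𝓝 (T.l b (x.1 + T.param c x • x.2))) := fun b c hc =>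
    (((coord_continuous (T.l b)).tendsto _).comp (point_tendsto hc)).mono_left nhdsWithin_le_nhds
  -- If the parameters agreed, the edges would share an inner point and be collinear by `noncross`;
  -- but a flight from `e` to `a` starts strictly on the inner side of `a`.
  have hlt : T.param e x < T.param a x := by
    refine lt_of_le_of_ne hle' fun heq => ?_
    rw [← heq] at hma
    have hz := noncross hme hma
    obtain ⟨x', hx'⟩ : (T.C e a).Nonempty := closure_nonempty_iff.1 ⟨x, hx⟩
    obtain ⟨-, -, -, h⟩ := mem_C_iff.1 hx'
    obtain ⟨τ, -, -, hτ⟩ := mem_openSegment_iff.1 h.1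
    have := h.2.2.2.1
    rw [hτ, AffineMap.apply_lineMap', hz.1, hz.2] at this
    linarith
  have pos_of : ∀ b : ι, ∀ s : ℝ, (T.l b).linear x.2 ≠ 0 → T.param b x ≠ s →
      0 ≤ T.l b (x.1 + s • x.2) → 0 < T.l b (x.1 + s • x.2) := by
    intro b s hb hs h0
    refine lt_of_le_of_ne h0 fun h => hs (param_eq hb h.symm)
  refine ⟨hlt, ?_, ?_, ?_⟩
  · refine pos_of a _ hla hlt.ne' (ge_of_tendsto (tl a e hle) ?_)
    filter_upwards [self_mem_nhdsWithin] with x' hx'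
    exact (mem_C_iff.1 hx').2.2.2.2.2.2.1.le
  · refine pos_of e _ hle hlt.ne (ge_of_tendsto (tl e a hla) ?_)
    filter_upwards [self_mem_nhdsWithin] with x' hx'
    exact (mem_C_iff.1 hx').2.2.2.2.2.2.2.le
  · intro r hr1 hr2
    constructor
    · have h1 : Tendsto (fun x' : Plane × Plane => x'.1 + r • x'.2) (𝓝[T.C e a] x)
          (𝓝 (x.1 + r • x.2)) :=
        (Continuous.tendsto (by fun_prop) x).mono_left nhdsWithin_le_nhds
      refine mem_closure_of_tendsto h1 ?_
      filter_upwards [self_mem_nhdsWithin, te.eventually (gt_mem_nhds hr1),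
        ta.eventually (lt_mem_nhds hr2)] with x' hx' h2 h3
      exact (mem_C_iff.1 hx').2.2.2.2.2.1 (mem_openSegment_line h2 h3)
    -- `f` reads the parameter of a point on a line, continuously in both. Near `r` it stays between
    -- the two crossing parameters, so a point of a nearby flight line that is near `x.1 + r • x.2`
    -- is inside the flight.
    · let f : (Plane × Plane) × Plane → ℝ :=
        fun q => inner ℝ (q.2 - q.1.1) q.1.2 / ‖q.1.2‖ ^ 2
      have hn : ‖x.2‖ ^ 2 ≠ 0 := by positivity
      have hf : Tendsto f (𝓝 (x, x.1 + r • x.2)) (𝓝 r) := by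
        have h1 : Tendsto (fun q : (Plane × Plane) × Plane => inner ℝ (q.2 - q.1.1) q.1.2)
          (𝓝 (x, x.1 + r • x.2)) (𝓝 (inner ℝ (x.1 + r • x.2 - x.1) x.2)) :=
          Continuous.tendsto (f := fun q : (Plane × Plane) × Plane => inner ℝ (q.2 - q.1.1) q.1.2)
            (by fun_prop) (x, x.1 + r • x.2)
        have h2 : Tendsto (fun q : (Plane × Plane) × Plane => ‖q.1.2‖ ^ 2)
          (𝓝 (x, x.1 + r • x.2)) (𝓝 (‖x.2‖ ^ 2)) :=
          Continuous.tendsto (f := fun q : (Plane × Plane) × Plane => ‖q.1.2‖ ^ 2)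
            (by fun_prop) (x, x.1 + r • x.2)
        have h3 := h1.div h2 hn
        rwa [add_sub_cancel_left, inner_smul_left, real_inner_self_eq_norm_sq,
          mul_div_cancel_right₀ _ hn] at h3
      have ev : ∀ᶠ q : (Plane × Plane) × Plane in 𝓝 (x, x.1 + r • x.2),
          T.param e q.1 < f q ∧ f q < T.param a q.1 ∧ q.1.2 ≠ 0 := by
        have g1 : Tendsto (fun q : (Plane × Plane) × Plane => T.param e q.1)
          (𝓝 (x, x.1 + r • x.2)) (𝓝 (T.param e x)) :=
          (param_tendsto hle).comp (continuous_fst.tendsto (x, x.1 + r • x.2))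
        have g2 : Tendsto (fun q : (Plane × Plane) × Plane => T.param a q.1)
          (𝓝 (x, x.1 + r • x.2)) (𝓝 (T.param a x)) :=
          (param_tendsto hla).comp (continuous_fst.tendsto (x, x.1 + r • x.2))
        have g3 : ∀ᶠ q : (Plane × Plane) × Plane in 𝓝 (x, x.1 + r • x.2), q.1.2 ≠ 0 :=
          ((continuous_snd.comp continuous_fst).tendsto (x, x.1 + r • x.2)).eventually
            (isOpen_ne.mem_nhds hu)
        filter_upwards [g1.eventually_lt hf hr1, hf.eventually_lt g2 hr2, g3] with q a1 a2 a3
        exact ⟨a1, a2, a3⟩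
      rw [nhds_prod_eq] at ev
      obtain ⟨V, hV, W, hW, hVW⟩ := Filter.eventually_prod_iff.1 ev
      refine ⟨{z | V z}, hV, {z | W z}, hW, ?_⟩
      rintro x' hx' hC _ hy' ⟨r', rfl⟩
      obtain ⟨a1, a2, a3⟩ := hVW hx' hy'
      have hr' : f (x', x'.1 + r' • x'.2) = r' := by
        have hn' : ‖x'.2‖ ^ 2 ≠ 0 := by dsimp only at a3; positivity
        simp only [f, add_sub_cancel_left, inner_smul_left, real_inner_self_eq_norm_sq]
        simp [hn']
      rw [hr'] at a1 a2
      exact (mem_C_iff.1 hC).2.2.2.2.2.1 (mem_openSegment_line a1 a2)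

end Billiard

/-! ### When a limit of flights is a flight; tilted lines -/

namespace Billiard

variable {ι : Type*} {T : Billiard ι}

/-- The only obstruction to being a flight is an edge `c` touched on the way. If arbitrarily close
to the touching point some nearby flight line also meets `c`, then that point of `c` would be inside
the region by `closure_chord`, against `disj`. -/
theorem blocked {e a : ι} {x : Plane × Plane} (hx : x ∈ closure (T.C e a))
    (he : T.Strict x e) (ha : T.Strict x a)
    (h : ∀ r, T.param e x < r → r < T.param a x → ∀ c, x.1 + r • x.2 ∈ segment ℝ (T.A c) (T.B c) →
      ∃ᶠ z : (Plane × Plane) × Plane in 𝓝 (x, x.1 + r • x.2), z.1 ∈ T.C e a ∧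
        z.2 ∈ segment ℝ (T.A c) (T.B c) ∧ ∃ r' : ℝ, z.2 = z.1.1 + r' • z.1.2) :
    x ∈ T.C e a := by
  obtain ⟨hlt, hla, hle, hr⟩ := closure_chord hx he ha
  refine ⟨_, _, hlt, he.exists.2, ha.exists.2, ?_, hla, hle⟩
  intro y hy
  obtain ⟨r, h1, h2, rfl⟩ := openSegment_line hlt hy
  by_contra hn
  obtain ⟨hcl, V, hV, W, hW, hVW⟩ := hr r h1 h2
  obtain ⟨c, hc⟩ := T.frontier _ hcl hn
  obtain ⟨z, ⟨hz1, hz2, hz3⟩, hz4⟩ := ((h r h1 h2 c hc).and_eventually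
    (prod_mem_nhds hV hW)).exists
  exact T.disj c _ hz2 (hVW z.1 hz4.1 hz1 z.2 hz4.2 hz3)

theorem strict_of_closure {e a : ι} {x : Plane × Plane} (hx : x ∈ closure (T.C e a))
    (hv : ∀ b, cross x.2 (T.A b - x.1) ≠ 0 ∧ cross x.2 (T.B b - x.1) ≠ 0) :
    T.Strict x e ∧ T.Strict x a := by
  have key : ∀ b, (∀ x' ∈ T.C e a, T.Strict x' b) → T.Strict x b := by
    intro b hb
    have hc : Continuous fun x : Plane × Plane => cross x.2 (T.A b - x.1) * cross x.2 (T.B b - x.1) :=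
      (Continuous.cross continuous_snd (by fun_prop)).mul
        (Continuous.cross continuous_snd (by fun_prop))
    have h1 : x ∈ {x : Plane × Plane | cross x.2 (T.A b - x.1) * cross x.2 (T.B b - x.1) ≤ 0} :=
      closure_minimal (fun x' hx' => (hb x' hx').le) (isClosed_le hc continuous_const) hx
    exact lt_of_le_of_ne h1 (mul_ne_zero (hv b).1 (hv b).2)
  exact ⟨key e fun x' hx' => (strict_of_mem_C hx').1, key a fun x' hx' => (strict_of_mem_C hx').2⟩

/-- A limit of flights from `e` to `a` along a line through no vertex is such a flight. -/
theorem mem_C_of_closure {e a : ι} {x : Plane × Plane} (hx : x ∈ closure (T.C e a))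
    (hv : ∀ b, cross x.2 (T.A b - x.1) ≠ 0 ∧ cross x.2 (T.B b - x.1) ≠ 0) : x ∈ T.C e a := by
  obtain ⟨he, ha⟩ := strict_of_closure hx hv
  refine blocked hx he ha fun r h1 h2 c hc => ?_
  -- An edge touched by a line through no vertex is crossed strictly, and then so do nearby lines at
  -- a nearby point, as `blocked` requires.
  have hst : T.Strict x c := by
    obtain ⟨τ, h0, h1, hτ⟩ := mem_segment_iff.1 hc
    have hz := cross_on_line x.1 x.2 r
    rw [hτ, cross_lineMap] at hz
    have hα := (hv c).1
    have hβ := (hv c).2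
    unfold Strict
    set α := cross x.2 (T.A c - x.1)
    set β := cross x.2 (T.B c - x.1)
    rcases h0.eq_or_lt with h | h
    · subst h; simp at hz; exact absurd hz hα
    rcases h1.eq_or_lt with h' | h'
    · subst h'; simp at hz; exact absurd hz hβ
    have : α = -(τ / (1 - τ)) * β := by
      have : 1 - τ ≠ 0 := by linarith
      field_simp; linarith
    rw [this]
    have h2 : 0 < τ / (1 - τ) := by apply div_pos <;> linarith
    have h3 : 0 < β * β := mul_self_pos.2 hβ
    nlinarith
  obtain ⟨hl, -⟩ := hst.exists
  have hp : T.param c x = r := param_eq hl (l_of_segment hc)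
  have ht := point_tendsto hl
  rw [hp] at ht
  have hf : ∃ᶠ x' in 𝓝 x, x' ∈ T.C e a := mem_closure_iff_frequently.1 hx
  have hst' : ∀ᶠ x' in 𝓝 x, T.Strict x' c := (isOpen_strict c).mem_nhds hst
  have := (tendsto_id.prodMk_nhds ht).frequently (hf.and_eventually hst' |>.mono ?_)
    (p := fun z : (Plane × Plane) × Plane => z.1 ∈ T.C e a ∧
        z.2 ∈ segment ℝ (T.A c) (T.B c) ∧ ∃ r' : ℝ, z.2 = z.1.1 + r' • z.1.2)
  · exact this
  · rintro x' ⟨h1, h2⟩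
    exact ⟨h1, openSegment_subset_segment _ _ _ h2.exists.2, _, rfl⟩

/-- The oriented line which passes at abscissa `t` of the line `x` at height `c + α t` above it. -/
noncomputable def tilt (x : Plane × Plane) (c α : ℝ) : Plane × Plane :=
  (x.1 + c • quarter x.2, x.2 + α • quarter x.2)

theorem tilt_zero (x : Plane × Plane) : tilt x 0 0 = x := by simp [tilt]

theorem tilt_point (x : Plane × Plane) (c α t : ℝ) :
    (tilt x c α).1 + t • (tilt x c α).2 = x.1 + t • x.2 + (c + α * t) • quarter x.2 := by
  simp only [tilt]; module

theorem tilt_continuous (x : Plane × Plane) : Continuous fun z : ℝ × ℝ => tilt x z.1 z.2 := by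
  unfold tilt; fun_prop

theorem tilt_tendsto (x : Plane × Plane) :
    Tendsto (fun z : ℝ × ℝ => tilt x z.1 z.2) (𝓝 0) (𝓝 x) := by
  have := (tilt_continuous x).tendsto 0
  simpa [tilt_zero] using this

theorem cross_shift (x : Plane × Plane) (c : ℝ) (y : Plane) :
    cross (tilt x c 0).2 (y - (tilt x c 0).1) = cross x.2 (y - x.1) - c * ‖x.2‖ ^ 2 := by
  simp only [tilt, zero_smul, add_zero]
  rw [← sub_sub, cross_sub, cross_smul, cross_quarter]

/-- If all lines close to `x` that miss finitely many points of `x` carry a flight from `e`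
to `a`, then so does `x`. -/
theorem mem_C_of_tilt {e a : ι} {x : Plane × Plane} (hu : x.2 ≠ 0) {S : Set ℝ} (hS : S.Finite)
    (h : ∀ᶠ z : ℝ × ℝ in 𝓝 0, (∀ t ∈ S, z.1 + z.2 * t ≠ 0) → z ≠ 0 → tilt x z.1 z.2 ∈ T.C e a) :
    x ∈ T.C e a := by
  have hn : 0 < ‖x.2‖ ^ 2 := by positivity
  have hc : ∀ᶠ c : ℝ in 𝓝 0, c ≠ 0 → tilt x c 0 ∈ T.C e a := by
    have : Tendsto (fun c : ℝ => ((c, 0) : ℝ × ℝ)) (𝓝 0) (𝓝 0) :=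
      Continuous.tendsto' (by fun_prop) _ _ rfl
    filter_upwards [this.eventually h] with c hc h0
    exact hc (fun t _ => by simpa using h0) (by simpa using h0)
  have hpos : ∃ᶠ c : ℝ in 𝓝 0, 0 < c := by
    have : ∃ᶠ c : ℝ in 𝓝[>] 0, 0 < c := Eventually.frequently self_mem_nhdsWithin
    exact this.filter_mono nhdsWithin_le_nhds
  have hcl : x ∈ closure (T.C e a) := by
    have h1 := ((tilt_continuous x).comp (g := fun z : ℝ × ℝ => tilt x z.1 z.2)
      (f := fun c : ℝ => ((c, 0) : ℝ × ℝ)) (by fun_prop)).tendsto 0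
    simp only [Function.comp_def, tilt_zero] at h1
    rw [mem_closure_iff_frequently]
    exact h1.frequently ((hpos.and_eventually hc).mono fun c h => h.2 h.1.ne')
  -- The parallels at heights `c` and `-c` both cross `b` strictly. Adding the two inequalities
  -- gives `2 * (α * β + c ^ 2 * ‖x.2‖ ^ 4) < 0`, so `x` itself crosses `b` strictly.
  have hst : ∀ b, (∀ x' ∈ T.C e a, T.Strict x' b) → T.Strict x b := by
    intro b hb
    obtain ⟨ε, hε, hh⟩ := Metric.eventually_nhds_iff.1 hc
    have h1 : ∀ c : ℝ, |c| < ε → c ≠ 0 → (cross x.2 (T.A b - x.1) - c * ‖x.2‖ ^ 2) *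
        (cross x.2 (T.B b - x.1) - c * ‖x.2‖ ^ 2) < 0 := by
      intro c h1 h2
      have := hb _ (hh (by simpa using h1) h2)
      unfold Strict at this
      rwa [cross_shift, cross_shift] at this
    have hcst : T.Strict x b ∨ ¬ T.Strict x b := em _
    unfold Strict at hcst ⊢
    set α := cross x.2 (T.A b - x.1)
    set β := cross x.2 (T.B b - x.1)
    rcases hcst with h2 | h2
    · exact h2
    push Not at h2
    exfalso
    set c := ε / 2 with hcdef
    have c0 : 0 < c := by positivity
    have a1 := h1 c (by rw [abs_of_pos c0]; linarith) c0.ne'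
    have a2 := h1 (-c) (by rw [abs_neg, abs_of_pos c0]; linarith) (by linarith)
    nlinarith [mul_pos (mul_pos c0 c0) (mul_pos hn hn)]
  have he := hst e fun x' hx' => (strict_of_mem_C hx').1
  have ha := hst a fun x' hx' => (strict_of_mem_C hx').2
  refine blocked hcl he ha fun r h1 h2 c hcs => ?_
  set y := x.1 + r • x.2 with hy
  have hη : ∃ᶠ η : ℝ in 𝓝 0, 0 < η ∧ η ≤ 1 := by
    refine hpos.and_eventually ?_
    filter_upwards [gt_mem_nhds (show (0 : ℝ) < 1 by norm_num)] with η h using h.le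
  have hseg : ∀ z ∈ segment ℝ (T.A c) (T.B c), ∀ η : ℝ, 0 < η ∧ η ≤ 1 →
      y + η • (z - y) ∈ segment ℝ (T.A c) (T.B c) := fun z hz η hη =>
    (convex_segment _ _).segment_subset hcs hz (mem_segment_iff.2 ⟨η, hη.1.le, hη.2, rfl⟩)
  have hyz : ∀ z : Plane, Tendsto (fun η : ℝ => y + η • (z - y)) (𝓝 0) (𝓝 y) := fun z =>
    Continuous.tendsto' (by fun_prop) _ _ (by simp)
  have hy0 : cross x.2 (y - x.1) = 0 := cross_on_line _ _ _
  -- If the touched edge `c` leaves the line `x`, the parallels to `x` through points of `c` near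
  -- `y` meet it. Otherwise `c` lies along `x`, and one rotates `x` about a point of `c` near `y`
  -- whose abscissa avoids `S`.
  by_cases hcase : ∃ z ∈ segment ℝ (T.A c) (T.B c), cross x.2 (z - x.1) ≠ 0
  · obtain ⟨z, hz, hz0⟩ := hcase
    set γ : ℝ := cross x.2 (z - x.1) / ‖x.2‖ ^ 2 with hγ
    have hγ0 : γ ≠ 0 := div_ne_zero hz0 hn.ne'
    have t1 : Tendsto (fun η : ℝ => tilt x (η * γ) 0) (𝓝 0) (𝓝 x) := by
      have : Continuous (fun η : ℝ => tilt x (η * γ) 0) :=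
        (tilt_continuous x).comp (f := fun η : ℝ => (η * γ, (0 : ℝ))) (by fun_prop)
      exact this.tendsto' _ _ (by simp [tilt_zero])
    have t2 : Tendsto (fun η : ℝ => η * γ) (𝓝 0) (𝓝 0) :=
      Continuous.tendsto' (by fun_prop) _ _ (by simp)
    refine (t1.prodMk_nhds (hyz z)).frequently ((hη.and_eventually (t2.eventually hc)).mono ?_)
    rintro η ⟨hη, hc'⟩
    refine ⟨hc' (mul_ne_zero hη.1.ne' hγ0), hseg z hz η hη, ?_⟩
    have hcr : cross x.2 (y + η • (z - y) - (tilt x (η * γ) 0).1) = 0 := by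
      have := cross_shift x (η * γ) (y + η • (z - y))
      simp only [tilt, zero_smul, add_zero] at this ⊢
      rw [this, cross_lineMap, hy0, hγ]; field_simp; ring
    obtain ⟨r', hr'⟩ := exists_smul_of_cross_eq_zero hu hcr
    refine ⟨r', ?_⟩
    simp only [tilt, zero_smul, add_zero] at hr' ⊢
    rw [← hr']; abel
  · push Not at hcase
    obtain ⟨z, hz, hzy⟩ : ∃ z ∈ segment ℝ (T.A c) (T.B c), z ≠ y := by
      by_contra hcon
      push Not at hcon
      exact T.ne c ((hcon _ (left_mem_segment ℝ _ _)).trans (hcon _ (right_mem_segment ℝ _ _)).symm)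
    obtain ⟨ρ, hρ⟩ := exists_smul_of_cross_eq_zero hu (hcase z hz)
    have hzρ : z - y = (ρ - r) • x.2 := by rw [hy, sub_smul, ← hρ]; abel
    have hρr : ρ - r ≠ 0 := by
      intro h0; rw [h0, zero_smul, sub_eq_zero] at hzρ; exact hzy hzρ
    have hfin : ∀ᶠ η : ℝ in 𝓝[>] 0, r + η * (ρ - r) ∉ S := by
      have : ((fun η : ℝ => r + η * (ρ - r)) ⁻¹' S).Finite :=
        hS.preimage fun a _ b _ hab => by
          simpa [hρr] using hab
      have h4 := (this.subset (Set.sdiff_subset (t := {(0 : ℝ)}))).isClosed.isOpen_compl.mem_nhds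
        (x := (0 : ℝ)) (by simp)
      filter_upwards [nhdsWithin_le_nhds h4, self_mem_nhdsWithin] with η h5 h6 h7
      exact h5 ⟨h7, ne_of_gt h6⟩
    have hη' : ∃ᶠ η : ℝ in 𝓝 0, (0 < η ∧ η ≤ 1) ∧ r + η * (ρ - r) ∉ S := by
      have h1 : ∀ᶠ η : ℝ in 𝓝[>] 0, η ≤ 1 :=
        nhdsWithin_le_nhds ((gt_mem_nhds (show (0 : ℝ) < 1 by norm_num)).mono fun _ h => h.le)
      have h2 : ∀ᶠ η : ℝ in 𝓝[>] 0, (0 < η ∧ η ≤ 1) ∧ r + η * (ρ - r) ∉ S := by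
        filter_upwards [self_mem_nhdsWithin, h1, hfin] with η a b c using ⟨⟨a, b⟩, c⟩
      exact h2.frequently.filter_mono nhdsWithin_le_nhds
    -- With these parameters the height at abscissa `t` is `η * (t - (r + η * (ρ - r)))`: a rotation
    -- about the chosen point of `c`.
    have t0 : Tendsto (fun η : ℝ => ((-(η * (r + η * (ρ - r))), η) : ℝ × ℝ)) (𝓝 0) (𝓝 0) :=
      Continuous.tendsto' (by fun_prop) _ _ (by simp)
    refine (((tilt_tendsto x).comp t0).prodMk_nhds (hyz z)).frequently
      ((hη'.and_eventually (t0.eventually h)).mono ?_)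
    rintro η ⟨⟨hη, hS'⟩, hc'⟩
    refine ⟨hc' ?_ ?_, hseg z hz η hη, r + η * (ρ - r), ?_⟩
    · intro t ht
      have : t - (r + η * (ρ - r)) ≠ 0 := by
        intro h0; exact hS' (by rwa [← sub_eq_zero.1 h0])
      have h3 := mul_ne_zero hη.1.ne' this
      intro h4; apply h3; dsimp only at h4; linarith
    · intro h0; exact hη.1.ne' (congrArg Prod.snd h0)
    · dsimp only [Function.comp_def]
      rw [tilt_point, hzρ, hy]
      module

end Billiard

/-! ### Two flights from the same edge along lines that do not cross -/

namespace Billiard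

variable {ι : Type*} {T : Billiard ι}

/-- Two transversals between two disjoint lines (the zero sets of `f` and `φ`) do not cross. -/
theorem collinear_of_meet {a c : ι} {y y' z z' : Plane} {f φ : Plane →ᵃ[ℝ] ℝ}
    (hy : y ∈ T.E a) (hy' : y' ∈ T.E a) (hz : z ∈ T.E c) (hz' : z' ∈ T.E c)
    (fy : f y = 0) (fz : f z = 0) (fy' : f y' < 0) (fz' : f z' < 0)
    (gy : 0 < φ y) (gz : 0 < φ z) (gy' : φ y' = 0) (gz' : φ z' = 0)
    (h0 : T.l a z ≤ 0) (h1 : 0 ≤ T.l a z') :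
    T.l a z = 0 ∧ T.l a z' = 0 := by
  obtain ⟨τ, t0, t1, ht⟩ : ∃ τ : ℝ, 0 ≤ τ ∧ τ ≤ 1 ∧ (1 - τ) * T.l a z + τ * T.l a z' = 0 := by
    rcases (sub_nonneg.2 (h0.trans h1)).eq_or_lt with h | h
    · exact ⟨0, le_rfl, zero_le_one, by linarith⟩
    · refine ⟨-T.l a z / (T.l a z' - T.l a z), div_nonneg (by linarith) h.le, ?_, ?_⟩
      · rw [div_le_one h]; linarith
      · field_simp; ring
  set D := z + τ • (z' - z) with hD
  have hDc : D ∈ T.E c :=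
    (convex_openSegment _ _).segment_subset hz hz' (mem_segment_iff.2 ⟨τ, t0, t1, rfl⟩)
  have hDl : T.l a D = 0 := by rw [hD, AffineMap.apply_lineMap', ht]
  have hfD : f D ≤ 0 := by rw [hD, AffineMap.apply_lineMap', fz]; nlinarith
  have hgD : 0 ≤ φ D := by rw [hD, AffineMap.apply_lineMap', gz']; nlinarith
  -- `D` lies between `z` and `z'`, so `f D ≤ 0 ≤ φ D`. On the line of `a` these inequalities cut
  -- out exactly the part between `y` and `y'`, so the edges `a` and `c` meet at `D`.
  have hDa : D ∈ T.E a := by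
    obtain ⟨r, hr⟩ := T.l_zero a D hDl
    obtain ⟨s, -, -, hs⟩ := mem_openSegment_iff.1 hy
    obtain ⟨s', -, -, hs'⟩ := mem_openSegment_iff.1 hy'
    have hss : s' - s ≠ 0 := by
      intro h
      rw [hs', show s' = s by linarith, ← hs] at fy'
      linarith
    set ρ := (r - s) / (s' - s) with hρ
    have hDy : D = y + ρ • (y' - y) := by
      rw [hr, hs, hs']
      have : r = s + ρ * (s' - s) := by rw [hρ]; field_simp; ring
      rw [this]; module
    rw [hDy, AffineMap.apply_lineMap', fy] at hfD
    rw [hDy, AffineMap.apply_lineMap', gy'] at hgD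
    have r0 : 0 ≤ ρ := by nlinarith
    have r1 : ρ ≤ 1 := by nlinarith
    exact (convex_openSegment _ _).segment_subset hy hy' (mem_segment_iff.2 ⟨ρ, r0, r1, hDy⟩)
  obtain ⟨h2, h3⟩ := noncross hDc hDa
  have hl : ∀ w ∈ T.E c, T.l a w = 0 := by
    intro w hw
    obtain ⟨s, -, -, rfl⟩ := mem_openSegment_iff.1 hw
    rw [AffineMap.apply_lineMap', h2, h3]; ring
  exact ⟨hl z hz, hl z' hz'⟩

/-- Two flights starting on the same edge, along two lines each of which cuts the target edge of
the other, end on the same edge if they do not cross. -/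
theorem eq_of_transversal {e a b : ι} {x y x' y' z z' : Plane} {f φ : Plane →ᵃ[ℝ] ℝ}
    (h : T.Chord e a x y) (h' : T.Chord e b x' y') (hz : z ∈ T.E b) (hz' : z' ∈ T.E a)
    (fx : f x = 0) (fy : f y = 0) (fz : f z = 0) (fx' : f x' < 0) (fy' : f y' < 0) (fz' : f z' < 0)
    (gx : 0 < φ x) (gy : 0 < φ y) (gz : 0 < φ z) (gx' : φ x' = 0) (gy' : φ y' = 0) (gz' : φ z' = 0)
    (hl : ∃ s : ℝ, z = x + s • (y - x)) (hl' : ∃ s : ℝ, z' = x' + s • (y' - x')) : a = b := by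
  obtain ⟨s, hs⟩ := hl
  obtain ⟨s', hs'⟩ := hl'
  obtain ⟨hx, hy, hr, hax, hey⟩ := h
  obtain ⟨hx', hy', hr', hbx', hey'⟩ := h'
  -- The first line meets `b` only at or beyond the end of its flight: strictly inside the flight is
  -- excluded by `disj`, and behind `x` the edges `e` and `b` would cross between the two lines.
  have hs1 : 1 ≤ s := by
    by_contra hlt
    push Not at hlt
    rcases le_or_gt s 0 with h0 | h0
    · have := collinear_of_meet hx hx' hz hy' fx fz fx' fy' gx gz gx' gy'
        (by rw [hs, AffineMap.apply_lineMap', l_of_mem hx]; nlinarith) hey'.le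
      linarith [this.2]
    · exact T.disj b z (openSegment_subset_segment _ _ _ hz) (hr (mem_openSegment_iff.2 ⟨s, h0, hlt, hs⟩))
  have hs1' : 1 ≤ s' := by
    by_contra hlt
    push Not at hlt
    rcases le_or_gt s' 0 with h0 | h0
    · have h3 := collinear_of_meet (f := -φ) (φ := -f) hx' hx hz' hy (by simp [gx']) (by simp [gz'])
        (by simpa using gx) (by simpa using gy) (by simpa using fx') (by simpa using fz')
        (by simp [fx]) (by simp [fy])
        (by rw [hs', AffineMap.apply_lineMap', l_of_mem hx']; nlinarith) hey.le
      linarith [h3.2]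
    · exact T.disj a z' (openSegment_subset_segment _ _ _ hz')
        (hr' (mem_openSegment_iff.2 ⟨s', h0, hlt, hs'⟩))
  have hax' : 0 < T.l a x' := by
    by_contra hcon
    push Not at hcon
    have := collinear_of_meet (f := -φ) (φ := -f) hz' hy hx' hx (by simp [gz']) (by simp [gx'])
        (by simpa using gy) (by simpa using gx) (by simpa using fz') (by simpa using fx')
        (by simp [fy]) (by simp [fx]) hcon hax.le
    linarith [this.2]
  have hay' : 0 ≤ T.l a y' := by
    have h0 := l_of_mem hz'
    rw [hs', AffineMap.apply_lineMap'] at h0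
    nlinarith
  have haz : T.l a z ≤ 0 := by
    rw [hs, AffineMap.apply_lineMap', l_of_mem hy]; nlinarith
  -- Between the two lines, `b` would pass from the outer to the inner side of `a`. Hence the two
  -- edges are collinear, `z = y`, and the inner sides agree at `x'`.
  obtain ⟨h1, -⟩ := collinear_of_meet hy hz' hz hy' fy fz fz' fy' gy gz gz' gy' haz hay'
  have hzy : z = y := by
    rw [hs, AffineMap.apply_lineMap', l_of_mem hy] at h1
    have : s = 1 := by nlinarith
    rw [hs, this]; module
  rw [hzy] at hz
  exact eq_of_mem hy hz hax' hbx'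

/-- The height above a line. -/
noncomputable def height (x : Plane × Plane) : Plane →ᵃ[ℝ] ℝ where
  toFun y := cross x.2 (y - x.1)
  linear :=
    { toFun := fun v => cross x.2 v
      map_add' := cross_add _
      map_smul' := fun r v => cross_smul _ _ _ }
  map_vadd' y v := by
    simp only [vadd_eq_add, LinearMap.coe_mk, AddHom.coe_mk]
    rw [add_sub_assoc, cross_add]

theorem height_apply (x : Plane × Plane) (y : Plane) : height x y = cross x.2 (y - x.1) := rfl

/-- This is `eq_of_transversal` with `f` and `φ` the two signed heights: the inequality at the
endpoints of the three edges extends to the edges by affinity, and it says that the two lines do not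
cross anywhere on them. -/
theorem eq_of_transversal_lines {e a b : ι} {x x' : Plane × Plane} {ε ε' : ℝ}
    (h : x ∈ T.C e a) (h' : x' ∈ T.C e b) (hb : T.Strict x b) (ha : T.Strict x' a)
    (hlt : ∀ c, c = e ∨ c = a ∨ c = b → ε * height x (T.A c) < ε' * height x' (T.A c) ∧
      ε * height x (T.B c) < ε' * height x' (T.B c)) : a = b := by
  obtain ⟨p, u⟩ := x
  obtain ⟨p', u'⟩ := x'
  obtain ⟨hst, h1, h2, hc⟩ := mem_C_iff.1 h
  obtain ⟨hst', h1', h2', hc'⟩ := mem_C_iff.1 h'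
  have key : ∀ c, c = e ∨ c = a ∨ c = b → ∀ y ∈ T.E c,
      ε * height (p, u) y < ε' * height (p', u') y := by
    intro c hc y hy
    obtain ⟨τ, t0, t1, rfl⟩ := mem_openSegment_iff.1 hy
    rw [AffineMap.apply_lineMap', AffineMap.apply_lineMap']
    nlinarith [mul_pos t0 (sub_pos.2 (hlt c hc).2), mul_pos (sub_pos.2 t1) (sub_pos.2 (hlt c hc).1)]
  have hon : ∀ s, ε * height (p, u) (p + s • u) = 0 := fun s => by
    rw [height_apply, cross_on_line, mul_zero]
  have hon' : ∀ s, ε' * height (p', u') (p' + s • u') = 0 := fun s => by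
    rw [height_apply, cross_on_line, mul_zero]
  have hlin : ∀ (p u : Plane) (s t r : ℝ), s < t →
      ∃ ρ : ℝ, p + r • u = (p + s • u) + ρ • ((p + t • u) - (p + s • u)) := by
    intro p u s t r hst
    have : t - s ≠ 0 := by linarith
    refine ⟨(r - s) / (t - s), ?_⟩
    have h2 : p + t • u - (p + s • u) = (t - s) • u := by module
    rw [h2, smul_smul, div_mul_cancel₀ _ this]; module
  have kx := key e (by simp) _ hc.1
  have ky := key a (by simp) _ hc.2.1
  have kz := key b (by simp) _ hb.exists.2
  have kx' := key e (by simp) _ hc'.1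
  have ky' := key b (by simp) _ hc'.2.1
  have kz' := key a (by simp) _ ha.exists.2
  dsimp only at kx ky kz kx' ky' kz'
  rw [hon] at kx ky kz
  rw [hon'] at kx' ky' kz'
  exact eq_of_transversal (f := ε • height (p, u)) (φ := ε' • height (p', u')) hc hc'
    hb.exists.2 ha.exists.2 (hon _) (hon _) (hon _) kx' ky' kz' kx ky kz (hon' _) (hon' _) (hon' _)
    (hlin _ _ _ _ _ hst) (hlin _ _ _ _ _ hst')

theorem height_continuous (y : Plane) : Continuous fun x : Plane × Plane => height x y := by
  simp only [height_apply]
  exact Continuous.cross continuous_snd (by fun_prop)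

/-- Version of `eq_of_transversal_lines` for limits of flights. -/
theorem eq_of_transversal_closure {e a b : ι} {x x' : Plane × Plane} {ε ε' : ℝ}
    (h : x ∈ closure (T.C e a)) (h' : x' ∈ closure (T.C e b)) (hb : T.Strict x b)
    (ha : T.Strict x' a)
    (hlt : ∀ c, c = e ∨ c = a ∨ c = b → ε * height x (T.A c) < ε' * height x' (T.A c) ∧
      ε * height x (T.B c) < ε' * height x' (T.B c)) : a = b := by
  have hev : ∀ y, ε * height x y < ε' * height x' y → ∀ᶠ z : (Plane × Plane) × (Plane × Plane) in
      𝓝 (x, x'), ε * height z.1 y < ε' * height z.2 y := by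
    intro y hy
    have c1 : Continuous fun z : (Plane × Plane) × (Plane × Plane) => ε * height z.1 y :=
      continuous_const.mul ((height_continuous y).comp continuous_fst)
    have c2 : Continuous fun z : (Plane × Plane) × (Plane × Plane) => ε' * height z.2 y :=
      continuous_const.mul ((height_continuous y).comp continuous_snd)
    exact (c1.tendsto (x, x')).eventually_lt (c2.tendsto (x, x')) hy
  have hf : ∃ᶠ z : (Plane × Plane) × (Plane × Plane) in 𝓝 (x, x'), z.1 ∈ T.C e a ∧ z.2 ∈ T.C e b := by
    have : (x, x') ∈ closure (T.C e a ×ˢ T.C e b) := by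
      rw [closure_prod_eq]; exact ⟨h, h'⟩
    exact mem_closure_iff_frequently.1 this
  have s1 : ∀ᶠ z : (Plane × Plane) × (Plane × Plane) in 𝓝 (x, x'), T.Strict z.1 b :=
    (continuous_fst.tendsto (x, x')).eventually ((isOpen_strict b).mem_nhds hb)
  have s2 : ∀ᶠ z : (Plane × Plane) × (Plane × Plane) in 𝓝 (x, x'), T.Strict z.2 a :=
    (continuous_snd.tendsto (x, x')).eventually ((isOpen_strict a).mem_nhds ha)
  have e1 := hev _ (hlt e (by simp)).1
  have e2 := hev _ (hlt e (by simp)).2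
  have e3 := hev _ (hlt a (by simp)).1
  have e4 := hev _ (hlt a (by simp)).2
  have e5 := hev _ (hlt b (by simp)).1
  have e6 := hev _ (hlt b (by simp)).2
  obtain ⟨z, ⟨hz, hz'⟩, z1, z2, z3, z4, z5, z6, z7, z8⟩ := (hf.and_eventually
    (s1.and (s2.and (e1.and (e2.and (e3.and (e4.and (e5.and e6)))))))).exists
  refine eq_of_transversal_lines hz hz' z1 z2 (ε := ε) (ε' := ε') ?_
  rintro c (rfl | rfl | rfl)
  exacts [⟨z3, z4⟩, ⟨z5, z6⟩, ⟨z7, z8⟩]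

/-- A ray which enters the table from an edge and meets no vertex leaves it through an edge. -/
theorem exists_mem_C {e : ι} {p u : Plane} (hp : p ∈ T.E e) (hu : 0 < (T.l e).linear u)
    (hv : ∀ s : ℝ, 0 < s → ∀ b, p + s • u ≠ T.A b ∧ p + s • u ≠ T.B b) :
    ∃ a, (p, u) ∈ T.C e a := by
  have hu0 : u ≠ 0 := by rintro rfl; simp at hu
  obtain ⟨ε, hε, hh⟩ := T.half e p hp
  obtain ⟨δ, hδ, hstart⟩ : ∃ δ > (0 : ℝ), ∀ s : ℝ, 0 < s → s < δ → p + s • u ∈ T.region := by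
    refine ⟨ε / ‖u‖, by positivity, fun s h0 h1 => hh _ ?_ ?_⟩
    · rw [dist_eq_norm, add_sub_cancel_left, norm_smul, Real.norm_of_nonneg h0.le]
      rwa [lt_div_iff₀ (by positivity)] at h1
    · rw [AffineMap.apply_add_smul, l_of_mem hp]; positivity
  -- The flight ends at the infimum of the parameters outside the region. It is positive by `half`,
  -- and `S` is nonempty because the region is bounded.
  set S : Set ℝ := {t | 0 < t ∧ p + t • u ∉ T.region} with hS
  have hSne : S.Nonempty := by
    obtain ⟨R, hR⟩ := T.bounded.subset_closedBall p
    refine ⟨(|R| + 1) / ‖u‖, by positivity, fun hm => ?_⟩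
    have := hR hm
    rw [Metric.mem_closedBall, dist_eq_norm, add_sub_cancel_left, norm_smul,
      Real.norm_of_nonneg (by positivity), div_mul_cancel₀ _ (by positivity)] at this
    linarith [le_abs_self R]
  have hSb : BddBelow S := ⟨0, fun t ht => ht.1.le⟩
  have hSge : δ ≤ sInf S := le_csInf hSne fun t ht => by
    by_contra hlt; push Not at hlt; exact ht.2 (hstart t ht.1 hlt)
  set t := sInf S with ht
  have ht0 : 0 < t := hδ.trans_le hSge
  have hnot : p + t • u ∉ T.region := by
    intro hm
    have hc : Continuous fun s : ℝ => p + s • u := by fun_prop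
    obtain ⟨η, hη, hb⟩ := Metric.mem_nhds_iff.1 ((T.isOpen.preimage hc).mem_nhds hm)
    obtain ⟨s, hs, hlt⟩ := exists_lt_of_csInf_lt hSne (show sInf S < t + η by linarith)
    refine hs.2 (hb ?_)
    have := csInf_le hSb hs
    rw [Metric.mem_ball, Real.dist_eq, abs_of_nonneg (by linarith)]; linarith
  have hin : openSegment ℝ p (p + t • u) ⊆ T.region := by
    intro z hz
    obtain ⟨s, h0, h1, rfl⟩ := openSegment_line (p := p) (u := u) (s := 0) ht0 (by simpa using hz)
    by_contra hn
    exact absurd (csInf_le hSb ⟨h0, hn⟩) (not_le.2 h1)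
  have hne : p ≠ p + t • u := by simp [hu0, ht0.ne']
  rcases T.exit _ _ hin hnot hne with ⟨a, h | h⟩ | ⟨a, ha, hla⟩
  · exact absurd h (hv t ht0 a).1
  · exact absurd h (hv t ht0 a).2
  · refine ⟨a, 0, t, ht0, by simpa using hp, ha, by simpa using hin, by simpa using hla, ?_⟩
    rw [AffineMap.apply_add_smul, l_of_mem hp]; positivity

end Billiard

/-! ### Isometries acting on oriented lines -/

/-- The action of an isometry on oriented lines, given by a point and a direction. -/
noncomputable def act (g : Plane ≃ᵃⁱ[ℝ] Plane) (x : Plane × Plane) : Plane × Plane :=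
  (g x.1, g.linearIsometryEquiv x.2)

theorem linear_mul (g h : Plane ≃ᵃⁱ[ℝ] Plane) (v : Plane) :
    (g * h).linearIsometryEquiv v = g.linearIsometryEquiv (h.linearIsometryEquiv v) := rfl

theorem act_mul (g h : Plane ≃ᵃⁱ[ℝ] Plane) (x : Plane × Plane) : act (g * h) x = act g (act h x) :=
  rfl

theorem act_one (x : Plane × Plane) : act 1 x = x := rfl

theorem act_inv_act (g : Plane ≃ᵃⁱ[ℝ] Plane) (x : Plane × Plane) : act g⁻¹ (act g x) = x := by
  rw [← act_mul, inv_mul_cancel, act_one]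

theorem act_act_inv (g : Plane ≃ᵃⁱ[ℝ] Plane) (x : Plane × Plane) : act g (act g⁻¹ x) = x := by
  rw [← act_mul, mul_inv_cancel, act_one]

theorem act_continuous (g : Plane ≃ᵃⁱ[ℝ] Plane) : Continuous (act g) :=
  (g.continuous.comp continuous_fst).prodMk (g.linearIsometryEquiv.continuous.comp continuous_snd)

theorem map_add_smul' (g : Plane ≃ᵃⁱ[ℝ] Plane) (p u : Plane) (t : ℝ) :
    g (p + t • u) = g p + t • g.linearIsometryEquiv u := by
  have := g.map_vadd p (t • u)
  rw [vadd_eq_add, add_comm] at this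
  rw [this, vadd_eq_add, add_comm, map_smul]

theorem isometry_sub (g : Plane ≃ᵃⁱ[ℝ] Plane) (p q : Plane) :
    g p - g q = g.linearIsometryEquiv (p - q) := by
  have := g.map_vsub p q
  simpa using this.symm

theorem inv_apply_self' (g : Plane ≃ᵃⁱ[ℝ] Plane) (p : Plane) : g⁻¹ (g p) = p := by
  change (g⁻¹ * g) p = p
  rw [inv_mul_cancel]; rfl

theorem apply_inv_self' (g : Plane ≃ᵃⁱ[ℝ] Plane) (p : Plane) : g (g⁻¹ p) = p := by
  change (g * g⁻¹) p = p
  rw [mul_inv_cancel]; rfl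

theorem linear_apply_inv (g : Plane ≃ᵃⁱ[ℝ] Plane) (u : Plane) :
    g.linearIsometryEquiv (g⁻¹.linearIsometryEquiv u) = u := by
  rw [← linear_mul, mul_inv_cancel]; rfl

theorem norm_linear (g : Plane ≃ᵃⁱ[ℝ] Plane) (u : Plane) : ‖g.linearIsometryEquiv u‖ = ‖u‖ :=
  g.linearIsometryEquiv.norm_map u

/-- Linear isometries of the plane preserve or reverse the orientation. -/
theorem exists_sign (g : Plane ≃ᵃⁱ[ℝ] Plane) : ∃ s : ℝ, (s = 1 ∨ s = -1) ∧
    ∀ u v, cross (g.linearIsometryEquiv u) (g.linearIsometryEquiv v) = s * cross u v := by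
  set L := g.linearIsometryEquiv
  let e0 : Plane := !₂[1, 0]
  let e1 : Plane := !₂[0, 1]
  have hin : ∀ u v, L u 0 * L v 0 + L u 1 * L v 1 = u 0 * v 0 + u 1 * v 1 := fun u v => by
    rw [← Plane.inner_eq, ← Plane.inner_eq, L.inner_map_map]
  have hcr : ∀ u v, cross (L u) (L v) = cross (L e0) (L e1) * cross u v := by
    intro u v
    have hu : ∀ u : Plane, L u = u 0 • L e0 + u 1 • L e1 := by
      intro u
      rw [← map_smul, ← map_smul, ← map_add]
      congr 1
      apply Plane.ext' <;> simp [e0, e1]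
    rw [hu u, hu v]
    simp [cross]; ring
  refine ⟨cross (L e0) (L e1), ?_, hcr⟩
  have h00 := hin e0 e0
  have h01 := hin e0 e1
  have h11 := hin e1 e1
  simp only [e0, e1, Matrix.cons_val_zero, Matrix.cons_val_one] at h00 h01 h11
  refine sq_eq_one_iff.1 ?_
  unfold cross
  linear_combination (L e1 0 * L e1 0 + L e1 1 * L e1 1) * h00 + h11 -
    (L e0 0 * L e1 0 + L e0 1 * L e1 1) * h01

/-- `quarter` is characterized by `cross v (quarter u) = inner v u`, so an isometry commutes with it
up to its orientation sign; both parameters of a tilt are multiplied by that sign. -/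
theorem tilt_act (g : Plane ≃ᵃⁱ[ℝ] Plane) {s : ℝ}
    (h : ∀ u v, cross (g.linearIsometryEquiv u) (g.linearIsometryEquiv v) = s * cross u v)
    (x : Plane × Plane) (c α : ℝ) :
    act g (Billiard.tilt x c α) = Billiard.tilt (act g x) (s * c) (s * α) := by
  have hq : g.linearIsometryEquiv (quarter x.2) = s • quarter (g.linearIsometryEquiv x.2) := by
    set L := g.linearIsometryEquiv
    have key : ∀ u v : Plane, cross v (quarter u) = inner ℝ v u := fun u v => by
      rw [Plane.inner_eq]; simp [cross]
    have hz : ∀ z, cross z (L (quarter x.2) - s • quarter (L x.2)) = 0 := by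
      intro z
      have h1 : cross z (L (quarter x.2)) = s * cross (g⁻¹.linearIsometryEquiv z) (quarter x.2) := by
        rw [← h, linear_apply_inv]
      rw [cross_sub, cross_smul, h1, key, key, ← L.inner_map_map, linear_apply_inv, sub_self]
    have h0 := hz !₂[1, 0]
    have h1 := hz !₂[0, 1]
    simp only [cross, Matrix.cons_val_zero, Matrix.cons_val_one, PiLp.sub_apply] at h0 h1
    apply Plane.ext' <;> linarith
  simp only [Billiard.tilt, act, map_add, map_smul, map_add_smul', hq, smul_smul, mul_comm s]

/-! ### Unfolding along a sequence of edges -/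

namespace Billiard

variable {ι : Type*} {T : Billiard ι}

/-- The frames of a sequence of edges `F`: the table has to be reflected to the position `frame F i`
for the flight from `F i` to `F (i + 1)` to continue the flight number `0` along a straight line. -/
noncomputable def frame (T : Billiard ι) (F : ℤ → ι) : ℤ → Plane ≃ᵃⁱ[ℝ] Plane
  | Int.ofNat n => n.rec 1 fun k g => g * T.refl (F (k + 1))
  | Int.negSucc n => n.rec (T.refl (F 0)) fun k g => g * T.refl (F (-(k + 1)))

variable {F F' : ℤ → ι}

@[simp] theorem frame_zero : T.frame F 0 = 1 := rfl

/-- Since the reflections are involutions, one recursion holds over all integers; at time `-1` the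
frame is the reflection in `F 0`, which `frame_succ` cancels. -/
theorem frame_succ (F : ℤ → ι) (i : ℤ) : T.frame F (i + 1) = T.frame F i * T.refl (F (i + 1)) := by
  match i with
  | Int.ofNat n => rfl
  | Int.negSucc 0 =>
    show (1 : Plane ≃ᵃⁱ[ℝ] Plane) = T.refl (F 0) * T.refl (F 0)
    rw [T.refl_sq]
  | Int.negSucc (n + 1) =>
    have h : (Int.negSucc (n + 1) + 1 : ℤ) = Int.negSucc n := by omega
    rw [h]
    have h2 : T.frame F (Int.negSucc (n + 1)) =
      T.frame F (Int.negSucc n) * T.refl (F (-(n + 1))) := rfl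
    rw [h2, mul_assoc]
    have h3 : Int.negSucc n = -((n : ℤ) + 1) := by omega
    rw [h3, T.refl_sq, mul_one]

theorem frame_pred (F : ℤ → ι) (i : ℤ) : T.frame F (i - 1) = T.frame F i * T.refl (F i) := by
  have := T.frame_succ F (i - 1)
  rw [sub_add_cancel] at this
  rw [this, mul_assoc, T.refl_sq, mul_one]

/-- The sequence of edges, seen from time `k`. -/
def shift (k : ℤ) (F : ℤ → ι) : ℤ → ι := fun i => F (k + i)

/-- The sequence of edges in reversed order. -/
def rev (F : ℤ → ι) : ℤ → ι := fun i => F (1 - i)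

theorem frame_add (F : ℤ → ι) (k i : ℤ) : T.frame F (k + i) = T.frame F k * T.frame (shift k F) i := by
  induction i using Int.induction_on with
  | zero => simp
  | succ i ih => rw [← add_assoc, frame_succ, ih, frame_succ, mul_assoc]; simp [shift, add_assoc]
  | pred i ih => rw [← add_sub_assoc, frame_pred, ih, frame_pred, mul_assoc]; simp [shift]

/-- The index `1 - i` in `rev` is chosen so that flight number `i` of the reversed sequence is
flight number `-i` of `F` run backward; flight number `0` keeps the trivial frame. -/
theorem frame_rev (F : ℤ → ι) (i : ℤ) : T.frame (rev F) i = T.frame F (-i) := by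
  induction i using Int.induction_on with
  | zero => simp
  | succ i ih => rw [frame_succ, ih, neg_add', frame_pred]; simp [rev]
  | pred i ih => rw [frame_pred, ih, neg_sub', sub_neg_eq_add, frame_succ]; simp [rev]; ring_nf

theorem frame_congr {i : ℤ} (h : ∀ j, min i 0 ≤ j → j ≤ max i 0 → F j = F' j) :
    T.frame F i = T.frame F' i := by
  induction i using Int.induction_on with
  | zero => rfl
  | succ i ih =>
    rw [frame_succ, frame_succ, ih fun j h1 h2 => h j (by omega) (by omega),
      h (i + 1) (by omega) (by omega)]
  | pred i ih =>
    rw [frame_pred, frame_pred, ih fun j h1 h2 => h j (by omega) (by omega),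
      h (-i) (by omega) (by omega)]

/-- The lines which, unfolded, follow the edges `F m`, ..., `F n`. -/
def R (T : Billiard ι) (F : ℤ → ι) (m n : ℤ) : Set (Plane × Plane) :=
  {x | ∀ i, m ≤ i → i < n → act (T.frame F i)⁻¹ x ∈ T.C (F i) (F (i + 1))}

theorem R_eq_iInter (F : ℤ → ι) (m n : ℤ) : T.R F m n =
    ⋂ i ∈ Set.Ico m n, act (T.frame F i)⁻¹ ⁻¹' T.C (F i) (F (i + 1)) := by
  ext x; simp [R]

theorem isOpen_R (F : ℤ → ι) (m n : ℤ) : IsOpen (T.R F m n) := by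
  rw [R_eq_iInter]
  exact (Set.finite_Ico m n).isOpen_biInter fun i _ => (isOpen_C _ _).preimage (act_continuous _)

theorem R_mono {m n m' n' : ℤ} (hm : m ≤ m') (hn : n' ≤ n) : T.R F m n ⊆ T.R F m' n' :=
  fun _ hx i h1 h2 => hx i (hm.trans h1) (h2.trans_le hn)

theorem R_congr {m n : ℤ} (h : ∀ j, min m 0 ≤ j → j ≤ max n 0 → F j = F' j) :
    T.R F m n = T.R F' m n := by
  ext x
  refine forall₃_congr fun i h1 h2 => ?_
  rw [frame_congr fun j h3 h4 => h j (by omega) (by omega), h i (by omega) (by omega),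
    h (i + 1) (by omega) (by omega)]

theorem mem_R_slide {m n : ℤ} {p u : Plane} {s r : ℝ} (hr : 0 < r) :
    (p + s • u, r • u) ∈ T.R F m n ↔ (p, u) ∈ T.R F m n := by
  refine forall₃_congr fun i h1 h2 => ?_
  simp only [act, map_add_smul', map_smul]
  exact mem_C_slide hr

theorem mem_R_shift {k m n : ℤ} {x : Plane × Plane} :
    act (T.frame F k)⁻¹ x ∈ T.R (shift k F) m n ↔ x ∈ T.R F (k + m) (k + n) := by
  have key : ∀ i, act (T.frame (shift k F) i)⁻¹ (act (T.frame F k)⁻¹ x) =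
      act (T.frame F (k + i))⁻¹ x := by
    intro i; rw [frame_add, mul_inv_rev, act_mul]
  constructor
  · intro h i h1 h2
    have := h (i - k) (by omega) (by omega)
    rw [key] at this
    simp only [shift] at this
    rwa [show k + (i - k + 1) = i + 1 by ring, show k + (i - k) = i by ring] at this
  · intro h i h1 h2
    rw [key]
    simpa only [shift, add_assoc] using h (k + i) (by omega) (by omega)

theorem mem_R_rev {m n : ℤ} {p u : Plane} :
    (p, -u) ∈ T.R (rev F) m n ↔ (p, u) ∈ T.R F (1 - n) (1 - m) := by
  have key : ∀ i, act (T.frame (rev F) i)⁻¹ (p, -u) ∈ T.C (rev F i) (rev F (i + 1)) ↔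
      act (T.frame F (-i))⁻¹ (p, u) ∈ T.C (F (-i)) (F (-i + 1)) := by
    intro i
    simp only [frame_rev, act, map_neg, rev]
    rw [mem_C_reverse, neg_neg, show 1 - (i + 1) = -i by ring, show 1 - i = -i + 1 by ring]
  constructor
  · intro h i h1 h2
    have := (key (-i)).1 (h (-i) (by omega) (by omega))
    rwa [neg_neg] at this
  · intro h i h1 h2
    exact (key i).2 (h (-i) (by omega) (by omega))

end Billiard

/-! ### Crossing times of limit lines -/

theorem Ultrafilter.exists_tendsto {α X : Type*} [TopologicalSpace X] (V : Ultrafilter α) {f : α → X}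
    {K : Set X} (hK : IsCompact K) (h : ∀ᶠ k in (V : Filter α), f k ∈ K) :
    ∃ x ∈ K, Tendsto f V (𝓝 x) := by
  obtain ⟨x, hx, hle⟩ := hK.ultrafilter_le_nhds' (V.map f) h
  exact ⟨x, hx, hle⟩

theorem Ultrafilter.exists_eq {α X : Type*} [Finite X] (V : Ultrafilter α) (f : α → X) :
    ∃ x, ∀ᶠ k in (V : Filter α), f k = x := by
  have h : ∀ᶠ k in (V : Filter α), ∃ x, f k = x := Eventually.of_forall fun k => ⟨_, rfl⟩
  exact Ultrafilter.eventually_exists_iff.1 h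

namespace Billiard

variable {ι : Type*} {T : Billiard ι} {F F' : ℤ → ι}

/-- The closed edge. -/
abbrev seg (T : Billiard ι) (a : ι) : Set Plane := segment ℝ (T.A a) (T.B a)

theorem isClosed_seg (a : ι) : IsClosed (T.seg a) := by
  have : T.seg a = AffineMap.lineMap (T.A a) (T.B a) '' Set.Icc (0 : ℝ) 1 :=
    segment_eq_image_lineMap ℝ _ _
  rw [this]
  exact (isCompact_Icc.image AffineMap.lineMap_continuous).isClosed

theorem refl_seg {a : ι} {y : Plane} (hy : y ∈ T.seg a) : T.refl a y = y := by
  obtain ⟨t, -, -, rfl⟩ := mem_segment_iff.1 hy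
  rw [map_add_smul', ← isometry_sub, T.refl_A, T.refl_B]

theorem refl_inv (a : ι) : (T.refl a)⁻¹ = T.refl a := inv_eq_of_mul_eq_one_left (T.refl_sq a)

theorem frame_succ_inv (F : ℤ → ι) (i : ℤ) (y : Plane) :
    (T.frame F (i + 1))⁻¹ y = T.refl (F (i + 1)) ((T.frame F i)⁻¹ y) := by
  rw [frame_succ, mul_inv_rev, refl_inv]; rfl

theorem frame_inv_succ (F : ℤ → ι) (i : ℤ) (y : Plane) :
    (T.frame F i)⁻¹ y = T.refl (F (i + 1)) ((T.frame F (i + 1))⁻¹ y) := by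
  rw [frame_succ_inv]
  change _ = (T.refl (F (i + 1)) * T.refl (F (i + 1))) _
  rw [T.refl_sq]; rfl

/-- A bounce point is fixed by the reflection in its edge, so the two copies of the table that share
this edge see it at the same place. -/
theorem frame_succ_inv_seg {i : ℤ} {y : Plane}
    (h : (T.frame F i)⁻¹ y ∈ T.seg (F (i + 1)) ∨ (T.frame F (i + 1))⁻¹ y ∈ T.seg (F (i + 1))) :
    (T.frame F i)⁻¹ y = (T.frame F (i + 1))⁻¹ y := by
  rcases h with h | h
  · rw [frame_succ_inv, refl_seg h]
  · rw [frame_inv_succ, refl_seg h]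

theorem exists_bound [Finite ι] (T : Billiard ι) :
    ∃ D : ℝ, 0 < D ∧ ∀ a, ∀ y ∈ T.seg a, ‖y‖ ≤ D := by
  have h : Bornology.IsBounded (⋃ a, T.seg a) := by
    rw [Bornology.isBounded_iUnion]
    intro a
    exact (isCompact_Icc.image AffineMap.lineMap_continuous).isBounded.subset
      (segment_eq_image_lineMap ℝ (T.A a) (T.B a)).le
  obtain ⟨D, hD, h⟩ := h.exists_pos_norm_le
  exact ⟨D, hD, fun a y hy => h y (Set.mem_iUnion.2 ⟨a, hy⟩)⟩

/-- The parameters at which a line in `R F m n` crosses the successive edges. -/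
theorem crossing {m n : ℤ} {x : Plane × Plane} (hx : x ∈ T.R F m n) {i : ℤ} (h1 : m ≤ i)
    (h2 : i < n) :
    (T.frame F i)⁻¹ (x.1 + T.param (F i) (act (T.frame F i)⁻¹ x) • x.2) ∈ T.E (F i) ∧
      (i + 1 < n → T.param (F i) (act (T.frame F i)⁻¹ x) <
        T.param (F (i + 1)) (act (T.frame F (i + 1))⁻¹ x)) := by
  obtain ⟨h, h3, h4, h5⟩ := mem_C_iff.1 (hx i h1 h2)
  refine ⟨by rw [map_add_smul']; exact h5.1, fun h6 => ?_⟩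
  obtain ⟨-, h7, -, -⟩ := mem_C_iff.1 (hx (i + 1) (by omega) h6)
  refine h.trans_eq (param_eq h7 ?_).symm
  have h8 := h5.2.1
  simp only [act] at h8 ⊢
  rw [← map_add_smul'] at h8 ⊢
  rw [← frame_succ_inv_seg (Or.inl (openSegment_subset_segment _ _ _ h8))]
  exact l_of_mem h8

/-- The crossing parameters of approximating lines are bounded for each edge, as the edges are
bounded and the directions stay away from zero. A single ultrafilter provides the limits for all
edges at once. Strict order becomes weak order because the limit line may pass through vertices. -/
theorem exists_crossings [Finite ι] {m : ℤ} {p u : Plane} (hu : u ≠ 0)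
    (hx : ∀ n, (p, u) ∈ closure (T.R F m n)) :
    ∃ s : ℤ → ℝ, (∀ i, m ≤ i → (T.frame F i)⁻¹ (p + s i • u) ∈ T.seg (F i)) ∧
      ∀ i, m ≤ i → s i ≤ s (i + 1) := by
  obtain ⟨D, hD, hDb⟩ := T.exists_bound
  have hex : ∀ k : ℕ, ∃ y ∈ T.R F m (m + k), dist y (p, u) < 1 / ((k : ℝ) + 1) := fun k => by
    obtain ⟨y, hy, hd⟩ := Metric.mem_closure_iff.1 (hx (m + k)) (1 / ((k : ℝ) + 1)) (by positivity)
    exact ⟨y, hy, by rwa [dist_comm]⟩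
  choose y hy hd using hex
  have hlim : Tendsto y (hyperfilter ℕ : Filter ℕ) (𝓝 (p, u)) := by
    refine Tendsto.mono_left ?_ Nat.hyperfilter_le_atTop
    rw [tendsto_iff_dist_tendsto_zero]
    exact squeeze_zero (fun _ => dist_nonneg) (fun k => (hd k).le) tendsto_one_div_add_atTop_nhds_zero_nat
  have hl1 := (continuous_fst.tendsto (p, u)).comp hlim
  have hl2 := (continuous_snd.tendsto (p, u)).comp hlim
  simp only [Function.comp_def] at hl1 hl2
  let σ : ℤ → ℕ → ℝ := fun i k => T.param (F i) (act (T.frame F i)⁻¹ (y k))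
  have hev : ∀ i, m ≤ i → ∀ᶠ k : ℕ in (hyperfilter ℕ : Filter ℕ), i + 1 < m + (k : ℤ) := by
    intro i hi
    refine Nat.hyperfilter_le_atTop ?_
    filter_upwards [eventually_gt_atTop (i + 1 - m).toNat] with k hk
    omega
  have hσ : ∀ i, m ≤ i → ∃ s, Tendsto (σ i) (hyperfilter ℕ : Filter ℕ) (𝓝 s) := by
    intro i hi
    set g := (T.frame F i)⁻¹
    have hu2 : 0 < ‖u‖ / 2 := by positivity
    have hb : ∀ᶠ k in (hyperfilter ℕ : Filter ℕ),
        σ i k ∈ Metric.closedBall (0 : ℝ) ((D + (‖g p‖ + 1)) / (‖u‖ / 2)) := by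
      have e1 : ∀ᶠ k in (hyperfilter ℕ : Filter ℕ), ‖u‖ / 2 < ‖(y k).2‖ :=
        hl2.norm.eventually (lt_mem_nhds (by linarith))
      have e2 : ∀ᶠ k in (hyperfilter ℕ : Filter ℕ), ‖g (y k).1‖ < ‖g p‖ + 1 :=
        ((g.continuous.tendsto p).comp hl1).norm.eventually (gt_mem_nhds (by linarith))
      filter_upwards [e1, e2, hev i hi] with k h1 h2 h3
      have h4 := (crossing (hy k) hi (by omega)).1
      have h5 := hDb _ _ (openSegment_subset_segment _ _ _ h4)
      rw [map_add_smul'] at h5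
      have h6 : ‖σ i k • g.linearIsometryEquiv (y k).2‖ ≤ D + ‖g (y k).1‖ := by
        have := norm_sub_le (g (y k).1 + σ i k • g.linearIsometryEquiv (y k).2) (g (y k).1)
        rw [add_sub_cancel_left] at this
        linarith
      rw [norm_smul, norm_linear] at h6
      rw [mem_closedBall_zero_iff, le_div_iff₀ hu2]
      calc ‖σ i k‖ * (‖u‖ / 2) ≤ ‖σ i k‖ * ‖(y k).2‖ := by gcongr
        _ ≤ _ := by linarith
    obtain ⟨s, -, hs⟩ := (hyperfilter ℕ).exists_tendsto (isCompact_closedBall _ _) hb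
    exact ⟨s, hs⟩
  choose! s hs using hσ
  refine ⟨s, fun i hi => ?_, fun i hi => ?_⟩
  · have h1 := ((T.frame F i)⁻¹.continuous.tendsto _).comp (hl1.add ((hs i hi).smul hl2))
    refine (T.isClosed_seg (F i)).mem_of_tendsto h1 ?_
    filter_upwards [hev i hi] with k h3
    exact openSegment_subset_segment _ _ _ (crossing (hy k) hi (by omega)).1
  · refine le_of_tendsto_of_tendsto (hs i hi) (hs (i + 1) (by omega)) ?_
    filter_upwards [hev i hi] with k h3
    exact ((crossing (hy k) hi (by omega)).2 h3).le

end Billiard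

/-! ### Crossing times tend to infinity -/

/-- The left side is the sine of the angle under which the segment from `a` to `b` on a line at
distance 1 is seen; it is at most the angle. -/
theorem norm_mul_arctan_sub {a b : ℝ} (hab : a < b) :
    (b - a) / (√(1 + a ^ 2) * √(1 + b ^ 2)) ≤ Real.arctan b - Real.arctan a := by
  have h : Real.sin (Real.arctan b - Real.arctan a) = (b - a) / (√(1 + a ^ 2) * √(1 + b ^ 2)) := by
    rw [Real.sin_sub, Real.sin_arctan, Real.cos_arctan, Real.sin_arctan, Real.cos_arctan]
    field_simp
  rw [← h]
  exact Real.sin_le (sub_nonneg.2 (Real.arctan_strictMono hab).le)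

namespace Billiard

variable {ι : Type*} {T : Billiard ι} {F F' : ℤ → ι}

theorem frame_apply_seg {m : ℤ} {q : Plane} (h : ∀ i, m ≤ i → q ∈ T.seg (F i)) (k : ℕ) :
    T.frame F (m + k) q = T.frame F m q := by
  induction k with
  | zero => simp
  | succ k ih =>
    rw [← ih, Nat.cast_succ, ← add_assoc, frame_succ]
    change T.frame F (m + k) (T.refl _ q) = _
    rw [refl_seg (h _ (by omega))]

/-- The constant is the smallest sine of an angle between two nonparallel edges, a minimum over
finitely many pairs. -/
theorem exists_angle [Finite ι] [Nonempty ι] (T : Billiard ι) : ∃ c : ℝ, 0 < c ∧ ∀ a b,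
    cross (T.B a - T.A a) (T.B b - T.A b) ≠ 0 →
    c * (‖T.B a - T.A a‖ * ‖T.B b - T.A b‖) ≤ |cross (T.B a - T.A a) (T.B b - T.A b)| := by
  let f : ι × ι → ℝ := fun z =>
    if cross (T.B z.1 - T.A z.1) (T.B z.2 - T.A z.2) = 0 then 1 else
      |cross (T.B z.1 - T.A z.1) (T.B z.2 - T.A z.2)| /
        (‖T.B z.1 - T.A z.1‖ * ‖T.B z.2 - T.A z.2‖)
  have hn : ∀ a, 0 < ‖T.B a - T.A a‖ := fun a => norm_pos_iff.2 (sub_ne_zero.2 (T.ne a).symm)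
  obtain ⟨z, hz⟩ := Finite.exists_min f
  refine ⟨f z, ?_, fun a b hab => ?_⟩
  · simp only [f]
    split_ifs with h
    · norm_num
    · have := hn z.1; have := hn z.2; have := abs_pos.2 h; positivity
  · have := hz (a, b)
    simp only [f, if_neg hab] at this
    rwa [le_div_iff₀ (mul_pos (hn a) (hn b))] at this

/-- No flight turns around a vertex forever. -/
theorem not_forall_mem_seg [Finite ι] {m : ℤ} {q : Plane} (hq : ∀ i, m ≤ i → q ∈ T.seg (F i))
    (h : ∀ n, (T.R F m n).Nonempty) : False := by
  have : Nonempty ι := ⟨F 0⟩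
  obtain ⟨c, hc, hang⟩ := T.exists_angle
  obtain ⟨M, hM⟩ := exists_nat_gt (Real.pi / c)
  obtain ⟨⟨p, u⟩, hx⟩ := h (m + (M + 3 : ℕ))
  set Q := T.frame F m q with hQ
  have hQi : ∀ k : ℕ, (T.frame F (m + k))⁻¹ Q = q := fun k => by
    rw [hQ, ← frame_apply_seg hq k, inv_apply_self']
  let s : ℕ → ℝ := fun k => T.param (F (m + k)) (act (T.frame F (m + k))⁻¹ (p, u))
  have hs : ∀ k : ℕ, k < M + 3 → (T.frame F (m + k))⁻¹ (p + s k • u) ∈ T.E (F (m + k)) := fun k hk =>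
    (crossing hx (by omega) (by push_cast; omega)).1
  have hlt : ∀ k : ℕ, k + 1 < M + 3 → s k < s (k + 1) := fun k hk => by
    have := (crossing hx (i := m + k) (by omega) (by push_cast; omega)).2 (by push_cast; omega)
    simpa only [s, Nat.cast_succ, add_assoc] using this
  have hlin : ∀ k : ℕ, k < M + 3 →
      (T.l (F (m + k))).linear ((T.frame F (m + k))⁻¹.linearIsometryEquiv u) ≠ 0 := fun k hk =>
    (mem_C_iff.1 (hx (m + k) (by omega) (by push_cast; omega))).2.1
  have hu : u ≠ 0 := by
    rintro rfl
    apply hlin 0 (by omega); simp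
  -- the line does not pass through the vertex
  have hoff : cross u (Q - p) ≠ 0 := by
    intro h0
    obtain ⟨r, hr⟩ := exists_smul_of_cross_eq_zero hu h0
    have hQ' : Q = p + r • u := by rw [← hr]; abel
    have hsr : ∀ k : ℕ, k < M + 3 → s k = r := by
      intro k hk
      refine param_eq (hlin k hk) ?_
      simp only [act]
      rw [← map_add_smul', ← hQ', hQi]
      exact l_of_segment (hq _ (by omega))
    have := hlt 0 (by omega)
    rw [hsr 0 (by omega), hsr 1 (by omega)] at this
    exact lt_irrefl _ this
  set n2 := ‖u‖ ^ 2 with hn2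
  have hn2' : 0 < n2 := by positivity
  set d := cross u (Q - p) / n2 with hd
  have hd0 : d ≠ 0 := div_ne_zero hoff hn2'.ne'
  obtain ⟨r, hr⟩ : ∃ r : ℝ, Q = p + r • u + d • quarter u := by
    have : cross u (Q - p - d • quarter u) = 0 := by
      rw [cross_sub, cross_smul, cross_quarter, hd, ← hn2]; field_simp; ring
    obtain ⟨r, hr⟩ := exists_smul_of_cross_eq_zero hu this
    exact ⟨r, by rw [← hr]; abel⟩
  -- `Real.arctan (t k)` is the angle at which the `k`-th crossing is seen from `Q`, measured from
  -- the foot of the perpendicular.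
  let t : ℕ → ℝ := fun k => (s k - r) / |d|
  have had : 0 < |d| := abs_pos.2 hd0
  clear_value d
  -- Consecutive unfolded edges all pass through `Q`, so the angle between the views of consecutive
  -- crossings is an angle between two edges of the table and its sine is at least `c`.
  have hstep : ∀ k : ℕ, k < M + 1 → c ≤ Real.arctan (t (k + 1)) - Real.arctan (t k) := by
    intro k hk
    have htt : t k < t (k + 1) := by
      simp only [t]; gcongr; exact hlt k (by omega)
    refine le_trans ?_ (norm_mul_arctan_sub htt)
    -- direction of the edges, seen from the vertex
    have hdir : ∀ j : ℕ, j < M + 3 → ∃ ρ : ℝ, (T.frame F (m + j))⁻¹.linearIsometryEquiv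
        (p + s j • u - Q) = ρ • (T.B (F (m + j)) - T.A (F (m + j))) := by
      intro j hj
      obtain ⟨τ, -, -, hτ⟩ := mem_openSegment_iff.1 (hs j hj)
      obtain ⟨τ', -, -, hτ'⟩ := mem_segment_iff.1 (hq (m + j) (by omega))
      refine ⟨τ - τ', ?_⟩
      rw [← isometry_sub, hτ, hQi, hτ']; module
    obtain ⟨ρ, hρ⟩ := hdir k (by omega)
    obtain ⟨ρ', hρ'⟩ := hdir (k + 1) (by omega)
    have hρ2 : (T.frame F (m + k))⁻¹.linearIsometryEquiv (p + s (k + 1) • u - Q) =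
        ρ' • (T.B (F (m + (k + 1 : ℕ))) - T.A (F (m + (k + 1 : ℕ)))) := by
      rw [← hρ', ← isometry_sub, ← isometry_sub]
      have e1 : (m + (k + 1 : ℕ) : ℤ) = m + k + 1 := by push_cast; ring
      have h1 := openSegment_subset_segment _ _ _ (hs (k + 1) (by omega))
      have h2 := hq (m + (k + 1 : ℕ)) (by omega)
      rw [← hQi (k + 1)] at h2
      rw [e1] at h1 h2 ⊢
      rw [frame_succ_inv_seg (Or.inr h1), frame_succ_inv_seg (Or.inr h2)]
    set va := T.B (F (m + k)) - T.A (F (m + k))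
    set vb := T.B (F (m + (k + 1 : ℕ))) - T.A (F (m + (k + 1 : ℕ)))
    obtain ⟨ε, hε, hcr⟩ := exists_sign (T.frame F (m + k))⁻¹
    have hε1 : |ε| = 1 := by rcases hε with h | h <;> simp [h]
    have h1 : |ρ * ρ'| * |cross va vb| = n2 * (|d| * (s (k + 1) - s k)) := by
      have h2 := hcr (p + s k • u - Q) (p + s (k + 1) • u - Q)
      rw [hρ, hρ2, smul_cross, cross_smul] at h2
      have h3 : cross (p + s k • u - Q) (p + s (k + 1) • u - Q) = n2 * (d * (s (k + 1) - s k)) := by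
        rw [hn2, Plane.norm_sq, hr]; simp [cross]; ring
      rw [h3] at h2
      have h4 := congrArg abs h2
      rw [← mul_assoc, abs_mul, abs_mul ε, hε1, abs_mul n2, abs_mul d, abs_of_pos hn2',
        abs_of_pos (sub_pos.2 (hlt k (by omega)))] at h4
      rw [h4]; ring
    have hnorm : ∀ j : ℕ, ‖p + s j • u - Q‖ = √n2 * |d| * √(1 + t j ^ 2) := by
      intro j
      have h5 : ‖p + s j • u - Q‖ ^ 2 = (√n2 * |d| * √(1 + t j ^ 2)) ^ 2 := by
        rw [mul_pow, mul_pow, Real.sq_sqrt hn2'.le, Real.sq_sqrt (by positivity), sq_abs]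
        have : n2 * d ^ 2 * (1 + t j ^ 2) = n2 * (d ^ 2 + (s j - r) ^ 2) := by
          simp only [t]
          rw [div_pow, sq_abs]; field_simp
        rw [this, hn2, Plane.norm_sq, Plane.norm_sq, hr]; simp; ring
      exact (pow_left_inj₀ (norm_nonneg _) (by positivity) two_ne_zero).1 h5
    have h6 : |ρ| * ‖va‖ = √n2 * |d| * √(1 + t k ^ 2) := by
      rw [← hnorm, ← norm_linear (T.frame F (m + k))⁻¹ (p + s k • u - Q), hρ, norm_smul, Real.norm_eq_abs]
    have h7 : |ρ'| * ‖vb‖ = √n2 * |d| * √(1 + t (k + 1) ^ 2) := by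
      rw [← hnorm, ← norm_linear (T.frame F (m + k))⁻¹ (p + s (k + 1) • u - Q), hρ2, norm_smul, Real.norm_eq_abs]
    have hne : cross va vb ≠ 0 := by
      intro h0
      rw [h0, abs_zero, mul_zero] at h1
      have := sub_pos.2 (hlt k (by omega))
      have : 0 < n2 * (|d| * (s (k + 1) - s k)) := by positivity
      linarith
    have h8 := hang _ _ hne
    have hpp : 0 < √(1 + t k ^ 2) * √(1 + t (k + 1) ^ 2) := by positivity
    rw [le_div_iff₀ hpp]
    have h9 : t (k + 1) - t k = (s (k + 1) - s k) / |d| := by simp only [t]; ring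
    rw [h9, le_div_iff₀ had]
    have h10 : c * (|ρ * ρ'| * (‖va‖ * ‖vb‖)) ≤ |ρ * ρ'| * |cross va vb| := by
      nlinarith [mul_le_mul_of_nonneg_left h8 (abs_nonneg (ρ * ρ'))]
    rw [h1, abs_mul] at h10
    have h11 : |ρ| * |ρ'| * (‖va‖ * ‖vb‖) =
        n2 * |d| * (|d| * (√(1 + t k ^ 2) * √(1 + t (k + 1) ^ 2))) := by
      calc |ρ| * |ρ'| * (‖va‖ * ‖vb‖) = (|ρ| * ‖va‖) * (|ρ'| * ‖vb‖) := by ring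
        _ = _ := by
          rw [h6, h7]
          linear_combination (|d| * |d| * √(1 + t k ^ 2) * √(1 + t (k + 1) ^ 2)) *
            Real.mul_self_sqrt hn2'.le
    rw [h11] at h10
    have hnd : 0 < n2 * |d| := by positivity
    nlinarith
  -- The `M + 1` steps add up to more than `π`, while a line is seen from a point off it under an
  -- angle less than `π`.
  have htot : ∀ k : ℕ, k ≤ M + 1 → k * c ≤ Real.arctan (t k) - Real.arctan (t 0) := by
    intro k
    induction k with
    | zero => simp
    | succ k ih =>
      intro hk
      have := ih (by omega)
      have := hstep k (by omega)
      push_cast; linarith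
  have h1 := htot (M + 1) le_rfl
  have h2 := Real.arctan_lt_pi_div_two (t (M + 1))
  have h3 := Real.neg_pi_div_two_lt_arctan (t 0)
  rw [div_lt_iff₀ hc] at hM
  push_cast at h1
  nlinarith

/-- If the nondecreasing crossing times were bounded, the bounce points would have summable steps
and converge to some `z`. As there are finitely many closed edges, all late edges would contain `z`,
which `not_forall_mem_seg` excludes. -/
theorem crossings_unbounded [Finite ι] {m : ℤ} {p u : Plane} (hne : ∀ n, (T.R F m n).Nonempty)
    {s : ℤ → ℝ} (hs : ∀ i, m ≤ i → (T.frame F i)⁻¹ (p + s i • u) ∈ T.seg (F i))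
    (hmono : ∀ i, m ≤ i → s i ≤ s (i + 1)) (B : ℝ) : ∃ j, m ≤ j ∧ ∀ i, j ≤ i → B < s i := by
  have hmono' : ∀ i, m ≤ i → ∀ k : ℕ, s i ≤ s (i + k) := by
    intro i hi k
    induction k with
    | zero => simp
    | succ k ih =>
      refine ih.trans ?_
      have := hmono (i + k) (by omega)
      rwa [add_assoc] at this
  suffices h : ∃ j, m ≤ j ∧ B < s j by
    obtain ⟨j, hj, hB⟩ := h
    refine ⟨j, hj, fun i hi => hB.trans_le ?_⟩
    have := hmono' j hj (i - j).toNat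
    rwa [show j + ((i - j).toNat : ℤ) = i by omega] at this
  by_contra hcon
  push Not at hcon
  let q : ℕ → Plane := fun k => (T.frame F (m + k))⁻¹ (p + s (m + k) • u)
  have hqs : ∀ k : ℕ, q k ∈ T.seg (F (m + k)) := fun k => hs _ (by omega)
  have hd : ∀ k : ℕ, dist (q k) (q (k + 1)) ≤ (s (m + (k + 1 : ℕ)) - s (m + k)) * ‖u‖ := by
    intro k
    have e1 : (m + (k + 1 : ℕ) : ℤ) = m + k + 1 := by push_cast; ring
    have h1 := hqs (k + 1)
    simp only [q] at h1 ⊢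
    rw [e1] at h1 ⊢
    rw [← frame_succ_inv_seg (Or.inr h1), (T.frame F (m + k))⁻¹.dist_map, dist_eq_norm]
    have h2 : p + s (m + k) • u - (p + s (m + k + 1) • u) = (s (m + k) - s (m + k + 1)) • u := by
      module
    have h3 := hmono (m + k) (by omega)
    rw [h2, norm_smul, Real.norm_eq_abs, abs_sub_comm, abs_of_nonneg (by linarith)]
  have hsum : Summable fun k : ℕ => (s (m + (k + 1 : ℕ)) - s (m + k)) * ‖u‖ := by
    apply Summable.mul_right
    refine summable_of_sum_range_le (c := B - s m) (fun k => ?_) fun n => ?_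
    · have h3 := hmono (m + k) (by omega)
      have e1 : (m + (k + 1 : ℕ) : ℤ) = m + k + 1 := by push_cast; ring
      rw [e1]; linarith
    · rw [Finset.sum_range_sub (fun k : ℕ => s (m + k))]
      have := hcon (m + n) (by omega)
      simp; linarith
  obtain ⟨z, hz⟩ := cauchySeq_tendsto_of_complete (cauchySeq_of_dist_le_of_summable _ hd hsum)
  have hev : ∀ᶠ k : ℕ in atTop, ∀ a, z ∉ T.seg a → q k ∉ T.seg a := by
    rw [eventually_all]
    intro a
    by_cases ha : z ∈ T.seg a
    · exact Eventually.of_forall fun k h => absurd ha h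
    · filter_upwards [hz.eventually ((T.isClosed_seg a).isOpen_compl.mem_nhds ha)] with k hk _ using hk
  obtain ⟨K, hK⟩ := eventually_atTop.1 hev
  refine not_forall_mem_seg (T := T) (F := F) (m := m + K) (q := z) (fun i hi => ?_) fun n =>
    (hne n).mono (R_mono (by omega) le_rfl)
  by_contra hn
  have h1 := hK (i - m).toNat (by omega) _ hn
  have h2 := hqs (i - m).toNat
  rw [show m + ((i - m).toNat : ℤ) = i by omega] at h2
  exact h1 h2

end Billiard

/-! ### Forward lines: invariance, parallelism, compactness -/

theorem mem_closure_act {g : Plane ≃ᵃⁱ[ℝ] Plane} {S : Set (Plane × Plane)} {x : Plane × Plane} :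
    act g x ∈ closure S ↔ x ∈ closure (act g ⁻¹' S) := by
  constructor
  · intro h
    have := map_mem_closure (act_continuous g⁻¹) h (t := act g ⁻¹' S)
      (fun y hy => by rwa [Set.mem_preimage, act_act_inv])
    rwa [act_inv_act] at this
  · intro h
    exact map_mem_closure (act_continuous g) h fun y hy => hy

namespace Billiard

variable {ι : Type*} {T : Billiard ι} {F F' : ℤ → ι}

theorem mem_closure_R_shift {k m n : ℤ} {x : Plane × Plane} :
    act (T.frame F k)⁻¹ x ∈ closure (T.R (shift k F) m n) ↔ x ∈ closure (T.R F (k + m) (k + n)) := by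
  rw [mem_closure_act]
  have : act (T.frame F k)⁻¹ ⁻¹' T.R (shift k F) m n = T.R F (k + m) (k + n) := by
    ext y; exact mem_R_shift
  rw [this]

theorem mem_closure_R_rev {m n : ℤ} {p u : Plane} :
    (p, -u) ∈ closure (T.R (rev F) m n) ↔ (p, u) ∈ closure (T.R F (1 - n) (1 - m)) := by
  have hc : Continuous fun x : Plane × Plane => (x.1, -x.2) := by fun_prop
  constructor
  · intro h
    have := map_mem_closure (f := fun x : Plane × Plane => (x.1, -x.2)) hc h
      (t := T.R F (1 - n) (1 - m)) fun y hy => by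
        rw [← mem_R_rev, neg_neg]; exact hy
    simpa using this
  · intro h
    exact map_mem_closure (f := fun x : Plane × Plane => (x.1, -x.2)) hc h
      fun y hy => mem_R_rev.2 hy

theorem mem_closure_R_slide {m n : ℤ} {p u : Plane} {s r : ℝ} (hr : 0 < r) :
    (p + s • u, r • u) ∈ closure (T.R F m n) ↔ (p, u) ∈ closure (T.R F m n) := by
  have key : ∀ (s r : ℝ) (p u : Plane), 0 < r → (p, u) ∈ closure (T.R F m n) →
      (p + s • u, r • u) ∈ closure (T.R F m n) := by
    intro s r p u hr h
    have hc : Continuous fun x : Plane × Plane => (x.1 + s • x.2, r • x.2) := by fun_prop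
    exact map_mem_closure (f := fun x : Plane × Plane => (x.1 + s • x.2, r • x.2)) hc h
      fun y hy => (mem_R_slide hr).2 hy
  refine ⟨fun h => ?_, key s r p u hr⟩
  have := key (-s / r) r⁻¹ _ _ (by positivity) h
  rw [smul_smul, smul_smul, inv_mul_cancel₀ hr.ne', div_mul_cancel₀ _ hr.ne', one_smul] at this
  convert this using 2
  module

/-- The oriented unit line `x` is a limit of lines that follow the edges `F m`, `F (m + 1)`, ...
arbitrarily long. -/
def Fwd (T : Billiard ι) (F : ℤ → ι) (m : ℤ) (x : Plane × Plane) : Prop :=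
  ‖x.2‖ = 1 ∧ ∀ n, x ∈ closure (T.R F m n)

theorem Fwd.ne_zero {m : ℤ} {x : Plane × Plane} (h : T.Fwd F m x) : x.2 ≠ 0 := by
  intro h0; have := h.1; simp [h0] at this

theorem Fwd.mono {m m' : ℤ} {x : Plane × Plane} (h : T.Fwd F m x) (hm : m ≤ m') : T.Fwd F m' x :=
  ⟨h.1, fun n => closure_mono (R_mono hm le_rfl) (h.2 n)⟩

theorem fwd_shift {k m : ℤ} {x : Plane × Plane} :
    T.Fwd (shift k F) m (act (T.frame F k)⁻¹ x) ↔ T.Fwd F (k + m) x := by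
  refine and_congr (by simp [act]) ⟨fun h n => ?_, fun h n => ?_⟩
  · have := mem_closure_R_shift.1 (h (n - k))
    rwa [add_sub_cancel] at this
  · exact mem_closure_R_shift.2 (h _)

theorem fwd_slide {m : ℤ} {p u : Plane} {s : ℝ} : T.Fwd F m (p + s • u, u) ↔ T.Fwd F m (p, u) := by
  refine and_congr Iff.rfl (forall_congr' fun n => ?_)
  have := mem_closure_R_slide (T := T) (F := F) (m := m) (n := n) (p := p) (u := u) (s := s) one_pos
  rwa [one_smul] at this

theorem Fwd.nonempty {m : ℤ} {x : Plane × Plane} (h : T.Fwd F m x) (n : ℤ) :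
    (T.R F m n).Nonempty := closure_nonempty_iff.1 ⟨x, h.2 n⟩

theorem fwd_of_mem {m : ℤ} {x : Plane × Plane} (h1 : ‖x.2‖ = 1) (h : ∀ n, x ∈ T.R F m n) :
    T.Fwd F m x := ⟨h1, fun n => subset_closure (h n)⟩

/-- All unfolded copies of the table are congruent, so one diameter bound serves for all. -/
theorem frame_inv_bound [Finite ι] (T : Billiard ι) : ∃ D : ℝ, 0 < D ∧ ∀ (F : ℤ → ι) (i : ℤ)
    (y z : Plane) (a b : ι), (T.frame F i)⁻¹ y ∈ T.seg a → (T.frame F i)⁻¹ z ∈ T.seg b →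
      ‖y - z‖ ≤ D := by
  obtain ⟨D, hD, h⟩ := T.exists_bound
  refine ⟨2 * D, by positivity, fun F i y z a b hy hz => ?_⟩
  rw [← norm_linear (T.frame F i)⁻¹, ← isometry_sub]
  linarith [norm_sub_le ((T.frame F i)⁻¹ y) ((T.frame F i)⁻¹ z), h _ _ hy, h _ _ hz]

theorem Fwd.crossings [Finite ι] {m : ℤ} {x : Plane × Plane} (h : T.Fwd F m x) :
    ∃ s : ℤ → ℝ, (∀ i, m ≤ i → (T.frame F i)⁻¹ (x.1 + s i • x.2) ∈ T.seg (F i)) ∧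
      (∀ i, m ≤ i → s i ≤ s (i + 1)) ∧ ∀ B, ∃ j, m ≤ j ∧ ∀ i, j ≤ i → B < s i := by
  obtain ⟨s, h1, h2⟩ := exists_crossings h.ne_zero h.2
  exact ⟨s, h1, h2, crossings_unbounded h.nonempty h1 h2⟩

theorem exists_smul_of_cross {u v : Plane} (hu : ‖u‖ = 1) (hv : ‖v‖ = 1) (h : cross u v = 0) :
    v = u ∨ v = -u := by
  obtain ⟨r, rfl⟩ := exists_smul_of_cross_eq_zero (by rintro rfl; simp at hu) h
  rw [norm_smul, hu, mul_one, Real.norm_eq_abs] at hv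
  rcases eq_or_eq_neg_of_abs_eq hv with h | h <;> simp [h]

/-- Two forward lines following the same edges are parallel. -/
theorem Fwd.parallel [Finite ι] {m : ℤ} {x y : Plane × Plane} (hx : T.Fwd F m x)
    (hy : T.Fwd F m y) : x.2 = y.2 := by
  obtain ⟨p, u⟩ := x
  obtain ⟨q, v⟩ := y
  obtain ⟨s, hs, -, hsu⟩ := hx.crossings
  obtain ⟨t, ht, -, htu⟩ := hy.crossings
  obtain ⟨D, hD, hb⟩ := T.frame_inv_bound
  dsimp only at hs ht ⊢
  have hd : ∀ i, m ≤ i → ‖p + s i • u - (q + t i • v)‖ ≤ D := fun i hi =>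
    hb F i _ _ _ _ (hs i hi) (ht i hi)
  -- At every time both lines meet the same unfolded edge, so they stay at distance at most `D`; if
  -- they were not parallel, this distance would grow linearly with `s j`.
  have hc : cross v u = 0 := by
    by_contra hne
    have h0 : 0 < |cross v u| := abs_pos.2 hne
    obtain ⟨j, hj, hB⟩ := hsu ((D + |cross v (p - q)|) / |cross v u|)
    have h1 := hB j le_rfl
    rw [div_lt_iff₀ h0] at h1
    have h2 := abs_cross_le v (p + s j • u - (q + t j • v))
    rw [show ‖v‖ = 1 from hy.1, one_mul] at h2
    have h3 : cross v (p + s j • u - (q + t j • v)) = cross v (p - q) + s j * cross v u := by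
      simp [cross]; ring
    rw [h3] at h2
    have h4 := abs_sub_abs_le_abs_sub (s j * cross v u) (-cross v (p - q))
    rw [abs_neg, sub_neg_eq_add, abs_mul, add_comm (s j * _)] at h4
    have h5 := le_abs_self (s j)
    nlinarith [hd j hj]
  rcases exists_smul_of_cross hy.1 hx.1 hc with h | h
  · exact h
  · exfalso
    dsimp only at h
    subst h
    -- Opposite directions are excluded because both crossing times tend to `+∞`, so the crossing
    -- points would move apart.
    obtain ⟨j, hj, hB⟩ := hsu (D + ‖p - q‖)
    obtain ⟨j', hj', hB'⟩ := htu 0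
    have h1 := hB (max j j') (le_max_left _ _)
    have h2 := hB' (max j j') (le_max_right _ _)
    have h3 := hd (max j j') (hj.trans (le_max_left _ _))
    have h4 : p + s (max j j') • -v - (q + t (max j j') • v) =
        (p - q) - (s (max j j') + t (max j j')) • v := by module
    rw [h4] at h3
    have h5 := norm_sub_norm_le ((s (max j j') + t (max j j')) • v) (p - q)
    rw [norm_smul, show ‖v‖ = 1 from hy.1, mul_one, Real.norm_eq_abs,
      norm_sub_rev ((s (max j j') + t (max j j')) • v)] at h5
    have h6 := le_abs_self (s (max j j') + t (max j j'))
    linarith [norm_nonneg (p - q)]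

/-- A line which is a limit of flights meets both edges. -/
theorem exists_mem_seg {e a b : ι} {x : Plane × Plane} (hx : x ∈ closure (T.C e a))
    (hb : b = e ∨ b = a) : ∃ y ∈ T.seg b, cross x.2 (y - x.1) = 0 := by
  have hc : Continuous fun x : Plane × Plane => cross x.2 (T.A b - x.1) * cross x.2 (T.B b - x.1) :=
    (Continuous.cross continuous_snd (by fun_prop)).mul
      (Continuous.cross continuous_snd (by fun_prop))
  have h1 : x ∈ {x : Plane × Plane | cross x.2 (T.A b - x.1) * cross x.2 (T.B b - x.1) ≤ 0} := by
    refine closure_minimal (fun x' hx' => ?_) (isClosed_le hc continuous_const) hx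
    have := strict_of_mem_C hx'
    rcases hb with rfl | rfl
    exacts [this.1.le, this.2.le]
  have h2 : cross x.2 (T.A b - x.1) * cross x.2 (T.B b - x.1) ≤ 0 := h1
  obtain ⟨τ, t0, t1, hτ⟩ : ∃ τ : ℝ, 0 ≤ τ ∧ τ ≤ 1 ∧
      (1 - τ) * cross x.2 (T.A b - x.1) + τ * cross x.2 (T.B b - x.1) = 0 := by
    set α := cross x.2 (T.A b - x.1)
    set β := cross x.2 (T.B b - x.1)
    rcases eq_or_ne α β with h | h
    · rw [h] at h2 ⊢
      exact ⟨0, le_rfl, zero_le_one, by nlinarith [mul_self_nonneg β]⟩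
    · have h' : α - β ≠ 0 := sub_ne_zero.2 h
      have h3 : 0 < (α - β) ^ 2 := by positivity
      refine ⟨α * (α - β) / (α - β) ^ 2, div_nonneg (by nlinarith [mul_self_nonneg α]) h3.le, ?_, ?_⟩
      · rw [div_le_one h3]; nlinarith [mul_self_nonneg β]
      · field_simp; ring
  exact ⟨_, mem_segment_iff.2 ⟨τ, t0, t1, rfl⟩, by rw [cross_lineMap, hτ]⟩

/-- Membership depends only on a finite window of the sequence, where `Φ j` eventually equals `F`;
closures are closed under limits. -/
theorem closure_R_congr_of_tendsto {α : Type*} {V : Ultrafilter α} {Φ : α → ℤ → ι}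
    {x : α → Plane × Plane} {y : Plane × Plane} (hΦ : ∀ i, ∀ᶠ j in (V : Filter α), Φ j i = F i)
    (hx : Tendsto x V (𝓝 y)) {m n : ℤ} (h : ∀ᶠ j in (V : Filter α), x j ∈ closure (T.R (Φ j) m n)) :
    y ∈ closure (T.R F m n) := by
  have h1 : ∀ᶠ j in (V : Filter α), ∀ i ∈ Set.Icc (min m 0) (max n 0), Φ j i = F i :=
    (eventually_all_finite (Set.finite_Icc _ _)).2 fun i _ => hΦ i
  refine isClosed_closure.mem_of_tendsto hx ?_
  filter_upwards [h, h1] with j h2 h3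
  rwa [R_congr fun i hi hi' => h3 i ⟨hi, hi'⟩] at h2

/-- Compactness: sequences of edges and lines through their edge number `0` have limits. -/
theorem exists_limit [Finite ι] {α : Type*} (V : Ultrafilter α) (Φ : α → ℤ → ι)
    (x : α → Plane × Plane) (h1 : ∀ᶠ j in (V : Filter α), ‖(x j).2‖ = 1)
    (hx : ∀ᶠ j in (V : Filter α), x j ∈ closure (T.R (Φ j) 0 1)) :
    ∃ (F : ℤ → ι) (y : Plane × Plane) (σ : α → ℝ), (∀ i, ∀ᶠ j in (V : Filter α), Φ j i = F i) ∧
      Tendsto (fun j => ((x j).1 + σ j • (x j).2, (x j).2)) V (𝓝 y) ∧ ‖y.2‖ = 1 := by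
  choose F hF using fun i => V.exists_eq fun j => Φ j i
  obtain ⟨D, hD, hDb⟩ := T.exists_bound
  -- Each line is slid along itself until its base point is on the closed edge number `0`; base
  -- points and unit directions then stay in a compact set.
  have hex : ∀ j, ∃ σ : ℝ, ‖(x j).2‖ = 1 → x j ∈ closure (T.R (Φ j) 0 1) →
      (x j).1 + σ • (x j).2 ∈ T.seg (Φ j 0) := by
    intro j
    by_cases hj : ‖(x j).2‖ = 1 ∧ x j ∈ closure (T.R (Φ j) 0 1)
    · have h3 : x j ∈ closure (T.C (Φ j 0) (Φ j 1)) :=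
        closure_mono (fun y (hy : y ∈ T.R (Φ j) 0 1) => by
          simpa [act_one] using hy 0 le_rfl one_pos) hj.2
      obtain ⟨y, hy, hy0⟩ := exists_mem_seg h3 (Or.inl rfl)
      obtain ⟨r, hr⟩ := exists_smul_of_cross_eq_zero (by intro h; simp [h] at hj) hy0
      refine ⟨r, fun _ _ => ?_⟩
      rwa [← hr, add_sub_cancel]
    · exact ⟨0, fun h h' => absurd ⟨h, h'⟩ hj⟩
  choose σ hσ using hex
  have hK : ∀ᶠ j in (V : Filter α), (((x j).1 + σ j • (x j).2, (x j).2) : Plane × Plane) ∈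
      Metric.closedBall (0 : Plane) D ×ˢ Metric.sphere (0 : Plane) 1 := by
    filter_upwards [h1, hx] with j h2 h3
    exact ⟨mem_closedBall_zero_iff.2 (hDb _ _ (hσ j h2 h3)), mem_sphere_zero_iff_norm.2 h2⟩
  obtain ⟨y, hy, hlim⟩ := V.exists_tendsto ((isCompact_closedBall _ _).prod (isCompact_sphere _ _)) hK
  exact ⟨F, y, σ, hF, hlim, mem_sphere_zero_iff_norm.1 hy.2⟩

end Billiard

/-! ### Perturbing a line past the vertices on it -/

theorem dense_generic {S : Set ℝ} (hS : S.Countable) :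
    Dense {z : ℝ × ℝ | ∀ t ∈ S, z.1 + z.2 * t ≠ 0} := by
  have : {z : ℝ × ℝ | ∀ t ∈ S, z.1 + z.2 * t ≠ 0} = ⋂ t ∈ S, {z : ℝ × ℝ | z.1 + z.2 * t ≠ 0} := by
    ext; simp
  rw [this]
  refine dense_biInter_of_isOpen (fun t _ => isOpen_ne_fun (by fun_prop) continuous_const) hS ?_
  intro t _
  rw [Metric.dense_iff]
  intro z r hr
  by_cases h : z.1 + z.2 * t = 0
  · refine ⟨(z.1 + r / 2, z.2), ?_, ?_⟩
    · rw [Metric.mem_ball, Prod.dist_eq, dist_self, Real.dist_eq, add_sub_cancel_left,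
        abs_of_pos (by positivity)]
      simp [hr]
    · show z.1 + r / 2 + z.2 * t ≠ 0
      intro h'; linarith
  · exact ⟨z, Metric.mem_ball_self hr, h⟩

namespace Billiard

variable {ι : Type*} {T : Billiard ι} {F F' : ℤ → ι}

/-- The vertices of the table. -/
def verts (T : Billiard ι) : Set Plane := Set.range T.A ∪ Set.range T.B

/-- The vertices of the unfolded table. -/
def placed (T : Billiard ι) (F : ℤ → ι) (m n : ℤ) : Set Plane :=
  {y | ∃ i, m ≤ i ∧ i < n ∧ (T.frame F i)⁻¹ y ∈ T.verts}

theorem finite_placed [Finite ι] (F : ℤ → ι) (m n : ℤ) : (T.placed F m n).Finite := by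
  have hv : T.verts.Finite := (Set.finite_range _).union (Set.finite_range _)
  refine ((Set.finite_Ico m n).biUnion (t := fun i => T.frame F i '' T.verts)
    fun i _ => hv.image _).subset ?_
  rintro y ⟨i, h1, h2, h3⟩
  exact Set.mem_biUnion (x := i) ⟨h1, h2⟩ ⟨_, h3, apply_inv_self' _ _⟩

/-- The abscissas of the vertices of the unfolded table on the line `x`. -/
def hits (T : Billiard ι) (F : ℤ → ι) (m n : ℤ) (x : Plane × Plane) : Set ℝ :=
  {t | x.1 + t • x.2 ∈ T.placed F m n}

theorem finite_hits [Finite ι] {m n : ℤ} {x : Plane × Plane} (hu : x.2 ≠ 0) :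
    (T.hits F m n x).Finite := by
  refine (finite_placed F m n).preimage fun a _ b _ hab => ?_
  simpa [hu] using hab

theorem placed_mono {m n m' n' : ℤ} (hm : m ≤ m') (hn : n' ≤ n) :
    T.placed F m' n' ⊆ T.placed F m n := by
  rintro y ⟨i, h1, h2, h3⟩
  exact ⟨i, by omega, by omega, h3⟩

theorem hits_mono {m n m' n' : ℤ} {x : Plane × Plane} (hm : m ≤ m') (hn : n' ≤ n) :
    T.hits F m' n' x ⊆ T.hits F m n x := fun _ ht => placed_mono hm hn ht

theorem mem_R_of_closure {m n : ℤ} {x : Plane × Plane} (hx : x ∈ closure (T.R F m n))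
    (hu : x.2 ≠ 0) {i : ℤ} (h1 : m ≤ i) (h2 : i < n)
    (hv : ∀ t : ℝ, (T.frame F i)⁻¹ (x.1 + t • x.2) ∉ T.verts) :
    act (T.frame F i)⁻¹ x ∈ T.C (F i) (F (i + 1)) := by
  have hcl : act (T.frame F i)⁻¹ x ∈ closure (T.C (F i) (F (i + 1))) :=
    map_mem_closure (act_continuous _) hx fun y hy => hy i h1 h2
  have key : ∀ v ∈ T.verts, cross ((T.frame F i)⁻¹.linearIsometryEquiv x.2)
      (v - (T.frame F i)⁻¹ x.1) ≠ 0 := by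
    intro v hv' h0
    obtain ⟨r, hr⟩ := exists_smul_of_cross_eq_zero (by simpa using hu) h0
    refine hv r ?_
    rw [map_add_smul', ← hr, add_sub_cancel]
    exact hv'
  exact mem_C_of_closure hcl fun b => ⟨key _ (Or.inl ⟨b, rfl⟩), key _ (Or.inr ⟨b, rfl⟩)⟩

/-- The set of lines that follow given edges can be left only through lines that meet a vertex. -/
theorem subset_R_of_isPreconnected {m n : ℤ} {K : Set (Plane × Plane)} (hK : IsPreconnected K)
    (hv : ∀ y ∈ K, y.2 ≠ 0 ∧ ∀ t : ℝ, y.1 + t • y.2 ∉ T.placed F m n)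
    (hne : (K ∩ T.R F m n).Nonempty) : K ⊆ T.R F m n := by
  refine hK.subset_of_closure_inter_subset (isOpen_R F m n) hne ?_
  rintro y ⟨hy, hyK⟩ i h1 h2
  exact mem_R_of_closure hy (hv y hyK).1 h1 h2 fun t ht => (hv y hyK).2 t ⟨i, h1, h2, ht⟩

theorem inner_quarter (u : Plane) : inner ℝ (quarter u) u = (0 : ℝ) := by
  rw [Plane.inner_eq]; simp; ring

theorem tilt_inj {x : Plane × Plane} (hu : x.2 ≠ 0) {c α t t' : ℝ}
    (h : (tilt x c α).1 + t • (tilt x c α).2 = x.1 + t' • x.2) : t' = t ∧ c + α * t = 0 := by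
  rw [tilt_point] at h
  have h1 : (t - t') • x.2 + (c + α * t) • quarter x.2 = 0 := by
    rw [sub_smul]
    have := sub_eq_zero.2 h
    rw [← this]; abel
  have hn : ‖x.2‖ ^ 2 ≠ 0 := by positivity
  have h2 := congrArg (fun v => inner ℝ v x.2) h1
  have h3 := congrArg (fun v => cross x.2 v) h1
  simp only [inner_add_left, inner_smul_left, inner_quarter, real_inner_self_eq_norm_sq,
    inner_zero_left] at h2
  simp only [cross_add, cross_smul, cross_same, cross_quarter] at h3
  have h4 : cross x.2 0 = 0 := by simp [cross]
  rw [h4] at h3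
  simp only [mul_zero, add_zero, zero_add, mul_eq_zero, hn, or_false] at h2 h3
  exact ⟨by have : t - t' = 0 := by simpa using h2
            linarith, h3⟩

/-- The finitely many unfolded vertices off the line stay off nearby lines. So a nearby tilt can
only meet vertices of `x` itself, at the same abscissa, where its height `z.1 + z.2 * t` must
vanish. -/
theorem tilt_placed [Finite ι] {m n : ℤ} {x : Plane × Plane} (hu : x.2 ≠ 0) :
    ∀ᶠ z : ℝ × ℝ in 𝓝 0, (tilt x z.1 z.2).2 ≠ 0 ∧ ∀ t : ℝ,
      (tilt x z.1 z.2).1 + t • (tilt x z.1 z.2).2 ∈ T.placed F m n →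
        t ∈ T.hits F m n x ∧ z.1 + z.2 * t = 0 := by
  have h1 : ∀ᶠ z : ℝ × ℝ in 𝓝 0, (tilt x z.1 z.2).2 ≠ 0 :=
    ((continuous_snd.tendsto x).comp (tilt_tendsto x)).eventually (isOpen_ne.mem_nhds hu)
  have h2 : ∀ᶠ z : ℝ × ℝ in 𝓝 0, ∀ v ∈ T.placed F m n, cross x.2 (v - x.1) ≠ 0 →
      cross (tilt x z.1 z.2).2 (v - (tilt x z.1 z.2).1) ≠ 0 := by
    rw [eventually_all_finite (finite_placed F m n)]
    intro v _
    by_cases hv : cross x.2 (v - x.1) ≠ 0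
    · have h3 := ((height_continuous v).tendsto x).comp (tilt_tendsto x)
      filter_upwards [h3.eventually (isOpen_ne.mem_nhds hv)] with z hz _ using hz
    · exact Eventually.of_forall fun z h => absurd h hv
  filter_upwards [h1, h2] with z hz1 hz2
  refine ⟨hz1, fun t ht => ?_⟩
  have h3 : cross x.2 ((tilt x z.1 z.2).1 + t • (tilt x z.1 z.2).2 - x.1) = 0 := by
    by_contra hne
    exact hz2 _ ht hne (cross_on_line _ _ _)
  obtain ⟨r, hr⟩ := exists_smul_of_cross_eq_zero hu h3
  have h4 : (tilt x z.1 z.2).1 + t • (tilt x z.1 z.2).2 = x.1 + r • x.2 := by rw [← hr]; abel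
  obtain ⟨h5, h6⟩ := tilt_inj hu h4
  subst h5
  rw [h4] at ht
  exact ⟨ht, h6⟩

/-- The lines near `x` that pass on prescribed sides of points of `x`. -/
def pattern (σ : ℝ → ℝ) (S : Set ℝ) : Set (ℝ × ℝ) := {z | ∀ t ∈ S, 0 < σ t * (z.1 + z.2 * t)}

theorem convex_pattern (σ : ℝ → ℝ) (S : Set ℝ) : Convex ℝ (pattern σ S) := by
  intro z hz w hw a b ha hb hab t ht
  have h1 := hz t ht
  have h2 := hw t ht
  simp only [Prod.fst_add, Prod.snd_add, Prod.smul_fst, Prod.smul_snd, smul_eq_mul]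
  have : σ t * (a * z.1 + b * w.1 + (a * z.2 + b * w.2) * t) =
      a * (σ t * (z.1 + z.2 * t)) + b * (σ t * (w.1 + w.2 * t)) := by ring
  rw [this]
  rcases ha.eq_or_lt with h | h
  · have : b = 1 := by linarith
    rw [← h, this]; linarith
  · nlinarith [mul_pos h h1, mul_nonneg hb h2.le]

theorem pattern_anti {σ : ℝ → ℝ} {S S' : Set ℝ} (h : S ⊆ S') : pattern σ S' ⊆ pattern σ S :=
  fun _ hz t ht => hz t (h ht)

theorem pattern_congr {σ τ : ℝ → ℝ} {S : Set ℝ} (h : ∀ t ∈ S, σ t = τ t) :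
    pattern σ S = pattern τ S := by
  ext z
  exact forall₂_congr fun t ht => by rw [h t ht]

/-- Nearby lines that pass the vertices on `x` on the same sides follow the same edges. -/
theorem eventually_mem_R [Finite ι] {m n : ℤ} {x : Plane × Plane} (hu : x.2 ≠ 0) {σ : ℝ → ℝ}
    (h : ∃ᶠ z : ℝ × ℝ in 𝓝 0, z ∈ pattern σ (T.hits F m n x) ∧ tilt x z.1 z.2 ∈ T.R F m n) :
    ∀ᶠ z : ℝ × ℝ in 𝓝 0, z ∈ pattern σ (T.hits F m n x) → tilt x z.1 z.2 ∈ T.R F m n := by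
  obtain ⟨δ, hδ, hb⟩ := Metric.eventually_nhds_iff_ball.1 (tilt_placed (T := T) (F := F)
    (m := m) (n := n) hu)
  -- The tilts with a given pattern form a convex set, hence a connected family of lines through no
  -- vertex. If one of them follows the edges, all do.
  set Q := pattern σ (T.hits F m n x) ∩ Metric.ball 0 δ with hQ
  have hpre : IsPreconnected ((fun z : ℝ × ℝ => tilt x z.1 z.2) '' Q) :=
    ((convex_pattern _ _).inter (convex_ball _ _)).isPreconnected.image _
      (tilt_continuous x).continuousOn
  obtain ⟨z, ⟨hz1, hz2⟩, hz3⟩ := (h.and_eventually (Metric.ball_mem_nhds 0 hδ)).exists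
  have hsub := subset_R_of_isPreconnected (T := T) (F := F) (m := m) (n := n) hpre
    (by
      rintro _ ⟨w, hw, rfl⟩
      refine ⟨(hb w hw.2).1, fun t ht => ?_⟩
      obtain ⟨h1, h2⟩ := (hb w hw.2).2 t ht
      have := hw.1 t h1
      rw [h2, mul_zero] at this
      exact lt_irrefl _ this)
    ⟨_, ⟨z, ⟨hz1, hz3⟩, rfl⟩, hz2⟩
  filter_upwards [Metric.ball_mem_nhds 0 hδ] with w hw1 hw2
  exact hsub ⟨w, ⟨hw2, hw1⟩, rfl⟩

/-- The sides on which lines close to `x` pass, in the limit. -/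
noncomputable def signAt (V : Ultrafilter (ℝ × ℝ)) (t : ℝ) : ℝ :=
  open Classical in if ∀ᶠ z in (V : Filter (ℝ × ℝ)), 0 < z.1 + z.2 * t then 1 else -1

theorem signAt_eq (V : Ultrafilter (ℝ × ℝ)) (t : ℝ) : signAt V t = 1 ∨ signAt V t = -1 := by
  unfold signAt; split_ifs <;> simp

theorem eventually_signAt {V : Ultrafilter (ℝ × ℝ)} {t : ℝ}
    (h : ∀ᶠ z in (V : Filter (ℝ × ℝ)), z.1 + z.2 * t ≠ 0) :
    ∀ᶠ z in (V : Filter (ℝ × ℝ)), 0 < signAt V t * (z.1 + z.2 * t) := by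
  unfold signAt
  split_ifs with h1
  · simpa using h1
  · rw [← Ultrafilter.eventually_not] at h1
    filter_upwards [h, h1] with z h2 h3
    have : z.1 + z.2 * t < 0 := lt_of_le_of_ne (not_lt.1 h3) h2
    linarith

theorem eventually_pattern_signAt {V : Ultrafilter (ℝ × ℝ)} {S : Set ℝ} (hS : S.Finite)
    (h : ∀ t ∈ S, ∀ᶠ z in (V : Filter (ℝ × ℝ)), z.1 + z.2 * t ≠ 0) :
    ∀ᶠ z in (V : Filter (ℝ × ℝ)), z ∈ pattern (signAt V) S :=
  (eventually_all_finite hS).2 fun t ht => eventually_signAt (h t ht)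

/-- Every line close to a unit line `x` is one of its tilts. -/
theorem exists_tilt {p u : Plane} (hu : ‖u‖ = 1) : ∃ c α : Plane × Plane → ℝ,
    Tendsto (fun y => (c y, α y)) (𝓝 (p, u)) (𝓝 0) ∧ ∀ᶠ y : Plane × Plane in 𝓝 (p, u),
      ∃ s r : ℝ, 0 < r ∧ tilt (p, u) (c y) (α y) = (y.1 + s • y.2, r • y.2) := by
  have huu : inner ℝ u u = (1 : ℝ) := by rw [real_inner_self_eq_norm_sq, hu]; norm_num
  -- Coordinates in the orthonormal frame `u`, `quarter u`: sliding by `s y` moves the base point to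
  -- abscissa 0, division by `d y` normalizes the direction, and `c y`, `α y` are the resulting
  -- height and slope.
  let d : Plane × Plane → ℝ := fun y => inner ℝ y.2 u
  have hd : Tendsto d (𝓝 (p, u)) (𝓝 1) := by
    have : Continuous d := by fun_prop
    exact this.tendsto' _ _ huu
  let s : Plane × Plane → ℝ := fun y => -inner ℝ (y.1 - p) u / d y
  have hs : Tendsto s (𝓝 (p, u)) (𝓝 0) := by
    have h1 : Continuous fun y : Plane × Plane => -(inner ℝ (y.1 - p) u : ℝ) := by fun_prop
    have := (h1.tendsto' (p, u) 0 (by simp)).div hd one_ne_zero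
    rw [zero_div] at this
    exact this
  let α : Plane × Plane → ℝ := fun y => inner ℝ y.2 (quarter u) / d y
  have hq : inner ℝ u (quarter u) = (0 : ℝ) := by rw [real_inner_comm, inner_quarter]
  have hα : Tendsto α (𝓝 (p, u)) (𝓝 0) := by
    have h1 : Continuous fun y : Plane × Plane => (inner ℝ y.2 (quarter u) : ℝ) := by fun_prop
    have := (h1.tendsto' (p, u) 0 hq).div hd one_ne_zero
    rw [zero_div] at this
    exact this
  let c : Plane × Plane → ℝ := fun y => inner ℝ (y.1 - p + s y • y.2) (quarter u)
  have hc : Tendsto c (𝓝 (p, u)) (𝓝 0) := by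
    have h1 : Tendsto (fun y : Plane × Plane => y.1 - p + s y • y.2) (𝓝 (p, u))
        (𝓝 (p - p + (0 : ℝ) • u)) :=
      ((continuous_fst.tendsto (p, u)).sub_const p).add (hs.smul (continuous_snd.tendsto (p, u)))
    have h2 : Tendsto c (𝓝 (p, u)) (𝓝 (inner ℝ (p - p + (0 : ℝ) • u) (quarter u))) :=
      h1.inner tendsto_const_nhds
    simpa using h2
  have hdec : ∀ v : Plane, v = (inner ℝ v u : ℝ) • u + (inner ℝ v (quarter u) : ℝ) • quarter u := by
    intro v
    have h1 : u 0 ^ 2 + u 1 ^ 2 = 1 := by rw [← Plane.norm_sq, hu]; norm_num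
    rw [Plane.inner_eq, Plane.inner_eq]
    apply Plane.ext' <;> simp
    · linear_combination -(v 0) * h1
    · linear_combination -(v 1) * h1
  refine ⟨c, α, hc.prodMk_nhds hα, ?_⟩
  filter_upwards [hd.eventually (lt_mem_nhds (zero_lt_one' ℝ))] with y hy
  refine ⟨s y, 1 / d y, by positivity, ?_⟩
  refine Prod.ext ?_ ?_
  · have h1 := hdec (y.1 - p + s y • y.2)
    have h2 : inner ℝ (y.1 - p + s y • y.2) u = (0 : ℝ) := by
      rw [inner_add_left, real_inner_smul_left]
      simp only [s]
      rw [div_mul_cancel₀ _ hy.ne']; ring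
    rw [h2, zero_smul, zero_add] at h1
    simp only [tilt, c]
    rw [← h1]; abel
  · have h1 := hdec y.2
    simp only [tilt, α]
    conv_rhs => rw [h1]
    rw [smul_add, smul_smul, smul_smul, one_div, inv_mul_cancel₀ hy.ne', one_smul, div_eq_inv_mul]

/-- Lines which are limits of lines following given edges, are so along a pattern. -/
theorem Fwd.exists_pattern [Finite ι] {m : ℤ} {x : Plane × Plane} (hx : T.Fwd F m x) :
    ∃ σ : ℝ → ℝ, (∀ t, σ t = 1 ∨ σ t = -1) ∧ ∀ n,
      ∃ᶠ z : ℝ × ℝ in 𝓝 0, z ∈ pattern σ (T.hits F m n x) ∧ tilt x z.1 z.2 ∈ T.R F m n := by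
  obtain ⟨p, u⟩ := x
  have hu0 := hx.ne_zero
  obtain ⟨c, α, hcα, hev⟩ := exists_tilt (p := p) (u := u) hx.1
  -- The lines following `k` edges near `x` form an open set of tilts, so one of them can be chosen
  -- off all the vertices on `x`.
  have hex : ∀ k : ℕ, ∃ z : ℝ × ℝ, z ∈ Metric.ball (0 : ℝ × ℝ) (1 / ((k : ℝ) + 1)) ∧
      tilt (p, u) z.1 z.2 ∈ T.R F m (m + k) ∧
      ∀ t ∈ T.hits F m (m + k) (p, u), z.1 + z.2 * t ≠ 0 := by
    intro k
    have hk : (0 : ℝ) < 1 / ((k : ℝ) + 1) := by positivity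
    have h1 : ∃ᶠ y in 𝓝 (p, u), y ∈ T.R F m (m + k) := mem_closure_iff_frequently.1 (hx.2 _)
    obtain ⟨y, ⟨hy, s, r, hr, htl⟩, hball⟩ := ((h1.and_eventually hev).and_eventually
      (hcα.eventually (Metric.ball_mem_nhds 0 hk))).exists
    have hin : tilt (p, u) (c y) (α y) ∈ T.R F m (m + k) := by
      rw [htl]; exact (mem_R_slide hr).2 hy
    have hopen : IsOpen ((fun z : ℝ × ℝ => tilt (p, u) z.1 z.2) ⁻¹' T.R F m (m + k) ∩
        Metric.ball 0 (1 / ((k : ℝ) + 1))) :=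
      ((isOpen_R _ _ _).preimage (tilt_continuous _)).inter Metric.isOpen_ball
    obtain ⟨z, hz1, hz2⟩ := (dense_generic (finite_hits (T := T) (F := F) (m := m) (n := m + k)
      hu0).countable).inter_open_nonempty _ hopen ⟨(c y, α y), hin, hball⟩
    exact ⟨z, hz1.2, hz1.1, hz2⟩
  choose z hz1 hz2 hz3 using hex
  have hz0 : Tendsto z (hyperfilter ℕ : Filter ℕ) (𝓝 0) := by
    refine Tendsto.mono_left ?_ Nat.hyperfilter_le_atTop
    rw [tendsto_iff_dist_tendsto_zero]
    exact squeeze_zero (fun _ => dist_nonneg) (fun k => (Metric.mem_ball.1 (hz1 k)).le)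
      tendsto_one_div_add_atTop_nhds_zero_nat
  -- The ultrafilter decides, for each vertex on `x`, on which side the approximating lines pass;
  -- this gives one pattern valid for all `n`.
  set V : Ultrafilter (ℝ × ℝ) := (hyperfilter ℕ).map z with hV
  have hVle : (V : Filter (ℝ × ℝ)) ≤ 𝓝 0 := hz0
  refine ⟨signAt V, signAt_eq V, fun n => ?_⟩
  have hk : ∀ᶠ k : ℕ in (hyperfilter ℕ : Filter ℕ), n ≤ m + k := by
    refine Nat.hyperfilter_le_atTop ?_
    filter_upwards [eventually_ge_atTop (n - m).toNat] with k hk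
    omega
  have h1 : ∀ᶠ z in (V : Filter (ℝ × ℝ)), z ∈ pattern (signAt V) (T.hits F m n (p, u)) := by
    refine eventually_pattern_signAt (finite_hits hu0) fun t ht => ?_
    show ∀ᶠ k in (hyperfilter ℕ : Filter ℕ), _
    filter_upwards [hk] with k hk
    exact hz3 k t (hits_mono le_rfl hk ht)
  have h2 : ∀ᶠ z in (V : Filter (ℝ × ℝ)), tilt (p, u) z.1 z.2 ∈ T.R F m n := by
    show ∀ᶠ k in (hyperfilter ℕ : Filter ℕ), _
    filter_upwards [hk] with k hk
    exact R_mono le_rfl hk (hz2 k)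
  exact (h1.and h2).frequently.filter_mono hVle

/-- No line passes three points of `x` on alternating sides. -/
theorem pattern_no_alternation {σ : ℝ → ℝ} (hσ : ∀ t, σ t = 1 ∨ σ t = -1) {S : Set ℝ}
    (hne : (pattern σ S).Nonempty) {t₁ t₂ t₃ : ℝ} (h1 : t₁ ∈ S) (h2 : t₂ ∈ S) (h3 : t₃ ∈ S)
    (h12 : t₁ < t₂) (h23 : t₂ < t₃) (h : σ t₁ = σ t₃) : σ t₂ = σ t₁ := by
  obtain ⟨z, hz⟩ := hne
  have a1 := hz _ h1
  have a2 := hz _ h2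
  have a3 := hz _ h3
  rw [← h] at a3
  by_contra hne
  have h4 : σ t₂ = -σ t₁ := by
    rcases hσ t₁ with h | h <;> rcases hσ t₂ with h' | h' <;>
      first | exact absurd (h'.trans h.symm) hne | (rw [h, h']; try norm_num)
  rw [h4] at a2
  have h5 : (t₃ - t₂) * (σ t₁ * (z.1 + z.2 * t₁)) + (t₂ - t₁) * (σ t₁ * (z.1 + z.2 * t₃)) =
      (t₃ - t₁) * (σ t₁ * (z.1 + z.2 * t₂)) := by ring
  nlinarith [mul_pos (sub_pos.2 h23) a1, mul_pos (sub_pos.2 h12) a3,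
    mul_pos (sub_pos.2 (h12.trans h23)) a2]

end Billiard

/-! ### One-sided neighbourhoods, determinism, strips -/

namespace Billiard

variable {ι : Type*} {T : Billiard ι} {F F' : ℤ → ι}

theorem verts_seg {v : Plane} (hv : v ∈ T.verts) : ∃ a, v ∈ T.seg a := by
  rcases hv with ⟨a, rfl⟩ | ⟨a, rfl⟩
  exacts [⟨a, left_mem_segment _ _ _⟩, ⟨a, right_mem_segment _ _ _⟩]

/-- The vertices met by late flights of a forward line are far away on it. -/
theorem Fwd.hits_gt [Finite ι] {m : ℤ} {x : Plane × Plane} (hx : T.Fwd F m x) (B : ℝ) :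
    ∃ I, m ≤ I ∧ ∀ i, I ≤ i → ∀ a, ∀ y : Plane, (T.frame F i)⁻¹ y ∈ T.seg a →
      B < inner ℝ (y - x.1) x.2 := by
  obtain ⟨s, hs, -, hsu⟩ := hx.crossings
  obtain ⟨D, hD, hb⟩ := T.frame_inv_bound
  obtain ⟨I, hI, hB⟩ := hsu (B + D)
  refine ⟨I, hI, fun i hi a y hy => ?_⟩
  have h1 := hb F i _ _ _ _ hy (hs i (hI.trans hi))
  have h2 := hB i hi
  have h3 := abs_real_inner_le_norm (y - (x.1 + s i • x.2)) x.2
  rw [hx.1, mul_one] at h3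
  have h4 : inner ℝ (y - (x.1 + s i • x.2)) x.2 = inner ℝ (y - x.1) x.2 - s i := by
    rw [← sub_sub, inner_sub_left, real_inner_smul_left, real_inner_self_eq_norm_sq, hx.1]; ring
  rw [h4] at h3
  have := neg_le_of_abs_le (h3.trans h1)
  linarith

/-- From some time on, the lines on one side of a forward line follow the same edges. -/
theorem Fwd.exists_side [Finite ι] {m : ℤ} {x : Plane × Plane} (hx : T.Fwd F m x) :
    ∃ I, m ≤ I ∧ ∃ s : ℝ, (s = 1 ∨ s = -1) ∧ ∀ n, ∀ᶠ c : ℝ in 𝓝[>] 0, tilt x (s * c) 0 ∈ T.R F I n := by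
  obtain ⟨σ, hσ, hfr⟩ := hx.exists_pattern
  -- A pattern realized by lines changes sign at most once along `x` (`pattern_no_alternation`), so
  -- it is constant far out.
  have hconst : ∃ (t₀ s : ℝ), (s = 1 ∨ s = -1) ∧
      ∀ n, ∀ t ∈ T.hits F m n x, t₀ < t → σ t = s := by
    by_contra hcon
    push Not at hcon
    obtain ⟨n₁, t₁, h1, -, e1⟩ := hcon 0 (-1) (Or.inr rfl)
    obtain ⟨n₂, t₂, h2, l2, e2⟩ := hcon t₁ 1 (Or.inl rfl)
    obtain ⟨n₃, t₃, h3, l3, e3⟩ := hcon t₂ (-1) (Or.inr rfl)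
    have e1' := (hσ t₁).resolve_right e1
    have e3' := (hσ t₃).resolve_right e3
    set n := max n₁ (max n₂ n₃)
    obtain ⟨z, hz, -⟩ := (hfr n).exists
    have := pattern_no_alternation hσ ⟨z, hz⟩ (hits_mono le_rfl (by omega) h1)
      (hits_mono le_rfl (by omega) h2) (hits_mono le_rfl (by omega) h3) l2 l3 (e1'.trans e3'.symm)
    exact e2 (this.trans e1')
  obtain ⟨t₀, s, hs, hst⟩ := hconst
  -- After time `I` only far vertices matter, and the constant pattern there is realized by parallel
  -- translates of `x` to the side `s`.
  obtain ⟨I, hI, hfar⟩ := hx.hits_gt t₀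
  refine ⟨I, hI, s, hs, fun n => ?_⟩
  have hpat : pattern σ (T.hits F I n x) = pattern (fun _ => s) (T.hits F I n x) := by
    refine pattern_congr fun t ht => hst n t (hits_mono hI le_rfl ht) ?_
    obtain ⟨i, h1, h2, h3⟩ := ht
    obtain ⟨a, ha⟩ := verts_seg h3
    have := hfar i h1 a _ ha
    rwa [add_sub_cancel_left, real_inner_smul_left, real_inner_self_eq_norm_sq, hx.1, one_pow,
      mul_one] at this
  have hev := eventually_mem_R (T := T) (F := F) (m := I) (n := n) hx.ne_zero
    (σ := fun _ => s) ((hfr n).mono fun z hz =>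
      ⟨hpat ▸ pattern_anti (hits_mono hI le_rfl) hz.1, R_mono hI le_rfl hz.2⟩)
  have ht : Tendsto (fun c : ℝ => ((s * c, 0) : ℝ × ℝ)) (𝓝[>] 0) (𝓝 0) :=
    (Continuous.tendsto' (by fun_prop) _ _ (by simp)).mono_left nhdsWithin_le_nhds
  filter_upwards [ht.eventually hev, self_mem_nhdsWithin] with c hc hc0
  refine hc fun t _ => ?_
  have : (0 : ℝ) < c := hc0
  rcases hs with rfl | rfl <;> simp [this]

/-- As long as the two sequences agree, their frames agree, and `C_determ` gives the next edge. -/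
theorem R_determ {n : ℤ} {y : Plane × Plane} (h : y ∈ T.R F 0 n) (h' : y ∈ T.R F' 0 n)
    (h0 : F 0 = F' 0) : ∀ i, 0 ≤ i → i ≤ n → F i = F' i := by
  have key : ∀ k : ℕ, (k : ℤ) ≤ n → ∀ i : ℤ, 0 ≤ i → i ≤ k → F i = F' i := by
    intro k
    induction k with
    | zero => intro _ i h1 h2; have : i = 0 := by simpa using le_antisymm h2 h1
              rw [this, h0]
    | succ k ih =>
      intro hk i h1 h2
      have ih' := ih (by push_cast at hk; omega)
      rcases h2.lt_or_eq with h3 | h3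
      · exact ih' i h1 (by push_cast at h3; omega)
      have e1 := h k (by omega) (by push_cast at hk; omega)
      have e2 := h' k (by omega) (by push_cast at hk; omega)
      rw [← frame_congr fun j h4 h5 => ih' j (by omega) (by omega), ← ih' k (by omega) le_rfl] at e2
      rw [h3]
      exact C_determ e1 e2
  intro i h1 h2
  exact key i.toNat (by omega) i h1 (by omega)

theorem R_determ' {n : ℤ} {y : Plane × Plane} (h : y ∈ T.R F n 0) (h' : y ∈ T.R F' n 0)
    (h0 : F 0 = F' 0) : ∀ i, n ≤ i → i ≤ 0 → F i = F' i := by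
  have key : ∀ k : ℕ, n ≤ -(k : ℤ) → ∀ i : ℤ, -(k : ℤ) ≤ i → i ≤ 0 → F i = F' i := by
    intro k
    induction k with
    | zero => intro _ i h1 h2; have : i = 0 := by simpa using le_antisymm h2 (by simpa using h1)
              rw [this, h0]
    | succ k ih =>
      intro hk i h1 h2
      have ih' := ih (by push_cast at hk; omega)
      rcases h1.lt_or_eq with h3 | h3
      · exact ih' i (by push_cast at h3; omega) h2
      have e1 := h (-(k : ℤ) - 1) (by push_cast at hk; omega) (by omega)
      have e2 := h' (-(k : ℤ) - 1) (by push_cast at hk; omega) (by omega)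
      rw [frame_pred] at e1 e2
      rw [← frame_congr fun j h4 h5 => ih' j (by omega) (by omega), ← ih' (-k) le_rfl (by omega),
        sub_add_cancel, ← ih' (-k) le_rfl (by omega)] at e2
      rw [sub_add_cancel] at e1
      rw [← h3, show -((k + 1 : ℕ) : ℤ) = -(k : ℤ) - 1 by push_cast; ring]
      exact C_determ' e1 e2
  intro i h1 h2
  exact key (-i).toNat (by omega) i (by omega) h2

/-- The height in the strip between the lines through `p` and `q` of direction `u`, normalized to be
nonnegative at `q`. -/
noncomputable def eta (p q u : Plane) : Plane →ᵃ[ℝ] ℝ := cross u (q - p) • height (p, u)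

theorem eta_apply (p q u y : Plane) : eta p q u y = cross u (q - p) * cross u (y - p) := rfl

theorem eta_swap (p q u y : Plane) : eta q p u y = cross u (q - p) ^ 2 - eta p q u y := by
  simp [eta_apply, cross]; ring

/-- Both factors of `eta` change sign with the orientation, so heights in a strip can be compared in
any frame. -/
theorem eta_act (g : Plane ≃ᵃⁱ[ℝ] Plane) (p q u y : Plane) :
    eta (g p) (g q) (g.linearIsometryEquiv u) (g y) = eta p q u y := by
  obtain ⟨s, hs, h⟩ := exists_sign g
  rw [eta_apply, eta_apply, isometry_sub, isometry_sub, h, h]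
  rcases hs with rfl | rfl <;> ring

theorem eta_neg (p q u y : Plane) : eta p q (-u) y = eta p q u y := by
  simp [eta_apply, cross_neg_left]

theorem strict_of_signs {x : Plane × Plane} {b : ι} {ε : ℝ} {y₁ y₂ : Plane} (h1 : y₁ ∈ T.seg b)
    (h2 : y₂ ∈ T.seg b) (e1 : ε * height x y₁ < 0) (e2 : 0 < ε * height x y₂) : T.Strict x b := by
  obtain ⟨t, t0, t1, rfl⟩ := mem_segment_iff.1 h1
  obtain ⟨r, r0, r1, rfl⟩ := mem_segment_iff.1 h2
  rw [AffineMap.apply_lineMap'] at e1 e2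
  show height x (T.A b) * height x (T.B b) < 0
  set α := height x (T.A b)
  set β := height x (T.B b)
  have hε : 0 < ε ^ 2 := by
    have : ε ≠ 0 := by rintro rfl; simp at e1
    positivity
  by_contra hcon
  push Not at hcon
  have h3 : 0 ≤ (ε * α) * (ε * β) := by nlinarith
  rcases mul_nonneg_iff.1 h3 with ⟨h4, h5⟩ | ⟨h4, h5⟩
  · nlinarith [mul_nonneg (sub_nonneg.2 t1) h4, mul_nonneg t0 h5]
  · nlinarith [mul_nonneg (sub_nonneg.2 r1) (neg_nonneg.2 h4), mul_nonneg r0 (neg_nonneg.2 h5)]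

/-- Two strips of flights of the same width that start on the same edge and overlap without
crossing end on the same edge. -/
theorem next_eq {e a b : ι} {p q u p' q' u' : Plane} {W : ℝ}
    (hp : (p, u) ∈ closure (T.C e a)) (hq : (q, u) ∈ closure (T.C e a))
    (hp' : (p', u') ∈ closure (T.C e b)) (hq' : (q', u') ∈ closure (T.C e b))
    (hW : cross u (q - p) ^ 2 = W) (hW' : cross u' (q' - p') ^ 2 = W)
    (h : ∀ y ∈ T.verts, 0 < eta p q u y - eta p' q' u' y ∧ eta p q u y - eta p' q' u' y < W) :
    a = b := by
  have hseg : ∀ c, ∀ y ∈ T.seg c, 0 < eta p q u y - eta p' q' u' y ∧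
      eta p q u y - eta p' q' u' y < W := by
    intro c y hy
    obtain ⟨t, t0, t1, rfl⟩ := mem_segment_iff.1 hy
    have h1 := h _ (Or.inl ⟨c, rfl⟩)
    have h2 := h _ (Or.inr ⟨c, rfl⟩)
    rw [AffineMap.apply_lineMap', AffineMap.apply_lineMap']
    rcases t0.eq_or_lt with h0 | h0
    · rw [← h0]; simpa using h1
    · constructor <;> nlinarith [mul_pos h0 (sub_pos.2 h2.2), mul_nonneg (sub_nonneg.2 t1) (sub_pos.2 h1.2).le,
        mul_pos h0 h2.1, mul_nonneg (sub_nonneg.2 t1) h1.1.le]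
  have eq : ∀ y, cross u (q - p) * height (q, u) y = eta p q u y - W := by
    intro y
    rw [eta_apply, height_apply, ← hW]; simp [cross]; ring
  have ep : ∀ y, cross u' (q' - p') * height (p', u') y = eta p' q' u' y := fun y => rfl
  have zero_p : ∀ (p q u y : Plane), cross u (y - p) = 0 → eta p q u y = 0 := fun p q u y h => by
    rw [eta_apply, h, mul_zero]
  have zero_q : ∀ (p q u y : Plane), cross u (y - q) = 0 → eta p q u y = cross u (q - p) ^ 2 :=
    fun p q u y h => by
      have h1 : cross u (y - p) = cross u (q - p) + cross u (y - q) := by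
        rw [← cross_add]; congr 1; abel
      rw [eta_apply, h1, h]; ring
  -- The lines used are the far side of the first strip and the near side of the second. The bound
  -- by `W` says that they do not cross on the edges; together with positivity it places the sides
  -- of each strip so that both lines cut the other target edge strictly.
  refine eq_of_transversal_closure (x := (q, u)) (x' := (p', u')) (ε := cross u (q - p))
    (ε' := cross u' (q' - p')) hq hp' ?_ ?_ ?_
  · obtain ⟨y₁, h1, e1⟩ := exists_mem_seg hp' (Or.inr rfl)
    obtain ⟨y₂, h2, e2⟩ := exists_mem_seg hq' (Or.inr rfl)
    refine strict_of_signs (ε := cross u (q - p)) h1 h2 ?_ ?_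
    · rw [eq]; linarith [hseg b y₁ h1, zero_p p' q' u' y₁ e1]
    · rw [eq]; linarith [hseg b y₂ h2, zero_q p' q' u' y₂ e2]
  · obtain ⟨y₁, h1, e1⟩ := exists_mem_seg hp (Or.inr rfl)
    obtain ⟨y₂, h2, e2⟩ := exists_mem_seg hq (Or.inr rfl)
    refine strict_of_signs (ε := cross u' (q' - p')) h1 h2 ?_ ?_
    · rw [ep]; linarith [hseg a y₁ h1, zero_p p q u y₁ e1]
    · rw [ep]; linarith [hseg a y₂ h2, zero_q p q u y₂ e2]
  · intro c _
    rw [eq, eq, ep, ep]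
    constructor <;> linarith [h _ (Or.inl ⟨c, rfl⟩), h _ (Or.inr ⟨c, rfl⟩)]

/-- A strip of lines that follow the same edges. -/
structure Strip (T : Billiard ι) (F : ℤ → ι) (m n : ℤ) (p q u : Plane) : Prop where
  left : (p, u) ∈ closure (T.R F m n)
  right : (q, u) ∈ closure (T.R F m n)

theorem Strip.mono {m n m' n' : ℤ} {p q u : Plane} (h : T.Strip F m n p q u) (hm : m ≤ m')
    (hn : n' ≤ n) : T.Strip F m' n' p q u :=
  ⟨closure_mono (R_mono hm hn) h.1, closure_mono (R_mono hm hn) h.2⟩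

theorem Strip.symm {m n : ℤ} {p q u : Plane} (h : T.Strip F m n p q u) : T.Strip F m n q p u :=
  ⟨h.2, h.1⟩

/-- This is `next_eq` in frame `i`: the sequences can separate only after the displacement of the
strips, measured at the vertices of the current copy, has left the interval from 0 to `W`. -/
theorem Strip.agree {n i : ℤ} {p q u p' q' u' : Plane} {W : ℝ} (h : T.Strip F 0 n p q u)
    (h' : T.Strip F' 0 n p' q' u') (hW : cross u (q - p) ^ 2 = W)
    (hW' : cross u' (q' - p') ^ 2 = W) (hi : 0 ≤ i) (hin : i < n)
    (hF : ∀ j, 0 ≤ j → j ≤ i → F j = F' j)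
    (hb : ∀ y, (T.frame F i)⁻¹ y ∈ T.verts →
      0 < eta p q u y - eta p' q' u' y ∧ eta p q u y - eta p' q' u' y < W) :
    F (i + 1) = F' (i + 1) := by
  have hfr : T.frame F i = T.frame F' i := frame_congr fun j h1 h2 => hF j (by omega) (by omega)
  have key : ∀ (F : ℤ → ι) (x : Plane × Plane), x ∈ closure (T.R F 0 n) →
      act (T.frame F i)⁻¹ x ∈ closure (T.C (F i) (F (i + 1))) := fun F x hx =>
    map_mem_closure (act_continuous _) hx fun y hy => hy i hi hin
  have k1 := key F _ h.1
  have k2 := key F _ h.2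
  have k3 := key F' _ h'.1
  have k4 := key F' _ h'.2
  rw [← hfr, ← hF i hi le_rfl] at k3 k4
  obtain ⟨s, hs, hcr⟩ := exists_sign (T.frame F i)⁻¹
  have hs2 : s ^ 2 = 1 := by rcases hs with rfl | rfl <;> norm_num
  refine next_eq (W := W) k1 k2 k3 k4 ?_ ?_ fun y hy => ?_
  · rw [isometry_sub, hcr, mul_pow, hs2, one_mul, hW]
  · rw [isometry_sub, hcr, mul_pow, hs2, one_mul, hW']
  · have := hb (T.frame F i y) (by rwa [inv_apply_self'])
    rw [← eta_act (T.frame F i)⁻¹ p, ← eta_act (T.frame F i)⁻¹ p', inv_apply_self'] at this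
    exact this

/-- Eventually periodic sequences of edges. -/
def EvPer (F : ℤ → ι) : Prop := ∃ P : ℤ, 0 < P ∧ ∃ I : ℤ, 0 ≤ I ∧ ∀ i, I ≤ i → F (i + P) = F i

end Billiard

/-! ### Parallel returns force periodicity -/

namespace Billiard

variable {ι : Type*} {T : Billiard ι} {F F' : ℤ → ι}

theorem Strip.shift {k m n : ℤ} {p q u : Plane} (h : T.Strip F (k + m) (k + n) p q u) :
    T.Strip (shift k F) m n ((T.frame F k)⁻¹ p) ((T.frame F k)⁻¹ q)
      ((T.frame F k)⁻¹.linearIsometryEquiv u) :=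
  ⟨mem_closure_R_shift.2 h.1, mem_closure_R_shift.2 h.2⟩

theorem Fwd.strip {m : ℤ} {p q u : Plane} (hp : T.Fwd F m (p, u)) (hq : T.Fwd F m (q, u)) (n : ℤ) :
    T.Strip F m n p q u := ⟨hp.2 n, hq.2 n⟩

theorem tilt_slide (p u : Plane) (r c : ℝ) :
    tilt (p + r • u, u) c 0 = ((tilt (p, u) c 0).1 + r • (tilt (p, u) c 0).2,
      (1 : ℝ) • (tilt (p, u) c 0).2) := by
  simp only [tilt, zero_smul, add_zero, one_smul]
  congr 1; abel

theorem sign_pigeon {α : Type*} (V : Ultrafilter α) (s : α → ℝ) (h : ∀ j, s j = 1 ∨ s j = -1) :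
    ∃ ε : ℝ, (ε = 1 ∨ ε = -1) ∧ ∀ᶠ j in (V : Filter α), s j = ε := by
  have h1 : ∀ᶠ j in (V : Filter α), s j = 1 ∨ s j = -1 := Eventually.of_forall h
  rcases Ultrafilter.eventually_or.1 h1 with h2 | h2
  exacts [⟨1, Or.inl rfl, h2⟩, ⟨-1, Or.inr rfl, h2⟩]

/-- A forward line whose image at two times is the same line, with the same orientation and the
same favourable side, repeats its edges. -/
theorem Fwd.eq_of_same_line {I : ℤ} {p u : Plane} {s : ℝ}
    (hside : ∀ n, ∀ᶠ c : ℝ in 𝓝[>] 0, tilt (p, u) (s * c) 0 ∈ T.R F I n)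
    {j k : ℤ} (hj : I ≤ j) (hk : I ≤ k) (h0 : F j = F k) {ε r : ℝ}
    (hεj : ∀ a b, cross ((T.frame F j)⁻¹.linearIsometryEquiv a)
      ((T.frame F j)⁻¹.linearIsometryEquiv b) = ε * cross a b)
    (hεk : ∀ a b, cross ((T.frame F k)⁻¹.linearIsometryEquiv a)
      ((T.frame F k)⁻¹.linearIsometryEquiv b) = ε * cross a b)
    (hu : (T.frame F j)⁻¹.linearIsometryEquiv u = (T.frame F k)⁻¹.linearIsometryEquiv u)
    (hr : (T.frame F k)⁻¹ p = (T.frame F j)⁻¹ p + r • (T.frame F j)⁻¹.linearIsometryEquiv u) :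
    ∀ i, 0 ≤ i → F (j + i) = F (k + i) := by
  intro i hi
  -- A translate of the line to its favourable side follows the edges. Since both refoldings have
  -- the same orientation, they carry this translate to the same line, and determinism applies to
  -- it.
  obtain ⟨c, h1, h2⟩ := ((hside (j + i)).and (hside (k + i))).exists
  have e1 : act (T.frame F j)⁻¹ (tilt (p, u) (s * c) 0) ∈ T.R (Billiard.shift j F) 0 i :=
    mem_R_shift.2 (R_mono (by omega) le_rfl h1)
  have e2 : act (T.frame F k)⁻¹ (tilt (p, u) (s * c) 0) ∈ T.R (Billiard.shift k F) 0 i :=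
    mem_R_shift.2 (R_mono (by omega) le_rfl h2)
  rw [tilt_act _ hεj, mul_zero] at e1
  rw [tilt_act _ hεk, mul_zero] at e2
  simp only [act] at e1 e2
  rw [← hu, hr, tilt_slide, mem_R_slide one_pos] at e2
  exact R_determ e1 e2 (by simpa [Billiard.shift] using h0) i hi le_rfl

/-- If a forward strip comes back infinitely often with the same direction, its sequence of
edges is eventually periodic. -/
theorem evPer_of_parallel [Finite ι] {p q u v : Plane} (hp : T.Fwd F 0 (p, u))
    (hq : T.Fwd F 0 (q, u)) (hpq : cross u (q - p) ≠ 0) {V : Ultrafilter ℕ}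
    (hV : (V : Filter ℕ) ≤ atTop)
    (hv : ∀ᶠ j : ℕ in (V : Filter ℕ), (T.frame F j)⁻¹.linearIsometryEquiv u = v) : EvPer F := by
  obtain ⟨I, hI, s, hs, hside⟩ := hp.exists_side
  choose sg hsg hcr using fun j : ℕ => exists_sign (T.frame F j)⁻¹
  obtain ⟨ε, hε, hVε⟩ := sign_pigeon V sg hsg
  obtain ⟨a, ha⟩ := V.exists_eq fun j : ℕ => F j
  set W := cross u (q - p) ^ 2 with hW
  have hW0 : 0 < W := by positivity
  have hsh : ∀ j : ℕ, T.Fwd (Billiard.shift j F) 0 (act (T.frame F j)⁻¹ (p, u)) := fun j =>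
    fwd_shift.2 (hp.mono (by omega))
  obtain ⟨-, y, σ, -, hlim, -⟩ := exists_limit (T := T) V (fun j : ℕ => Billiard.shift j F)
    (fun j : ℕ => act (T.frame F j)⁻¹ (p, u)) (Eventually.of_forall fun j => (hsh j).1)
    (Eventually.of_forall fun j => (hsh j).2 1)
  -- `h j` is the transversal position of the returning line. It converges along `V`, so there are
  -- two return times with positions closer than the width of the strip.
  let h : ℕ → ℝ := fun j => cross v ((T.frame F j)⁻¹ p)
  have hh : Tendsto h V (𝓝 (cross v y.1)) := by
    have h1 : Tendsto (fun j : ℕ => cross v ((T.frame F j)⁻¹ p +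
        σ j • (T.frame F j)⁻¹.linearIsometryEquiv u)) V (𝓝 (cross v y.1)) :=
      tendsto_const_nhds.cross ((continuous_fst.tendsto y).comp hlim)
    refine h1.congr' ?_
    filter_upwards [hv] with j hj
    rw [hj, cross_add, cross_smul, cross_same, mul_zero, add_zero]
  set w := cross u (q - p) with hw
  have hclose : ∀ᶠ j in (V : Filter ℕ), |h j - cross v y.1| < |w| / 2 := by
    have := hh.eventually (Metric.ball_mem_nhds _ (show 0 < |w| / 2 by positivity))
    simpa [Real.dist_eq] using this
  have hIV : ∀ᶠ j : ℕ in (V : Filter ℕ), I ≤ j := by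
    refine hV ?_
    filter_upwards [eventually_ge_atTop I.toNat] with j hj; omega
  have hall := hv.and (hVε.and (ha.and (hclose.and hIV)))
  obtain ⟨j, hj⟩ := hall.exists
  obtain ⟨k, hk, hjk⟩ := (hall.and (hV (eventually_gt_atTop j))).exists
  obtain ⟨vj, εj, aj, cj, Ij⟩ := hj
  obtain ⟨vk, εk, ak, ck, Ik⟩ := hk
  have hcj := hcr j
  have hck := hcr k
  rw [εj] at hcj
  rw [εk] at hck
  suffices hmain : ∀ i : ℤ, 0 ≤ i → F (j + i) = F (k + i) by
    refine ⟨k - j, by omega, j, by omega, fun i hi => ?_⟩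
    have := hmain (i - j) (by omega)
    rw [add_sub_cancel] at this
    rw [this]; congr 1; ring
  have hv1 : ‖v‖ = 1 := by rw [← vj, norm_linear]; exact hp.1
  -- Equal positions mean the same line, so a one-sided translate decides. Otherwise the two
  -- returned strips are parallel and partially overlap: the difference of their heights is a
  -- nonzero constant of absolute value less than `W`, and `Strip.agree` applies at every step,
  -- after exchanging sides if the constant is negative.
  rcases eq_or_ne (h j) (h k) with heq | hne
  · have h0 : cross v ((T.frame F k)⁻¹ p - (T.frame F j)⁻¹ p) = 0 := by
      rw [cross_sub]; simp only [h] at heq; linarith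
    obtain ⟨r, hr⟩ := exists_smul_of_cross_eq_zero (by rintro rfl; simp at hv1) h0
    refine Fwd.eq_of_same_line (r := r) hside Ij Ik (aj.trans ak.symm) hcj hck (vj.trans vk.symm) ?_
    rw [vj, ← hr]; abel
  · have hS : ∀ (l : ℕ) (n : ℤ), T.Strip (Billiard.shift l F) 0 n ((T.frame F l)⁻¹ p)
        ((T.frame F l)⁻¹ q) ((T.frame F l)⁻¹.linearIsometryEquiv u) := fun l n =>
      Strip.shift ((hp.strip hq _).mono (by omega) le_rfl)
    have hε2 : ε ^ 2 = 1 := by rcases hε with rfl | rfl <;> norm_num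
    have hwd : ∀ l : ℕ, (∀ a b, cross ((T.frame F l)⁻¹.linearIsometryEquiv a)
        ((T.frame F l)⁻¹.linearIsometryEquiv b) = ε * cross a b) →
        (T.frame F l)⁻¹.linearIsometryEquiv u = v →
        cross v ((T.frame F l)⁻¹ q - (T.frame F l)⁻¹ p) = ε * w := by
      intro l h1 h2
      rw [isometry_sub, ← h2, h1]
    have hwj := hwd j hcj vj
    have hwk := hwd k hck vk
    have hη : ∀ y, eta ((T.frame F j)⁻¹ p) ((T.frame F j)⁻¹ q) v y -
        eta ((T.frame F k)⁻¹ p) ((T.frame F k)⁻¹ q) v y = ε * w * (h k - h j) := by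
      intro y
      rw [eta_apply, eta_apply, hwj, hwk, cross_sub, cross_sub]; ring
    have habs : |ε * w * (h k - h j)| < W := by
      rw [abs_mul, abs_mul, show |ε| = 1 by rcases hε with rfl | rfl <;> simp, one_mul, hW,
        ← sq_abs, sq]
      have hw0 : 0 < |w| := abs_pos.2 hpq
      have : |h k - h j| < |w| := by
        rw [abs_lt] at cj ck ⊢
        constructor <;> linarith
      nlinarith
    have hne' : ε * w * (h k - h j) ≠ 0 := by
      have : ε ≠ 0 := by rcases hε with rfl | rfl <;> norm_num
      exact mul_ne_zero (mul_ne_zero this hpq) (sub_ne_zero.2 hne.symm)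
    have hagree : ∀ n : ℕ, ∀ i : ℤ, 0 ≤ i → i ≤ n → Billiard.shift j F i = Billiard.shift k F i := by
      intro n
      induction n with
      | zero =>
        intro i h1 h2
        have : i = 0 := le_antisymm h2 h1
        rw [this]; simpa [Billiard.shift] using aj.trans ak.symm
      | succ n ih =>
        intro i h1 h2
        rcases h2.lt_or_eq with h3 | h3
        · exact ih i h1 (by push_cast at h3; omega)
        rw [h3]
        have Sj := hS j (n + 1)
        have Sk := hS k (n + 1)
        rw [vj] at Sj
        rw [vk] at Sk
        have W1 : (ε * w) ^ 2 = W := by rw [mul_pow, hε2, one_mul]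
        rcases lt_or_gt_of_ne hne' with h4 | h4
        · rw [abs_of_neg h4] at habs
          refine Sj.symm.agree (W := W) Sk.symm ?_ ?_ (by omega) (by omega) ih fun y _ => ?_
          · rw [← neg_sub, ← neg_one_smul ℝ, cross_smul, hwj, ← W1]; ring
          · rw [← neg_sub, ← neg_one_smul ℝ, cross_smul, hwk, ← W1]; ring
          · rw [eta_swap ((T.frame F j)⁻¹ p), eta_swap ((T.frame F k)⁻¹ p), hwj, hwk]
            have := hη y
            constructor <;> linarith
        · rw [abs_of_pos h4] at habs
          refine Sj.agree (W := W) Sk (by rw [hwj, W1]) (by rw [hwk, W1]) (by omega) (by omega) ih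
            fun y _ => ?_
          have := hη y
          constructor <;> linarith
    intro i hi
    exact hagree i.toNat i hi (by omega)

end Billiard

/-! ### Strips that climb above a limit strip -/

/-- `G j` climbs from near 0 to near `h ≥ W` in steps that tend to 0. The time sought is the first
one within `W / 2` of the final value, rounded down to a multiple of `P`. Small steps make it far
from both time 0 and `n j`. -/
theorem exists_times {α : Type*} {V : Ultrafilter α} {G : α → ℕ → ℝ} {δ : α → ℝ} {n : α → ℕ}
    {W h : ℝ} (hW : 0 < W) (hδ : Tendsto δ V (𝓝 0))
    (hstep : ∀ᶠ j in (V : Filter α), 0 ≤ δ j ∧ ∀ i, G j i ≤ G j (i + 1) ∧ G j (i + 1) ≤ G j i + δ j)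
    (hG : ∀ i, Tendsto (fun j => G j i) V (𝓝 0)) (hn : Tendsto (fun j => G j (n j)) V (𝓝 h))
    (hh : W ≤ h) {P : ℕ} (hP : 0 < P) :
    ∃ m : α → ℕ, (∀ j, P ∣ m j) ∧ (∀ B, ∀ᶠ j in (V : Filter α), B ≤ m j) ∧
      (∀ B, ∀ᶠ j in (V : Filter α), m j + B ≤ n j) ∧
      Tendsto (fun j => G j (m j)) V (𝓝 (h - W / 2)) := by
  have hex : ∀ j, ∃ i, G j (n j) - W / 2 ≤ G j i := fun j => ⟨n j, by linarith⟩
  classical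
  let f : α → ℕ := fun j => Nat.find (hex j)
  have hf : ∀ j, G j (n j) - W / 2 ≤ G j (f j) := fun j => Nat.find_spec (hex j)
  have hfmin : ∀ j i, i < f j → G j i < G j (n j) - W / 2 := fun j i hi =>
    not_le.1 (Nat.find_min (hex j) hi)
  have hfn : ∀ j, f j ≤ n j := fun j => Nat.find_min' (hex j) (by linarith)
  have hnW : ∀ᶠ j in (V : Filter α), W * (3 / 4) < G j (n j) :=
    hn.eventually (lt_mem_nhds (by linarith))
  have hfinf : ∀ B, ∀ᶠ j in (V : Filter α), B ≤ f j := by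
    intro B
    have h1 : ∀ᶠ j in (V : Filter α), ∀ i ∈ Set.Iio B, G j i < W / 4 :=
      (eventually_all_finite (Set.finite_Iio B)).2 fun i _ =>
        (hG i).eventually (gt_mem_nhds (by positivity))
    filter_upwards [hnW, h1] with j h2 h3
    by_contra hlt
    have := h3 (f j) (not_le.1 hlt)
    linarith [hf j]
  have hup : ∀ᶠ j in (V : Filter α), ∀ i k, G j (i + k) ≤ G j i + k * δ j := by
    filter_upwards [hstep] with j hj i k
    induction k with
    | zero => simp
    | succ k ih => have := (hj.2 (i + k)).2; rw [← add_assoc]; push_cast; linarith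
  have hmono : ∀ᶠ j in (V : Filter α), ∀ i k, G j i ≤ G j (i + k) := by
    filter_upwards [hstep] with j hj i k
    induction k with
    | zero => simp
    | succ k ih => have := (hj.2 (i + k)).1; rw [← add_assoc]; linarith
  have hδB : ∀ (B : ℝ) (ε : ℝ), 0 < ε → ∀ᶠ j in (V : Filter α), B * δ j < ε := by
    intro B ε hε
    have := hδ.const_mul B
    rw [mul_zero] at this
    exact this.eventually (gt_mem_nhds hε)
  have hfle : ∀ᶠ j in (V : Filter α), G j (f j) ≤ G j (n j) - W / 2 + δ j := by
    filter_upwards [hfinf 1, hstep] with j h1 h2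
    have h3 := hfmin j (f j - 1) (by omega)
    have h4 := (h2.2 (f j - 1)).2
    rw [Nat.sub_add_cancel h1] at h4
    linarith
  have hfar : ∀ B, ∀ᶠ j in (V : Filter α), f j + B ≤ n j := by
    intro B
    filter_upwards [hup, hfle, hstep, hδB (B + 1) (W / 2) (by positivity)] with j h1 h2 h3 h4
    by_contra hlt
    push Not at hlt
    have h5 := h1 (f j) (n j - f j)
    rw [Nat.add_sub_cancel' (hfn j)] at h5
    have h6 : ((n j - f j : ℕ) : ℝ) ≤ B := by exact_mod_cast (by omega : n j - f j ≤ B)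
    nlinarith [mul_le_mul_of_nonneg_right h6 h3.1]
  refine ⟨fun j => f j - f j % P, fun j => Nat.dvd_sub_mod _, fun B => ?_, fun B => ?_, ?_⟩
  · filter_upwards [hfinf (B + P)] with j hj
    have := Nat.mod_lt (f j) hP
    omega
  · filter_upwards [hfar B] with j hj
    omega
  · have hmG : ∀ᶠ j in (V : Filter α), G j (n j) - W / 2 - P * δ j ≤ G j (f j - f j % P) ∧
        G j (f j - f j % P) ≤ G j (n j) - W / 2 + δ j := by
      filter_upwards [hup, hmono, hfle, hstep] with j h1 h2 h3 h4
      have h5 := h1 (f j - f j % P) (f j % P)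
      have h6 := h2 (f j - f j % P) (f j % P)
      rw [Nat.sub_add_cancel (Nat.mod_le _ _)] at h5 h6
      have h7 : ((f j % P : ℕ) : ℝ) ≤ P := by exact_mod_cast (Nat.mod_lt (f j) hP).le
      constructor
      · nlinarith [mul_le_mul_of_nonneg_right h7 h4.1, hf j]
      · linarith
    have l1 : Tendsto (fun j => G j (n j) - W / 2 - P * δ j) V (𝓝 (h - W / 2)) := by
      have := (hn.sub_const (W / 2)).sub (hδ.const_mul (P : ℝ))
      simpa using this
    have l2 : Tendsto (fun j => G j (n j) - W / 2 + δ j) V (𝓝 (h - W / 2)) := by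
      have := (hn.sub_const (W / 2)).add hδ
      simpa using this
    exact tendsto_of_tendsto_of_tendsto_of_le_of_le' l1 l2 (hmG.mono fun j h => h.1)
      (hmG.mono fun j h => h.2)

namespace Billiard

variable {ι : Type*} {T : Billiard ι} {F : ℤ → ι}

/-- Strips `(p' j, q' j, u' j)` converging to the strip `(p, q, u)`, of the same width, and their
sequences of edges. -/
structure Near (T : Billiard ι) {α : Type*} (V : Ultrafilter α) (F : ℤ → ι) (p q u : Plane)
    (F' : α → ℤ → ι) (p' q' u' : α → Plane) : Prop where
  fwd_p : T.Fwd F 0 (p, u)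
  fwd_q : T.Fwd F 0 (q, u)
  pos : cross u (q - p) ≠ 0
  unit : ∀ᶠ j in (V : Filter α), ‖u' j‖ = 1
  lim_p : Tendsto p' V (𝓝 p)
  lim_q : Tendsto q' V (𝓝 q)
  lim_u : Tendsto u' V (𝓝 u)
  lim_code : ∀ i, ∀ᶠ j in (V : Filter α), F' j i = F i
  width : ∀ᶠ j in (V : Filter α), cross (u' j) (q' j - p' j) ^ 2 = cross u (q - p) ^ 2

/-- The strips `(p' j, q' j, u' j)` rise above the strip `(p, q, u)`. -/
def Up {α : Type*} (V : Ultrafilter α) (p q u : Plane) (p' q' u' : α → Plane) : Prop :=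
  ∃ b, ∀ᶠ j in (V : Filter α), 0 < -(cross u (q - p) * cross (u' j) u) ∧
    0 ≤ eta p q u b - eta (p' j) (q' j) (u' j) b

/-- The strips rise and follow the same edges up to the time `n j` exactly. -/
structure Climb (T : Billiard ι) {α : Type*} (V : Ultrafilter α) (F : ℤ → ι) (p q u : Plane)
    (F' : α → ℤ → ι) (p' q' u' : α → Plane) (n : α → ℕ) : Prop
    extends T.Near V F p q u F' p' q' u' where
  strip : ∀ᶠ j in (V : Filter α), T.Strip (F' j) 0 (n j + 1) (p' j) (q' j) (u' j)
  agree : ∀ᶠ j in (V : Filter α), ∀ i : ℤ, 0 ≤ i → i ≤ n j → F i = F' j i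
  differ : ∀ᶠ j in (V : Filter α), F (n j + 1) ≠ F' j (n j + 1)
  up : Up V p q u p' q' u'

/-- For unit vectors at an angle of at most a right angle, the chord is at most twice the sine. -/
theorem norm_sub_le_cross {u v : Plane} (hu : ‖u‖ = 1) (hv : ‖v‖ = 1) (h : 0 ≤ inner ℝ u v) :
    ‖u - v‖ ≤ 2 * |cross v u| := by
  refine abs_le_of_sq_le_sq' ?_ (by positivity) |>.2
  have h1 : u 0 ^ 2 + u 1 ^ 2 = 1 := by rw [← Plane.norm_sq, hu]; norm_num
  have h2 : v 0 ^ 2 + v 1 ^ 2 = 1 := by rw [← Plane.norm_sq, hv]; norm_num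
  rw [Plane.inner_eq] at h
  rw [mul_pow, sq_abs, Plane.norm_sq]
  simp only [cross, PiLp.sub_apply]
  set c := u 0 * v 0 + u 1 * v 1 with hc
  have h3 : (v 0 * u 1 - v 1 * u 0) ^ 2 = 1 - c ^ 2 := by
    rw [hc]; linear_combination (v 0 ^ 2 + v 1 ^ 2) * h1 + h2
  have h4 : (u 0 - v 0) ^ 2 + (u 1 - v 1) ^ 2 = 2 - 2 * c := by
    rw [hc]; linear_combination h1 + h2
  rw [h3, h4]
  have h5 : c ≤ 1 := by nlinarith [sq_nonneg (v 0 * u 1 - v 1 * u 0)]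
  nlinarith

/-- The displacement `g j` of the two strips is almost constant on each copy of the table, and it
grows slowly along the line through `p`. The sequences cannot separate before it is about `W`, so it
passes a value `t ≥ W / 2` at times `m j` long before the separation at `n j`, where it is near `t +
W / 2`. Taking `m j` divisible by `P` serves the periodic case. -/
theorem Climb.exists [Finite ι] {α : Type*} {V : Ultrafilter α} {p q u : Plane}
    {F' : α → ℤ → ι} {p' q' u' : α → Plane} {n : α → ℕ} (h : T.Climb V F p q u F' p' q' u' n)
    {P : ℕ} (hP : 0 < P) : ∃ (m : α → ℕ) (t : ℝ), cross u (q - p) ^ 2 / 2 ≤ t ∧ (∀ j, P ∣ m j) ∧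
      (∀ B, ∀ᶠ j in (V : Filter α), B ≤ m j) ∧ (∀ B, ∀ᶠ j in (V : Filter α), m j + B ≤ n j) ∧
      (∀ ε > 0, ∀ᶠ j in (V : Filter α), ∀ a y, (T.frame F (m j))⁻¹ y ∈ T.seg a →
        |eta p q u y - eta (p' j) (q' j) (u' j) y - t| < ε) ∧
      ∀ ε > 0, ∀ᶠ j in (V : Filter α), ∀ a y, (T.frame F (n j))⁻¹ y ∈ T.seg a →
        |eta p q u y - eta (p' j) (q' j) (u' j) y - (t + cross u (q - p) ^ 2 / 2)| < ε := by
  obtain ⟨s, hs, hsm, hsu⟩ := h.fwd_p.crossings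
  obtain ⟨D, hD, hDb⟩ := T.frame_inv_bound
  dsimp only at hs
  obtain ⟨b, hup⟩ := h.up
  set w := cross u (q - p) with hw
  set W := w ^ 2 with hWdef
  have hW : 0 < W := by have := h.pos; positivity
  have hu1 : ‖u‖ = 1 := h.fwd_p.1
  -- the sign of the width is eventually constant
  have hwlim : Tendsto (fun j => cross (u' j) (q' j - p' j)) V (𝓝 w) :=
    h.lim_u.cross (h.lim_q.sub h.lim_p)
  have hwe : ∀ᶠ j in (V : Filter α), cross (u' j) (q' j - p' j) = w := by
    have h1 : ∀ᶠ j in (V : Filter α), 0 < cross (u' j) (q' j - p' j) * w :=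
      (hwlim.mul_const w).eventually (lt_mem_nhds (by rw [← sq]; exact hW))
    filter_upwards [h1, h.width] with j h2 h3
    rcases sq_eq_sq_iff_eq_or_eq_neg.1 h3 with h4 | h4
    · exact h4
    · rw [h4] at h2; nlinarith
  let κ : α → ℝ := fun j => -(w * cross (u' j) u)
  have hκ0 : Tendsto κ V (𝓝 0) := by
    have := ((h.lim_u.cross (tendsto_const_nhds (x := u))).const_mul w).neg
    simpa [cross_same] using this
  -- `g j` is the displacement of the strips at a point, `κ j` its slope along the line through `p`,
  -- and `G j i` its value at the `i`-th crossing of that line.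
  let g : α → Plane → ℝ := fun j y => eta p q u y - eta (p' j) (q' j) (u' j) y
  have hgsub : ∀ᶠ j in (V : Filter α), ∀ y z, g j y - g j z = w * cross (u - u' j) (y - z) := by
    filter_upwards [hwe] with j hj y z
    simp only [g, eta_apply, hj, ← hw]
    simp [cross]; ring
  have hglip : ∀ᶠ j in (V : Filter α), ∀ y z, |g j y - g j z| ≤ 2 * κ j * ‖y - z‖ := by
    have hin : ∀ᶠ j in (V : Filter α), (0 : ℝ) < inner ℝ u (u' j) := by
      have h1 : Tendsto (fun j => (inner ℝ u (u' j) : ℝ)) V (𝓝 (inner ℝ u u)) :=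
        tendsto_const_nhds.inner h.lim_u
      rw [real_inner_self_eq_norm_sq, hu1] at h1
      exact h1.eventually (lt_mem_nhds (by norm_num))
    filter_upwards [hgsub, hin, h.unit, hup] with j h1 h2 h3 h4 y z
    rw [h1, abs_mul]
    have h5 := abs_cross_le (u - u' j) (y - z)
    have h6 := norm_sub_le_cross hu1 h3 h2.le
    have h7 : κ j = |w| * |cross (u' j) u| := by
      rw [← abs_mul, ← abs_neg, abs_of_pos h4.1]
    rw [h7]
    calc |w| * |cross (u - u' j) (y - z)| ≤ |w| * (2 * |cross (u' j) u| * ‖y - z‖) := by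
          gcongr; exact h5.trans (by gcongr)
      _ = _ := by ring
  let G : α → ℕ → ℝ := fun j i => g j (p + s i • u)
  have hGs : ∀ᶠ j in (V : Filter α), ∀ i : ℕ, G j i = g j p + κ j * s i := by
    filter_upwards [hgsub] with j h1 i
    have h2 := h1 (p + s i • u) p
    rw [add_sub_cancel_left, cross_smul] at h2
    have h3 : cross (u - u' j) u = -cross (u' j) u := by simp [cross]; ring
    rw [h3] at h2
    simp only [G, κ]; linarith
  have hzdiff : ∀ i : ℕ, s (i + 1 : ℕ) - s i ≤ D := by
    intro i
    have h1 := hs i (by omega)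
    have h2 := hs (i + 1) (by omega)
    rw [← frame_succ_inv_seg (Or.inr h2)] at h2
    have h3 := hDb F i _ _ _ _ h2 h1
    have h4 : p + s (i + 1) • u - (p + s i • u) = (s (i + 1) - s i) • u := by module
    rw [h4, norm_smul, hu1, mul_one, Real.norm_eq_abs] at h3
    push_cast
    exact (le_abs_self _).trans h3
  have hδ : Tendsto (fun j => κ j * D) V (𝓝 0) := by simpa using hκ0.mul_const D
  have hstep : ∀ᶠ j in (V : Filter α), 0 ≤ κ j * D ∧
      ∀ i, G j i ≤ G j (i + 1) ∧ G j (i + 1) ≤ G j i + κ j * D := by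
    filter_upwards [hGs, hup] with j h1 h2
    have hk : 0 < κ j := h2.1
    refine ⟨by positivity, fun i => ?_⟩
    rw [h1, h1]
    have h3 := hsm i (by omega)
    have h4 := hzdiff i
    push_cast at h4 ⊢
    constructor <;> nlinarith
  have hgp : Tendsto (fun j => g j p) V (𝓝 0) := by
    have h1 := (h.lim_u.cross (h.lim_q.sub h.lim_p)).mul
      (h.lim_u.cross ((tendsto_const_nhds (x := p)).sub h.lim_p))
    have h2 := (tendsto_const_nhds (x := eta p q u p)).sub h1
    have h3 : eta p q u p - cross u (q - p) * cross u (p - p) = 0 := by rw [eta_apply, sub_self]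
    rw [h3] at h2
    exact h2
  have hG0 : ∀ i, Tendsto (fun j => G j i) V (𝓝 0) := by
    intro i
    have h1 := hgp.add (hκ0.mul_const (s i))
    rw [zero_mul, add_zero] at h1
    exact h1.congr' (hGs.mono fun j hj => (hj i).symm)
  have hdev : ∀ᶠ j in (V : Filter α), ∀ (i : ℕ) a y, (T.frame F i)⁻¹ y ∈ T.seg a →
      |g j y - G j i| ≤ 2 * (κ j * D) := by
    filter_upwards [hglip, hup] with j h1 h2 i a y hy
    have hk : 0 < κ j := h2.1
    have h3 := hDb F i _ _ _ _ hy (hs i (by omega))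
    have h4 := h1 y (p + s i • u)
    simp only [G]
    nlinarith
  -- the times at which the sequences separate
  obtain ⟨N, hN0, hN⟩ := hsu (3 * D + 2 * ‖b - p‖)
  have hnN : ∀ᶠ j in (V : Filter α), N ≤ n j := by
    have h1 : ∀ᶠ j in (V : Filter α), ∀ i ∈ Set.Icc 0 N, F' j i = F i :=
      (eventually_all_finite (Set.finite_Icc 0 N)).2 fun i _ => h.lim_code i
    filter_upwards [h1, h.differ] with j h2 h3
    by_contra hlt
    push Not at hlt
    exact h3 (h2 _ ⟨by omega, by omega⟩).symm
  -- If the displacement at time `n j` were below `W - 2 * κ j * D`, it would lie strictly between 0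
  -- and `W` on the whole copy, and `Strip.agree` would postpone the separation. It is positive
  -- because past `N` the gain `κ j * s` exceeds the variation `2 * κ j * D` inside a copy and the
  -- possible deficit `2 * κ j * ‖b - p‖` at `p`.
  have hlow : ∀ᶠ j in (V : Filter α), W - 2 * (κ j * D) ≤ G j (n j) := by
    filter_upwards [hnN, h.width, h.strip, h.agree, h.differ, hdev, hGs, hup, hglip] with j h1 h2 h3
      h4 h5 h6 h7 h8 h12
    by_contra hlt
    push Not at hlt
    have hk : 0 < κ j := h8.1
    have hgp0 : -(2 * κ j * ‖b - p‖) ≤ g j p := by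
      have h9 := (abs_le.1 (h12 b p)).2
      have h10 : 0 ≤ g j b := h8.2
      linarith
    refine h5 (Strip.agree (W := W) (h.fwd_p.strip h.fwd_q _) h3 rfl h2 (by omega) (by omega) h4
      fun y hy => ?_)
    obtain ⟨a, ha⟩ := verts_seg hy
    have h9 := abs_le.1 (h6 (n j) a y ha)
    have h10 := h7 (n j)
    have h11 := hN (n j) h1
    simp only [g] at h9 hgp0 h10 hlt
    constructor
    · nlinarith [h9.1]
    · linarith [h9.2]
  -- At time `n j` both strips still meet the same edge, which bounds their displacement.
  have hbdd : ∀ᶠ j in (V : Filter α), G j (n j) ∈ Metric.closedBall (0 : ℝ) (|w| * D) := by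
    filter_upwards [h.strip, h.agree, hwe, h.unit] with j h1 h2 h3 h4
    have h5 : act (T.frame (F' j) (n j))⁻¹ (p' j, u' j) ∈ closure (T.C (F' j (n j)) (F' j (n j + 1))) :=
      map_mem_closure (act_continuous _) h1.1 fun y hy => hy (n j) (by omega) (by omega)
    rw [← frame_congr fun i hi1 hi2 => h2 i (by omega) (by omega)] at h5
    obtain ⟨y, hy, hy0⟩ := exists_mem_seg h5 (Or.inl rfl)
    obtain ⟨y, rfl⟩ : ∃ z, (T.frame F (n j))⁻¹ z = y := ⟨T.frame F (n j) y, inv_apply_self' _ _⟩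
    have h6 := hDb F (n j) _ _ _ _ (hs (n j) (by omega)) hy
    obtain ⟨ε, hε, hcr⟩ := exists_sign (T.frame F (n j))⁻¹
    simp only [act] at hy0
    rw [isometry_sub, hcr] at hy0
    have h7 : cross (u' j) (y - p' j) = 0 := by
      rcases hε with rfl | rfl <;> linarith
    have h8 : G j (n j) = -(w * cross (u' j) (p + s (n j) • u - y)) := by
      simp only [G, g]
      have e1 : eta p q u (p + s (n j) • u) = 0 := by
        rw [eta_apply, cross_on_line, mul_zero]
      rw [e1, eta_apply, h3]
      have e2 : cross (u' j) (p + s (n j) • u - p' j) =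
          cross (u' j) (p + s (n j) • u - y) + cross (u' j) (y - p' j) := by
        rw [← cross_add]; congr 1; abel
      rw [e2, h7]; ring
    rw [mem_closedBall_zero_iff, h8, norm_neg, Real.norm_eq_abs, abs_mul]
    have h9 := abs_cross_le (u' j) (p + s (n j) • u - y)
    rw [h4, one_mul] at h9
    gcongr
    exact h9.trans h6
  obtain ⟨hE, -, hlim⟩ := V.exists_tendsto (isCompact_closedBall _ _) hbdd
  have hWE : W ≤ hE := by
    have h1 := (tendsto_const_nhds (x := W)).sub (hδ.const_mul 2)
    rw [mul_zero, sub_zero] at h1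
    exact le_of_tendsto_of_tendsto h1 hlim hlow
  obtain ⟨m, hm1, hm2, hm3, hm4⟩ := exists_times hW hδ hstep hG0 hlim hWE hP
  have hfin : ∀ (k : α → ℕ) (t : ℝ), Tendsto (fun j => G j (k j)) V (𝓝 t) → ∀ ε > 0,
      ∀ᶠ j in (V : Filter α), ∀ a y, (T.frame F (k j))⁻¹ y ∈ T.seg a →
        |eta p q u y - eta (p' j) (q' j) (u' j) y - t| < ε := by
    intro k t hk ε hε
    have h1 := hk.eventually (Metric.ball_mem_nhds t (half_pos hε))
    have h2 := (hδ.const_mul 2).eventually (gt_mem_nhds (show 2 * 0 < ε / 2 by linarith))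
    filter_upwards [h1, h2, hdev] with j h3 h4 h5 a y hy
    have h6 := h5 (k j) a y hy
    rw [Real.dist_eq, abs_lt] at h3
    have h7 := abs_le.1 h6
    simp only [g] at h7
    rw [abs_lt]
    constructor <;> linarith [h3.1, h3.2]
  refine ⟨m, hE - W / 2, by linarith, hm1, hm2, hm3, hfin m _ hm4, ?_⟩
  rw [sub_add_cancel]
  exact hfin n _ hlim

end Billiard

/-! ### Wider strips from tilted ones -/

theorem cross_neg (u v : Plane) : cross u (-v) = -cross u v := by
  simp [cross]; ring

namespace Billiard

variable {ι : Type*} {T : Billiard ι} {F F' : ℤ → ι}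

/-- The oriented unit line `x` is a limit of lines that follow the edges `F` arbitrarily long
in both directions. -/
def Two (T : Billiard ι) (F : ℤ → ι) (x : Plane × Plane) : Prop := ∀ m, T.Fwd F m x

theorem two_iff {x : Plane × Plane} :
    T.Two F x ↔ ‖x.2‖ = 1 ∧ ∀ N : ℕ, x ∈ closure (T.R F (-N) N) := by
  refine ⟨fun h => ⟨(h 0).1, fun N => (h _).2 _⟩, fun h m => ⟨h.1, fun n => ?_⟩⟩
  exact closure_mono (R_mono (by omega) (by omega)) (h.2 (m.natAbs + n.natAbs))

theorem Two.rev {p u : Plane} (h : T.Two F (p, u)) : T.Two (rev F) (p, -u) := fun m =>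
  ⟨by simpa using (h 0).1, fun n => mem_closure_R_rev.2 ((h _).2 _)⟩

/-- The sequences whose finite segments all occur in `F`. -/
def OrbCl (F : ℤ → ι) : Set (ℤ → ι) := {K | ∀ N : ℕ, ∃ k : ℤ, ∀ i : ℤ, |i| ≤ N → K i = F (k + i)}

theorem rev_rev (F : ℤ → ι) : Billiard.rev (Billiard.rev F) = F := by
  funext i; simp [Billiard.rev]

/-- Compactness for strips that become long in both directions. -/
theorem exists_limit_strip [Finite ι] {α : Type*} (V : Ultrafilter α) (Φ : α → ℤ → ι)
    (p q u : α → Plane) (h1 : ∀ᶠ j in (V : Filter α), ‖u j‖ = 1)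
    (hS : ∀ N : ℕ, ∀ᶠ j in (V : Filter α), T.Strip (Φ j) (-N) N (p j) (q j) (u j)) :
    ∃ (K : ℤ → ι) (p₀ q₀ u₀ : Plane) (σ τ : α → ℝ), (∀ i, ∀ᶠ j in (V : Filter α), Φ j i = K i) ∧
      Tendsto (fun j => p j + σ j • u j) V (𝓝 p₀) ∧ Tendsto (fun j => q j + τ j • u j) V (𝓝 q₀) ∧
      Tendsto u V (𝓝 u₀) ∧ T.Two K (p₀, u₀) ∧ T.Two K (q₀, u₀) := by
  obtain ⟨K, ⟨p₀, u₀⟩, σ, hK, hp, hu⟩ := exists_limit (T := T) V Φ (fun j => (p j, u j)) h1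
    ((hS 1).mono fun j h => closure_mono (R_mono (by simp) le_rfl) h.1)
  obtain ⟨-, ⟨q₀, u₁⟩, τ, -, hq, -⟩ := exists_limit (T := T) V Φ (fun j => (q j, u j)) h1
    ((hS 1).mono fun j h => closure_mono (R_mono (by simp) le_rfl) h.2)
  have hu0 : Tendsto u V (𝓝 u₀) := (continuous_snd.tendsto _).comp hp
  have hu1 : Tendsto u V (𝓝 u₁) := (continuous_snd.tendsto _).comp hq
  obtain rfl := tendsto_nhds_unique hu0 hu1
  refine ⟨K, p₀, q₀, u₀, σ, τ, hK, (continuous_fst.tendsto _).comp hp,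
    (continuous_fst.tendsto _).comp hq, hu0, two_iff.2 ⟨hu, fun N => ?_⟩, two_iff.2 ⟨hu, fun N => ?_⟩⟩
  · refine closure_R_congr_of_tendsto hK hp ((hS N).mono fun j h => ?_)
    have := (mem_closure_R_slide (T := T) (F := Φ j) (s := σ j) one_pos).2 h.1
    rwa [one_smul] at this
  · refine closure_R_congr_of_tendsto hK hq ((hS N).mono fun j h => ?_)
    have := (mem_closure_R_slide (T := T) (F := Φ j) (s := τ j) one_pos).2 h.2
    rwa [one_smul] at this

theorem cross_slide (u p q : Plane) (s t : ℝ) :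
    cross u (q + t • u - (p + s • u)) = cross u (q - p) := by
  simp [cross]; ring

theorem eta_slide (p q u y : Plane) (s t : ℝ) :
    eta (p + s • u) (q + t • u) u y = eta p q u y := by
  have h := cross_slide u p y s 0
  rw [zero_smul, add_zero] at h
  rw [eta_apply, eta_apply, cross_slide, h]

theorem tendsto_eta {α : Type*} {V : Ultrafilter α} {p q u : α → Plane} {p₀ q₀ u₀ : Plane}
    {σ τ : α → ℝ} (hp : Tendsto (fun j => p j + σ j • u j) V (𝓝 p₀))
    (hq : Tendsto (fun j => q j + τ j • u j) V (𝓝 q₀)) (hu : Tendsto u V (𝓝 u₀)) (y : Plane) :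
    Tendsto (fun j => eta (p j) (q j) (u j) y) V (𝓝 (eta p₀ q₀ u₀ y)) := by
  have h := (hu.cross (hq.sub hp)).mul (hu.cross ((tendsto_const_nhds (x := y)).sub hp))
  refine h.congr fun j => ?_
  rw [← eta_slide _ _ _ _ (σ j) (τ j), eta_apply]

/-- The limit of two strips that separate, at a time when they have moved apart. -/
theorem Climb.exists_limit [Finite ι] {α : Type*} {V : Ultrafilter α} {p q u : Plane}
    {F' : α → ℤ → ι} {p' q' u' : α → Plane} {n : α → ℕ} (h : T.Climb V F p q u F' p' q' u' n)
    {m : α → ℕ} {t : ℝ} (hm : ∀ B, ∀ᶠ j in (V : Filter α), B ≤ m j)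
    (hmn : ∀ B, ∀ᶠ j in (V : Filter α), m j + B ≤ n j)
    (ht : ∀ ε > 0, ∀ᶠ j in (V : Filter α), ∀ a y, (T.frame F (m j))⁻¹ y ∈ T.seg a →
        |eta p q u y - eta (p' j) (q' j) (u' j) y - t| < ε) :
    ∃ (K : ℤ → ι) (p₀ q₀ p₁ q₁ u₀ : Plane),
      (∀ i, ∀ᶠ j in (V : Filter α), F (m j + i) = K i) ∧
      T.Two K (p₀, u₀) ∧ T.Two K (q₀, u₀) ∧ T.Two K (p₁, u₀) ∧ T.Two K (q₁, u₀) ∧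
      (∀ y, Tendsto (fun j => eta ((T.frame F (m j))⁻¹ p) ((T.frame F (m j))⁻¹ q)
        ((T.frame F (m j))⁻¹.linearIsometryEquiv u) y) V (𝓝 (eta p₀ q₀ u₀ y))) ∧
      Tendsto (fun j => (T.frame F (m j))⁻¹.linearIsometryEquiv u) V (𝓝 u₀) ∧
      cross u₀ (q₀ - p₀) ^ 2 = cross u (q - p) ^ 2 ∧
      cross u₀ (q₁ - p₁) = cross u₀ (q₀ - p₀) ∧
      cross u₀ (q₀ - p₀) * cross u₀ (p₁ - p₀) = t := by
  have hu1 : ‖u‖ = 1 := h.fwd_p.1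
  let H : α → Plane ≃ᵃⁱ[ℝ] Plane := fun j => (T.frame F (m j))⁻¹
  have hS : ∀ N : ℕ, ∀ᶠ j in (V : Filter α), T.Strip (Billiard.shift (m j) F) (-N) N
      (H j p) (H j q) ((H j).linearIsometryEquiv u) := fun N => by
    filter_upwards [hm N] with j hj
    exact Strip.shift ((h.fwd_p.strip h.fwd_q _).mono (by omega) le_rfl)
  have hS' : ∀ N : ℕ, ∀ᶠ j in (V : Filter α), T.Strip (Billiard.shift (m j) (F' j)) (-N) N
      (H j (p' j)) (H j (q' j)) ((H j).linearIsometryEquiv (u' j)) := fun N => by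
    filter_upwards [hm N, hmn N, h.strip, h.agree] with j h1 h2 h3 h4
    have h5 : T.frame F (m j) = T.frame (F' j) (m j) :=
      frame_congr fun i hi1 hi2 => h4 i (by omega) (by omega)
    simp only [H, h5]
    exact Strip.shift (h3.mono (by omega) (by omega))
  obtain ⟨K, p₀, q₀, u₀, σ, τ, hK, hp₀, hq₀, hu₀, T1, T2⟩ := exists_limit_strip (T := T) V _ _ _ _
    (Eventually.of_forall fun j => by rw [norm_linear, hu1]) hS
  obtain ⟨K', p₁, q₁, u₀', σ', τ', hK', hp₁, hq₁, hu₁, T3, T4⟩ := exists_limit_strip (T := T) V _ _ _ _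
    (h.unit.mono fun j hj => by rw [norm_linear, hj]) hS'
  -- The two sequences agree up to `n j`, and `n j - m j` tends to infinity, so their limits around
  -- time `m j` coincide.
  obtain rfl : K' = K := by
    funext i
    obtain ⟨j, h1, h2, h3, h4, h5⟩ := ((hK i).and ((hK' i).and ((hm i.natAbs).and
      ((hmn i.natAbs).and h.agree)))).exists
    rw [← h1, ← h2]
    exact (h5 _ (by omega) (by omega)).symm
  obtain rfl : u₀' = u₀ := by
    refine tendsto_nhds_unique hu₁ (hu₀.congr_dist ?_)
    have h1 : Tendsto (fun j => dist u (u' j)) V (𝓝 0) := by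
      have := (tendsto_const_nhds (x := u)).dist h.lim_u
      rwa [dist_self] at this
    simpa only [LinearIsometryEquiv.dist_map] using h1
  choose sg hsg hcr using fun j => exists_sign (H j)
  obtain ⟨ε, hε, hVε⟩ := sign_pigeon V sg hsg
  have hε2 : ε ^ 2 = 1 := by rcases hε with rfl | rfl <;> norm_num
  have e1 : cross u₀' (q₀ - p₀) = ε * cross u (q - p) := by
    refine tendsto_nhds_unique (hu₀.cross (hq₀.sub hp₀)) (tendsto_const_nhds.congr' ?_)
    filter_upwards [hVε] with j hj
    rw [cross_slide, isometry_sub, hcr, hj]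
  have e2 : cross u₀' (q₁ - p₁) = ε * cross u (q - p) := by
    have h1 := (h.lim_u.cross (h.lim_q.sub h.lim_p)).const_mul ε
    refine tendsto_nhds_unique (hu₁.cross (hq₁.sub hp₁)) (h1.congr' ?_)
    filter_upwards [hVε] with j hj
    rw [cross_slide, isometry_sub, hcr, hj]
  refine ⟨K', p₀, q₀, p₁, q₁, u₀', hK, T1, T2, T3, T4, tendsto_eta hp₀ hq₀ hu₀, hu₀, ?_, e2.trans e1.symm, ?_⟩
  · rw [e1, mul_pow, hε2, one_mul]
  -- The offset of the two limit strips is read off at one point, the vertex `T.A (F 0)`; the limit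
  -- strips are parallel and equally wide, so any other point would give the same value.
  · have l1 := (tendsto_eta hp₀ hq₀ hu₀ (T.A (F 0))).sub (tendsto_eta hp₁ hq₁ hu₁ (T.A (F 0)))
    have l2 : Tendsto (fun j => eta (H j p) (H j q) ((H j).linearIsometryEquiv u) (T.A (F 0)) -
        eta (H j (p' j)) (H j (q' j)) ((H j).linearIsometryEquiv (u' j)) (T.A (F 0))) V (𝓝 t) := by
      rw [Metric.tendsto_nhds]
      intro ε hε
      filter_upwards [ht ε hε] with j hj
      have h1 := hj (F 0) (T.frame F (m j) (T.A (F 0)))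
        (by rw [inv_apply_self']; exact left_mem_segment _ _ _)
      rw [← eta_act (H j), ← eta_act (H j) (p' j), inv_apply_self'] at h1
      exact h1
    have l3 := tendsto_nhds_unique l1 l2
    rw [eta_apply, eta_apply, e2, ← e1] at l3
    rw [← l3]
    simp [cross]; ring

/-- A strip that strictly climbs above a two-sided strip produces a wider strip. -/
theorem Climb.exists_wider [Finite ι] {α : Type*} {V : Ultrafilter α} {p q u : Plane}
    {F' : α → ℤ → ι} {p' q' u' : α → Plane} {n : α → ℕ} (h : T.Climb V F p q u F' p' q' u' n) :
    ∃ (K : ℤ → ι) (p₀ q₀ u₀ : Plane), T.Two K (p₀, u₀) ∧ T.Two K (q₀, u₀) ∧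
      9 / 4 * cross u (q - p) ^ 2 ≤ cross u₀ (q₀ - p₀) ^ 2 ∧
      K ∈ OrbCl F := by
  obtain ⟨m, t, ht, -, hm, hmn, hlim, -⟩ := h.exists one_pos
  obtain ⟨K, p₀, q₀, p₁, q₁, u₀, hK, T1, -, -, T4, -, -, e1, e2, e3⟩ := h.exists_limit hm hmn hlim
  refine ⟨K, p₀, q₁, u₀, T1, T4, ?_, fun N => ?_⟩
  -- The limit strips have the same signed width `w` and offset `d` with `w * d = t ≥ w ^ 2 / 2`. So
  -- `d` has the sign of `w` and at least half its size, and the outer lines through `p₀` and `q₁`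
  -- are at distance at least 3/2 of the width.
  · have h1 : cross u₀ (q₁ - p₀) = cross u₀ (q₀ - p₀) + cross u₀ (p₁ - p₀) := by
      rw [← e2, ← cross_add]; congr 1; abel
    have hW : 0 < cross u (q - p) ^ 2 := by have := h.pos; positivity
    rw [h1, ← e1]
    rw [← e1] at ht hW
    set w := cross u₀ (q₀ - p₀)
    set d := cross u₀ (p₁ - p₀)
    have h2 : w ^ 2 * d ^ 2 = t ^ 2 := by rw [← e3]; ring
    have h3 : w ^ 2 / 4 ≤ d ^ 2 := by
      by_contra hlt
      push Not at hlt
      nlinarith [mul_lt_mul_of_pos_left hlt hW]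
    nlinarith
  · have h1 : ∀ᶠ j in (V : Filter α), ∀ i ∈ Set.Icc (-(N : ℤ)) N, F (m j + i) = K i :=
      (eventually_all_finite (Set.finite_Icc _ _)).2 fun i _ => hK i
    obtain ⟨j, hj⟩ := h1.exists
    exact ⟨m j, fun i hi => (hj i (abs_le.1 hi)).symm⟩

theorem exists_first_differ {F F' : ℤ → ι} (h0 : F 0 = F' 0) (h : ∃ i : ℤ, 0 ≤ i ∧ F i ≠ F' i) :
    ∃ n : ℕ, (∀ i : ℤ, 0 ≤ i → i ≤ n → F i = F' i) ∧ F (n + 1) ≠ F' (n + 1) := by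
  classical
  obtain ⟨i, hi, hne⟩ := h
  have hex : ∃ k : ℕ, F k ≠ F' k := ⟨i.toNat, by rwa [Int.toNat_of_nonneg hi]⟩
  have h1 := Nat.find_spec hex
  have h2 : Nat.find hex ≠ 0 := by intro h; rw [h] at h1; exact h1 h0
  obtain ⟨n, hn⟩ := Nat.exists_eq_succ_of_ne_zero h2
  refine ⟨n, fun i h3 h4 => ?_, by rw [hn] at h1; exact_mod_cast h1⟩
  have := Nat.find_min hex (m := i.toNat) (by omega)
  rw [Int.toNat_of_nonneg h3] at this
  exact not_not.1 this

/-- If the sequences never separated, the lines would be parallel by `Fwd.parallel`, against the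
nonzero slope in `Up`. So there is a first separation time and the strips form a `Climb`. -/
theorem Near.exists_wider [Finite ι] {α : Type*} {V : Ultrafilter α} {p q u : Plane}
    {F' : α → ℤ → ι} {p' q' u' : α → Plane} (h : T.Near V F p q u F' p' q' u')
    (hp : ∀ᶠ j in (V : Filter α), T.Fwd (F' j) 0 (p' j, u' j))
    (hq : ∀ᶠ j in (V : Filter α), T.Fwd (F' j) 0 (q' j, u' j)) (hup : Up V p q u p' q' u') :
    ∃ (K : ℤ → ι) (p₀ q₀ u₀ : Plane), T.Two K (p₀, u₀) ∧ T.Two K (q₀, u₀) ∧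
      9 / 4 * cross u (q - p) ^ 2 ≤ cross u₀ (q₀ - p₀) ^ 2 ∧
      K ∈ OrbCl F := by
  have hex : ∀ᶠ j in (V : Filter α), ∃ n : ℕ, (∀ i : ℤ, 0 ≤ i → i ≤ n → F i = F' j i) ∧
      F (n + 1) ≠ F' j (n + 1) := by
    obtain ⟨b, hb⟩ := hup
    filter_upwards [h.lim_code 0, hp, hb] with j h0 h1 h2
    refine exists_first_differ h0.symm ?_
    by_contra hcon
    push Not at hcon
    have h3 : T.Fwd F 0 (p' j, u' j) := ⟨h1.1, fun n => by
      rw [R_congr fun i hi _ => hcon i (by simpa using hi)]; exact h1.2 n⟩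
    have h4 := h3.parallel h.fwd_p
    dsimp only at h4
    rw [h4, cross_same] at h2
    simp at h2
  obtain ⟨n, hn⟩ := hex.choice
  exact Climb.exists_wider (n := n)
    { toNear := h
      strip := by filter_upwards [hp, hq] with j h1 h2 using h1.strip h2 _
      agree := hn.mono fun j hj => hj.1
      differ := hn.mono fun j hj => hj.2
      up := hup }

theorem OrbCl.rev {K : ℤ → ι} (h : K ∈ OrbCl (Billiard.rev F)) : Billiard.rev K ∈ OrbCl F := by
  intro N
  obtain ⟨k, hk⟩ := h (N + 1)
  refine ⟨-k, fun i hi => ?_⟩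
  rw [abs_le] at hi
  have := hk (1 - i) (by rw [abs_le]; push_cast; omega)
  simp only [Billiard.rev] at this ⊢
  rw [this]; congr 1; ring

theorem Near.swap {α : Type*} {V : Ultrafilter α} {p q u : Plane}
    {F' : α → ℤ → ι} {p' q' u' : α → Plane} (h : T.Near V F p q u F' p' q' u') :
    T.Near V F q p u F' q' p' u' where
  fwd_p := h.fwd_q
  fwd_q := h.fwd_p
  pos := by rw [← neg_sub, cross_neg]; exact neg_ne_zero.2 h.pos
  unit := h.unit
  lim_p := h.lim_q
  lim_q := h.lim_p
  lim_u := h.lim_u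
  lim_code := h.lim_code
  width := by
    filter_upwards [h.width] with j hj
    rw [← neg_sub, cross_neg, ← neg_sub q p, cross_neg, neg_sq, neg_sq, hj]

theorem Near.rev {α : Type*} {V : Ultrafilter α} {p q u : Plane}
    {F' : α → ℤ → ι} {p' q' u' : α → Plane} (h : T.Near V F p q u F' p' q' u')
    (tp : T.Two F (p, u)) (tq : T.Two F (q, u)) :
    T.Near V (Billiard.rev F) p q (-u) (fun j => Billiard.rev (F' j)) p' q' (fun j => -u' j) where
  fwd_p := tp.rev 0
  fwd_q := tq.rev 0
  pos := by rw [cross_neg_left]; exact neg_ne_zero.2 h.pos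
  unit := by simpa using h.unit
  lim_p := h.lim_p
  lim_q := h.lim_q
  lim_u := h.lim_u.neg
  lim_code := fun i => h.lim_code (1 - i)
  width := by simpa [cross_neg_left] using h.width

/-- Nearby strips that are not parallel rise on one of the two sides, in one of the two
directions. -/
theorem Near.up_cases {α : Type*} {V : Ultrafilter α} {p q u : Plane}
    {F' : α → ℤ → ι} {p' q' u' : α → Plane} (h : T.Near V F p q u F' p' q' u')
    (hne : ∀ᶠ j in (V : Filter α), cross (u' j) u ≠ 0) :
    (Up V p q u p' q' u' ∨ Up V q p u q' p' u') ∨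
      (Up V p q (-u) p' q' (fun j => -u' j) ∨ Up V q p (-u) q' p' (fun j => -u' j)) := by
  have hc : cross u (p - q) = -cross u (q - p) := by
    rw [← neg_sub, cross_neg]
  have hw := h.width
  have hk : ∀ᶠ j in (V : Filter α), 0 < -(cross u (q - p) * cross (u' j) u) ∨
      0 < cross u (q - p) * cross (u' j) u := by
    filter_upwards [hne] with j hj
    rcases lt_or_gt_of_ne (mul_ne_zero h.pos hj) with h1 | h1
    exacts [Or.inl (by linarith), Or.inr h1]
  have he : ∀ᶠ j in (V : Filter α), 0 ≤ eta p q u p - eta (p' j) (q' j) (u' j) p ∨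
      eta p q u p - eta (p' j) (q' j) (u' j) p ≤ 0 := Eventually.of_forall fun j => le_total _ _
  have hes : ∀ᶠ j in (V : Filter α), eta q p u p - eta (q' j) (p' j) (u' j) p =
      -(eta p q u p - eta (p' j) (q' j) (u' j) p) := by
    filter_upwards [hw] with j hj
    rw [eta_swap, eta_swap (p' j), hj]; ring
  -- Exchanging the two sides of the strips negates both the slope and the displacement, and
  -- reversing the direction negates only the slope. So one of the four combinations makes both have
  -- the right sign.
  rcases Ultrafilter.eventually_or.1 hk with hk | hk <;>
    rcases Ultrafilter.eventually_or.1 he with he | he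
  · exact Or.inl (Or.inl ⟨p, by filter_upwards [hk, he] with j h1 h2 using ⟨h1, h2⟩⟩)
  · refine Or.inr (Or.inr ⟨p, ?_⟩)
    filter_upwards [hk, he, hes] with j h1 h2 h3
    rw [cross_neg_left, cross_neg_left, cross_neg, hc, eta_neg, eta_neg, h3]
    constructor <;> linarith
  · refine Or.inr (Or.inl ⟨p, ?_⟩)
    filter_upwards [hk, he] with j h1 h2
    rw [cross_neg_left, cross_neg_left, cross_neg, eta_neg, eta_neg]
    constructor <;> linarith
  · refine Or.inl (Or.inr ⟨p, ?_⟩)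
    filter_upwards [hk, he, hes] with j h1 h2 h3
    rw [hc, h3]
    constructor <;> linarith

/-- Two-sided strips of the same width that converge to a two-sided strip without being
parallel to it produce a wider strip. -/
theorem exists_wider [Finite ι] {α : Type*} {V : Ultrafilter α} {p q u : Plane}
    {F' : α → ℤ → ι} {p' q' u' : α → Plane} (h : T.Near V F p q u F' p' q' u')
    (tp : T.Two F (p, u)) (tq : T.Two F (q, u))
    (hp : ∀ᶠ j in (V : Filter α), T.Two (F' j) (p' j, u' j))
    (hq : ∀ᶠ j in (V : Filter α), T.Two (F' j) (q' j, u' j))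
    (hne : ∀ᶠ j in (V : Filter α), cross (u' j) u ≠ 0) :
    ∃ (K : ℤ → ι) (p₀ q₀ u₀ : Plane), T.Two K (p₀, u₀) ∧ T.Two K (q₀, u₀) ∧
      9 / 4 * cross u (q - p) ^ 2 ≤ cross u₀ (q₀ - p₀) ^ 2 ∧ K ∈ OrbCl F := by
  have hrev : ∀ {p q : Plane} {p' q' : α → Plane}, T.Near V F p q u F' p' q' u' →
      T.Two F (p, u) → T.Two F (q, u) → (∀ᶠ j in (V : Filter α), T.Two (F' j) (p' j, u' j)) →
      (∀ᶠ j in (V : Filter α), T.Two (F' j) (q' j, u' j)) →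
      Up V p q (-u) p' q' (fun j => -u' j) →
      ∃ (K : ℤ → ι) (p₀ q₀ u₀ : Plane), T.Two K (p₀, u₀) ∧ T.Two K (q₀, u₀) ∧
      9 / 4 * cross u (q - p) ^ 2 ≤ cross u₀ (q₀ - p₀) ^ 2 ∧ K ∈ OrbCl F := by
    intro p q p' q' h tp tq hp hq hup
    obtain ⟨K, p₀, q₀, u₀, h1, h2, h3, h4⟩ := (h.rev tp tq).exists_wider
      (hp.mono fun j hj => hj.rev 0) (hq.mono fun j hj => hj.rev 0) hup
    refine ⟨Billiard.rev K, p₀, q₀, -u₀, h1.rev, h2.rev, ?_, OrbCl.rev h4⟩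
    simpa [cross_neg_left] using h3
  have hsq : cross u (p - q) ^ 2 = cross u (q - p) ^ 2 := by
    rw [← neg_sub, cross_neg, neg_sq]
  rcases h.up_cases hne with (hup | hup) | (hup | hup)
  · exact h.exists_wider (hp.mono fun j hj => hj 0) (hq.mono fun j hj => hj 0) hup
  · rw [← hsq]
    exact h.swap.exists_wider (hq.mono fun j hj => hj 0) (hp.mono fun j hj => hj 0) hup
  · exact hrev h tp tq hp hq hup
  · rw [← hsq]
    exact hrev h.swap tq tp hq hp hup

end Billiard

/-! ### Periodic sequences and their translations -/

namespace Billiard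

variable {ι : Type*} {T : Billiard ι} {F F' : ℤ → ι}

theorem fwd_congr {m : ℤ} (hm : 0 ≤ m) {x : Plane × Plane} (h : ∀ i, 0 ≤ i → F i = F' i) :
    T.Fwd F m x ↔ T.Fwd F' m x := by
  refine and_congr Iff.rfl (forall_congr' fun n => ?_)
  rw [R_congr fun i hi _ => h i (by simpa [hm] using hi)]

/-- A linear isometry of the plane that fixes a unit vector is the identity or a reflection, hence
an involution. -/
theorem linear_eq_self_of_fix {g : Plane ≃ᵃⁱ[ℝ] Plane} {u : Plane} (hu : ‖u‖ = 1)
    (h : g.linearIsometryEquiv u = u) (y : Plane) :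
    g.linearIsometryEquiv (g.linearIsometryEquiv y) = y := by
  obtain ⟨s, hs, hcr⟩ := exists_sign g
  have hs2 : s * s = 1 := by rcases hs with rfl | rfl <;> norm_num
  have h1 : ∀ y, cross u (g.linearIsometryEquiv y) = s * cross u y := fun y => by
    rw [← hcr, h]
  have h2 : ∀ y, inner ℝ u (g.linearIsometryEquiv y) = inner ℝ u y := fun y => by
    conv_lhs => rw [← h]
    exact g.linearIsometryEquiv.inner_map_map _ _
  have hz : ∀ z : Plane, cross u z = 0 → inner ℝ u z = 0 → z = 0 := by
    intro z h3 h4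
    have hu2 : u 0 ^ 2 + u 1 ^ 2 = 1 := by rw [← Plane.norm_sq, hu]; norm_num
    rw [Plane.inner_eq] at h4
    simp only [cross] at h3
    refine Plane.ext' ?_ ?_
    · show z 0 = 0
      linear_combination u 0 * h4 - u 1 * h3 - z 0 * hu2
    · show z 1 = 0
      linear_combination u 1 * h4 + u 0 * h3 - z 1 * hu2
  rw [← sub_eq_zero]
  refine hz _ ?_ ?_
  · rw [cross_sub, h1, h1, ← mul_assoc, hs2, one_mul, sub_self]
  · rw [inner_sub_right, h2, h2, sub_self]

theorem eq_shift_mul {F : ℤ → ι} {P : ℤ} (h : ∀ i, 0 ≤ i → F (i + P) = F i) (hP : 0 ≤ P) (k : ℕ) :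
    ∀ i, 0 ≤ i → F (k * P + i) = F i := by
  induction k with
  | zero => simp
  | succ k ih =>
    intro i hi
    rw [← ih i hi, ← h (k * P + i) (by positivity)]
    congr 1; push_cast; ring

theorem frame_mul {F : ℤ → ι} {P : ℤ} (h : ∀ i, 0 ≤ i → F (i + P) = F i) (hP : 0 ≤ P) {c : Plane}
    (hc : ∀ y, T.frame F P y = y + c) (k : ℕ) (y : Plane) :
    T.frame F (k * P) y = y + (k : ℝ) • c := by
  induction k generalizing y with
  | zero => simp
  | succ k ih =>
    have e : ((k + 1 : ℕ) : ℤ) * P = k * P + P := by push_cast; ring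
    rw [e, frame_add, frame_congr (F := Billiard.shift (k * P) F) (F' := F) (i := P) fun j h1 h2 =>
      eq_shift_mul h hP k j (by simpa [hP] using h1)]
    show T.frame F (k * P) (T.frame F P y) = _
    rw [hc, ih]; push_cast; module

/-- The second power of the holonomy of a periodic sequence of edges is a translation in the
direction of the lines that follow it. -/
theorem Fwd.exists_translation [Finite ι] {P : ℤ} (hP : 0 < P) (h : ∀ i, 0 ≤ i → F (i + P) = F i)
    {p u : Plane} (hx : T.Fwd F 0 (p, u)) :
    ∃ r : ℝ, 0 < r ∧ ∀ y, T.frame F (2 * P) y = y + r • u := by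
  have hu : ‖u‖ = 1 := hx.1
  have hP' : ∀ i, 0 ≤ i → Billiard.shift P F i = F i := fun i hi => by
    rw [Billiard.shift, add_comm, h i hi]
  -- Refolding by one period gives another forward line of the same sequence, so by `Fwd.parallel`
  -- the holonomy fixes the direction `u`; its square has trivial linear part.
  have h1 : T.Fwd F 0 (act (T.frame F P)⁻¹ (p, u)) := by
    rw [← fwd_congr le_rfl hP', fwd_shift]
    exact hx.mono (by omega)
  have h2 : (T.frame F P)⁻¹.linearIsometryEquiv u = u := h1.parallel hx
  have h3 : (T.frame F P).linearIsometryEquiv u = u := by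
    conv_lhs => rw [← h2]
    exact linear_apply_inv _ _
  have h4 : T.frame F (2 * P) = T.frame F P * T.frame F P := by
    rw [two_mul, frame_add]
    congr 1
    exact frame_congr fun j h1 _ => hP' j (by simpa [hP.le] using h1)
  obtain ⟨c, hc⟩ : ∃ c, ∀ y, T.frame F (2 * P) y = y + c := by
    refine ⟨T.frame F (2 * P) 0, fun y => ?_⟩
    have h5 := isometry_sub (T.frame F (2 * P)) y 0
    rw [h4, linear_mul, linear_eq_self_of_fix hu h3, sub_zero, sub_eq_iff_eq_add, ← h4] at h5
    exact h5
  have hQ : ∀ i, 0 ≤ i → F (i + 2 * P) = F i := fun i hi => by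
    rw [two_mul, ← add_assoc, h _ (by omega), h i hi]
  obtain ⟨s, hs, -, hsu⟩ := hx.crossings
  obtain ⟨D, hD, hb⟩ := T.exists_bound
  have h6 : ∀ k : ℕ, ‖p + s (k * (2 * P)) • u - (k : ℝ) • c‖ ≤ D := by
    intro k
    have h7 := hs (k * (2 * P)) (by positivity)
    have h8 : (T.frame F (k * (2 * P)))⁻¹ (p + s (k * (2 * P)) • u) =
        p + s (k * (2 * P)) • u - (k : ℝ) • c := by
      have h9 := frame_mul (T := T) hQ (by omega) hc k (p + s (k * (2 * P)) • u - (k : ℝ) • c)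
      rw [sub_add_cancel] at h9
      rw [← inv_apply_self' (T.frame F (k * (2 * P))) (p + s (k * (2 * P)) • u - (k : ℝ) • c), h9]
    dsimp only at h7
    rw [h8] at h7
    exact hb _ _ h7
  -- The translated copies of the table must stay within bounded distance of the line, so the
  -- translation is along it; it is forward because the crossing times tend to `+∞`.
  have hcu : cross u c = 0 := by
    by_contra hne
    obtain ⟨k, hk⟩ := exists_nat_gt ((D + |cross u p|) / |cross u c|)
    rw [div_lt_iff₀ (abs_pos.2 hne)] at hk
    have h7 := abs_cross_le u (p + s (k * (2 * P)) • u - (k : ℝ) • c)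
    rw [hu, one_mul, cross_sub, cross_add, cross_smul, cross_smul, cross_same, mul_zero,
      add_zero] at h7
    have h8 := abs_sub_abs_le_abs_sub ((k : ℝ) * cross u c) (cross u p)
    rw [abs_sub_comm, abs_mul, Nat.abs_cast] at h8
    linarith [h6 k]
  obtain ⟨r, rfl⟩ := exists_smul_of_cross_eq_zero (by rintro rfl; simp at hu) hcu
  refine ⟨r, ?_, hc⟩
  by_contra hr
  push Not at hr
  obtain ⟨j, hj, hB⟩ := hsu (D + ‖p‖)
  have h7 := hB (j.toNat * (2 * P)) (by nlinarith [Int.toNat_of_nonneg hj])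
  have h8 := h6 j.toNat
  have h9 : s (j.toNat * (2 * P)) - j.toNat * r ≤ D + ‖p‖ := by
    have e : (s (j.toNat * (2 * P)) - j.toNat * r) • u =
        (p + s (j.toNat * (2 * P)) • u - (j.toNat : ℝ) • r • u) - p := by
      rw [smul_smul]; module
    have := norm_sub_le (p + s (j.toNat * (2 * P)) • u - (j.toNat : ℝ) • r • u) p
    rw [← e, norm_smul, hu, mul_one, Real.norm_eq_abs] at this
    linarith [le_abs_self (s (j.toNat * (2 * P)) - j.toNat * r)]
  nlinarith [mul_nonneg (Nat.cast_nonneg (α := ℝ) j.toNat) (neg_nonneg.2 hr)]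

/-- A strip does not climb above a two-sided periodic strip. -/
theorem Climb.false_of_periodic [Finite ι] {α : Type*} {V : Ultrafilter α} {p q u : Plane}
    {F' : α → ℤ → ι} {p' q' u' : α → Plane} {n : α → ℕ} (h : T.Climb V F p q u F' p' q' u' n)
    {P : ℤ} (hP : 0 < P) (hF : ∀ i, F (i + P) = F i) : False := by
  obtain ⟨r, -, hr⟩ := h.fwd_p.exists_translation hP fun i _ => hF i
  have hQ : ∀ i, F (i + 2 * P) = F i := fun i => by
    rw [two_mul, ← add_assoc, hF, hF]
  -- At multiples of twice the period the refolding is a translation along `u` and the sequence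
  -- looks like `F` again. Hence the limit strip at the times `m j` follows `F` itself and is
  -- parallel to the original strip with offset `t`.
  obtain ⟨m, t, ht, hdiv, hm, hmn, hlim, hlim'⟩ := h.exists (P := 2 * P.toNat) (by omega)
  have hm' : ∀ j, ∃ k : ℕ, (m j : ℤ) = k * (2 * P) := by
    intro j
    obtain ⟨k, hk⟩ := hdiv j
    refine ⟨k, ?_⟩
    rw [hk]; push_cast [Int.toNat_of_nonneg hP.le]; ring
  have hsh : ∀ j i, F (m j + i) = F i := by
    intro j
    have : ∀ (k : ℕ) i, F (k * (2 * P) + i) = F i := by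
      intro k
      induction k with
      | zero => simp
      | succ k ih =>
        intro i
        rw [← ih i, ← hQ (k * (2 * P) + i)]
        congr 1; push_cast; ring
    obtain ⟨k, hk⟩ := hm' j
    rw [hk]
    exact this k
  have htr : ∀ j, ∃ ρ : ℝ, ∀ y, (T.frame F (m j))⁻¹ y = y + ρ • u := by
    intro j
    obtain ⟨k, hk⟩ := hm' j
    refine ⟨-(k * r), fun y => ?_⟩
    have h1 := frame_mul (T := T) (fun i _ => hQ i) (by omega) hr k (y + (-(k * r)) • u)
    rw [← inv_apply_self' (T.frame F (m j)) (y + (-(k * r)) • u), hk, h1]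
    congr 1
    module
  have hlin : ∀ j, (T.frame F (m j))⁻¹.linearIsometryEquiv u = u := by
    intro j
    obtain ⟨ρ, hρ⟩ := htr j
    have := isometry_sub (T.frame F (m j))⁻¹ u 0
    rw [hρ, hρ, sub_zero] at this
    rw [← this]; abel
  obtain ⟨K, p₀, q₀, p₁, q₁, u₀, hK, -, -, T3, T4, he, hu, e1, e2, e3⟩ := h.exists_limit hm hmn hlim
  obtain rfl : F = K := by
    funext i
    obtain ⟨j, hj⟩ := (hK i).exists
    rw [← hj, hsh]
  obtain rfl : u = u₀ := by
    refine tendsto_nhds_unique (tendsto_const_nhds.congr fun j => ?_) hu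
    exact (hlin j).symm
  have he' : ∀ y, eta p₀ q₀ u y = eta p q u y := by
    intro y
    refine tendsto_nhds_unique (he y) (tendsto_const_nhds.congr fun j => ?_)
    obtain ⟨ρ, hρ⟩ := htr j
    rw [hlin, hρ, hρ, eta_slide]
  have he1 : ∀ y, eta p₁ q₁ u y = eta p q u y - t := by
    intro y
    rw [← he', eta_apply, eta_apply, e2, ← e3]
    simp [cross]; ring
  have hW : 0 < cross u (q - p) ^ 2 := by have := h.pos; positivity
  -- Compared with this second strip of `F`, the climbing strip has displacement about `W / 2` at
  -- time `n j`, well inside the range of `Strip.agree`. So it cannot separate from `F` then.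
  obtain ⟨j, h1, h2, h3, h4, h5⟩ := ((hlim' _ (half_pos hW)).and (h.strip.and (h.agree.and
    (h.differ.and h.width)))).exists
  refine h4 (Strip.agree (W := cross u (q - p) ^ 2) ((T3 0).strip (T4 0) _) h2 ?_ h5 (by omega)
    (by omega) h3 fun y hy => ?_)
  · rw [e2, e1]
  · obtain ⟨a, ha⟩ := verts_seg hy
    have h6 := abs_lt.1 (h1 a y ha)
    rw [he1]
    constructor <;> linarith [h6.1, h6.2]

/-- Strips that rise above a two-sided periodic strip follow the same edges. -/
theorem Near.agree_of_periodic [Finite ι] {α : Type*} {V : Ultrafilter α} {p q u : Plane}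
    {F' : α → ℤ → ι} {p' q' u' : α → Plane} (h : T.Near V F p q u F' p' q' u')
    (hup : Up V p q u p' q' u') {P : ℤ} (hP : 0 < P) (hF : ∀ i, F (i + P) = F i) {l : α → ℤ}
    (hS : ∀ᶠ j in (V : Filter α), T.Strip (F' j) 0 (l j) (p' j) (q' j) (u' j)) :
    ∀ᶠ j in (V : Filter α), ∀ i, 0 ≤ i → i ≤ l j → F i = F' j i := by
  by_contra hcon
  rw [← Ultrafilter.eventually_not] at hcon
  push Not at hcon
  have hex : ∀ᶠ j in (V : Filter α), ∃ n : ℕ, (∀ i : ℤ, 0 ≤ i → i ≤ n → F i = F' j i) ∧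
      F (n + 1) ≠ F' j (n + 1) ∧ (n : ℤ) + 1 ≤ l j := by
    filter_upwards [h.lim_code 0, hcon] with j h0 ⟨i, hi, hil, hne⟩
    obtain ⟨n, h1, h2⟩ := exists_first_differ h0.symm ⟨i, hi, hne⟩
    refine ⟨n, h1, h2, ?_⟩
    by_contra hlt
    exact hne (h1 i hi (by omega))
  obtain ⟨n, hn⟩ := hex.choice
  exact Climb.false_of_periodic (n := n)
    { toNear := h
      strip := by filter_upwards [hS, hn] with j h1 h2 using h1.mono le_rfl h2.2.2
      agree := hn.mono fun j hj => hj.1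
      differ := hn.mono fun j hj => hj.2.1
      up := hup } hP hF

end Billiard

/-! ### Uniqueness of forward lines -/

namespace Billiard

variable {ι : Type*} {T : Billiard ι} {F F' : ℤ → ι}

/-- The late images of a forward strip have a limit, which is two-sided. -/
theorem Fwd.exists_near [Finite ι] {α : Type*} {V : Ultrafilter α} {p q u : Plane}
    (hp : T.Fwd F 0 (p, u)) (hq : T.Fwd F 0 (q, u)) (hpq : cross u (q - p) ≠ 0) {t : α → ℕ}
    (ht : Tendsto t V atTop) :
    ∃ (K : ℤ → ι) (p₀ q₀ u₀ : Plane) (p' q' : α → Plane),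
      T.Two K (p₀, u₀) ∧ T.Two K (q₀, u₀) ∧ cross u₀ (q₀ - p₀) ^ 2 = cross u (q - p) ^ 2 ∧
      T.Near V K p₀ q₀ u₀ (fun j => Billiard.shift (t j) F) p' q'
        (fun j => (T.frame F (t j))⁻¹.linearIsometryEquiv u) ∧
      ∀ m j, (T.Fwd F m (p, u) → T.Fwd F m (q, u) →
        T.Fwd (Billiard.shift (t j) F) (m - t j)
          (p' j, (T.frame F (t j))⁻¹.linearIsometryEquiv u) ∧
        T.Fwd (Billiard.shift (t j) F) (m - t j)
          (q' j, (T.frame F (t j))⁻¹.linearIsometryEquiv u)) := by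
  have hu1 : ‖u‖ = 1 := hp.1
  let H : α → Plane ≃ᵃⁱ[ℝ] Plane := fun j => (T.frame F (t j))⁻¹
  have hS : ∀ N : ℕ, ∀ᶠ j in (V : Filter α), T.Strip (Billiard.shift (t j) F) (-N) N
      (H j p) (H j q) ((H j).linearIsometryEquiv u) := fun N => by
    filter_upwards [ht.eventually_ge_atTop N] with j hj
    exact Strip.shift ((hp.strip hq _).mono (by omega) le_rfl)
  obtain ⟨K, p₀, q₀, u₀, σ, τ, hK, hp₀, hq₀, hu₀, T1, T2⟩ := exists_limit_strip (T := T) V _ _ _ _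
    (Eventually.of_forall fun j => by rw [norm_linear, hu1]) hS
  have hw : ∀ j, cross ((H j).linearIsometryEquiv u) (H j q + τ j • (H j).linearIsometryEquiv u -
      (H j p + σ j • (H j).linearIsometryEquiv u)) ^ 2 = cross u (q - p) ^ 2 := by
    intro j
    obtain ⟨s, hs, hcr⟩ := exists_sign (H j)
    rw [cross_slide, isometry_sub, hcr]
    rcases hs with rfl | rfl <;> ring
  have e1 : cross u₀ (q₀ - p₀) ^ 2 = cross u (q - p) ^ 2 :=
    tendsto_nhds_unique ((hu₀.cross (hq₀.sub hp₀)).pow 2)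
      (tendsto_const_nhds.congr fun j => (hw j).symm)
  refine ⟨K, p₀, q₀, u₀, fun j => H j p + σ j • (H j).linearIsometryEquiv u,
    fun j => H j q + τ j • (H j).linearIsometryEquiv u, T1, T2, e1, ?_, fun m j h1 h2 => ⟨fwd_slide.2 ?_, fwd_slide.2 ?_⟩⟩
  · exact
      { fwd_p := T1 0
        fwd_q := T2 0
        pos := by
          intro h0
          rw [h0] at e1
          exact hpq (by simpa using e1.symm)
        unit := Eventually.of_forall fun j => by rw [norm_linear, hu1]
        lim_p := hp₀
        lim_q := hq₀
        lim_u := hu₀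
        lim_code := hK
        width := Eventually.of_forall fun j => (hw j).trans e1.symm }
  · exact (fwd_shift (x := (p, u))).2 (by rwa [add_sub_cancel])
  · exact (fwd_shift (x := (q, u))).2 (by rwa [add_sub_cancel])

/-- Either the sequence of a forward strip is eventually periodic, or its late images are not
parallel to their limit. -/
theorem Fwd.evPer_or [Finite ι] {α : Type*} {V : Ultrafilter α} {p q u u₀ : Plane}
    (hp : T.Fwd F 0 (p, u)) (hq : T.Fwd F 0 (q, u)) (hpq : cross u (q - p) ≠ 0) {t : α → ℕ}
    (ht : Tendsto t V atTop)
    (hu : Tendsto (fun j => (T.frame F (t j))⁻¹.linearIsometryEquiv u) V (𝓝 u₀)) :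
    EvPer F ∨ ∀ᶠ j in (V : Filter α), cross ((T.frame F (t j))⁻¹.linearIsometryEquiv u) u₀ ≠ 0 := by
  by_cases h : ∀ᶠ j in (V : Filter α), cross ((T.frame F (t j))⁻¹.linearIsometryEquiv u) u₀ ≠ 0
  · exact Or.inr h
  left
  rw [← Ultrafilter.eventually_not] at h
  have hu1 : ∀ j, ‖(T.frame F (t j))⁻¹.linearIsometryEquiv u‖ = 1 := fun j => by
    rw [norm_linear]; exact hp.1
  have hu0 : ‖u₀‖ = 1 := tendsto_nhds_unique hu.norm (tendsto_const_nhds.congr fun j => (hu1 j).symm)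
  -- Directions parallel to their limit `u₀` and close to it are equal to it, so the strip returns
  -- with exactly the same direction.
  refine evPer_of_parallel hp hq hpq (V := V.map t) (v := u₀) ht (Filter.mem_map.2 ?_)
  filter_upwards [h, hu.eventually (Metric.ball_mem_nhds u₀ one_pos)] with j h1 h2
  rcases exists_smul_of_cross (hu1 j) hu0 (not_not.1 h1) with h3 | h3
  · exact h3.symm
  · rw [h3, dist_eq_norm, sub_neg_eq_add, ← two_smul ℝ, norm_smul, hu1] at h2
    norm_num at h2

/-- The sequences whose finite segments all occur arbitrarily late in `F`. -/
def Omega (F : ℤ → ι) : Set (ℤ → ι) :=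
  {G | ∀ N : ℕ, ∃ᶠ j : ℕ in atTop, ∀ i : ℤ, |i| ≤ N → F (j + i) = G i}

theorem Omega.of_orbCl {G K : ℤ → ι} (hG : G ∈ Omega F) (hK : K ∈ OrbCl G) : K ∈ Omega F := by
  intro N
  obtain ⟨k, hk⟩ := hK N
  rw [frequently_atTop]
  intro a
  obtain ⟨j, hj, h⟩ := (frequently_atTop.1 (hG (N + k.natAbs))) (a + k.natAbs)
  refine ⟨((j : ℤ) + k).toNat, by omega, fun i hi => ?_⟩
  rw [Int.toNat_of_nonneg (by omega), hk i hi, ← h (k + i), add_assoc]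
  rw [abs_le] at hi ⊢
  omega

theorem Omega.exists_times {G : ℤ → ι} (hG : G ∈ Omega F) : ∃ t : ℕ → ℕ, Tendsto t atTop atTop ∧
    ∀ i, ∀ᶠ j in atTop, F (t j + i) = G i := by
  choose t h1 h2 using fun N : ℕ => (frequently_atTop.1 (hG N)) N
  refine ⟨t, tendsto_atTop_mono h1 tendsto_id, fun i => ?_⟩
  filter_upwards [eventually_ge_atTop i.natAbs] with j hj
  refine h2 j i ?_
  rw [abs_le]; omega

theorem mem_omega_of_tendsto {V : Ultrafilter ℕ} {t : ℕ → ℕ} (ht : Tendsto t V atTop) {K : ℤ → ι}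
    (hK : ∀ i, ∀ᶠ j in (V : Filter ℕ), F (t j + i) = K i) : K ∈ Omega F := by
  intro N
  rw [frequently_atTop]
  intro a
  have h1 : ∀ᶠ j in (V : Filter ℕ), ∀ i ∈ Set.Icc (-(N : ℤ)) N, F (t j + i) = K i :=
    (eventually_all_finite (Set.finite_Icc _ _)).2 fun i _ => hK i
  obtain ⟨j, hj, hja⟩ := (h1.and (ht.eventually_ge_atTop a)).exists
  exact ⟨t j, hja, fun i hi => hj i (abs_le.1 hi)⟩

theorem mem_orbCl_of_tendsto {V : Ultrafilter ℕ} {t : ℕ → ℕ} {K : ℤ → ι}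
    (hK : ∀ i, ∀ᶠ j in (V : Filter ℕ), F (t j + i) = K i) : K ∈ OrbCl F := by
  intro N
  have h1 : ∀ᶠ j in (V : Filter ℕ), ∀ i ∈ Set.Icc (-(N : ℤ)) N, F (t j + i) = K i :=
    (eventually_all_finite (Set.finite_Icc _ _)).2 fun i _ => hK i
  obtain ⟨j, hj⟩ := h1.exists
  exact ⟨t j, fun i hi => (hj i (abs_le.1 hi)).symm⟩

/-- If the sequence of a forward strip comes close to a periodic sequence, it is eventually
periodic. -/
theorem Fwd.evPer_of_periodic [Finite ι] {p q u : Plane} (hp : T.Fwd F 0 (p, u))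
    (hq : T.Fwd F 0 (q, u)) (hpq : cross u (q - p) ≠ 0) {G : ℤ → ι} (hG : G ∈ Omega F) {P : ℤ}
    (hP : 0 < P) (hper : ∀ i, G (i + P) = G i) : EvPer F := by
  obtain ⟨t, ht, hcode⟩ := Omega.exists_times hG
  set V : Ultrafilter ℕ := hyperfilter ℕ
  have hV : (V : Filter ℕ) ≤ atTop := Nat.hyperfilter_le_atTop
  replace ht := ht.mono_left hV
  obtain ⟨K, p₀, q₀, u₀, p', q', T1, T2, -, near, hfwd⟩ := hp.exists_near hq hpq ht
  obtain rfl : K = G := by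
    funext i
    obtain ⟨j, h1, h2⟩ := ((near.lim_code i).and (hV (hcode i))).exists
    exact h1.symm.trans h2
  refine (hp.evPer_or hq hpq ht near.lim_u).elim id fun hne => ?_
  -- If the late strips rise in the forward direction, they follow the periodic sequence forever
  -- from some time on.
  have key : ∀ {p₀ q₀ : Plane} {p' q' : ℕ → Plane},
      T.Near V K p₀ q₀ u₀ (fun j => Billiard.shift (t j) F) p' q'
        (fun j => (T.frame F (t j))⁻¹.linearIsometryEquiv u) →
      (∀ j, T.Fwd (Billiard.shift (t j) F) (0 - t j)
          (p' j, (T.frame F (t j))⁻¹.linearIsometryEquiv u)) →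
      (∀ j, T.Fwd (Billiard.shift (t j) F) (0 - t j)
          (q' j, (T.frame F (t j))⁻¹.linearIsometryEquiv u)) →
      Up V p₀ q₀ u₀ p' q' (fun j => (T.frame F (t j))⁻¹.linearIsometryEquiv u) → EvPer F := by
    intro p₀ q₀ p' q' near h1 h2 hup
    by_cases hall : ∀ᶠ j in (V : Filter ℕ), ∀ i : ℤ, 0 ≤ i → K i = Billiard.shift (t j) F i
    · obtain ⟨j, hj⟩ := hall.exists
      refine ⟨P, hP, t j, by omega, fun i hi => ?_⟩
      have e1 := hj (i - t j) (by omega)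
      have e2 := hj (i - t j + P) (by omega)
      rw [hper] at e2
      rw [e1, Billiard.shift, Billiard.shift, add_sub_cancel] at e2
      rw [e2]; congr 1; ring
    · rw [← Ultrafilter.eventually_not] at hall
      push Not at hall
      obtain ⟨l, hl⟩ := hall.choice
      have := near.agree_of_periodic hup hP hper (l := l)
        (Eventually.of_forall fun j => ((h1 j).mono (by omega)).strip ((h2 j).mono (by omega)) _)
      obtain ⟨j, h3, h4⟩ := (this.and hl).exists
      exact absurd (h3 _ h4.1 le_rfl) h4.2
  have key' : ∀ {p₀ q₀ : Plane} {p' q' : ℕ → Plane}, T.Two K (p₀, u₀) → T.Two K (q₀, u₀) →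
      T.Near V K p₀ q₀ u₀ (fun j => Billiard.shift (t j) F) p' q'
        (fun j => (T.frame F (t j))⁻¹.linearIsometryEquiv u) →
      (∀ j, T.Fwd (Billiard.shift (t j) F) (0 - t j)
          (p' j, (T.frame F (t j))⁻¹.linearIsometryEquiv u)) →
      (∀ j, T.Fwd (Billiard.shift (t j) F) (0 - t j)
          (q' j, (T.frame F (t j))⁻¹.linearIsometryEquiv u)) →
      Up V p₀ q₀ (-u₀) p' q' (fun j => -(T.frame F (t j))⁻¹.linearIsometryEquiv u) → EvPer F := by
    intro p₀ q₀ p' q' T1 T2 near h1 h2 hup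
    have hper' : ∀ i, Billiard.rev K (i + P) = Billiard.rev K i := fun i => by
      rw [Billiard.rev, Billiard.rev, ← hper]; congr 1; ring
    -- If they rise in the backward direction, they follow the periodic sequence back to the start:
    -- index `t j + 1` of the reversed shifted sequence is `F 0`. As `t j` tends to infinity, `F` is
    -- periodic from time 0 on.
    have hag := (near.rev T1 T2).agree_of_periodic hup hP hper' (l := fun j => t j + 1)
      (Eventually.of_forall fun j => ⟨mem_closure_R_rev.2 ?_, mem_closure_R_rev.2 ?_⟩)
    · refine ⟨P, hP, 0, le_rfl, fun i hi => ?_⟩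
      obtain ⟨j, h3, h4⟩ := (hag.and (ht.eventually_ge_atTop (i + P).toNat)).exists
      have h5 : i + P ≤ t j := by omega
      have e1 := h3 (1 - (i + P - t j)) (by omega) (by omega)
      have e2 := h3 (1 - (i - t j)) (by omega) (by omega)
      simp only [Billiard.rev, Billiard.shift, sub_sub_cancel, add_sub_cancel] at e1 e2
      rw [← e1, ← e2, ← hper (i - t j)]; congr 1; ring
    · exact closure_mono (R_mono (by omega) le_rfl) ((h1 j).2 _)
    · exact closure_mono (R_mono (by omega) le_rfl) ((h2 j).2 _)
  have f1 := fun j => (hfwd 0 j hp hq).1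
  have f2 := fun j => (hfwd 0 j hp hq).2
  rcases near.up_cases hne with (hup | hup) | (hup | hup)
  · exact key near f1 f2 hup
  · exact key near.swap f2 f1 hup
  · exact key' T1 T2 near f1 f2 hup
  · exact key' T2 T1 near.swap f2 f1 hup

/-- The period is repeated in both directions; every finite window of the result occurs far enough
to the right in `F`. -/
theorem EvPer.exists_periodic (h : EvPer F) : ∃ P : ℤ, 0 < P ∧ ∃ I : ℤ, 0 ≤ I ∧ ∃ G ∈ OrbCl F,
    (∀ i, G (i + P) = G i) ∧ ∀ i, 0 ≤ i → F (I + i) = G i := by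
  obtain ⟨P, hP, I, hI, h⟩ := h
  have h' : ∀ i, 0 ≤ i → Billiard.shift I F (i + P) = Billiard.shift I F i := fun i hi => by
    rw [Billiard.shift, Billiard.shift, ← add_assoc, h _ (by omega)]
  have hG : ∀ (M : ℕ) i, 0 ≤ M * P + i → F (I + i % P) = F (I + (M * P + i)) := by
    intro M i hi
    have h1 := eq_shift_mul h' hP.le ((M * P + i) / P).toNat (i % P) (Int.emod_nonneg _ hP.ne')
    rw [Int.toNat_of_nonneg (Int.ediv_nonneg hi hP.le)] at h1
    rw [Billiard.shift, Billiard.shift] at h1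
    rw [← h1]; congr 2
    have h2 := Int.mul_ediv_add_emod (M * P + i) P
    rw [Int.add_emod, Int.mul_emod_left, zero_add, Int.emod_emod_of_dvd _ dvd_rfl] at h2
    linarith
  refine ⟨P, hP, I, hI, fun i => F (I + i % P), fun N => ?_, fun i => ?_, fun i hi => ?_⟩
  · refine ⟨I + N * P, fun i hi => ?_⟩
    rw [abs_le] at hi
    show F (I + i % P) = _
    rw [hG N i (by nlinarith), add_assoc]
  · simp
  · show _ = F (I + i % P)
    rw [hG 0 i (by simpa using hi)]; simp

/-- Both lines meet the closed edge `F 0`, so the distance between them is bounded by the size of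
the table. -/
theorem width_bound [Finite ι] (T : Billiard ι) : ∃ D : ℝ, ∀ (F : ℤ → ι) (p q u : Plane),
    T.Two F (p, u) → T.Two F (q, u) → cross u (q - p) ^ 2 ≤ D := by
  obtain ⟨D, hD, hb⟩ := T.exists_bound
  refine ⟨(2 * D) ^ 2, fun F p q u hp hq => ?_⟩
  have key : ∀ p, T.Two F (p, u) → ∃ y, ‖y‖ ≤ D ∧ cross u (y - p) = 0 := by
    intro p hp
    have h3 : (p, u) ∈ closure (T.C (F 0) (F 1)) :=
      closure_mono (fun y (hy : y ∈ T.R F 0 1) => by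
        simpa [act_one] using hy 0 le_rfl one_pos) ((hp 0).2 1)
    obtain ⟨y, hy, hy0⟩ := exists_mem_seg h3 (Or.inl rfl)
    exact ⟨y, hb _ _ hy, hy0⟩
  obtain ⟨y, hy, hyp⟩ := key p hp
  obtain ⟨z, hz, hzq⟩ := key q hq
  have h1 : cross u (q - p) = -cross u (y - z) := by
    rw [cross_sub] at hyp hzq ⊢
    rw [cross_sub]; linarith
  rw [h1, neg_sq, ← sq_abs]
  have h2 := abs_cross_le u (y - z)
  rw [(hp 0).1, one_mul] at h2
  have := norm_sub_le y z
  gcongr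
  linarith

/-- **Uniqueness**: a sequence of edges followed by two different forward lines is eventually
periodic. -/
theorem Fwd.evPer [Finite ι] {p q u : Plane} (hp : T.Fwd F 0 (p, u)) (hq : T.Fwd F 0 (q, u))
    (hpq : cross u (q - p) ≠ 0) : EvPer F := by
  obtain ⟨D, hD⟩ := T.width_bound
  let 𝒲 : Set ℝ := {W | ∃ G ∈ Omega F, ∃ p q u : Plane, T.Two G (p, u) ∧ T.Two G (q, u) ∧
    W = cross u (q - p) ^ 2}
  have hbdd : BddAbove 𝒲 := by
    refine ⟨D, ?_⟩
    rintro W ⟨G, -, p, q, u, h1, h2, rfl⟩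
    exact hD _ _ _ _ h1 h2
  set V : Ultrafilter ℕ := hyperfilter ℕ
  have hV : Tendsto (fun j : ℕ => j) V atTop := Nat.hyperfilter_le_atTop
  have hpos : ∃ W ∈ 𝒲, 0 < W := by
    obtain ⟨K, p₀, q₀, u₀, p', q', T1, T2, e, near, -⟩ := hp.exists_near hq hpq hV
    refine ⟨_, ⟨K, mem_omega_of_tendsto hV near.lim_code, p₀, q₀, u₀, T1, T2, rfl⟩, ?_⟩
    have := near.pos; positivity
  obtain ⟨W₀, hW₀, hW₀'⟩ := hpos
  have hsup : 0 < sSup 𝒲 := hW₀'.trans_le (le_csSup hbdd hW₀)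
  -- A tilted return multiplies the squared width by at least `9 / 4`; above `4 / 9` of the supremum
  -- this is impossible.
  obtain ⟨W, ⟨G, hG, p₁, q₁, u₁, T1, T2, rfl⟩, hW⟩ :=
    exists_lt_of_lt_csSup (b := 4 / 9 * sSup 𝒲) ⟨W₀, hW₀⟩ (by linarith)
  have hpq1 : cross u₁ (q₁ - p₁) ≠ 0 := by
    intro h; rw [h] at hW; norm_num at hW; linarith
  have hGper : EvPer G := by
    obtain ⟨K, p₀, q₀, u₀, p', q', T3, T4, e, near, hf⟩ := (T1 0).exists_near (T2 0) hpq1 hV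
    refine ((T1 0).evPer_or (T2 0) hpq1 hV near.lim_u).elim id fun hne => ?_
    have t1 : ∀ j, T.Two (Billiard.shift (j : ℕ) G)
        (p' j, (T.frame G (j : ℕ))⁻¹.linearIsometryEquiv u₁) := fun j m => by
      have := (hf (m + j) j (T1 _) (T2 _)).1
      rwa [add_sub_cancel_right] at this
    have t2 : ∀ j, T.Two (Billiard.shift (j : ℕ) G)
        (q' j, (T.frame G (j : ℕ))⁻¹.linearIsometryEquiv u₁) := fun j m => by
      have := (hf (m + j) j (T1 _) (T2 _)).2
      rwa [add_sub_cancel_right] at this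
    obtain ⟨L, p₂, q₂, u₂, h1, h2, h3, h4⟩ := exists_wider near T3 T4 (Eventually.of_forall t1)
      (Eventually.of_forall t2) hne
    have hK : K ∈ Omega F := Omega.of_orbCl hG (mem_orbCl_of_tendsto near.lim_code)
    have := le_csSup hbdd ⟨L, Omega.of_orbCl hK h4, p₂, q₂, u₂, h1, h2, rfl⟩
    rw [e] at h3
    linarith
  -- The nearly widest strip has an eventually periodic sequence, so `F` accumulates at a periodic
  -- one.
  obtain ⟨P, hP, I, -, G', hG', hper, -⟩ := hGper.exists_periodic
  exact hp.evPer_of_periodic hq hpq (Omega.of_orbCl hG hG') hP hper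

end Billiard

/-! ### From forward orbits to two-sided orbits -/

namespace Billiard

variable {ι : Type*} {T : Billiard ι} {F F' : ℤ → ι}

/-- An oriented line follows `F` in both directions. -/
def Orb (T : Billiard ι) (F : ℤ → ι) : Prop := ∃ x : Plane × Plane, ‖x.2‖ = 1 ∧ ∀ m n, x ∈ T.R F m n

/-- An oriented line follows `F` from the edge number `0` on. -/
def FOrb (T : Billiard ι) (F : ℤ → ι) : Prop := ∃ x : Plane × Plane, ‖x.2‖ = 1 ∧ ∀ n, x ∈ T.R F 0 n

theorem mem_R_slide' {m n : ℤ} {p u : Plane} {s : ℝ} :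
    (p + s • u, u) ∈ T.R F m n ↔ (p, u) ∈ T.R F m n := by
  have := mem_R_slide (T := T) (F := F) (m := m) (n := n) (p := p) (u := u) (s := s) one_pos
  rwa [one_smul] at this

/-- A line that follows a periodic sequence forward follows it in both directions. -/
theorem mem_R_of_periodic [Finite ι] {Q : ℤ} (hQ : 0 < Q) (h : ∀ i, F (i + Q) = F i)
    {x : Plane × Plane} (hu : ‖x.2‖ = 1) (hx : ∀ n, x ∈ T.R F 0 n) (m n : ℤ) : x ∈ T.R F m n := by
  obtain ⟨p, u⟩ := x
  obtain ⟨r, -, hr⟩ := (fwd_of_mem hu hx).exists_translation hQ fun i _ => h i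
  have h2 : ∀ i, F (i + 2 * Q) = F i := fun i => by rw [two_mul, ← add_assoc, h, h]
  have hsh : ∀ (k : ℕ) i, F (k * (2 * Q) + i) = F i := by
    intro k
    induction k with
    | zero => simp
    | succ k ih =>
      intro i
      rw [← ih i, ← h2 (k * (2 * Q) + i)]
      congr 1; push_cast; ring
  have hk := frame_mul (T := T) (fun i _ => h2 i) (by omega) hr m.natAbs
  set N : ℤ := m.natAbs * (2 * Q) with hN
  have hmN : 0 ≤ N + m := by
    have : (m.natAbs : ℤ) ≤ N := by rw [hN]; nlinarith [Int.natCast_nonneg m.natAbs]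
    omega
  have hinv : ∀ y, (T.frame F N)⁻¹ y = y + (-(m.natAbs * r)) • u := by
    intro y
    rw [← inv_apply_self' (T.frame F N) (y + (-(m.natAbs * r)) • u), hk]
    congr 1; module
  have hlin : (T.frame F N)⁻¹.linearIsometryEquiv u = u := by
    have := isometry_sub (T.frame F N)⁻¹ u 0
    rw [hinv, hinv, sub_zero] at this
    rw [← this]; abel
  have h3 : act (T.frame F N)⁻¹ (p, u) ∈ T.R (Billiard.shift N F) m n :=
    mem_R_shift.2 (R_mono hmN le_rfl (hx (N + n)))
  have h4 : Billiard.shift N F = F := funext fun i => hsh _ i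
  rw [h4] at h3
  simp only [act] at h3
  rw [hlin, hinv] at h3
  exact mem_R_slide'.1 h3

/-- An eventually periodic sequence determines a periodic sequence, of which every line following
the given sequence shows a part. -/
theorem EvPer.exists_periodic_of_mem [Finite ι] (h : EvPer F) :
    ∃ (G : ℤ → ι) (Q : ℤ), 0 < Q ∧ (∀ i, G (i + Q) = G i) ∧ ∀ (T : Billiard ι) (x : Plane × Plane)
      (m : ℤ), m ≤ 0 → ‖x.2‖ = 1 → (∀ n, x ∈ T.R F m n) → ∀ i, m ≤ i → F i = G i := by
  obtain ⟨P, hP, I, hI, G, -, hper, hG⟩ := h.exists_periodic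
  refine ⟨Billiard.shift (-I) G, P, hP, fun i => ?_, fun T x m hm hu hx i hi => ?_⟩
  · rw [Billiard.shift, Billiard.shift, ← add_assoc, hper]
  have h1 : ∀ n, act (T.frame F I)⁻¹ x ∈ T.R (Billiard.shift I F) (m - I) n := fun n =>
    mem_R_shift.2 (R_mono (by omega) le_rfl (hx (I + n)))
  have hIG : ∀ i, 0 ≤ i → Billiard.shift I F i = G i := hG
  have h2 : ∀ n, act (T.frame F I)⁻¹ x ∈ T.R G 0 n := fun n => by
    rw [← R_congr fun i hi _ => hIG i (by simpa using hi)]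
    exact R_mono (by omega) le_rfl (h1 n)
  have h3 := mem_R_of_periodic hP hper (by simpa [act] using hu) h2 (m - I) 0
  rcases le_total I i with hiI | hiI
  · have := hG (i - I) (by omega)
    rw [add_sub_cancel] at this
    rw [this, Billiard.shift]; congr 1; ring
  -- The refolded line follows the periodic sequence `G` also backward, and it follows `F`;
  -- determinism backward in time identifies the two before time `I`.
  · have := R_determ' (h1 0) h3 (hIG 0 le_rfl) (i - I) (by omega) (by omega)
    rw [Billiard.shift, add_sub_cancel] at this
    rw [this, Billiard.shift]; congr 1; ring

theorem eq_add_smul_of_cross {p q u : Plane} (hu : u ≠ 0) (h : cross u (q - p) = 0) :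
    ∃ r : ℝ, q = p + r • u := by
  obtain ⟨r, hr⟩ := exists_smul_of_cross_eq_zero hu h
  exact ⟨r, by rw [← hr]; abel⟩

/-- Two forward lines of a sequence that is not eventually periodic agree. -/
theorem Fwd.eq_slide [Finite ι] {m : ℤ} {x y : Plane × Plane} (hx : T.Fwd F m x)
    (hy : T.Fwd F m y) (h : ∀ k, ¬ EvPer (Billiard.shift k F)) :
    ∃ r : ℝ, y = (x.1 + r • x.2, x.2) := by
  obtain ⟨p, u⟩ := x
  obtain ⟨q, v⟩ := y
  obtain rfl : u = v := hx.parallel hy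
  by_cases hc : cross u (q - p) = 0
  · obtain ⟨r, hr⟩ := eq_add_smul_of_cross hx.ne_zero hc
    exact ⟨r, by rw [hr]⟩
  · have h1 : T.Fwd (Billiard.shift m F) 0 (act (T.frame F m)⁻¹ (p, u)) := by
      rw [fwd_shift, add_zero]; exact hx
    have h2 : T.Fwd (Billiard.shift m F) 0 (act (T.frame F m)⁻¹ (q, u)) := by
      rw [fwd_shift, add_zero]; exact hy
    refine absurd (h1.evPer h2 ?_) (h m)
    obtain ⟨s, hs, hcr⟩ := exists_sign (T.frame F m)⁻¹
    rw [isometry_sub, hcr]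
    refine mul_ne_zero ?_ hc
    rcases hs with rfl | rfl <;> norm_num

theorem evPer_shift {k : ℤ} : EvPer (Billiard.shift k F) ↔ EvPer F := by
  have key : ∀ (F : ℤ → ι) k, EvPer F → EvPer (Billiard.shift k F) := by
    rintro F k ⟨P, hP, I, hI, h⟩
    refine ⟨P, hP, I + |k|, by positivity, fun i hi => ?_⟩
    rw [Billiard.shift, Billiard.shift, ← add_assoc, h]
    have := neg_abs_le k
    omega
  refine ⟨fun h => ?_, key F k⟩
  have := key _ (-k) h
  convert this using 1
  funext i; simp [Billiard.shift]

/-- Every shift of `F` is a forward sequence of `T`, hence of `T'`, which gives for every `m` a line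
of `T'` following `F` from time `m` on. Unless `F` is eventually periodic, uniqueness makes all
these lines the same. If it is, it is periodic, and the line starting at time 0 already follows it
backward. -/
theorem orb_of_fOrb [Finite ι] {T' : Billiard ι} (h : ∀ F, T.FOrb F → T'.FOrb F) (hF : T.Orb F) :
    T'.Orb F := by
  obtain ⟨x, hu, hx⟩ := hF
  have hρ : ∀ m : ℤ, ∃ y : Plane × Plane, ‖y.2‖ = 1 ∧ ∀ n, y ∈ T'.R F m n := by
    intro m
    obtain ⟨y, hy, hyn⟩ := h (Billiard.shift m F) ⟨act (T.frame F m)⁻¹ x, by simpa [act] using hu,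
      fun n => mem_R_shift.2 (hx _ _)⟩
    refine ⟨act (T'.frame F m) y, by simpa [act] using hy, fun n => ?_⟩
    have h1 := hyn (n - m)
    rw [← act_inv_act (T'.frame F m) y, mem_R_shift] at h1
    simpa using h1
  obtain ⟨y, hy, hyn⟩ := hρ 0
  refine ⟨y, hy, fun m n => ?_⟩
  by_cases hE : EvPer F
  · obtain ⟨G, Q, hQ, hper, hG⟩ := hE.exists_periodic_of_mem
    obtain rfl : F = G := funext fun i => hG T x (min i 0) (min_le_right _ _) hu (fun n => hx _ _) i
      (min_le_left _ _)
    exact mem_R_of_periodic hQ hper hy hyn m n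
  · obtain ⟨z, hz, hzn⟩ := hρ m
    obtain ⟨r, hr⟩ := ((fwd_of_mem hy hyn).mono (le_max_left 0 m)).eq_slide
      ((fwd_of_mem hz hzn).mono (le_max_right 0 m)) fun k => by rwa [evPer_shift]
    have h1 := hzn n
    rw [hr] at h1
    exact mem_R_slide'.1 h1

end Billiard

/-! ### Generic lines have two-sided sequences -/

namespace Billiard

variable {ι : Type*} {T : Billiard ι} {F F' : ℤ → ι}

/-- The vertices of all unfoldings of the table. -/
def orbitVerts (T : Billiard ι) : Set Plane :=
  ⋃ L : List ι, (fun v => (L.map T.refl).prod v) '' T.verts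

theorem countable_orbitVerts [Finite ι] : T.orbitVerts.Countable :=
  Set.countable_iUnion fun _ => (((Set.finite_range _).union (Set.finite_range _)).image _).countable

theorem exists_list_frame (F : ℤ → ι) (i : ℤ) : ∃ L : List ι, T.frame F i = (L.map T.refl).prod := by
  induction i with
  | zero => exact ⟨[], rfl⟩
  | succ i ih =>
    obtain ⟨L, hL⟩ := ih
    exact ⟨L ++ [F (i + 1)], by rw [frame_succ, hL]; simp⟩
  | pred i ih =>
    obtain ⟨L, hL⟩ := ih
    exact ⟨L ++ [F (-i)], by rw [frame_pred, hL]; simp⟩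

theorem mem_orbitVerts {i : ℤ} {y : Plane} (h : (T.frame F i)⁻¹ y ∈ T.verts) : y ∈ T.orbitVerts := by
  obtain ⟨L, hL⟩ := exists_list_frame (T := T) F i
  refine Set.mem_iUnion.2 ⟨L, _, h, ?_⟩
  dsimp only
  rw [← hL, apply_inv_self']

/-- A flight ends at the start of the next one. -/
theorem exists_crossing {m n : ℤ} {p u : Plane} (hmn : m < n) (hx : (p, u) ∈ T.R F m n) :
    ∃ s : ℝ, (T.frame F n)⁻¹ (p + s • u) ∈ T.E (F n) ∧
      0 < (T.l (F n)).linear ((T.frame F n)⁻¹.linearIsometryEquiv u) := by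
  obtain ⟨s, t, hst, h⟩ := hx (n - 1) (by omega) (by omega)
  rw [sub_add_cancel] at h
  obtain ⟨-, h2, -, h4, -⟩ := h
  simp only [act] at h2 h4
  rw [← map_add_smul'] at h2
  have e : (T.frame F (n - 1))⁻¹ (p + t • u) = (T.frame F n)⁻¹ (p + t • u) := by
    have := frame_succ_inv_seg (T := T) (F := F) (i := n - 1) (y := p + t • u)
      (Or.inl (by rw [sub_add_cancel]; exact openSegment_subset_segment _ _ _ h2))
    rwa [sub_add_cancel] at this
  refine ⟨t, e ▸ h2, ?_⟩
  have h5 := l_of_mem h2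
  rw [map_add_smul', AffineMap.apply_add_smul] at h5
  rw [AffineMap.apply_add_smul] at h4
  set v := (T.frame F (n - 1))⁻¹.linearIsometryEquiv u
  have h6 : (T.l (F n)).linear v < 0 := by nlinarith
  have h7 : (T.frame F n)⁻¹.linearIsometryEquiv u = (T.refl (F n)).linearIsometryEquiv v := by
    have := frame_succ (T := T) F (n - 1)
    rw [sub_add_cancel] at this
    rw [this, mul_inv_rev, refl_inv]; rfl
  have h8 := T.l_refl (F n) (T.A (F n) + (1 : ℝ) • v)
  rw [map_add_smul', AffineMap.apply_add_smul, AffineMap.apply_add_smul, T.refl_A, T.l_A] at h8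
  rw [h7]
  linarith

/-- After its last bounce the line is reflected into the table and meets no vertex, so it reaches a
further edge by `exists_mem_C`; the sequence is redefined at `n + 1` accordingly. -/
theorem exists_extend {m n : ℤ} {p u : Plane} (hmn : m < n) (hn : 0 ≤ n) (hx : (p, u) ∈ T.R F m n)
    {s : ℝ} (hs : (T.frame F n)⁻¹ (p + s • u) ∈ T.E (F n))
    (hv : ∀ t, s < t → p + t • u ∉ T.orbitVerts) :
    ∃ F' : ℤ → ι, (∀ i ≤ n, F' i = F i) ∧ (p, u) ∈ T.R F' m (n + 1) ∧
      ∃ t, s < t ∧ (T.frame F' (n + 1))⁻¹ (p + t • u) ∈ T.E (F' (n + 1)) := by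
  obtain ⟨-, -, hl⟩ := exists_crossing hmn hx
  obtain ⟨b, hb⟩ := exists_mem_C hs hl fun t ht b => by
    have key : ∀ v ∈ T.verts, (T.frame F n)⁻¹ (p + s • u) +
        t • (T.frame F n)⁻¹.linearIsometryEquiv u ≠ v := by
      intro v hv' h
      rw [← map_add_smul', add_assoc, ← add_smul] at h
      exact hv (s + t) (by linarith) (mem_orbitVerts (h ▸ hv'))
    exact ⟨key _ (Or.inl ⟨b, rfl⟩), key _ (Or.inr ⟨b, rfl⟩)⟩
  classical
  let F' := Function.update F (n + 1) b
  have hF' : ∀ i ≤ n, F' i = F i := fun i hi => Function.update_of_ne (by omega) _ _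
  have hb' : F' (n + 1) = b := Function.update_self _ _ _
  have hfr : T.frame F' n = T.frame F n := frame_congr fun j _ h2 => hF' j (by omega)
  have hmem : (p, u) ∈ T.R F' m (n + 1) := by
    intro i h1 h2
    rcases (Int.lt_add_one_iff.1 h2).lt_or_eq with h3 | rfl
    · have : (p, u) ∈ T.R F' m n := by
        rw [R_eq_iInter] at hx ⊢
        rw [Set.mem_iInter₂] at hx ⊢
        intro j hj
        have h4 := hx j hj
        rw [Set.mem_Ico] at hj
        rw [Set.mem_preimage] at h4 ⊢
        rwa [hF' j (by omega), hF' (j + 1) (by omega),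
          frame_congr (F := F') (F' := F) fun k _ h6 => hF' k (by omega)]
      exact this i h1 h3
    · rw [hfr, hF' _ le_rfl, hb']
      simp only [act]
      rw [map_add_smul'] at hb
      have := mem_C_slide (T := T) (e := F i) (a := b) (p := (T.frame F i)⁻¹ p)
        (u := (T.frame F i)⁻¹.linearIsometryEquiv u) (s := s) one_pos
      rw [one_smul] at this
      exact this.1 hb
  refine ⟨F', hF', hmem, ?_⟩
  obtain ⟨t, ht, -⟩ := exists_crossing (by omega) hmem
  refine ⟨t, ?_, ht⟩
  obtain ⟨s', t', hst, h⟩ := hmem n hmn.le (by omega)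
  obtain ⟨h1, h2, -, h3, h4⟩ := h
  simp only [act] at h1 h2 h3 h4
  rw [← map_add_smul', hfr, hF' n le_rfl] at h1
  rw [← map_add_smul', hfr] at h2
  have e1 : s' = s := by
    have a1 := l_of_mem h1
    have a2 := l_of_mem hs
    rw [map_add_smul', AffineMap.apply_add_smul] at a1 a2
    have : (s' - s) * (T.l (F n)).linear ((T.frame F n)⁻¹.linearIsometryEquiv u) = 0 := by linarith
    rcases mul_eq_zero.1 this with h | h
    · linarith
    · exact absurd h hl.ne'
  have e2 : t' = t := by
    have a1 : (T.frame F' n)⁻¹ (p + t' • u) ∈ T.E (F' (n + 1)) := by rw [hfr]; exact h2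
    have a3 := frame_succ_inv_seg (T := T) (F := F') (Or.inl (openSegment_subset_segment _ _ _ a1))
    rw [a3] at a1
    obtain ⟨t₀, ht₀, hl'⟩ := exists_crossing (by omega) hmem
    have a2 := l_of_mem ht
    have a1 := l_of_mem a1
    rw [map_add_smul', AffineMap.apply_add_smul] at a1 a2
    have : (t' - t) * (T.l (F' (n + 1))).linear
        ((T.frame F' (n + 1))⁻¹.linearIsometryEquiv u) = 0 := by linarith
    rcases mul_eq_zero.1 this with h | h
    · linarith
    · exact absurd h hl'.ne'
  linarith

/-- A line that meets no vertex later follows a sequence forever. -/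
theorem exists_forward {m n : ℤ} {p u : Plane} (hm : m ≤ 0) (hn : 0 < n) (hx : (p, u) ∈ T.R F m n)
    {s : ℝ} (hs : (T.frame F n)⁻¹ (p + s • u) ∈ T.E (F n))
    (hv : ∀ t, s < t → p + t • u ∉ T.orbitVerts) :
    ∃ F' : ℤ → ι, (∀ i ≤ n, F' i = F i) ∧ ∀ k, (p, u) ∈ T.R F' m k := by
  have hex : ∀ k : ℕ, ∃ F' : ℤ → ι, (∀ i ≤ n, F' i = F i) ∧ (p, u) ∈ T.R F' m (n + k) ∧
      ∃ t, s ≤ t ∧ (T.frame F' (n + k))⁻¹ (p + t • u) ∈ T.E (F' (n + k)) := by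
    intro k
    induction k with
    | zero => exact ⟨F, fun _ _ => rfl, by simpa using hx, s, le_rfl, by simpa using hs⟩
    | succ k ih =>
      obtain ⟨F', h1, h2, t, ht, h3⟩ := ih
      obtain ⟨F'', h4, h5, t', ht', h6⟩ := exists_extend (by omega) (by omega) h2 h3
        fun r hr => hv r (by linarith)
      refine ⟨F'', fun i hi => (h4 i (by omega)).trans (h1 i hi), ?_, t', by linarith, ?_⟩
      · push_cast; rwa [← add_assoc]
      · push_cast; rwa [← add_assoc]
  choose G h1 h2 _ _ _ using hex
  -- The extensions of different lengths agree by determinism, so reading entry `i` from a long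
  -- enough one defines a single sequence.
  have hag : ∀ k k' : ℕ, k ≤ k' → ∀ i : ℤ, i ≤ n + k → G k i = G k' i := by
    intro k k' hk i hi
    rcases le_or_gt i 0 with h0 | h0
    · rw [h1 k i (by omega), h1 k' i (by omega)]
    · exact R_determ (n := n + k) (R_mono hm le_rfl (h2 k)) (R_mono hm (by omega) (h2 k'))
        ((h1 k 0 hn.le).trans (h1 k' 0 hn.le).symm) i h0.le hi
  refine ⟨fun i => G (i - n).toNat i, fun i hi => h1 _ i hi, fun k => ?_⟩
  have : T.R (fun i => G (i - n).toNat i) m k = T.R (G (k - n).toNat) m k :=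
    R_congr fun j _ h4 => by
      rcases le_or_gt j n with h | h
      · rw [h1 _ j h, h1 _ j h]
      · exact hag _ _ (by omega) _ (by omega)
  rw [this]
  exact R_mono le_rfl (by omega) (h2 _)

/-- A line that meets no vertex follows a sequence in both directions. -/
theorem exists_two_sided {n : ℤ} {p u : Plane} (hn : 0 < n) (hx : (p, u) ∈ T.R F 0 n)
    (hv : ∀ t : ℝ, p + t • u ∉ T.orbitVerts) :
    ∃ F' : ℤ → ι, (∀ i, 0 ≤ i → i ≤ n → F' i = F i) ∧ ∀ m k, (p, u) ∈ T.R F' m k := by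
  obtain ⟨s, hs, -⟩ := exists_crossing hn hx
  obtain ⟨G, h1, h2⟩ := exists_forward le_rfl hn hx hs fun t _ => hv t
  -- The past is obtained by extending the reversed line forward. This changes nothing in the
  -- reversed sequence at indices up to 1, so the forward part is kept.
  have h3 : (p, -u) ∈ T.R (Billiard.rev G) 0 1 := mem_R_rev.2 (by simpa using h2 1)
  obtain ⟨s', hs', -⟩ := exists_crossing one_pos h3
  obtain ⟨K, h4, h5⟩ := exists_forward le_rfl one_pos h3 hs' fun t _ => by
    rw [smul_neg, ← neg_smul]; exact hv _
  have h6 : ∀ m k, (p, -u) ∈ T.R K m k := by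
    intro m k i hi hi'
    rcases le_or_gt 0 i with h0 | h0
    · exact h5 k i h0 hi'
    · have h7 : (p, -u) ∈ T.R (Billiard.rev G) m 0 := mem_R_rev.2 (R_mono (by omega) le_rfl (h2 (1 - m)))
      rw [← R_congr (F := K) fun j _ h8 => h4 j (by simp at h8; omega)] at h7
      exact h7 i hi h0
  refine ⟨Billiard.rev K, fun i hi hin => ?_, fun m k => ?_⟩
  · rw [Billiard.rev]
    rcases hi.eq_or_lt with rfl | h0
    · rw [h4 _ (by omega), Billiard.rev, ← h1 0 hn.le]; simp
    · rw [h4 _ (by omega), Billiard.rev, sub_sub_cancel, h1 _ hin]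
  · have := mem_R_rev (T := T) (F := K) (m := m) (n := k) (p := p) (u := -u)
    rw [neg_neg] at this
    have h7 := mem_R_rev (T := T) (F := Billiard.rev K) (m := 1 - k) (n := 1 - m) (p := p) (u := u)
    rw [rev_rev, sub_sub_cancel, sub_sub_cancel] at h7
    exact h7.1 (h6 _ _)

/-- Open sets of lines contain lines that avoid countably many points. -/
theorem exists_generic {U : Set (Plane × Plane)} (hU : IsOpen U) {p u : Plane} (hx : (p, u) ∈ U)
    (hu : u ≠ 0) {Z : Set Plane} (hZ : Z.Countable) :
    ∃ q, (q, u) ∈ U ∧ ∀ t : ℝ, q + t • u ∉ Z := by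
  have hn : ‖u‖ ^ 2 ≠ 0 := by have := norm_pos_iff.2 hu; positivity
  have hc : Continuous fun c : ℝ => (p + c • quarter u, u) := by fun_prop
  -- Among the parallels to the line, each point of `Z` excludes exactly one height.
  have hd : Dense ((fun z => cross u (z - p) / ‖u‖ ^ 2) '' Z)ᶜ := (hZ.image _).dense_compl ℝ
  obtain ⟨c, hc1, hc2⟩ := hd.inter_open_nonempty _ (hU.preimage hc) ⟨0, by simpa using hx⟩
  refine ⟨_, hc1, fun t ht => hc2 ⟨_, ht, ?_⟩⟩
  dsimp only
  rw [div_eq_iff hn, add_assoc, add_sub_cancel_left, cross_add, cross_smul, cross_smul,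
    cross_quarter, cross_same]
  ring

theorem ne_zero_of_mem_R {m n : ℤ} (hmn : m < n) {x : Plane × Plane} (hx : x ∈ T.R F m n) :
    x.2 ≠ 0 := by
  intro h
  have h1 := (strict_of_mem_C (hx m le_rfl hmn)).1.ne_zero
  apply h1
  simp [act, h]

/-- The sequences of edges followed by open sets of lines are determined by the two-sided
sequences. -/
theorem nonempty_R_of_orb [Finite ι] {T' : Billiard ι} (h : ∀ F, T.Orb F → T'.Orb F) {n : ℤ}
    (hF : (T.R F 0 n).Nonempty) : (T'.R F 0 n).Nonempty := by
  rcases le_or_gt n 0 with hn | hn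
  · exact ⟨0, fun i h1 h2 => by omega⟩
  obtain ⟨⟨p, u⟩, hx⟩ := hF
  have hu := ne_zero_of_mem_R hn hx
  dsimp only at hu
  obtain ⟨q, hq, hv⟩ := exists_generic (isOpen_R _ _ _) hx hu (countable_orbitVerts (T := T))
  obtain ⟨G, h1, h2⟩ := exists_two_sided hn hq hv
  obtain ⟨y, -, hy⟩ := h G ⟨(q, ‖u‖⁻¹ • u), by simp [norm_smul, hu], fun m k => by
    have := (mem_R_slide (T := T) (F := G) (m := m) (n := k) (p := q) (u := u) (s := 0)
      (r := ‖u‖⁻¹) (by positivity)).2 (h2 m k)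
    simpa using this⟩
  refine ⟨y, ?_⟩
  rw [← R_congr (F := G) fun i hi hi' => h1 i (by simpa [hn.le] using hi) (by simpa [hn.le] using hi')]
  exact hy 0 n

end Billiard

/-! ### Step patterns and pivot vertices -/

/-- The sign that changes once, at `b`. -/
noncomputable def stepSign (s b : ℝ) : ℝ → ℝ := fun t => if t < b then s else -s

/-- Every nonempty subset of `S` has a least element; `b` is the first point whose sign differs from
that of the first point of `S`, and without alternation the sign cannot change back. -/
theorem exists_stepSign {S : Set ℝ} (hS : ∀ B, (S ∩ Set.Iic B).Finite) {σ : ℝ → ℝ}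
    (hσ : ∀ t, σ t = 1 ∨ σ t = -1)
    (h : ∀ t₁ ∈ S, ∀ t₂ ∈ S, ∀ t₃ ∈ S, t₁ < t₂ → t₂ < t₃ → σ t₁ = σ t₃ → σ t₂ = σ t₁) :
    ∃ s b : ℝ, (s = 1 ∨ s = -1) ∧ ∀ t ∈ S, σ t = stepSign s b t := by
  have hmin : ∀ S' ⊆ S, S'.Nonempty → ∃ t ∈ S', ∀ t' ∈ S', t ≤ t' := by
    rintro S' hS' ⟨t₀, ht₀⟩
    have hfin : (S' ∩ Set.Iic t₀).Finite := (hS t₀).subset (Set.inter_subset_inter_left _ hS')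
    obtain ⟨t, ht, hle⟩ := hfin.exists_minimalFor id _ ⟨t₀, ht₀, Set.mem_Iic.2 le_rfl⟩
    refine ⟨t, ht.1, fun t' ht' => ?_⟩
    rcases le_total t' t₀ with h1 | h1
    · rcases le_total t t' with h2 | h2
      · exact h2
      · exact hle ⟨ht', h1⟩ h2
    · exact ht.2.trans h1
  rcases S.eq_empty_or_nonempty with rfl | hne
  · exact ⟨1, 0, Or.inl rfl, by simp⟩
  obtain ⟨t₁, h1, hle⟩ := hmin S le_rfl hne
  have hneg : ∀ t t', σ t ≠ σ t' → σ t = -σ t' := by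
    intro t t' hne
    rcases hσ t with h2 | h2 <;> rcases hσ t' with h3 | h3 <;> simp_all
  by_cases hc : ∃ t ∈ S, σ t ≠ σ t₁
  · obtain ⟨b, ⟨hb, hb1⟩, hbl⟩ := hmin {t ∈ S | σ t ≠ σ t₁} (fun t ht => ht.1) hc
    refine ⟨σ t₁, b, hσ _, fun t ht => ?_⟩
    unfold stepSign
    split_ifs with htb
    · by_contra hne'
      exact absurd (hbl t ⟨ht, hne'⟩) (not_le.2 htb)
    · push Not at htb
      rcases htb.eq_or_lt with rfl | hlt
      · exact hneg _ _ hb1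
      · by_contra hne'
        have h4 : σ t = σ t₁ := by
          by_contra h5; exact hne' (hneg _ _ h5)
        have h5 : t₁ < b := lt_of_le_of_ne (hle b hb) (by rintro rfl; exact hb1 rfl)
        exact hb1 (h t₁ h1 b hb t ht h5 hlt h4.symm)
  · push Not at hc
    refine ⟨-σ t₁, t₁, ?_, fun t ht => ?_⟩
    · rcases hσ t₁ with h2 | h2 <;> rw [h2] <;> norm_num
    · rw [stepSign, if_neg (not_lt.2 (hle t ht)), neg_neg]; exact hc t ht

namespace Billiard

variable {ι : Type*} {T : Billiard ι} {F F' : ℤ → ι}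

/-- This is `mem_C_of_tilt` in every frame; the orientation sign of the frame is absorbed by
replacing `z` by `s • z`. -/
theorem mem_R_of_tilt {m n : ℤ} {x : Plane × Plane} (hu : x.2 ≠ 0) {S : Set ℝ} (hS : S.Finite)
    (h : ∀ᶠ z : ℝ × ℝ in 𝓝 0, (∀ t ∈ S, z.1 + z.2 * t ≠ 0) → z ≠ 0 →
      tilt x z.1 z.2 ∈ T.R F m n) : x ∈ T.R F m n := by
  intro i h1 h2
  obtain ⟨s, hs, hcr⟩ := exists_sign (T.frame F i)⁻¹
  have hs0 : s ≠ 0 := by rcases hs with rfl | rfl <;> norm_num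
  have hss : s * s = 1 := by rcases hs with rfl | rfl <;> norm_num
  have hu' : (act (T.frame F i)⁻¹ x).2 ≠ 0 := by
    intro h0
    apply hu
    rw [← norm_eq_zero, ← norm_linear (T.frame F i)⁻¹, norm_eq_zero]
    exact h0
  refine mem_C_of_tilt hu' hS ?_
  have ht : Tendsto (fun z : ℝ × ℝ => s • z) (𝓝 0) (𝓝 0) :=
    Continuous.tendsto' (by fun_prop) _ _ (by simp)
  filter_upwards [ht.eventually h] with z hz h3 h4
  have h5 := hz (fun t ht => by
    have := mul_ne_zero hs0 (h3 t ht)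
    simp only [Prod.smul_fst, Prod.smul_snd, smul_eq_mul]
    intro h0; apply this; rw [← h0]; ring) (smul_ne_zero hs0 h4) i h1 h2
  rw [tilt_act _ hcr] at h5
  simp only [Prod.smul_fst, Prod.smul_snd, smul_eq_mul] at h5
  rwa [← mul_assoc, ← mul_assoc, hss, one_mul, one_mul] at h5

/-- Lines that pass a forward line's vertices on the sides prescribed by `σ` follow the same
edges. -/
def Good (T : Billiard ι) (F : ℤ → ι) (x : Plane × Plane) (n : ℤ) (σ : ℝ → ℝ) : Prop :=
  ∃ᶠ z : ℝ × ℝ in 𝓝 0, z ∈ pattern σ (T.hits F 0 n x) ∧ tilt x z.1 z.2 ∈ T.R F 0 n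

/-- The parameters at which a forward line meets vertices. -/
def allHits (T : Billiard ι) (F : ℤ → ι) (x : Plane × Plane) : Set ℝ := ⋃ n : ℤ, T.hits F 0 n x

theorem Good.congr {x : Plane × Plane} {n : ℤ} {σ τ : ℝ → ℝ} (h : T.Good F x n σ)
    (hστ : ∀ t ∈ T.hits F 0 n x, σ t = τ t) : T.Good F x n τ := by
  unfold Good at h ⊢
  rwa [pattern_congr hστ] at h

theorem Fwd.finite_allHits [Finite ι] {x : Plane × Plane} (hx : T.Fwd F 0 x) (B : ℝ) :
    (T.allHits F x ∩ Set.Iic B).Finite := by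
  obtain ⟨I, hI, hfar⟩ := hx.hits_gt B
  refine (finite_hits (T := T) (F := F) (m := 0) (n := I) hx.ne_zero).subset ?_
  rintro t ⟨ht, htB⟩
  obtain ⟨n, i, h1, h2, h3⟩ := Set.mem_iUnion.1 ht
  refine ⟨i, h1, ?_, h3⟩
  by_contra hiI
  obtain ⟨a, ha⟩ := verts_seg h3
  have := hfar i (not_lt.1 hiI) a _ ha
  rw [add_sub_cancel_left, real_inner_smul_left, real_inner_self_eq_norm_sq, hx.1, one_pow,
    mul_one] at this
  exact absurd htB (not_le.2 this)

/-- If every step pattern is good, the line itself follows the edges. -/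
theorem mem_R_of_good [Finite ι] {x : Plane × Plane} {n : ℤ} (hu : x.2 ≠ 0)
    (h : ∀ s b : ℝ, (s = 1 ∨ s = -1) → T.Good F x n (stepSign s b)) : x ∈ T.R F 0 n := by
  have hS := finite_hits (T := T) (F := F) (m := 0) (n := n) hu
  refine mem_R_of_tilt hu hS ?_
  -- Otherwise an ultrafilter of arbitrarily small bad tilts exists. Its pattern does not alternate,
  -- so it is a step pattern; as this one is good, `eventually_mem_R` shows that these tilts follow
  -- the edges after all.
  by_contra hcon
  rw [not_eventually, frequently_iff_neBot] at hcon
  obtain ⟨V, hV⟩ := @Ultrafilter.exists_le _ _ hcon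
  have h1 : ∀ᶠ z in (V : Filter (ℝ × ℝ)), ¬((∀ t ∈ T.hits F 0 n x, z.1 + z.2 * t ≠ 0) →
    z ≠ 0 → tilt x z.1 z.2 ∈ T.R F 0 n) := hV (mem_inf_of_right (mem_principal_self _))
  have h2 : (V : Filter (ℝ × ℝ)) ≤ 𝓝 0 := hV.trans inf_le_left
  have h3 := eventually_pattern_signAt (V := V) hS fun t ht => h1.mono fun z hz => by
    push Not at hz; exact hz.1 t ht
  obtain ⟨s, b, hs, hsb⟩ := exists_stepSign (fun B => hS.inter_of_left _) (signAt_eq V)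
    fun t₁ e1 t₂ e2 t₃ e3 => pattern_no_alternation (signAt_eq V) h3.exists e1 e2 e3
  have h4 := h2 (eventually_mem_R hu (h s b hs))
  rw [pattern_congr hsb] at h3
  obtain ⟨z, z1, z2, z3⟩ := (h1.and (h3.and h4)).exists
  exact z1 fun _ _ => z3 z2

/-- For a forward line that does not follow the edges itself, two step patterns that differ at a
single vertex behave differently. -/
theorem Fwd.exists_pivot [Finite ι] {x : Plane × Plane} (hx : T.Fwd F 0 x) {N : ℤ}
    (hN : x ∉ T.R F 0 N) : ∃ (s t : ℝ) (σ σ' : ℝ → ℝ), (s = 1 ∨ s = -1) ∧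
      (∀ t' ∈ T.allHits F x, t' < t → σ t' = s ∧ σ' t' = s) ∧
      (∀ t' ∈ T.allHits F x, t < t' → σ t' = -s ∧ σ' t' = -s) ∧
      (σ t = 1 ∨ σ t = -1) ∧ (σ' t = 1 ∨ σ' t = -1) ∧
      (∀ n, T.Good F x n σ) ∧ ∃ n, ¬ T.Good F x n σ' := by
  have hsub : ∀ n, T.hits F 0 n x ⊆ T.allHits F x := fun n => Set.subset_iUnion (fun n : ℤ => T.hits F 0 n x) n
  have hfin := hx.finite_allHits
  let G : ℝ → ℝ → Prop := fun s b => ∀ n, T.Good F x n (stepSign s b)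
  by_contra hcon
  -- without a pivot, goodness of a step pattern does not depend on the step
  have hloc : ∀ s : ℝ, (s = 1 ∨ s = -1) → ∀ b b', G s b = G s b' := by
    intro s hs
    -- Moving the step from `t` to the right, not beyond the next vertex on the line, changes the
    -- sign at `t` only. If this changed goodness, `t` would be a pivot.
    have hpiv : ∀ t b', t < b' → (∀ t' ∈ T.allHits F x, t < t' → b' ≤ t') → (G s t ↔ G s b') := by
      intro t b' htb hgap
      have e1 : ∀ t' ∈ T.allHits F x, t' < t → stepSign s t t' = s ∧ stepSign s b' t' = s :=
        fun t' _ h => ⟨if_pos h, if_pos (h.trans htb)⟩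
      have e2 : ∀ t' ∈ T.allHits F x, t < t' → stepSign s t t' = -s ∧ stepSign s b' t' = -s :=
        fun t' h' h => ⟨if_neg (not_lt.2 h.le), if_neg (not_lt.2 (hgap t' h' h))⟩
      have e3 : stepSign s t t = -s := if_neg (lt_irrefl _)
      have e4 : stepSign s b' t = s := if_pos htb
      have e3' : stepSign s t t = 1 ∨ stepSign s t t = -1 := by
        rw [e3]; rcases hs with rfl | rfl <;> norm_num
      have e4' : stepSign s b' t = 1 ∨ stepSign s b' t = -1 := by rwa [e4]
      constructor
      · intro h
        by_contra hb
        exact hcon ⟨s, t, _, _, hs, e1, e2, e3', e4', h, not_forall.1 hb⟩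
      · intro h
        by_contra hb
        exact hcon ⟨s, t, _, _, hs, fun t' h1 h2 => (e1 t' h1 h2).symm,
          fun t' h1 h2 => (e2 t' h1 h2).symm, e4', e3', h, not_forall.1 hb⟩
    -- Goodness is locally constant in the position of the step because the vertices on the line are
    -- locally finite, hence constant by connectedness of the real line.
    have hlc : IsLocallyConstant (G s) := by
      rw [IsLocallyConstant.iff_eventually_eq]
      intro b₀
      have hfar : ∀ᶠ b in 𝓝 b₀, ∀ t' ∈ (T.allHits F x ∩ Set.Iic (b₀ + 1)) \ {b₀},
          (b₀ < t' → b < t') ∧ (t' < b₀ → t' < b) := by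
        refine (eventually_all_finite ((hfin _).subset Set.sdiff_subset)).2 fun t' ht' => ?_
        rcases lt_or_gt_of_ne ht'.2 with h | h
        · filter_upwards [lt_mem_nhds h] with b hb using ⟨fun h' => absurd h' h.not_gt, fun _ => hb⟩
        · filter_upwards [gt_mem_nhds h] with b hb using ⟨fun _ => hb, fun h' => absurd h' h.not_gt⟩
      filter_upwards [hfar, gt_mem_nhds (lt_add_one b₀)] with b hb hb1
      rcases lt_trichotomy b b₀ with hlt | rfl | hlt
      · refine propext (forall_congr' fun n => ?_)
        have : ∀ t' ∈ T.hits F 0 n x, stepSign s b t' = stepSign s b₀ t' := by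
          intro t' ht'
          unfold stepSign
          by_cases h1 : t' < b₀
          · rw [if_pos h1, if_pos ((hb t' ⟨⟨hsub n ht', by simp; linarith⟩, h1.ne⟩).2 h1)]
          · rw [if_neg h1, if_neg (by linarith)]
        exact ⟨fun h => h.congr this, fun h => h.congr fun t ht => (this t ht).symm⟩
      · rfl
      · refine (propext (hpiv b₀ b hlt fun t' ht' h => ?_)).symm
        by_contra h2
        push Not at h2
        exact absurd ((hb t' ⟨⟨ht', by simp; linarith⟩, h.ne'⟩).1 h) h2.not_gt
    exact fun b b' => hlc.apply_eq_of_preconnectedSpace b b'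
  obtain ⟨σ, hσ, hgood⟩ := hx.exists_pattern
  obtain ⟨s₀, b₀, hs₀, hstep⟩ := exists_stepSign hfin hσ fun t₁ h1 t₂ h2 t₃ h3 => by
    obtain ⟨n₁, h1⟩ := Set.mem_iUnion.1 h1
    obtain ⟨n₂, h2⟩ := Set.mem_iUnion.1 h2
    obtain ⟨n₃, h3⟩ := Set.mem_iUnion.1 h3
    obtain ⟨z, hz, -⟩ := (hgood (max n₁ (max n₂ n₃))).exists
    exact pattern_no_alternation hσ ⟨z, hz⟩ (hits_mono le_rfl (by omega) h1)
      (hits_mono le_rfl (by omega) h2) (hits_mono le_rfl (by omega) h3)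
  have hG₀ : G s₀ b₀ := fun n => Good.congr (hgood n) fun t ht => hstep t (hsub n ht)
  have hall : ∀ b, G s₀ b := fun b => hloc s₀ hs₀ b b₀ ▸ hG₀
  have hmin : ∃ b, ∀ t ∈ T.allHits F x, b ≤ t := by
    obtain ⟨b, hb⟩ := (hfin 0).bddBelow
    refine ⟨min b 0, fun t ht => ?_⟩
    rcases le_total t 0 with h | h
    · exact (min_le_left _ _).trans (hb ⟨ht, h⟩)
    · exact (min_le_right _ _).trans h
  obtain ⟨b₁, hb₁⟩ := hmin
  have hs₀' : -s₀ = 1 ∨ -s₀ = -1 := by rcases hs₀ with rfl | rfl <;> norm_num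
  -- For given `n`, a step placed beyond all vertices gives a constant pattern, which is also the
  -- pattern with the opposite sign and the step before all vertices. So goodness passes from one
  -- sign to the other, every step pattern is good, and the line follows the edges by
  -- `mem_R_of_good`.
  have hG₁ : G (-s₀) b₁ := by
    intro n
    obtain ⟨B, hB⟩ := (finite_hits (T := T) (F := F) (m := 0) (n := n) hx.ne_zero).bddAbove
    refine (hall (B + 1) n).congr fun t ht => ?_
    rw [stepSign, stepSign, if_pos (by linarith [hB ht]), if_neg (not_lt.2 (hb₁ t (hsub n ht))),
      neg_neg]
  have hall' : ∀ b, G (-s₀) b := fun b => hloc _ hs₀' b b₁ ▸ hG₁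
  refine hN (mem_R_of_good hx.ne_zero fun s b hs => ?_)
  have : s = s₀ ∨ s = -s₀ := by
    rcases hs with rfl | rfl <;> rcases hs₀ with rfl | rfl <;> norm_num
  rcases this with rfl | rfl
  exacts [hall b N, hall' b N]

/-- Lines through a pivot vertex are limits of lines following the edges, but do not follow them. -/
theorem Fwd.exists_pivot_lines [Finite ι] {x : Plane × Plane} (hx : T.Fwd F 0 x) {N : ℤ}
    (hN : x ∉ T.R F 0 N) : ∃ (s t : ℝ) (N₀ : ℤ), (s = 1 ∨ s = -1) ∧ ∀ n, ∀ᶠ θ : ℝ in 𝓝[>] 0,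
      tilt x (θ * (s * t)) (-(θ * s)) ∈ closure (T.R F 0 n) ∧
      tilt x (θ * (s * t)) (-(θ * s)) ∉ T.R F 0 N₀ := by
  obtain ⟨s, t, σ, σ', hs, h1, h2, hσt, hσt', hg, N₀, hb⟩ := hx.exists_pivot hN
  refine ⟨s, t, N₀, hs, fun n => ?_⟩
  have hss : s * s = 1 := by rcases hs with rfl | rfl <;> norm_num
  have hz : Tendsto (fun θ : ℝ => ((θ * (s * t), -(θ * s)) : ℝ × ℝ)) (𝓝[>] 0) (𝓝 0) :=
    (Continuous.tendsto' (by fun_prop) _ _ (by simp)).mono_left nhdsWithin_le_nhds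
  have hδ : ∀ θ ε : ℝ, Tendsto (fun δ : ℝ => ((θ * (s * t) + δ * ε, -(θ * s)) : ℝ × ℝ)) (𝓝[>] 0)
      (𝓝 (θ * (s * t), -(θ * s))) := fun θ ε =>
    (Continuous.tendsto' (by fun_prop) _ _ (by simp)).mono_left nhdsWithin_le_nhds
  -- These parameters rotate the line about its point of abscissa `t`: the height at `t'` is `θ * s
  -- * (t - t')`, of sign `s` before `t` and `-s` after it. A further shift by a small `δ` in the
  -- direction `τ t` realizes the pattern `τ`.
  have hpat : ∀ (τ : ℝ → ℝ) (n : ℤ) (θ : ℝ), 0 < θ → (τ t = 1 ∨ τ t = -1) →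
      (∀ t' ∈ T.hits F 0 n x, t' < t → τ t' = s) → (∀ t' ∈ T.hits F 0 n x, t < t' → τ t' = -s) →
      ∀ᶠ δ : ℝ in 𝓝[>] 0, ((θ * (s * t) + δ * τ t, -(θ * s)) : ℝ × ℝ) ∈
        pattern τ (T.hits F 0 n x) := by
    intro τ n θ hθ hτ e1 e2
    refine (eventually_all_finite (finite_hits hx.ne_zero)).2 fun t' ht' => ?_
    rcases eq_or_ne t' t with rfl | hne
    · filter_upwards [self_mem_nhdsWithin] with δ hδ
      have : (0 : ℝ) < δ := hδ
      have e3 : τ t' * (θ * (s * t') + δ * τ t' + -(θ * s) * t') = δ * (τ t' * τ t') := by ring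
      have e4 : τ t' * τ t' = 1 := by rcases hτ with h | h <;> rw [h] <;> norm_num
      show 0 < τ t' * (θ * (s * t') + δ * τ t' + -(θ * s) * t')
      rw [e3, e4, mul_one]; exact this
    · have hlim : Tendsto (fun δ : ℝ => τ t' * ((θ * (s * t) + δ * τ t) + -(θ * s) * t')) (𝓝[>] 0)
          (𝓝 (τ t' * (θ * s * (t - t')))) :=
        (Continuous.tendsto' (by fun_prop) _ _ (by ring)).mono_left nhdsWithin_le_nhds
      refine hlim.eventually (lt_mem_nhds ?_)
      rcases lt_or_gt_of_ne hne with h | h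
      · rw [e1 t' ht' h]
        have : s * (θ * s * (t - t')) = θ * (t - t') * (s * s) := by ring
        rw [this, hss, mul_one]
        exact mul_pos hθ (sub_pos.2 h)
      · rw [e2 t' ht' h]
        have : -s * (θ * s * (t - t')) = θ * (t' - t) * (s * s) := by ring
        rw [this, hss, mul_one]
        exact mul_pos hθ (sub_pos.2 h)
  have hsub : ∀ n, T.hits F 0 n x ⊆ T.allHits F x := fun n => Set.subset_iUnion (fun n : ℤ => T.hits F 0 n x) n
  -- Shifts toward the side `σ t` follow the edges, so the rotated line is a limit of such lines.
  -- Shifts toward the side `σ' t` do not follow them up to `N₀`, and as `R F 0 N₀` is open the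
  -- rotated line does not either.
  have g1 := hz.eventually (eventually_eventually_nhds.2 (eventually_mem_R hx.ne_zero (hg n)))
  have g2 := hz.eventually (eventually_eventually_nhds.2 (not_frequently.1 hb))
  filter_upwards [g1, g2, self_mem_nhdsWithin] with θ h3 h4 hθ
  constructor
  · have h5 := hpat σ n θ hθ hσt (fun t' h => fun h' => (h1 t' (hsub n h) h').1)
      fun t' h => fun h' => (h2 t' (hsub n h) h').1
    have h6 := ((tilt_continuous x).tendsto _).comp (hδ θ (σ t))
    refine mem_closure_of_tendsto h6 ?_
    filter_upwards [h5, (hδ θ (σ t)).eventually h3] with δ h7 h8 using h8 h7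
  · intro hmem
    have h5 := hpat σ' N₀ θ hθ hσt' (fun t' h => fun h' => (h1 t' (hsub _ h) h').2)
      fun t' h => fun h' => (h2 t' (hsub _ h) h').2
    have h6 := ((tilt_continuous x).tendsto _).comp (hδ θ (σ' t))
    obtain ⟨δ, h7, h8, h9⟩ := (h5.and (((hδ θ (σ' t)).eventually h4).and
      (h6.eventually ((isOpen_R F 0 N₀).mem_nhds hmem)))).exists
    exact h8 ⟨h7, h9⟩

end Billiard

/-! ### Sequences that branch backward -/

namespace Billiard

variable {ι : Type*} {T : Billiard ι} {F F' : ℤ → ι}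

/-- The products of reflections. -/
def products (T : Billiard ι) : Set (Plane ≃ᵃⁱ[ℝ] Plane) := Set.range fun L : List ι => (L.map T.refl).prod

theorem frame_mem_products (F : ℤ → ι) (i : ℤ) : T.frame F i ∈ T.products := by
  obtain ⟨L, hL⟩ := exists_list_frame (T := T) F i
  exact ⟨L, hL.symm⟩

theorem mul_mem_products {g h : Plane ≃ᵃⁱ[ℝ] Plane} (hg : g ∈ T.products) (hh : h ∈ T.products) :
    g * h ∈ T.products := by
  obtain ⟨L, rfl⟩ := hg
  obtain ⟨M, rfl⟩ := hh
  exact ⟨L ++ M, by simp⟩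

theorem countable_products [Finite ι] : T.products.Countable := Set.countable_range _

theorem apply_mem_orbitVerts {g : Plane ≃ᵃⁱ[ℝ] Plane} (hg : g ∈ T.products) {v : Plane}
    (hv : v ∈ T.orbitVerts) : g v ∈ T.orbitVerts := by
  obtain ⟨M, w, hw, rfl⟩ := Set.mem_iUnion.1 hv
  obtain ⟨L, rfl⟩ := hg
  exact Set.mem_iUnion.2 ⟨L ++ M, w, hw, by simp⟩

/-- Small rotations of a direction avoid countably many directions. -/
theorem exists_rotation {u : Plane} (hu : u ≠ 0) {s : ℝ} (hs : s ≠ 0) {Z : Set Plane}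
    (hZ : Z.Countable) {p : ℝ → Prop} (hp : ∀ᶠ θ in 𝓝[>] (0 : ℝ), p θ) :
    ∃ θ, p θ ∧ ∀ d ∈ Z, d ≠ 0 → cross (u + (-(θ * s)) • quarter u) d ≠ 0 := by
  have hbad : {θ : ℝ | ∃ d ∈ Z, d ≠ 0 ∧ cross (u + (-(θ * s)) • quarter u) d = 0}.Countable := by
    have : {θ : ℝ | ∃ d ∈ Z, d ≠ 0 ∧ cross (u + (-(θ * s)) • quarter u) d = 0} ⊆
        ⋃ d ∈ Z, {θ : ℝ | d ≠ 0 ∧ cross (u + (-(θ * s)) • quarter u) d = 0} := by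
      rintro θ ⟨d, hd, h⟩
      exact Set.mem_biUnion hd h
    refine (hZ.biUnion fun d _ => Set.Subsingleton.countable ?_).mono this
    rintro θ ⟨hd, h1⟩ θ' ⟨-, h2⟩
    by_contra hne
    rw [add_cross, smul_cross] at h1 h2
    have h3 : (θ' - θ) * (s * cross (quarter u) d) = 0 := by linarith
    have h4 : cross (quarter u) d = 0 :=
      ((mul_eq_zero.1 h3).resolve_left (sub_ne_zero.2 (Ne.symm hne)) |> mul_eq_zero.1).resolve_left hs
    have h5 : cross u d = 0 := by rw [h4] at h1; linarith
    obtain ⟨r, rfl⟩ := exists_smul_of_cross_eq_zero hu h5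
    have h6 : cross (quarter u) u = -‖u‖ ^ 2 := by
      rw [Plane.norm_sq]; simp [cross, quarter]; ring
    rw [cross_smul, h6] at h4
    have := norm_pos_iff.2 hu
    rcases mul_eq_zero.1 h4 with h | h
    · exact hd (by rw [h, zero_smul])
    · nlinarith
  obtain ⟨ε, hε, hsub⟩ := mem_nhdsGT_iff_exists_Ioo_subset.1 hp
  obtain ⟨θ, h1, h2⟩ := (hbad.dense_compl ℝ).inter_open_nonempty _ isOpen_Ioo (Set.nonempty_Ioo.2 hε)
  exact ⟨θ, hsub h1, fun d hd hd0 h => h2 ⟨d, hd, hd0, h⟩⟩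

/-- A line that follows edges from the edge number `0` on comes from some edge. -/
theorem exists_backward {n : ℤ} (hn : 0 < n) {x : Plane × Plane} (hx : x ∈ T.R F 0 n)
    (hv : ∀ t : ℝ, (T.refl (F 0)) (x.1 + t • x.2) ∉ T.verts) :
    ∃ b, act (T.refl (F 0)) x ∈ T.C b (F 0) ∧
      ∀ F' : ℤ → ι, F' (-1) = b → (∀ i, 0 ≤ i → F' i = F i) → x ∈ T.R F' (-1) n := by
  obtain ⟨p, u⟩ := x
  obtain ⟨s, t, hst, h1, -, -, -, h5⟩ := hx 0 le_rfl hn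
  have e0 : act (T.frame F 0)⁻¹ (p, u) = (p, u) := by
    simp only [frame_zero, inv_one]; exact act_one _
  rw [e0] at h1 h5
  dsimp only at h1 h5 hv
  have hl : 0 < (T.l (F 0)).linear u := by
    have := l_of_mem h1
    rw [AffineMap.apply_add_smul] at this h5
    nlinarith
  have hl' : (T.l (F 0)).linear ((T.refl (F 0)).linearIsometryEquiv u) =
      -(T.l (F 0)).linear u := by
    have h8 := T.l_refl (F 0) (T.A (F 0) + (1 : ℝ) • u)
    rw [map_add_smul', AffineMap.apply_add_smul, AffineMap.apply_add_smul, T.refl_A, T.l_A] at h8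
    linarith
  have hpt : T.refl (F 0) (p + s • u) = p + s • u :=
    refl_seg (openSegment_subset_segment _ _ _ h1)
  rw [← hpt] at h1
  obtain ⟨b, hb⟩ := exists_mem_C (u := -(T.refl (F 0)).linearIsometryEquiv u) h1
    (by rw [map_neg, hl', neg_neg]; exact hl) fun r hr b => by
      have key : T.refl (F 0) (p + s • u) + r • -(T.refl (F 0)).linearIsometryEquiv u ∉ T.verts := by
        rw [smul_neg, ← neg_smul, ← map_add_smul', add_assoc, ← add_smul]
        exact hv _
      exact ⟨fun h => key (Or.inl ⟨b, h.symm⟩), fun h => key (Or.inr ⟨b, h.symm⟩)⟩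
  rw [mem_C_reverse, map_add_smul'] at hb
  have hb' : act (T.refl (F 0)) (p, u) ∈ T.C b (F 0) := by
    have := mem_C_slide (T := T) (e := b) (a := F 0) (p := T.refl (F 0) p)
      (u := (T.refl (F 0)).linearIsometryEquiv u) (s := s) one_pos
    rw [one_smul] at this
    exact this.1 (by simpa using hb)
  refine ⟨b, hb', fun F' hF' hF i h1 h2 => ?_⟩
  rcases h1.eq_or_lt with rfl | h1
  · have h3 := frame_pred (T := T) F' 0
    rw [frame_zero, one_mul, zero_sub] at h3
    rw [h3, refl_inv, hF', neg_add_cancel, hF 0 le_rfl]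
    exact hb'
  · have h4 : (p, u) ∈ T.R F' 0 n := by
      rw [R_congr fun j hj _ => hF j (by simpa using hj)]; exact hx
    exact h4 i (by omega) h2

end Billiard

namespace Billiard

variable {ι : Type*} {T : Billiard ι} {F F' : ℤ → ι}

theorem fwd_normalize {m : ℤ} {p u : Plane} (hu : u ≠ 0) (h : ∀ n, (p, u) ∈ T.R F m n) :
    T.Fwd F m (p, ‖u‖⁻¹ • u) := by
  refine fwd_of_mem (by simp [norm_smul, hu]) fun n => ?_
  have := (mem_R_slide (T := T) (F := F) (m := m) (n := n) (p := p) (u := u) (s := 0)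
    (r := ‖u‖⁻¹) (by positivity)).2 (h n)
  simpa using this

theorem linear_ne_zero {g : Plane ≃ᵃⁱ[ℝ] Plane} {u : Plane} (hu : u ≠ 0) :
    g.linearIsometryEquiv u ≠ 0 := by
  rw [← norm_pos_iff, norm_linear]; exact norm_pos_iff.2 hu

/-- The directions of the translations in the group generated by the reflections, and their
images. -/
def directions (T : Billiard ι) : Set Plane :=
  (fun z : (Plane ≃ᵃⁱ[ℝ] Plane) × (Plane ≃ᵃⁱ[ℝ] Plane) => z.1.linearIsometryEquiv (z.2 0)) ''
    (T.products ×ˢ T.products)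

theorem countable_directions [Finite ι] : T.directions.Countable :=
  (countable_products.prod countable_products).image _

/-- The line is parallel to a translation in the countable group generated by the reflections. So
lines with eventually periodic sequences have only countably many directions, which a generic
rotation avoids. -/
theorem EvPer.exists_direction [Finite ι] (h : EvPer F) {p u : Plane} (hu : u ≠ 0)
    (hx : ∀ n, (p, u) ∈ T.R F 0 n) {g : Plane ≃ᵃⁱ[ℝ] Plane} (hg : g ∈ T.products) :
    ∃ r : ℝ, 0 < r ∧ r • g.linearIsometryEquiv u ∈ T.directions := by
  obtain ⟨P, hP, I, hI, h⟩ := h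
  have h' : ∀ i, 0 ≤ i → Billiard.shift I F (i + P) = Billiard.shift I F i := fun i hi => by
    rw [Billiard.shift, Billiard.shift, ← add_assoc, h _ (by omega)]
  have hf : T.Fwd (Billiard.shift I F) 0 (act (T.frame F I)⁻¹ (p, ‖u‖⁻¹ • u)) :=
    fwd_shift.2 ((fwd_normalize hu hx).mono (by omega))
  obtain ⟨r, hr, htr⟩ := hf.exists_translation hP h'
  refine ⟨r * ‖u‖⁻¹, by positivity, (g * T.frame F I, T.frame (Billiard.shift I F) (2 * P)),
    ⟨mul_mem_products hg (frame_mem_products _ _), frame_mem_products _ _⟩, ?_⟩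
  dsimp only
  rw [htr, zero_add, linear_mul, map_smul, linear_apply_inv, map_smul, map_smul, smul_smul]

/-- A forward line that does not follow the edges itself produces sequences of edges that branch
backward. -/
theorem Fwd.exists_words [Finite ι] {x : Plane × Plane} (hx : T.Fwd F 0 x) {N : ℤ}
    (hN : x ∉ T.R F 0 N) : ∃ I : ℤ, ∀ n : ℤ, ∃ J : ℤ, 0 ≤ J ∧ J < I ∧ ∃ (φ : ℤ → ι) (b : ι),
      (∀ i ≤ n, φ i = F i) ∧ ¬ EvPer φ ∧ (∀ M, (T.R φ 0 M).Nonempty) ∧ b ≠ F J ∧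
      ∀ ψ : ℤ → ι, ψ J = b → (∀ i, J < i → ψ i = φ i) →
        ∀ M, (T.R (Billiard.shift (J + 1) ψ) (-1) M).Nonempty := by
  obtain ⟨s, t, N₀, hs, hline⟩ := hx.exists_pivot_lines hN
  obtain ⟨I, hI, hfar⟩ := hx.hits_gt t
  refine ⟨I, fun n => ?_⟩
  have hs0 : s ≠ 0 := by rcases hs with rfl | rfl <;> norm_num
  set n' := max n (max I N₀) + 2 with hn'
  set X := x.1 + t • x.2 with hX
  -- The angle is chosen to avoid two countable sets of directions: those allowing eventually
  -- periodic sequences, and those joining the pivot `X` to another unfolded vertex. So `X` is the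
  -- only vertex that the rotated line can meet.
  obtain ⟨θ, ⟨hcl, hnot⟩, hgen⟩ := exists_rotation hx.ne_zero hs0
    (countable_directions (T := T) |>.union ((countable_orbitVerts (T := T)).image (fun v => v - X)))
    (hline n')
  obtain ⟨lam, hlam⟩ : ∃ y, y = tilt x (θ * (s * t)) (-(θ * s)) := ⟨_, rfl⟩
  rw [← hlam] at hcl hnot
  have hpt : ∀ τ : ℝ, lam.1 + τ • lam.2 = X + (τ - t) • lam.2 := by
    intro τ; rw [hlam, hX]; simp only [tilt]; module
  have hw : lam.2 = x.2 + (-(θ * s)) • quarter x.2 := by rw [hlam, tilt]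
  rw [← hw] at hgen
  have hin : ∀ τ : ℝ, inner ℝ (lam.1 + τ • lam.2 - x.1) x.2 = τ := by
    intro τ
    have : lam.1 + τ • lam.2 - x.1 = τ • x.2 + (θ * (s * t) - τ * (θ * s)) • quarter x.2 := by
      rw [hlam]; simp only [tilt]; module
    rw [this, inner_add_left, real_inner_smul_left, real_inner_smul_left, inner_quarter,
      real_inner_self_eq_norm_sq, hx.1]
    ring
  have hw0 : lam.2 ≠ 0 := by
    intro h0
    have h1 := hin 0
    have h2 := hin 1
    rw [h0] at h1 h2
    simp only [smul_zero] at h1 h2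
    linarith
  -- the only vertex on the line is at the parameter `t`
  have hvert : ∀ τ : ℝ, lam.1 + τ • lam.2 ∈ T.orbitVerts → τ = t := by
    intro τ hτ
    by_contra hne
    have h1 := hgen _ (Or.inr ⟨_, hτ, rfl⟩)
    dsimp only at h1
    rw [hpt, add_sub_cancel_left] at h1
    refine h1 (smul_ne_zero (sub_ne_zero.2 hne) hw0) ?_
    rw [cross_smul, cross_same, mul_zero]
  -- The copies met from time `I` on lie beyond abscissa `t`, so `X` is not a vertex of theirs and
  -- the limit line follows their flights.
  have hbadI : ∀ i, 0 ≤ i → i < n' → act (T.frame F i)⁻¹ lam ∉ T.C (F i) (F (i + 1)) → i < I := by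
    intro i h0 h1 h2
    by_contra hiI
    refine h2 (mem_R_of_closure hcl hw0 h0 h1 fun τ hτ => ?_)
    have h3 := hvert τ (mem_orbitVerts hτ)
    obtain ⟨a, ha⟩ := verts_seg hτ
    have h4 := hfar i (not_lt.1 hiI) a _ ha
    rw [hin, h3] at h4
    exact lt_irrefl _ h4
  -- the last flight that the line does not follow
  obtain ⟨J, ⟨hJ0, hJn, hJ⟩, hJmax⟩ : ∃ J ∈ {i : ℤ | 0 ≤ i ∧ i < n' ∧
      act (T.frame F i)⁻¹ lam ∉ T.C (F i) (F (i + 1))}, ∀ i ∈ {i : ℤ | 0 ≤ i ∧ i < n' ∧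
      act (T.frame F i)⁻¹ lam ∉ T.C (F i) (F (i + 1))}, i ≤ J := by
    have hfin : {i : ℤ | 0 ≤ i ∧ i < n' ∧
        act (T.frame F i)⁻¹ lam ∉ T.C (F i) (F (i + 1))}.Finite :=
      (Set.finite_Ico 0 n').subset fun i hi => ⟨hi.1, hi.2.1⟩
    have hne : {i : ℤ | 0 ≤ i ∧ i < n' ∧
        act (T.frame F i)⁻¹ lam ∉ T.C (F i) (F (i + 1))}.Nonempty := by
      by_contra hcon
      rw [Set.not_nonempty_iff_eq_empty, Set.eq_empty_iff_forall_notMem] at hcon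
      refine hnot fun i h1 h2 => ?_
      by_contra h3
      exact hcon i ⟨h1, by omega, h3⟩
    exact ⟨_, hne.csSup_mem hfin, fun i hi => le_csSup hfin.bddAbove hi⟩
  have hJI := hbadI J hJ0 hJn hJ
  have hlate : lam ∈ T.R F (J + 1) n' := by
    intro i h1 h2
    by_contra h3
    have := hJmax i ⟨by omega, h2, h3⟩
    omega
  set g := T.frame F (J + 1) with hg
  obtain ⟨p, u⟩ := lam
  dsimp only at hpt hin hw0 hvert hgen
  have h0 : act g⁻¹ (p, u) ∈ T.R (Billiard.shift (J + 1) F) 0 (n' - (J + 1)) :=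
    mem_R_shift.2 (by simpa using hlate)
  obtain ⟨σ, hσ, -⟩ := exists_crossing (by omega) h0
  have hσt : t < σ := by
    have h2 : T.frame F n' = g * T.frame (Billiard.shift (J + 1) F) (n' - (J + 1)) := by
      rw [hg, ← frame_add]; congr 1; ring
    rw [← map_add_smul'] at hσ
    have h3 : (T.frame F n')⁻¹ (p + σ • u) ∈ T.seg (Billiard.shift (J + 1) F (n' - (J + 1))) := by
      rw [h2, mul_inv_rev]
      exact openSegment_subset_segment _ _ _ hσ
    have := hfar n' (by omega) _ _ h3
    rwa [hin] at this
  -- Beyond `X` the line meets no vertex, so it follows some sequence forever; `φ` is this sequence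
  -- renumbered, with the entries of `F` before.
  obtain ⟨Φ, hΦ, hΦR⟩ := exists_forward le_rfl (by omega) h0 hσ fun τ hτ hτv => by
    rw [← map_add_smul'] at hτv
    have h2 := apply_mem_orbitVerts (T := T) (frame_mem_products F (J + 1)) hτv
    rw [apply_inv_self'] at h2
    have := hvert τ h2
    linarith
  set φ := Billiard.shift (-(J + 1)) Φ with hφdef
  have hshφ : Billiard.shift (J + 1) φ = Φ := by
    funext i; simp only [hφdef, Billiard.shift]; congr 1; ring
  have hφ : ∀ i ≤ n', φ i = F i := by
    intro i hi
    rw [hφdef, Billiard.shift, hΦ _ (by omega), Billiard.shift]; congr 1; ring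
  have hfr : ∀ i ≤ n', T.frame φ i = T.frame F i := fun i hi =>
    frame_congr fun j _ h2 => hφ j (by omega)
  have hφR : ∀ k, (p, u) ∈ T.R φ (J + 1) k := by
    intro k
    have h2 := hΦR (k - (J + 1))
    rw [← hshφ, hg, ← hfr (J + 1) (by omega)] at h2
    simpa using mem_R_shift.1 h2
  have hΦ0 : Φ 0 = F (J + 1) := by
    rw [hΦ 0 (by omega), Billiard.shift, add_zero]
  have hnper : ¬ EvPer φ := by
    intro hE
    rw [hφdef, evPer_shift] at hE
    obtain ⟨r, hr, hmem⟩ := hE.exists_direction (linear_ne_zero hw0) hΦR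
      (frame_mem_products F (J + 1))
    rw [← hg, linear_apply_inv] at hmem
    refine hgen _ (Or.inl hmem) (smul_ne_zero hr.ne' hw0) ?_
    rw [cross_smul, cross_same, mul_zero]
  have hne : ∀ M, (T.R φ 0 M).Nonempty := by
    intro M
    rw [← R_congr (F := φ) fun i _ h2 => hφ i (by omega)] at hcl
    obtain ⟨y, hy1, hy2⟩ := mem_closure_iff.1 hcl _ (isOpen_R φ (J + 1) M) (hφR M)
    refine ⟨y, fun i h1 h2 => ?_⟩
    rcases lt_or_ge i n' with h3 | h3
    exacts [hy2 i h1 h3, hy1 i (by omega) h2]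
  -- nearby lines come from another edge before
  have hback : ∀ M : ℕ, ∃ b ≠ F J, ∀ ψ : ℤ → ι, ψ J = b → (∀ i, J < i → ψ i = φ i) →
      (T.R (Billiard.shift (J + 1) ψ) (-1) (M + 1)).Nonempty := by
    intro M
    have hJR : (p, u) ∉ T.R F J (J + 1) := fun h => hJ (h J le_rfl (by omega))
    -- The line itself fails flight number `J`, so by `mem_R_of_tilt` there are arbitrarily close
    -- lines off the vertices that fail it too. They still follow `φ` for a long time after `J`, and
    -- their preceding edge cannot be `F J`.
    have hfreq : ∃ᶠ z : ℝ × ℝ in 𝓝 0, ¬((∀ τ ∈ T.hits F J (J + 1) (p, u), z.1 + z.2 * τ ≠ 0) →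
        z ≠ 0 → tilt (p, u) z.1 z.2 ∈ T.R F J (J + 1)) := by
      rw [← not_eventually]
      exact fun h => hJR (mem_R_of_tilt hw0 (finite_hits hw0) h)
    have hopen := (tilt_tendsto (p, u)).eventually ((isOpen_R φ (J + 1) (J + 1 + (M + 1))).mem_nhds (hφR _))
    obtain ⟨z, hz1, hz2, hz3⟩ := (hfreq.and_eventually (hopen.and
      (tilt_placed (T := T) (F := F) (m := J) (n := J + 1) (x := (p, u)) hw0))).exists
    push Not at hz1
    obtain ⟨hz1, -, hz4⟩ := hz1
    have hk : act g⁻¹ (tilt (p, u) z.1 z.2) ∈ T.R Φ 0 (M + 1) := by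
      rw [hg, ← hfr (J + 1) (by omega), ← hshφ]
      exact mem_R_shift.2 (by rw [add_zero]; exact hz2)
    have hgJ : ∀ y, T.refl (Φ 0) (g⁻¹ y) = (T.frame F J)⁻¹ y := fun y => by
      rw [hΦ0, hg, ← frame_inv_succ]
    obtain ⟨b, hb, hbR⟩ := exists_backward (by omega) hk fun τ hτ => by
      simp only [act] at hτ
      rw [← map_add_smul', hgJ] at hτ
      obtain ⟨h5, h6⟩ := hz3.2 τ ⟨J, le_rfl, by omega, hτ⟩
      exact hz1 τ h5 h6
    refine ⟨b, fun hbJ => hz4 fun i h1 h2 => ?_, fun ψ h1 h2 => ⟨_, hbR _ ?_ fun i hi => ?_⟩⟩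
    · obtain rfl : i = J := by omega
      rw [← act_mul, hbJ, hΦ0] at hb
      have : T.refl (F (i + 1)) * g⁻¹ = (T.frame F i)⁻¹ := by
        rw [hg, frame_succ, mul_inv_rev, refl_inv, ← mul_assoc, T.refl_sq, one_mul]
      rwa [this] at hb
    · rw [Billiard.shift, ← h1]; congr 1; ring
    · rw [Billiard.shift, h2 _ (by omega), hφdef, Billiard.shift]; congr 1; ring
  choose b hb hbR using hback
  -- The preceding edge found depends on the length `M`; as there are finitely many edges, one of
  -- them serves for arbitrarily large `M`.
  obtain ⟨b₀, hb₀⟩ := (hyperfilter ℕ).exists_eq b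
  refine ⟨J, hJ0, hJI, φ, b₀, fun i hi => hφ i (by omega), hnper, hne, ?_, fun ψ h1 h2 M => ?_⟩
  · obtain ⟨k, hk⟩ := hb₀.exists
    exact hk ▸ hb k
  · obtain ⟨k, hk, hkM⟩ := (hb₀.and
      (Nat.hyperfilter_le_atTop (eventually_ge_atTop M.toNat))).exists
    exact (hbR k ψ (h1.trans hk.symm) h2).mono (R_mono le_rfl (by omega))

end Billiard

/-! ### The equivalence for abstract billiards -/

namespace Billiard

variable {ι : Type*} {T : Billiard ι} {F F' : ℤ → ι}

/-- Compactness: unit lines following `k + 1` edges, slid to the edge number `0`, have a limit. -/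
theorem exists_fwd [Finite ι] (h : ∀ n, (T.R F 0 n).Nonempty) : ∃ x, T.Fwd F 0 x := by
  have hex : ∀ k : ℕ, ∃ x : Plane × Plane, ‖x.2‖ = 1 ∧ x ∈ T.R F 0 (k + 1) := by
    intro k
    obtain ⟨⟨p, u⟩, hx⟩ := h (k + 1)
    have hu := ne_zero_of_mem_R (by omega) hx
    dsimp only at hu
    refine ⟨(p, ‖u‖⁻¹ • u), by simp [norm_smul, hu], ?_⟩
    have := (mem_R_slide (T := T) (F := F) (m := 0) (n := k + 1) (p := p) (u := u) (s := 0)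
      (r := ‖u‖⁻¹) (by positivity)).2 hx
    simpa using this
  choose x hx hxR using hex
  obtain ⟨K, y, σ, hK, hlim, hy⟩ := exists_limit (T := T) (hyperfilter ℕ) (fun _ => F) x
    (Eventually.of_forall hx)
    (Eventually.of_forall fun k => subset_closure (R_mono le_rfl (by omega) (hxR k)))
  obtain rfl : F = K := by
    funext i; exact (hK i).exists.choose_spec
  refine ⟨y, hy, fun n => closure_R_congr_of_tendsto hK hlim ?_⟩
  filter_upwards [Nat.hyperfilter_le_atTop (eventually_ge_atTop n.toNat)] with k hk
  exact subset_closure (mem_R_slide'.2 (R_mono le_rfl (by omega) (hxR k)))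

theorem nonempty_R_shift {k m n : ℤ} :
    (T.R (Billiard.shift k F) m n).Nonempty ↔ (T.R F (k + m) (k + n)).Nonempty := by
  constructor
  · rintro ⟨y, hy⟩
    refine ⟨act (T.frame F k) y, ?_⟩
    rwa [← mem_R_shift, act_inv_act]
  · rintro ⟨y, hy⟩
    exact ⟨_, mem_R_shift.2 hy⟩

/-- A forward line does not follow an edge if the sequence can branch there backward. -/
theorem Fwd.not_mem_of_branch [Finite ι] {φ ψ : ℤ → ι} {J : ℤ} (hJ : 0 ≤ J) (hper : ¬ EvPer φ)
    {x : Plane × Plane} (hx : T.Fwd φ 0 x) (hne : ψ J ≠ φ J) (hψ : ∀ i, J < i → ψ i = φ i)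
    {y : Plane × Plane} (hy : T.Fwd ψ J y) : x ∉ T.R φ J (J + 1) := by
  intro hmem
  set Φ := Billiard.shift (J + 1) φ with hΦ
  set Ψ := Billiard.shift (J + 1) ψ with hΨ
  have hag : ∀ i, 0 ≤ i → Ψ i = Φ i := fun i hi => hψ _ (by omega)
  have h1 : T.Fwd Φ 0 (act (T.frame φ (J + 1))⁻¹ x) := fwd_shift.2 (hx.mono (by omega))
  have h2 : T.Fwd Ψ (-1) (act (T.frame ψ (J + 1))⁻¹ y) := fwd_shift.2 (by simpa using hy)
  have h3 : T.Fwd Φ 0 (act (T.frame ψ (J + 1))⁻¹ y) :=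
    (fwd_congr le_rfl hag).1 (h2.mono (by omega))
  -- By uniqueness the lines of `φ` and of `ψ` coincide after time `J`. If this line really followed
  -- flight `J` of `φ`, so would all nearby lines, including those following `ψ`, and determinism
  -- backward would give `ψ J = φ J`.
  obtain ⟨r, hr⟩ := h1.eq_slide h3 fun k => by rwa [evPer_shift, hΦ, evPer_shift]
  have h4 : act (T.frame φ (J + 1))⁻¹ x ∈ T.R Φ (-1) 0 := mem_R_shift.2 (by simpa using hmem)
  have h5 : act (T.frame ψ (J + 1))⁻¹ y ∈ T.R Φ (-1) 0 := by rw [hr]; exact mem_R_slide'.2 h4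
  obtain ⟨z, hz1, hz2⟩ := mem_closure_iff.1 (h2.2 0) _ (isOpen_R _ _ _) h5
  have h6 := R_determ' hz2 hz1 (hag 0 le_rfl) (-1) le_rfl (by omega)
  simp only [hΦ, hΨ, Billiard.shift, add_neg_cancel_right] at h6
  exact hne h6

/-- If the forward sequence is eventually periodic, it is the forward half of a periodic two-sided
one. Otherwise a failure in `T'` yields words `φ n` close to `F` with two pasts at a time `J n < I`.
Both tables have the same finite words, so in `T` the lines of `φ n` are singular at time `J n`,
while their limit is the nonsingular line `x`. -/
theorem fOrb_of_orb [Finite ι] {T' : Billiard ι} (h : ∀ F, T.Orb F ↔ T'.Orb F) (hF : T.FOrb F) :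
    T'.FOrb F := by
  obtain ⟨x, hx, hxR⟩ := hF
  by_cases hE : EvPer F
  · obtain ⟨G, Q, hQ, hper, hG⟩ := hE.exists_periodic_of_mem
    have hFG := hG T x 0 le_rfl hx hxR
    have h1 : ∀ n, x ∈ T.R G 0 n := fun n => by
      rw [← R_congr fun i hi _ => hFG i (by simpa using hi)]; exact hxR n
    obtain ⟨y, hy, hyR⟩ := (h G).1 ⟨x, hx, mem_R_of_periodic hQ hper hx h1⟩
    refine ⟨y, hy, fun n => ?_⟩
    rw [R_congr fun i hi _ => hFG i (by simpa using hi)]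
    exact hyR 0 n
  obtain ⟨y, hy⟩ := exists_fwd fun n => nonempty_R_of_orb (fun G => (h G).1) ⟨x, hxR n⟩
  by_contra hcon
  obtain ⟨N, hN⟩ : ∃ N, y ∉ T'.R F 0 N := by
    by_contra hall
    push Not at hall
    exact hcon ⟨y, hy.1, hall⟩
  obtain ⟨I, hwords⟩ := hy.exists_words hN
  choose J hJ0 hJI φ b hφ hnper hφne hb hψne using fun n : ℕ => hwords (I + n)
  have htr : ∀ (G : ℤ → ι) n, (T'.R G 0 n).Nonempty → (T.R G 0 n).Nonempty := fun G n =>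
    nonempty_R_of_orb fun G => (h G).2
  choose t ht using fun n => exists_fwd (T := T) fun M => htr _ _ (hφne n M)
  -- The branched sequence `ψ` has forward lines in `T` as well, because its finite words occur in
  -- `T'`.
  have hbranch : ∀ n, t n ∉ T.R F (J n) (J n + 1) := by
    intro n
    classical
    let ψ := Function.update (φ n) (J n) (b n)
    have hψ1 : ψ (J n) = b n := Function.update_self _ _ _
    have hψ2 : ∀ i, J n < i → ψ i = φ n i := fun i hi => Function.update_of_ne (by omega) _ _
    have h1 : ∀ M, (T'.R (Billiard.shift (J n) ψ) 0 M).Nonempty := by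
      intro M
      have h2 := nonempty_R_shift.1 (hψne n ψ hψ1 hψ2 M)
      rw [nonempty_R_shift]
      exact h2.mono (R_mono (by omega) (by omega))
    obtain ⟨z, hz⟩ := exists_fwd (T := T) fun M => htr _ _ (h1 M)
    have h3 : T.Fwd ψ (J n) (act (T.frame ψ (J n)) z) := by
      have := fwd_shift (T := T) (F := ψ) (k := J n) (m := 0) (x := act (T.frame ψ (J n)) z)
      rw [act_inv_act, add_zero] at this
      exact this.1 hz
    have hJn := hJI n
    have hJn0 := hJ0 n
    rw [R_congr (F' := φ n) fun i hi1 hi2 => (hφ n i (by omega)).symm]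
    exact (ht n).not_mem_of_branch (hJ0 n) (hnper n)
      (by rw [hψ1, hφ n _ (by omega)]; exact hb n) hψ2 h3
  obtain ⟨K, z, σ, hK, hlim, hz⟩ := exists_limit (T := T) (hyperfilter ℕ) φ t
    (Eventually.of_forall fun n => (ht n).1) (Eventually.of_forall fun n => (ht n).2 1)
  obtain rfl : F = K := by
    funext i
    obtain ⟨n, hn, hni⟩ := ((hK i).and
      (Nat.hyperfilter_le_atTop (eventually_ge_atTop (i - I).toNat))).exists
    rw [← hn, hφ n i (by omega)]
  have hzF : T.Fwd F 0 z := by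
    refine ⟨hz, fun n => closure_R_congr_of_tendsto hK hlim (Eventually.of_forall fun k => ?_)⟩
    exact (fwd_slide.2 (ht k)).2 n
  -- The singular times `J n` are bounded, so one value `j` occurs along the ultrafilter. The limit
  -- of the lines is `x` up to sliding, by uniqueness; `x` follows flight `j`, an open condition
  -- that the nearby lines violate.
  obtain ⟨⟨j, hj0, hjI⟩, hj⟩ := (hyperfilter ℕ).exists_eq
    fun n => (⟨J n, hJ0 n, hJI n⟩ : Set.Ico 0 I)
  obtain ⟨r, hr⟩ := (fwd_of_mem hx hxR).eq_slide hzF fun k => by rwa [evPer_shift]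
  have hzR : z ∈ T.R F j (j + 1) := by
    rw [hr]; exact mem_R_slide'.2 (R_mono hj0 le_rfl (hxR _))
  obtain ⟨n, h1, h2⟩ := (hj.and (hlim.eventually ((isOpen_R _ _ _).mem_nhds hzR))).exists
  have h3 : J n = j := congrArg Subtype.val h1
  rw [← h3] at h2
  exact hbranch n (mem_R_slide'.1 h2)

/-- Two tables have the same two-sided sequences of edges if and only if they have the same
forward sequences. -/
theorem orb_iff_fOrb [Finite ι] {T' : Billiard ι} :
    (∀ F, T.Orb F ↔ T'.Orb F) ↔ ∀ F, T.FOrb F ↔ T'.FOrb F :=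
  ⟨fun h _ => ⟨fOrb_of_orb h, fOrb_of_orb fun F => (h F).symm⟩,
    fun h _ => ⟨orb_of_fOrb fun F => (h F).1, orb_of_fOrb fun F => (h F).2⟩⟩

/-- Every edge is hit by a two-sided line. -/
theorem exists_orb [Finite ι] (T : Billiard ι) (a : ι) : ∃ F, F 0 = a ∧ T.Orb F := by
  classical
  have hne : T.B a - T.A a ≠ 0 := sub_ne_zero.2 (T.ne a).symm
  obtain ⟨w, hw⟩ : ∃ w, 0 < (T.l a).linear w := by
    have h0 : (T.l a).linear (quarter (T.B a - T.A a)) ≠ 0 := by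
      intro h
      obtain ⟨r, hr⟩ := T.l_zero a (T.A a + (1 : ℝ) • quarter (T.B a - T.A a))
        (by rw [AffineMap.apply_add_smul, h, T.l_A]; ring)
      rw [one_smul, add_right_inj] at hr
      have := cross_quarter (T.B a - T.A a)
      rw [hr, cross_smul, cross_same, mul_zero] at this
      exact hne (norm_eq_zero.1 (pow_eq_zero_iff two_ne_zero |>.1 this.symm))
    rcases lt_or_gt_of_ne h0 with h | h
    · exact ⟨-quarter (T.B a - T.A a), by rw [map_neg]; linarith⟩
    · exact ⟨_, h⟩
  set p := AffineMap.lineMap (k := ℝ) (T.A a) (T.B a) (1 / 2 : ℝ) with hp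
  have hpE : p ∈ T.E a := by
    refine mem_openSegment_iff.2 ⟨1 / 2, by norm_num, by norm_num, ?_⟩
    rw [hp, AffineMap.lineMap_apply, vsub_eq_sub, vadd_eq_add, add_comm]
  have hw0 : w ≠ 0 := by rintro rfl; simp at hw
  have hfin : T.verts.Finite := (Set.finite_range _).union (Set.finite_range _)
  have hlin : ∀ᶠ θ : ℝ in 𝓝[>] 0, 0 < (T.l a).linear (w + (-(θ * 1)) • quarter w) := by
    have hc : Continuous fun θ : ℝ => (T.l a).linear (w + (-(θ * 1)) • quarter w) :=
      (linear_continuous _).comp (by fun_prop)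
    exact (hc.tendsto' 0 _ (by simp) |>.mono_left nhdsWithin_le_nhds).eventually (lt_mem_nhds hw)
  obtain ⟨θ, h1, h2⟩ := exists_rotation hw0 one_ne_zero (hfin.image fun v => v - p).countable hlin
  set u := w + (-(θ * 1)) • quarter w
  have hu : u ≠ 0 := by intro h; rw [h] at h1; simp at h1
  obtain ⟨b, hb⟩ := exists_mem_C hpE h1 fun s hs b => by
    have key : p + s • u ∉ T.verts := by
      intro hv
      have := h2 _ ⟨_, hv, rfl⟩
      dsimp only at this
      rw [add_sub_cancel_left] at this
      refine this (smul_ne_zero hs.ne' hu) ?_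
      rw [cross_smul, cross_same, mul_zero]
    exact ⟨fun h => key (Or.inl ⟨b, h.symm⟩), fun h => key (Or.inr ⟨b, h.symm⟩)⟩
  let F : ℤ → ι := Function.update (fun _ => a) 1 b
  have hF0 : F 0 = a := Function.update_of_ne (by norm_num) _ _
  have hF1 : F 1 = b := Function.update_self _ _ _
  have hR : (p, u) ∈ T.R F 0 1 := by
    intro i h3 h4
    obtain rfl : i = 0 := by omega
    rw [zero_add, hF0, hF1]
    exact hb
  obtain ⟨q, hq, hv⟩ := exists_generic (isOpen_R _ _ _) hR hu (countable_orbitVerts (T := T))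
  obtain ⟨G, h3, h4⟩ := exists_two_sided one_pos hq hv
  refine ⟨G, (h3 0 le_rfl zero_le_one).trans hF0, (q, ‖u‖⁻¹ • u), by simp [norm_smul, hu],
    fun m k => ?_⟩
  have := (mem_R_slide (T := T) (F := G) (m := m) (n := k) (p := q) (u := u) (s := 0)
    (r := ‖u‖⁻¹) (by positivity)).2 (h4 m k)
  simpa using this

end Billiard

/-! ### Barycentric coordinates in the triangles -/

namespace PolygonalTable

variable {V 𝒜 : Type*} {P : PolygonalTable V 𝒜}

/-- The vertices of a triangle as an affine basis of the plane. -/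
noncomputable def basis (P : PolygonalTable V 𝒜) (f : Finset V) (hf : f ∈ P.faces) :
    AffineBasis f ℝ Plane where
  toFun v := P.pos v
  ind' := P.nondegenerate f hf
  tot' := by
    rw [(P.nondegenerate f hf).affineSpan_eq_top_iff_card_eq_finrank_add_one]
    simp [P.card_face f hf]

open Classical in
/-- The barycentric coordinates in the triangle `f`. -/
noncomputable def bary (P : PolygonalTable V 𝒜) (f : Finset V) (v : V) : Plane →ᵃ[ℝ] ℝ :=
  if h : f ∈ P.faces ∧ v ∈ f then (P.basis f h.1).coord ⟨v, h.2⟩ else 0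

theorem bary_eq {f : Finset V} (hf : f ∈ P.faces) (v : f) : P.bary f v = (P.basis f hf).coord v := by
  rw [bary, dif_pos ⟨hf, v.2⟩]

theorem bary_self {f : Finset V} (hf : f ∈ P.faces) {v : V} (hv : v ∈ f) :
    P.bary f v (P.pos v) = 1 := by
  rw [bary_eq hf ⟨v, hv⟩]
  exact (P.basis f hf).coord_apply_eq ⟨v, hv⟩

theorem bary_ne {f : Finset V} (hf : f ∈ P.faces) {v w : V} (hv : v ∈ f) (hw : w ∈ f) (h : v ≠ w) :
    P.bary f v (P.pos w) = 0 := by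
  rw [bary_eq hf ⟨v, hv⟩]
  exact (P.basis f hf).coord_apply_ne (i := ⟨v, hv⟩) (j := ⟨w, hw⟩) (by simpa using h)

theorem sum_bary {f : Finset V} (hf : f ∈ P.faces) (x : Plane) : ∑ v ∈ f, P.bary f v x = 1 := by
  rw [← Finset.sum_coe_sort, ← (P.basis f hf).sum_coord_apply_eq_one x]
  exact Finset.sum_congr rfl fun v _ => by rw [bary_eq hf]

theorem sum_bary_smul {f : Finset V} (hf : f ∈ P.faces) (x : Plane) :
    ∑ v ∈ f, P.bary f v x • P.pos v = x := by
  rw [← Finset.sum_coe_sort]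
  conv_rhs => rw [← (P.basis f hf).linear_combination_coord_eq_self x]
  exact Finset.sum_congr rfl fun v _ => by rw [bary_eq hf]; rfl

theorem range_basis {f : Finset V} (hf : f ∈ P.faces) :
    Set.range (P.basis f hf) = P.pos '' (f : Set V) := by
  ext x
  constructor
  · rintro ⟨v, rfl⟩; exact ⟨v, v.2, rfl⟩
  · rintro ⟨v, hv, rfl⟩; exact ⟨⟨v, hv⟩, rfl⟩

theorem mem_tri_iff {f : Finset V} (hf : f ∈ P.faces) {x : Plane} :
    x ∈ interior (convexHull ℝ (P.pos '' (f : Set V))) ↔ ∀ v ∈ f, 0 < P.bary f v x := by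
  rw [← range_basis hf, AffineBasis.interior_convexHull]
  constructor
  · intro h v hv; rw [bary_eq hf ⟨v, hv⟩]; exact h ⟨v, hv⟩
  · intro h v; rw [← bary_eq hf]; exact h v v.2

theorem mem_hull_iff {f : Finset V} (hf : f ∈ P.faces) {x : Plane} :
    x ∈ convexHull ℝ (P.pos '' (f : Set V)) ↔ ∀ v ∈ f, 0 ≤ P.bary f v x := by
  rw [← range_basis hf, AffineBasis.convexHull_eq_nonneg_coord]
  constructor
  · intro h v hv; rw [bary_eq hf ⟨v, hv⟩]; exact h ⟨v, hv⟩
  · intro h v; rw [← bary_eq hf]; exact h v v.2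

theorem exists_opposite {f e : Finset V} (hf : f ∈ P.faces) (hef : e ⊆ f) (he : e.card = 2) :
    ∃ c ∈ f, c ∉ e ∧ ∀ v ∈ f, v ∉ e → v = c := by
  classical
  have h := Finset.card_sdiff_of_subset hef
  rw [P.card_face f hf, he] at h
  obtain ⟨c, hc⟩ := Finset.card_eq_one.1 h
  have hmem : ∀ v, v ∈ f \ e ↔ v = c := fun v => by rw [hc, Finset.mem_singleton]
  have h1 := Finset.mem_sdiff.1 ((hmem c).2 rfl)
  exact ⟨c, h1.1, h1.2, fun v h2 h3 => (hmem v).1 (Finset.mem_sdiff.2 ⟨h2, h3⟩)⟩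

theorem bary_segment {f : Finset V} (v a b : V) (t : ℝ) :
    P.bary f v (P.pos a + t • (P.pos b - P.pos a)) =
      (1 - t) * P.bary f v (P.pos a) + t * P.bary f v (P.pos b) := AffineMap.apply_lineMap' _ _ _ _

theorem mem_segment_iff_bary {f : Finset V} (hf : f ∈ P.faces) {a b : V} (ha : a ∈ f) (hb : b ∈ f)
    (hab : a ≠ b) {x : Plane} : x ∈ segment ℝ (P.pos a) (P.pos b) ↔
      0 ≤ P.bary f a x ∧ 0 ≤ P.bary f b x ∧ ∀ v ∈ f, v ≠ a → v ≠ b → P.bary f v x = 0 := by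
  classical
  constructor
  · intro h
    obtain ⟨t, t0, t1, rfl⟩ := mem_segment_iff.1 h
    refine ⟨?_, ?_, fun v hv hva hvb => ?_⟩
    · rw [bary_segment, bary_self hf ha, bary_ne hf ha hb hab]; linarith
    · rw [bary_segment, bary_self hf hb, bary_ne hf hb ha hab.symm]; linarith
    · rw [bary_segment, bary_ne hf hv ha hva, bary_ne hf hv hb hvb]; ring
  · rintro ⟨h1, h2, h3⟩
    have hsub : ({a, b} : Finset V) ⊆ f := by
      intro v hv
      rcases Finset.mem_insert.1 hv with rfl | hv
      · exact ha
      · rwa [Finset.mem_singleton.1 hv]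
    have hz : ∀ v ∈ f, v ∉ ({a, b} : Finset V) → P.bary f v x = 0 := fun v hv hn => by
      simp only [Finset.mem_insert, Finset.mem_singleton, not_or] at hn
      exact h3 v hv hn.1 hn.2
    have e1 := sum_bary hf x
    have e2 := sum_bary_smul hf x
    rw [← Finset.sum_subset hsub hz, Finset.sum_pair hab] at e1
    rw [← Finset.sum_subset hsub fun v hv hn => by rw [hz v hv hn, zero_smul],
      Finset.sum_pair hab] at e2
    exact ⟨_, _, h1, h2, e1, e2⟩

theorem mem_openSegment_iff_bary {f : Finset V} (hf : f ∈ P.faces) {a b : V} (ha : a ∈ f) (hb : b ∈ f)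
    (hab : a ≠ b) {x : Plane} : x ∈ openSegment ℝ (P.pos a) (P.pos b) ↔
      0 < P.bary f a x ∧ 0 < P.bary f b x ∧ ∀ v ∈ f, v ≠ a → v ≠ b → P.bary f v x = 0 := by
  constructor
  · intro h
    refine ⟨?_, ?_, ((mem_segment_iff_bary hf ha hb hab).1 (openSegment_subset_segment _ _ _ h)).2.2⟩
    all_goals obtain ⟨t, t0, t1, rfl⟩ := mem_openSegment_iff.1 h
    · rw [bary_segment, bary_self hf ha, bary_ne hf ha hb hab]; linarith
    · rw [bary_segment, bary_self hf hb, bary_ne hf hb ha hab.symm]; linarith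
  · rintro ⟨h1, h2, h3⟩
    have h := (mem_segment_iff_bary hf ha hb hab).2 ⟨h1.le, h2.le, h3⟩
    refine mem_openSegment_of_ne_left_right ?_ ?_ h
    · rintro rfl; rw [bary_ne hf hb ha hab.symm] at h2; exact lt_irrefl _ h2
    · rintro rfl; rw [bary_ne hf ha hb hab] at h1; exact lt_irrefl _ h1

theorem openEdge_eq {e : Finset V} {a b : V} (he : ∀ v, v ∈ e ↔ v = a ∨ v = b) (hab : a ≠ b) :
    P.openEdge e = openSegment ℝ (P.pos a) (P.pos b) := by
  ext x
  constructor
  · rintro ⟨v, hv, w, hw, hvw, hx⟩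
    rcases (he v).1 hv with rfl | rfl <;> rcases (he w).1 hw with rfl | rfl
    · exact absurd rfl hvw
    · exact hx
    · rwa [openSegment_symm]
    · exact absurd rfl hvw
  · exact fun hx => ⟨a, (he a).2 (Or.inl rfl), b, (he b).2 (Or.inr rfl), hab, hx⟩

theorem exists_pair {e : Finset V} (he : e.card = 2) :
    ∃ a b, a ≠ b ∧ ∀ v, v ∈ e ↔ v = a ∨ v = b := by
  classical
  obtain ⟨a, b, hab, rfl⟩ := Finset.card_eq_two.1 he
  exact ⟨a, b, hab, by simp⟩

theorem mem_openEdge_iff {f e : Finset V} (hf : f ∈ P.faces) (hef : e ⊆ f) (he : e.card = 2)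
    {x : Plane} : x ∈ P.openEdge e ↔
      (∀ v ∈ e, 0 < P.bary f v x) ∧ ∀ v ∈ f, v ∉ e → P.bary f v x = 0 := by
  obtain ⟨a, b, hab, hmem⟩ := exists_pair he
  have ha := hef ((hmem a).2 (Or.inl rfl))
  have hb := hef ((hmem b).2 (Or.inr rfl))
  rw [openEdge_eq hmem hab, mem_openSegment_iff_bary hf ha hb hab]
  constructor
  · rintro ⟨h1, h2, h3⟩
    refine ⟨fun v hv => ?_, fun v hv hve => ?_⟩
    · rcases (hmem v).1 hv with rfl | rfl <;> assumption
    · rw [hmem, not_or] at hve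
      exact h3 v hv hve.1 hve.2
  · rintro ⟨h1, h2⟩
    refine ⟨h1 a ((hmem a).2 (Or.inl rfl)), h1 b ((hmem b).2 (Or.inr rfl)), fun v hv h3 h4 => ?_⟩
    exact h2 v hv (by rw [hmem, not_or]; exact ⟨h3, h4⟩)

/-- A point of a triangle is an interior point, a point on an open edge or a vertex. -/
theorem mem_hull_cases {f : Finset V} (hf : f ∈ P.faces) {x : Plane}
    (hx : x ∈ convexHull ℝ (P.pos '' (f : Set V))) :
    x ∈ interior (convexHull ℝ (P.pos '' (f : Set V))) ∨
      (∃ e ⊆ f, e.card = 2 ∧ x ∈ P.openEdge e) ∨ ∃ v ∈ f, x = P.pos v := by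
  classical
  rw [mem_hull_iff hf] at hx
  set S := f.filter fun v => 0 < P.bary f v x with hS
  have hSf : S ⊆ f := Finset.filter_subset _ _
  have hS1 : ∀ v ∈ S, 0 < P.bary f v x := fun v hv => (Finset.mem_filter.1 hv).2
  have hz : ∀ v ∈ f, v ∉ S → P.bary f v x = 0 := fun v hv hn => by
    by_contra hne
    exact hn (Finset.mem_filter.2 ⟨hv, lt_of_le_of_ne (hx v hv) (Ne.symm hne)⟩)
  have e1 := sum_bary hf x
  have e2 := sum_bary_smul hf x
  rw [← Finset.sum_subset hSf hz] at e1
  rw [← Finset.sum_subset hSf fun v hv hn => by rw [hz v hv hn, zero_smul]] at e2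
  have hc := Finset.card_le_card hSf
  rw [P.card_face f hf] at hc
  interval_cases hcard : S.card
  · rw [Finset.card_eq_zero.1 hcard] at e1; simp at e1
  · obtain ⟨v, hv⟩ := Finset.card_eq_one.1 hcard
    rw [hv, Finset.sum_singleton] at e1 e2
    rw [e1, one_smul] at e2
    exact Or.inr (Or.inr ⟨v, hSf (by rw [hv]; simp), e2.symm⟩)
  · exact Or.inr (Or.inl ⟨S, hSf, hcard, (mem_openEdge_iff hf hSf hcard).2 ⟨hS1, hz⟩⟩)
  · have hSe : S = f := Finset.eq_of_subset_of_card_le hSf (by rw [P.card_face f hf, hcard])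
    exact Or.inl ((mem_tri_iff hf).2 (hSe ▸ hS1))

theorem bary_continuous (f : Finset V) (v : V) : Continuous (P.bary f v) :=
  Billiard.coord_continuous _

/-- Near an open edge of a triangle, the points on the inner side belong to the triangle. -/
theorem eventually_mem_tri {f e : Finset V} (hf : f ∈ P.faces) (hef : e ⊆ f) (he : e.card = 2)
    {c : V} (hc : ∀ v ∈ f, v ∉ e → v = c) {x : Plane} (hx : x ∈ P.openEdge e) :
    ∀ᶠ y in 𝓝 x, (0 < P.bary f c y → y ∈ interior (convexHull ℝ (P.pos '' (f : Set V)))) ∧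
      (P.bary f c y = 0 → y ∈ P.openEdge e) := by
  have h1 := ((mem_openEdge_iff hf hef he).1 hx).1
  have h2 : ∀ᶠ y in 𝓝 x, ∀ v ∈ e, 0 < P.bary f v y := by
    rw [Filter.eventually_all_finset]
    exact fun v hv => ((bary_continuous f v).tendsto x).eventually (lt_mem_nhds (h1 v hv))
  filter_upwards [h2] with y hy
  refine ⟨fun h3 => (mem_tri_iff hf).2 fun v hv => ?_,
    fun h3 => (mem_openEdge_iff hf hef he).2 ⟨hy, fun v hv hve => by rw [hc v hv hve, h3]⟩⟩
  by_cases hve : v ∈ e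
  · exact hy v hve
  · rw [hc v hv hve]; exact h3

theorem mem_closure_tri {f : Finset V} (hf : f ∈ P.faces) {x : Plane}
    (hx : x ∈ convexHull ℝ (P.pos '' (f : Set V))) :
    x ∈ closure (interior (convexHull ℝ (P.pos '' (f : Set V)))) := by
  have hne : (interior (convexHull ℝ (P.pos '' (f : Set V)))).Nonempty := by
    rw [← range_basis hf]
    exact ⟨_, (P.basis f hf).centroid_mem_interior_convexHull⟩
  rw [(convex_convexHull ℝ _).closure_interior_eq_closure_of_nonempty_interior hne]
  exact subset_closure hx

theorem isClosed_hull (f : Finset V) : IsClosed (convexHull ℝ (P.pos '' (f : Set V))) :=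
  ((f.finite_toSet.image _).isCompact_convexHull ℝ).isClosed

/-- The triangles do not overlap. -/
theorem eq_of_mem_tri {f g : Finset V} (hf : f ∈ P.faces) (hg : g ∈ P.faces) {x : Plane}
    (hx : x ∈ convexHull ℝ (P.pos '' (f : Set V)))
    (hx' : x ∈ interior (convexHull ℝ (P.pos '' (g : Set V)))) : f = g := by
  by_contra hne
  obtain ⟨y, h1, h2⟩ := mem_closure_iff.1 (mem_closure_tri hf hx) _ isOpen_interior hx'
  exact Set.disjoint_left.1 (P.interior_embedded f hf g hg hne) h2 h1

end PolygonalTable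

/-! ### The interior of the table and its boundary edges -/

namespace PolygonalTable

variable {V 𝒜 : Type*} {P : PolygonalTable V 𝒜}

/-- The triangles at a shared edge lie on different sides of it. -/
theorem bary_pos_of_neg {e f g : Finset V} (he : e.card = 2) (hf : f ∈ P.faces) (hg : g ∈ P.faces)
    (hfg : f ≠ g) (hef : e ⊆ f) (heg : e ⊆ g) {c d : V} (hcf : c ∈ f) (hce : c ∉ e)
    (hc : ∀ v ∈ f, v ∉ e → v = c) (hdg : d ∈ g) (hde : d ∉ e) (hd : ∀ v ∈ g, v ∉ e → v = d)
    {z : Plane} (hz : P.bary f c z < 0) : 0 < P.bary g d z := by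
  by_contra hn
  rw [not_lt] at hn
  obtain ⟨a, b, hab, hmem⟩ := exists_pair he
  have hx : P.pos a + (1 / 2 : ℝ) • (P.pos b - P.pos a) ∈ P.openEdge e := by
    rw [openEdge_eq hmem hab]
    exact mem_openSegment_iff.2 ⟨1 / 2, by norm_num, by norm_num, rfl⟩
  set x := P.pos a + (1 / 2 : ℝ) • (P.pos b - P.pos a)
  have hx1 := ((mem_openEdge_iff hf hef he).1 hx).2 c hcf hce
  have hx2 := ((mem_openEdge_iff hg heg he).1 hx).2 d hdg hde
  have ht : Tendsto (fun s : ℝ => x + s • (z - x)) (𝓝[<] 0) (𝓝 x) := by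
    have : Tendsto (fun s : ℝ => x + s • (z - x)) (𝓝 0) (𝓝 (x + (0 : ℝ) • (z - x))) :=
      (by fun_prop : Continuous fun s : ℝ => x + s • (z - x)).tendsto 0
    rw [zero_smul, add_zero] at this
    exact this.mono_left nhdsWithin_le_nhds
  -- Moving from the midpoint `x` of the edge away from `z` enters the open triangle `f`; if `z`
  -- were not on the inner side of `g`, this would also stay in the closed triangle `g`, and the
  -- triangles would overlap.
  obtain ⟨s, ⟨h1, h2⟩, hs⟩ := ((ht.eventually (eventually_mem_tri hf hef he hc hx)).and
    (ht.eventually (eventually_mem_tri hg heg he hd hx))).and self_mem_nhdsWithin |>.exists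
  replace hs : s < 0 := hs
  have e1 : P.bary f c (x + s • (z - x)) = s * P.bary f c z := by
    rw [AffineMap.apply_lineMap', hx1]; ring
  have e2 : P.bary g d (x + s • (z - x)) = s * P.bary g d z := by
    rw [AffineMap.apply_lineMap', hx2]; ring
  have h3 := h1.1 (by rw [e1]; exact mul_pos_of_neg_of_neg hs hz)
  refine hfg (eq_of_mem_tri hg hf ?_ h3).symm
  rcases (mul_nonneg_of_nonpos_of_nonpos hs.le hn).lt_or_eq with h4 | h4
  · exact interior_subset (h2.1 (by rwa [e2]))
  · have h5 := (mem_openEdge_iff hg heg he).1 (h2.2 (by rw [e2, ← h4]))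
    rw [mem_hull_iff hg]
    intro v hv
    by_cases hve : v ∈ e
    · exact (h5.1 v hve).le
    · exact (h5.2 v hv hve).ge

/-- The two triangles lie on opposite sides of the shared edge, so together with the edge they fill
a neighbourhood of each of its points. -/
theorem eventually_shared {e f g : Finset V} (he : e.card = 2) (hf : f ∈ P.faces) (hg : g ∈ P.faces)
    (hfg : f ≠ g) (hef : e ⊆ f) (heg : e ⊆ g) {x : Plane} (hx : x ∈ P.openEdge e) :
    ∀ᶠ y in 𝓝 x, y ∈ interior (convexHull ℝ (P.pos '' (f : Set V))) ∨
      y ∈ interior (convexHull ℝ (P.pos '' (g : Set V))) ∨ y ∈ P.openEdge e := by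
  obtain ⟨c, hcf, hce, hc⟩ := exists_opposite hf hef he
  obtain ⟨d, hdg, hde, hd⟩ := exists_opposite hg heg he
  filter_upwards [eventually_mem_tri hf hef he hc hx, eventually_mem_tri hg heg he hd hx]
    with y h1 h2
  rcases lt_trichotomy (P.bary f c y) 0 with h | h | h
  · exact Or.inr (Or.inl (h2.1 (bary_pos_of_neg he hf hg hfg hef heg hcf hce hc hdg hde hd h)))
  · exact Or.inr (Or.inr (h1.2 h))
  · exact Or.inl (h1.1 h)

theorem isOpen_region : IsOpen P.region := by
  rw [isOpen_iff_mem_nhds]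
  rintro x (⟨f, hf, hx⟩ | ⟨e, he, ⟨f, hf, g, hg, hfg, hef, heg⟩, hx⟩)
  · filter_upwards [isOpen_interior.mem_nhds hx] with y hy
    exact Or.inl ⟨f, hf, hy⟩
  · filter_upwards [eventually_shared he hf hg hfg hef heg hx] with y hy
    rcases hy with hy | hy | hy
    · exact Or.inl ⟨f, hf, hy⟩
    · exact Or.inl ⟨g, hg, hy⟩
    · exact Or.inr ⟨e, he, ⟨f, hf, g, hg, hfg, hef, heg⟩, hy⟩

theorem openEdge_subset_hull {f e : Finset V} (hf : f ∈ P.faces) (hef : e ⊆ f) (he : e.card = 2) :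
    P.openEdge e ⊆ convexHull ℝ (P.pos '' (f : Set V)) := by
  intro x hx
  have h := (mem_openEdge_iff hf hef he).1 hx
  rw [mem_hull_iff hf]
  intro v hv
  by_cases hve : v ∈ e
  · exact (h.1 v hve).le
  · exact (h.2 v hv hve).ge

theorem region_subset : P.region ⊆ ⋃ f ∈ P.faces, convexHull ℝ (P.pos '' (f : Set V)) := by
  rintro x (⟨f, hf, hx⟩ | ⟨e, he, ⟨f, hf, g, hg, hfg, hef, heg⟩, hx⟩)
  · exact Set.mem_biUnion hf (interior_subset hx)
  · exact Set.mem_biUnion hf (openEdge_subset_hull hf hef he hx)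

theorem isClosed_iUnion_hull :
    IsClosed (⋃ f ∈ P.faces, convexHull ℝ (P.pos '' (f : Set V))) :=
  P.faces.finite_toSet.isClosed_biUnion fun f _ => isClosed_hull f

theorem isBounded_region : Bornology.IsBounded P.region := by
  refine Bornology.IsBounded.subset ?_ region_subset
  refine (Bornology.isBounded_biUnion P.faces.finite_toSet).2 fun f _ => ?_
  exact ((f.finite_toSet.image _).isCompact_convexHull ℝ).isBounded

/-- The points of a triangle in the interior of the table. -/
theorem mem_region_cases {f : Finset V} (hf : f ∈ P.faces) {y : Plane}
    (hy : y ∈ convexHull ℝ (P.pos '' (f : Set V))) (hr : y ∈ P.region) :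
    (∀ v ∈ f, 0 < P.bary f v y) ∨ ∃ e ⊆ f, e.card = 2 ∧ (∃ g ∈ P.faces, f ≠ g ∧ e ⊆ g) ∧
      y ∈ P.openEdge e := by
  rcases hr with ⟨g, hg, h⟩ | ⟨e, he, ⟨g, hg, g', hg', hne, heg, heg'⟩, h⟩
  · obtain rfl := eq_of_mem_tri hf hg hy h
    exact Or.inl ((mem_tri_iff hf).1 h)
  · right
    obtain ⟨y1, h1, h2⟩ := mem_closure_iff_nhds.1 (mem_closure_tri hf hy) _
      (eventually_shared he hg hg' hne heg heg' h)
    have : f = g ∨ f = g' := by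
      rcases h1 with h1 | h1 | h1
      · exact Or.inl (eq_of_mem_tri hf hg (interior_subset h2) h1)
      · exact Or.inr (eq_of_mem_tri hf hg' (interior_subset h2) h1)
      · exact Or.inl (eq_of_mem_tri hg hf (openEdge_subset_hull hg heg he h1) h2).symm
    rcases this with rfl | rfl
    · exact ⟨e, heg, he, ⟨g', hg', hne, heg'⟩, h⟩
    · exact ⟨e, heg', he, ⟨g, hg, hne.symm, heg⟩, h⟩

/-- Every vertex is an endpoint of a boundary edge. -/
theorem exists_boundaryEdge (v : V) : ∃ e : P.BoundaryEdge, v ∈ e.1 := by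
  classical
  obtain ⟨n, ⟨φ⟩⟩ := P.link_path v
  obtain ⟨f₀, hf₀, hv₀⟩ := P.pure_complex v
  obtain ⟨a₀, ha₀, hav₀⟩ : ∃ a ∈ f₀, a ≠ v := by
    refine Finset.exists_mem_ne ?_ v
    rw [P.card_face f₀ hf₀]; norm_num
  have hn : 0 < n := (φ ⟨a₀, hav₀, f₀, hf₀, hv₀, ha₀⟩).pos
  -- The boundary edge joins `v` to the first vertex `a` of its link path: any triangle through `v`
  -- and `a` has its third vertex adjacent to `a` in the path, hence at position 1, which determines
  -- the triangle.
  obtain ⟨⟨a, hav, f, hf, hvf, haf⟩, ha⟩ := φ.surjective ⟨0, hn⟩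
  have hcard : ({v, a} : Finset V).card = 2 := Finset.card_pair hav.symm
  have hsub : ∀ {g : Finset V}, v ∈ g → a ∈ g → ({v, a} : Finset V) ⊆ g := fun h1 h2 w hw => by
    rcases Finset.mem_insert.1 hw with rfl | hw
    · exact h1
    · rwa [Finset.mem_singleton.1 hw]
  have key : ∀ g ∈ P.faces, v ∈ g → a ∈ g → ∃ c ∈ g, (∀ w ∈ g, w = v ∨ w = a ∨ w = c) ∧
      ∃ hc, (φ ⟨c, hc⟩ : ℕ) = 1 := by
    intro g hg hv ha'
    obtain ⟨c, hcg, hce, hc⟩ := exists_opposite hg (hsub hv ha') hcard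
    have hcv : c ≠ v := fun h => hce (by simp [h])
    have hca : c ≠ a := fun h => hce (by simp [h])
    refine ⟨c, hcg, fun w hw => ?_, ⟨hcv, g, hg, hv, hcg⟩, ?_⟩
    · by_cases hwe : w ∈ ({v, a} : Finset V)
      · simp only [Finset.mem_insert, Finset.mem_singleton] at hwe
        tauto
      · exact Or.inr (Or.inr (hc w hw hwe))
    · have hadj := φ.map_rel_iff.2 (show (SimpleGraph.fromRel fun a b :
          {a : V // a ≠ v ∧ ∃ f ∈ P.faces, v ∈ f ∧ a ∈ f} =>
          ∃ f ∈ P.faces, v ∈ f ∧ a.1 ∈ f ∧ b.1 ∈ f).Adj ⟨a, hav, f, hf, hvf, haf⟩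
          ⟨c, hcv, g, hg, hv, hcg⟩ from
        (SimpleGraph.fromRel_adj _ _ _).2 ⟨fun h => hca (Subtype.ext_iff.1 h).symm,
          Or.inl ⟨g, hg, hv, ha', hcg⟩⟩)
      rw [SimpleGraph.pathGraph_adj] at hadj
      have h0 : (φ ⟨a, hav, f, hf, hvf, haf⟩ : ℕ) = 0 := by rw [ha]
      rcases hadj with h | h
      · exact (by omega : (φ ⟨c, hcv, g, hg, hv, hcg⟩ : ℕ) = 1)
      · exact absurd h0 (by omega)
  refine ⟨⟨{v, a}, hcard, f, ⟨hf, hsub hvf haf⟩, ?_⟩, by simp⟩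
  rintro g ⟨hg, heg⟩
  have hvg : v ∈ g := heg (by simp)
  have hag : a ∈ g := heg (by simp)
  obtain ⟨c, hcf, hc, hc', hc1⟩ := key f hf hvf haf
  obtain ⟨d, hdg, hd, hd', hd1⟩ := key g hg hvg hag
  have hcd : c = d := by
    have := φ.injective (Fin.ext (hc1.trans hd1.symm))
    exact Subtype.ext_iff.1 this
  refine Finset.eq_of_subset_of_card_le (fun w hw => ?_)
    (by rw [P.card_face f hf, P.card_face g hg])
  rcases hd w hw with rfl | rfl | rfl
  · exact hvf
  · exact haf
  · exact hcd ▸ hcf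

instance : Finite P.BoundaryEdge := by
  classical
  have hfin : (⋃ f ∈ P.faces, {e : Finset V | e ⊆ f}).Finite :=
    P.faces.finite_toSet.biUnion fun f _ => by
      refine (Finset.finite_toSet f.powerset).subset fun e he => ?_
      exact Finset.mem_coe.2 (Finset.mem_powerset.2 he)
  refine Set.finite_coe_iff.2 (hfin.subset fun e he => ?_)
  obtain ⟨-, f, ⟨hf, hef⟩, -⟩ := he
  exact Set.mem_biUnion hf hef

end PolygonalTable

/-! ### Boundary edges as edges of an abstract billiard -/

namespace PolygonalTable

variable {V 𝒜 : Type*} {P : PolygonalTable V 𝒜}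

namespace BoundaryEdge

/-- The triangle at a boundary edge. -/
noncomputable def face (e : P.BoundaryEdge) : Finset V := e.2.2.choose

theorem face_mem (e : P.BoundaryEdge) : face e ∈ P.faces := e.2.2.choose_spec.1.1

theorem subset_face (e : P.BoundaryEdge) : e.1 ⊆ face e := e.2.2.choose_spec.1.2

theorem eq_face (e : P.BoundaryEdge) {f : Finset V} (hf : f ∈ P.faces) (h : e.1 ⊆ f) :
    f = face e := e.2.2.choose_spec.2 f ⟨hf, h⟩

/-- The first endpoint of a boundary edge. -/
noncomputable def fst (e : P.BoundaryEdge) : V := (exists_pair e.2.1).choose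

/-- The second endpoint of a boundary edge. -/
noncomputable def snd (e : P.BoundaryEdge) : V := (exists_pair e.2.1).choose_spec.choose

theorem fst_ne_snd (e : P.BoundaryEdge) : fst e ≠ snd e :=
  (exists_pair e.2.1).choose_spec.choose_spec.1

theorem mem_iff (e : P.BoundaryEdge) (v : V) : v ∈ e.1 ↔ v = fst e ∨ v = snd e :=
  (exists_pair e.2.1).choose_spec.choose_spec.2 v

/-- The vertex opposite to a boundary edge. -/
noncomputable def apex (e : P.BoundaryEdge) : V :=
  (exists_opposite (face_mem e) (subset_face e) e.2.1).choose

theorem apex_mem (e : P.BoundaryEdge) : apex e ∈ face e :=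
  (exists_opposite (face_mem e) (subset_face e) e.2.1).choose_spec.1

theorem apex_notMem (e : P.BoundaryEdge) : apex e ∉ e.1 :=
  (exists_opposite (face_mem e) (subset_face e) e.2.1).choose_spec.2.1

theorem eq_apex (e : P.BoundaryEdge) : ∀ v ∈ face e, v ∉ e.1 → v = apex e :=
  (exists_opposite (face_mem e) (subset_face e) e.2.1).choose_spec.2.2

theorem fst_mem (e : P.BoundaryEdge) : fst e ∈ e.1 := (mem_iff e _).2 (Or.inl rfl)

theorem snd_mem (e : P.BoundaryEdge) : snd e ∈ e.1 := (mem_iff e _).2 (Or.inr rfl)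

/-- The coordinate that vanishes on the edge and is positive on the inner side. -/
noncomputable def height (e : P.BoundaryEdge) : Plane →ᵃ[ℝ] ℝ := P.bary (face e) (apex e)

theorem height_of_mem (e : P.BoundaryEdge) {v : V} (hv : v ∈ e.1) : height e (P.pos v) = 0 :=
  bary_ne (face_mem e) (apex_mem e) (subset_face e hv) fun h => apex_notMem e (h ▸ hv)

theorem height_apex (e : P.BoundaryEdge) : height e (P.pos (apex e)) = 1 :=
  bary_self (face_mem e) (apex_mem e)

theorem openEdge (e : P.BoundaryEdge) :
    P.openEdge e.1 = openSegment ℝ (P.pos (fst e)) (P.pos (snd e)) :=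
  openEdge_eq (mem_iff e) (fst_ne_snd e)

theorem pos_ne (e : P.BoundaryEdge) : P.pos (fst e) ≠ P.pos (snd e) := by
  intro h
  have h1 := bary_self (face_mem e) (subset_face e (fst_mem e))
  rw [h, bary_ne (face_mem e) (subset_face e (fst_mem e)) (subset_face e (snd_mem e))
    (fst_ne_snd e)] at h1
  exact zero_ne_one h1

theorem height_zero (e : P.BoundaryEdge) (y : Plane) (hy : height e y = 0) :
    ∃ r : ℝ, y = P.pos (fst e) + r • (P.pos (snd e) - P.pos (fst e)) := by
  classical
  have hz : ∀ v ∈ face e, v ∉ e.1 → P.bary (face e) v y = 0 := fun v h1 h2 => by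
    rw [eq_apex e v h1 h2]; exact hy
  have he : e.1 = {fst e, snd e} := by
    ext v; rw [mem_iff]; simp
  have e1 := sum_bary (face_mem e) y
  have e2 := sum_bary_smul (face_mem e) y
  rw [← Finset.sum_subset (subset_face e) hz, he, Finset.sum_pair (fst_ne_snd e)] at e1
  rw [← Finset.sum_subset (subset_face e) fun v hv hn => by rw [hz v hv hn, zero_smul], he,
    Finset.sum_pair (fst_ne_snd e)] at e2
  refine ⟨P.bary (face e) (snd e) y, ?_⟩
  conv_lhs => rw [← e2, eq_sub_of_add_eq e1]
  module

theorem height_linear (e : P.BoundaryEdge) {v : Plane}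
    (hv : v ∈ vectorSpan ℝ (P.pos '' (e.1 : Set V))) : (height e).linear v = 0 := by
  have : vectorSpan ℝ (P.pos '' (e.1 : Set V)) ≤ LinearMap.ker (height e).linear := by
    rw [vectorSpan_def, Submodule.span_le]
    rintro _ ⟨_, ⟨a, ha, rfl⟩, _, ⟨b, hb, rfl⟩, rfl⟩
    simp only [SetLike.mem_coe, LinearMap.mem_ker]
    rw [AffineMap.linearMap_vsub, height_of_mem e ha, height_of_mem e hb, vsub_self]
  exact this hv

/-- The reflection in the line through a boundary edge. -/
noncomputable def reflection (e : P.BoundaryEdge) : Plane ≃ᵃⁱ[ℝ] Plane :=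
  AffineIsometryEquiv.mk'
    (fun y => (vectorSpan ℝ (P.pos '' (e.1 : Set V))).reflection (y -ᵥ P.pos (fst e)) +ᵥ
      P.pos (fst e))
    (vectorSpan ℝ (P.pos '' (e.1 : Set V))).reflection (P.pos (fst e)) fun y => by simp

theorem reflection_apply (e : P.BoundaryEdge) (y : Plane) : reflection e y =
    (vectorSpan ℝ (P.pos '' (e.1 : Set V))).reflection (y - P.pos (fst e)) + P.pos (fst e) := rfl

theorem reflection_linear (e : P.BoundaryEdge) (u : Plane) :
    (reflection e).linearIsometryEquiv u = P.reflect e u := by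
  rw [reflection, AffineIsometryEquiv.linearIsometryEquiv_mk']; rfl

theorem sub_mem_vectorSpan (e : P.BoundaryEdge) {v w : V} (hv : v ∈ e.1) (hw : w ∈ e.1) :
    P.pos v - P.pos w ∈ vectorSpan ℝ (P.pos '' (e.1 : Set V)) :=
  vsub_mem_vectorSpan ℝ ⟨v, hv, rfl⟩ ⟨w, hw, rfl⟩

/-- The linear part of `height` kills the direction of the edge, hence the orthogonal projection
onto it, and the reflection is twice this projection minus the identity. -/
theorem height_reflection (e : P.BoundaryEdge) (y : Plane) :
    height e (reflection e y) = -height e y := by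
  have h1 : height e y = (height e).linear (y - P.pos (fst e)) := by
    have := (height e).linearMap_vsub y (P.pos (fst e))
    rw [height_of_mem e (fst_mem e)] at this
    simpa using this.symm
  have h2 : height e (reflection e y) = (height e).linear (reflection e y - P.pos (fst e)) := by
    have := (height e).linearMap_vsub (reflection e y) (P.pos (fst e))
    rw [height_of_mem e (fst_mem e)] at this
    simpa using this.symm
  rw [h2, h1, reflection_apply, add_sub_cancel_right, Submodule.reflection_apply, map_sub,
    two_smul, map_add, height_linear e (Submodule.starProjection_apply_mem _ _)]
  ring

theorem eventually_mem_region (e : P.BoundaryEdge) {x : Plane} (hx : x ∈ P.openEdge e.1) :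
    ∀ᶠ y in 𝓝 x, 0 < height e y →
      y ∈ interior (convexHull ℝ (P.pos '' (face e : Set V))) := by
  filter_upwards [eventually_mem_tri (face_mem e) (subset_face e) e.2.1 (eq_apex e) hx] with y hy
  exact hy.1

theorem mem_segment_iff (e : P.BoundaryEdge) {x : Plane} :
    x ∈ segment ℝ (P.pos (fst e)) (P.pos (snd e)) ↔
      x ∈ convexHull ℝ (P.pos '' (face e : Set V)) ∧ height e x = 0 := by
  rw [mem_segment_iff_bary (face_mem e) (subset_face e (fst_mem e)) (subset_face e (snd_mem e))
    (fst_ne_snd e), mem_hull_iff (face_mem e)]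
  have hne : ∀ v, v ≠ fst e → v ≠ snd e → v ∉ e.1 := fun v h1 h2 h => by
    rcases (mem_iff e v).1 h with h | h <;> contradiction
  constructor
  · rintro ⟨h1, h2, h3⟩
    refine ⟨fun v hv => ?_, h3 _ (apex_mem e) (fun h => apex_notMem e (h ▸ fst_mem e))
      fun h => apex_notMem e (h ▸ snd_mem e)⟩
    by_cases hv1 : v = fst e
    · rwa [hv1]
    by_cases hv2 : v = snd e
    · rwa [hv2]
    exact (h3 v hv hv1 hv2).ge
  · rintro ⟨h1, h2⟩
    refine ⟨h1 _ (subset_face e (fst_mem e)), h1 _ (subset_face e (snd_mem e)), fun v hv h3 h4 => ?_⟩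
    rw [eq_apex e v hv (hne v h3 h4)]
    exact h2

/-- A point of the table's interior in the triangle `face e` has positive coordinates or lies on an
edge shared with another triangle. Where the apex coordinate vanishes, that shared edge would have
to be `e`, which lies in one triangle only. -/
theorem notMem_region (e : P.BoundaryEdge) {y : Plane}
    (hy : y ∈ segment ℝ (P.pos (fst e)) (P.pos (snd e))) : y ∉ P.region := by
  intro hr
  obtain ⟨h1, h2⟩ := (mem_segment_iff e).1 hy
  rcases mem_region_cases (face_mem e) h1 hr with h | ⟨e', hs, hc, ⟨g, hg, hne, heg⟩, h⟩
  · exact (h _ (apex_mem e)).ne' h2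
  · have h3 := ((mem_openEdge_iff (face_mem e) hs hc).1 h).1
    have h4 : e' ⊆ e.1 := fun v hv => by
      by_contra hn
      have := h3 v hv
      rw [eq_apex e v (hs hv) hn] at this
      exact this.ne' h2
    have h5 : e' = e.1 := Finset.eq_of_subset_of_card_le h4 (by rw [hc, e.2.1])
    exact hne (eq_face e hg (h5 ▸ heg)).symm

/-- Points just inside `e` are just inside `e'`, so both edges belong to the same triangle; there
the positive barycentric coordinates of the common point determine the edge. Edges that coincide in
the plane but face opposite sides are not identified. -/
theorem eq_of_mem (e e' : P.BoundaryEdge) {x : Plane} (hx : x ∈ P.openEdge e.1)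
    (hx' : x ∈ P.openEdge e'.1) (h : ∀ y, 0 < height e y → 0 < height e' y) : e = e' := by
  have h0 : height e x = 0 :=
    ((mem_openEdge_iff (face_mem e) (subset_face e) e.2.1).1 hx).2 _ (apex_mem e) (apex_notMem e)
  have ht : Tendsto (fun s : ℝ => x + s • (P.pos (apex e) - x)) (𝓝[>] 0) (𝓝 x) := by
    have : Tendsto (fun s : ℝ => x + s • (P.pos (apex e) - x)) (𝓝 0)
        (𝓝 (x + (0 : ℝ) • (P.pos (apex e) - x))) :=
      (by fun_prop : Continuous fun s : ℝ => x + s • (P.pos (apex e) - x)).tendsto 0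
    rw [zero_smul, add_zero] at this
    exact this.mono_left nhdsWithin_le_nhds
  obtain ⟨s, ⟨h1, h2⟩, hs⟩ := ((ht.eventually (eventually_mem_region e hx)).and
    (ht.eventually (eventually_mem_region e' hx'))).and self_mem_nhdsWithin |>.exists
  replace hs : 0 < s := hs
  have hp : 0 < height e (x + s • (P.pos (apex e) - x)) := by
    rw [AffineMap.apply_lineMap', h0, height_apex]; linarith
  have hf : face e = face e' :=
    eq_of_mem_tri (face_mem e) (face_mem e') (interior_subset (h1 hp)) (h2 (h _ hp))
  have k1 := ((mem_openEdge_iff (face_mem e) (subset_face e) e.2.1).1 hx).1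
  have k2 := ((mem_openEdge_iff (face_mem e') (subset_face e') e'.2.1).1 hx').2
  have h4 : e.1 ⊆ e'.1 := fun v hv => by
    by_contra hn
    have h5 := k1 v hv
    rw [hf, k2 v (hf ▸ subset_face e hv) hn] at h5
    exact lt_irrefl _ h5
  exact Subtype.ext (Finset.eq_of_subset_of_card_le h4 (by rw [e.2.1, e'.2.1]))

/-- The inner side of an edge is given by the sign of the height. -/
theorem innerSide_iff (e : P.BoundaryEdge) (x : Plane) : P.InnerSide e x ↔ 0 < height e x := by
  have key : ∀ y, y ∈ affineSpan ℝ (P.pos '' (e.1 : Set V)) ↔ height e y = 0 := by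
    intro y
    constructor
    · intro hy
      have h1 := AffineSubspace.vsub_mem_direction hy
        (subset_affineSpan ℝ _ ⟨fst e, fst_mem e, rfl⟩ :
          P.pos (fst e) ∈ affineSpan ℝ (P.pos '' (e.1 : Set V)))
      rw [direction_affineSpan] at h1
      have h2 := height_linear e h1
      rw [AffineMap.linearMap_vsub, height_of_mem e (fst_mem e)] at h2
      simpa using h2
    · intro hy
      obtain ⟨r, rfl⟩ := height_zero e y hy
      have h1 : P.pos (fst e) ∈ affineSpan ℝ (P.pos '' (e.1 : Set V)) :=
        subset_affineSpan ℝ _ ⟨fst e, fst_mem e, rfl⟩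
      have h2 : P.pos (snd e) ∈ affineSpan ℝ (P.pos '' (e.1 : Set V)) :=
        subset_affineSpan ℝ _ ⟨snd e, snd_mem e, rfl⟩
      have := AffineMap.lineMap_mem r h1 h2
      rwa [AffineMap.lineMap_apply, vsub_eq_sub, vadd_eq_add, add_comm] at this
  have hlin : ∀ y z, (height e).linear (y - z) = height e y - height e z := fun y z =>
    (height e).linearMap_vsub y z
  constructor
  · rintro ⟨f, hf, hef, c, hcf, hce, ⟨p₁, hp₁, p₂, hp₂, hray⟩, hx, -⟩
    obtain rfl := eq_face e hf hef
    obtain rfl := eq_apex e c hcf hce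
    have h3 := hray.map (height e).linear
    rw [vsub_eq_sub, vsub_eq_sub, hlin, hlin, (key _).1 hp₁, (key _).1 hp₂, height_apex] at h3
    simp only [sub_zero] at h3
    rcases h3 with h3 | h3 | ⟨r, s, hr, hs, h3⟩
    · exact absurd ((key x).2 h3) hx
    · norm_num at h3
    · rw [smul_eq_mul, smul_eq_mul, mul_one] at h3
      by_contra hn
      nlinarith
  · intro hx
    refine ⟨face e, face_mem e, subset_face e, apex e, apex_mem e, apex_notMem e, ?_, ?_, ?_⟩
    · have h0 : height e (x - height e x • (P.pos (apex e) - P.pos (fst e))) = 0 := by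
        have := hlin x (x - height e x • (P.pos (apex e) - P.pos (fst e)))
        rw [sub_sub_cancel, map_smul, hlin, height_apex, height_of_mem e (fst_mem e)] at this
        simp only [sub_zero, smul_eq_mul, mul_one] at this
        linarith
      refine ⟨_, (key _).2 h0, P.pos (fst e), (key _).2 (height_of_mem e (fst_mem e)), ?_⟩
      rw [vsub_eq_sub, vsub_eq_sub, sub_sub_cancel]
      exact SameRay.sameRay_pos_smul_left _ hx
    · rw [key]; exact hx.ne'
    · rw [key, height_apex]; norm_num

end BoundaryEdge

/-- A point of a triangle that is not in the interior of the table is a vertex or on a boundary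
edge. -/
theorem exists_of_notMem_region {f : Finset V} (hf : f ∈ P.faces) {y : Plane}
    (hy : y ∈ convexHull ℝ (P.pos '' (f : Set V))) (hr : y ∉ P.region) :
    (∃ v, y = P.pos v) ∨ ∃ a : P.BoundaryEdge, BoundaryEdge.face a = f ∧ y ∈ P.openEdge a.1 := by
  rcases mem_hull_cases hf hy with h | ⟨e, hef, he, h⟩ | ⟨v, -, h⟩
  · exact absurd (Or.inl ⟨f, hf, h⟩) hr
  · right
    have hu : ∀ g, g ∈ P.faces ∧ e ⊆ g → g = f := by
      rintro g ⟨hg, heg⟩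
      by_contra hne
      exact hr (Or.inr ⟨e, he, ⟨g, hg, f, hf, hne, heg, hef⟩, h⟩)
    let a : P.BoundaryEdge := ⟨e, he, f, ⟨hf, hef⟩, hu⟩
    exact ⟨a, (BoundaryEdge.eq_face a hf hef).symm, h⟩
  · exact Or.inl ⟨v, h⟩

theorem exists_pos_eq (v : V) : ∃ a : P.BoundaryEdge,
    P.pos v = P.pos (BoundaryEdge.fst a) ∨ P.pos v = P.pos (BoundaryEdge.snd a) := by
  obtain ⟨a, ha⟩ := exists_boundaryEdge (P := P) v
  refine ⟨a, ?_⟩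
  rcases (BoundaryEdge.mem_iff a v).1 ha with rfl | rfl
  · exact Or.inl rfl
  · exact Or.inr rfl

theorem exists_segment {y : Plane} (hy : y ∈ closure P.region) (hr : y ∉ P.region) :
    ∃ a : P.BoundaryEdge,
      y ∈ segment ℝ (P.pos (BoundaryEdge.fst a)) (P.pos (BoundaryEdge.snd a)) := by
  obtain ⟨f, hf, h⟩ := Set.mem_iUnion₂.1 (closure_minimal region_subset isClosed_iUnion_hull hy)
  rcases exists_of_notMem_region hf h hr with ⟨v, rfl⟩ | ⟨a, -, ha⟩
  · obtain ⟨a, h | h⟩ := exists_pos_eq (P := P) v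
    · exact ⟨a, h ▸ left_mem_segment ℝ _ _⟩
    · exact ⟨a, h ▸ right_mem_segment ℝ _ _⟩
  · rw [BoundaryEdge.openEdge] at ha
    exact ⟨a, openSegment_subset_segment ℝ _ _ ha⟩

/-- Some triangle contains points of the flight arbitrarily close to `y`, hence `y` itself, which is
then a vertex or on a boundary edge of that very triangle. Taking the edge of this triangle ensures
that the flight arrives from the inner side: its points there have positive apex coordinate. -/
theorem exists_exit {x y : Plane} (hs : openSegment ℝ x y ⊆ P.region) (hy : y ∉ P.region)
    (hxy : x ≠ y) :
    (∃ a : P.BoundaryEdge, y = P.pos (BoundaryEdge.fst a) ∨ y = P.pos (BoundaryEdge.snd a)) ∨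
      ∃ a : P.BoundaryEdge, y ∈ P.openEdge a.1 ∧ 0 < BoundaryEdge.height a x := by
  have ht : Tendsto (fun s : ℝ => x + s • (y - x)) (𝓝[<] 1) (𝓝 y) := by
    have : Tendsto (fun s : ℝ => x + s • (y - x)) (𝓝 1) (𝓝 (x + (1 : ℝ) • (y - x))) :=
      (by fun_prop : Continuous fun s : ℝ => x + s • (y - x)).tendsto 1
    rw [one_smul, add_sub_cancel] at this
    exact this.mono_left nhdsWithin_le_nhds
  have hev : ∀ᶠ s : ℝ in 𝓝[<] 1, x + s • (y - x) ∈ P.region := by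
    filter_upwards [Ioo_mem_nhdsLT (zero_lt_one' ℝ)] with s h
    exact hs (mem_openSegment_iff.2 ⟨s, h.1, h.2, rfl⟩)
  obtain ⟨f, hf, hfr⟩ : ∃ f ∈ P.faces, ∃ᶠ s : ℝ in 𝓝[<] 1,
      x + s • (y - x) ∈ convexHull ℝ (P.pos '' (f : Set V)) := by
    by_contra! hn
    have h1 : ∀ᶠ s : ℝ in 𝓝[<] 1, ∀ f ∈ P.faces,
        x + s • (y - x) ∉ convexHull ℝ (P.pos '' (f : Set V)) := by
      rw [Filter.eventually_all_finset]
      exact hn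
    obtain ⟨s, h2, h3⟩ := (h1.and hev).exists
    obtain ⟨f, hf, h4⟩ := Set.mem_iUnion₂.1 (region_subset h3)
    exact h2 f hf h4
  have hyf := (isClosed_hull f).mem_of_frequently_of_tendsto hfr ht
  rcases exists_of_notMem_region hf hyf hy with ⟨v, rfl⟩ | ⟨a, rfl, ha⟩
  · exact Or.inl (exists_pos_eq v)
  · refine Or.inr ⟨a, ha, ?_⟩
    obtain ⟨s, ⟨h1, h2⟩, h3⟩ := ((hfr.and_eventually hev).and_eventually
      self_mem_nhdsWithin).exists
    replace h3 : s < 1 := h3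
    have h0 : BoundaryEdge.height a y = 0 :=
      ((mem_openEdge_iff (BoundaryEdge.face_mem a) (BoundaryEdge.subset_face a) a.2.1).1 ha).2 _
        (BoundaryEdge.apex_mem a) (BoundaryEdge.apex_notMem a)
    have h4 : BoundaryEdge.height a (x + s • (y - x)) = (1 - s) * BoundaryEdge.height a x := by
      rw [AffineMap.apply_lineMap', h0]; ring
    have h5 : 0 ≤ BoundaryEdge.height a (x + s • (y - x)) :=
      (mem_hull_iff hf).1 h1 _ (BoundaryEdge.apex_mem a)
    have h6 : BoundaryEdge.height a (x + s • (y - x)) ≠ 0 := fun h =>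
      BoundaryEdge.notMem_region a ((BoundaryEdge.mem_segment_iff a).2 ⟨h1, h⟩) h2
    have h7 := lt_of_le_of_ne h5 h6.symm
    rw [h4] at h7
    exact (mul_pos_iff_of_pos_left (by linarith)).1 h7

/-- The table as a billiard, with the boundary edges indexed by a given type. -/
noncomputable def billiard (P : PolygonalTable V 𝒜) {ι : Type*} (φ : ι ≃ P.BoundaryEdge) :
    Billiard ι where
  region := P.region
  A a := P.pos (BoundaryEdge.fst (φ a))
  B a := P.pos (BoundaryEdge.snd (φ a))
  l a := BoundaryEdge.height (φ a)
  refl a := BoundaryEdge.reflection (φ a)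
  ne a := BoundaryEdge.pos_ne _
  l_A a := BoundaryEdge.height_of_mem _ (BoundaryEdge.fst_mem _)
  l_B a := BoundaryEdge.height_of_mem _ (BoundaryEdge.snd_mem _)
  l_zero a := BoundaryEdge.height_zero _
  refl_A a := by rw [BoundaryEdge.reflection_apply, sub_self, map_zero, zero_add]
  refl_B a := by
    rw [BoundaryEdge.reflection_apply, Submodule.reflection_mem_subspace_eq_self
      (BoundaryEdge.sub_mem_vectorSpan _ (BoundaryEdge.snd_mem _) (BoundaryEdge.fst_mem _)),
      sub_add_cancel]
  refl_sq a := by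
    ext1 y
    rw [AffineIsometryEquiv.coe_mul, Function.comp_apply, BoundaryEdge.reflection_apply,
      BoundaryEdge.reflection_apply, add_sub_cancel_right, Submodule.reflection_reflection,
      sub_add_cancel]
    rfl
  l_refl a := BoundaryEdge.height_reflection _
  isOpen := isOpen_region
  bounded := isBounded_region
  half a x hx := by
    rw [← BoundaryEdge.openEdge] at hx
    obtain ⟨ε, h1, h2⟩ := Metric.eventually_nhds_iff.1
      (BoundaryEdge.eventually_mem_region (φ a) hx)
    exact ⟨ε, h1, fun y h3 h4 => Or.inl ⟨_, BoundaryEdge.face_mem _, h2 h3 h4⟩⟩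
  disj a y := BoundaryEdge.notMem_region _
  frontier y h1 h2 := by
    obtain ⟨a, ha⟩ := exists_segment h1 h2
    exact ⟨φ.symm a, by simpa using ha⟩
  exit x y h1 h2 h3 := by
    rcases exists_exit h1 h2 h3 with ⟨a, ha⟩ | ⟨a, ha, hl⟩
    · exact Or.inl ⟨φ.symm a, by simpa using ha⟩
    · rw [BoundaryEdge.openEdge] at ha
      exact Or.inr ⟨φ.symm a, by simpa using ha, by simpa using hl⟩
  uniq a b x h1 h2 h3 := by
    rw [← BoundaryEdge.openEdge] at h1 h2
    exact φ.injective (BoundaryEdge.eq_of_mem _ _ h1 h2 h3)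

end PolygonalTable

/-! ### Bounces and unfolded lines -/

namespace Billiard

variable {ι : Type*} {T : Billiard ι} {F : ℤ → ι}

theorem linear_refl (a : ι) (u : Plane) :
    (T.l a).linear ((T.refl a).linearIsometryEquiv u) = -(T.l a).linear u := by
  have h1 := T.l_refl a (T.A a + (1 : ℝ) • u)
  rw [map_add_smul', AffineMap.apply_add_smul, AffineMap.apply_add_smul, T.refl_A, T.l_A] at h1
  linarith

theorem linear_refl_refl (a : ι) (u : Plane) :
    (T.refl a).linearIsometryEquiv ((T.refl a).linearIsometryEquiv u) = u := by
  rw [← linear_mul, T.refl_sq]; rfl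

theorem act_frame_succ_inv (F : ℤ → ι) (i : ℤ) (x : Plane × Plane) :
    act (T.frame F (i + 1))⁻¹ x = act (T.refl (F (i + 1))) (act (T.frame F i)⁻¹ x) := by
  rw [frame_succ, mul_inv_rev, refl_inv, act_mul]

theorem act_frame_inv_succ (F : ℤ → ι) (i : ℤ) (x : Plane × Plane) :
    act (T.frame F i)⁻¹ x = act (T.refl (F (i + 1))) (act (T.frame F (i + 1))⁻¹ x) := by
  rw [act_frame_succ_inv, ← act_mul, T.refl_sq, act_one]

/-- The successive bounce points `q` and directions `d` of a trajectory with code `F`. -/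
def Bounces (T : Billiard ι) (F : ℤ → ι) (q d : ℤ → Plane) (i : ℤ) : Prop :=
  d (i + 1) = (T.refl (F i)).linearIsometryEquiv (d i) ∧
    (∃ t : ℝ, 0 < t ∧ q (i + 1) = q i + t • d (i + 1)) ∧ T.Chord (F i) (F (i + 1)) (q i) (q (i + 1))

/-- After a reflection, the motion is directed to the inner side. -/
theorem l_pos_of_reflected {a : ι} {x y z u : Plane} {s t : ℝ} (hs : 0 < s) (ht : 0 < t)
    (hx : 0 < T.l a x) (hy : T.l a y = 0) (hxy : y = x + s • u)
    (hz : z = y + t • (T.refl a).linearIsometryEquiv u) : 0 < T.l a z := by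
  have h1 : T.l a x + s * (T.l a).linear u = 0 := by
    rw [← hy, hxy, AffineMap.apply_add_smul]
  rw [hz, AffineMap.apply_add_smul, hy, linear_refl, zero_add]
  refine mul_pos ht ?_
  by_contra hn
  nlinarith

/-- Refolding the line of flight 0 to time `i` gives the line through `q i` with direction `d (i +
1)`, up to a slide `s` along itself. This is proved by induction upward and downward from 0, each
step using that the reflection fixes the bounce point. -/
theorem mem_R_of_bounces {q d : ℤ → Plane} {m : ℤ} (hm : m ≤ 0)
    (h : ∀ i, m ≤ i → T.Bounces F q d i) (n : ℤ) : (q 0, d 1) ∈ T.R F m n := by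
  have up : ∀ k : ℕ, ∃ s : ℝ, act (T.frame F k)⁻¹ (q 0, d 1) =
      (q k + s • d (k + 1), d (k + 1)) := by
    intro k
    induction k with
    | zero => exact ⟨0, by simp [act_one]⟩
    | succ k ih =>
      obtain ⟨s, hs⟩ := ih
      obtain ⟨t, -, ht⟩ := (h k (by omega)).2.1
      have h2 := h (k + 1) (by omega)
      have hq := refl_seg (openSegment_subset_segment ℝ _ _ h2.2.2.1)
      refine ⟨s - t, ?_⟩
      push_cast
      rw [act_frame_succ_inv, hs, act, h2.1, map_add_smul', show q k = q (k + 1) - t • d (k + 1) by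
        rw [ht, add_sub_cancel_right], sub_eq_add_neg, ← neg_smul, map_add_smul', hq, add_assoc,
        ← add_smul, neg_add_eq_sub]
  have down : ∀ k : ℕ, m ≤ -(k : ℤ) → ∃ s : ℝ, act (T.frame F (-k))⁻¹ (q 0, d 1) =
      (q (-k) + s • d (-k + 1), d (-k + 1)) := by
    intro k
    induction k with
    | zero => exact fun _ => ⟨0, by simp [act_one]⟩
    | succ k ih =>
      intro hk
      push_cast at hk
      obtain ⟨s, hs⟩ := ih (by omega)
      obtain ⟨i, hi⟩ : ∃ i : ℤ, i = -((k + 1 : ℕ) : ℤ) := ⟨_, rfl⟩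
      have hi' : -(k : ℤ) = i + 1 := by rw [hi]; push_cast; ring
      rw [hi'] at hs
      rw [← hi]
      obtain ⟨t, -, ht⟩ := (h i (by omega)).2.1
      have h2 := h (i + 1) (by omega)
      have hq := refl_seg (openSegment_subset_segment ℝ _ _ h2.2.2.1)
      refine ⟨t + s, ?_⟩
      rw [act_frame_inv_succ, hs, act, map_add_smul', hq, h2.1, linear_refl_refl, ht, add_assoc,
        ← add_smul]
  intro i hi hin
  obtain ⟨s, hs⟩ : ∃ s : ℝ, act (T.frame F i)⁻¹ (q 0, d 1) = (q i + s • d (i + 1), d (i + 1)) := by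
    rcases le_total 0 i with h0 | h0
    · obtain ⟨k, rfl⟩ := Int.eq_ofNat_of_zero_le h0
      exact up k
    · obtain ⟨k, hk⟩ := Int.eq_ofNat_of_zero_le (neg_nonneg.2 h0)
      obtain rfl : i = -(k : ℤ) := by omega
      exact down k hi
  obtain ⟨-, ⟨t, ht0, ht⟩, hc⟩ := h i hi
  rw [hs]
  refine ⟨-s, t - s, by linarith, ?_⟩
  rw [ht] at hc
  rw [add_assoc, add_assoc, ← add_smul, ← add_smul, add_neg_cancel, zero_smul, add_zero,
    add_sub_cancel]
  exact hc

/-- The bounce points are the crossings of the refolded lines with their edges. As `d i` is the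
direction in which `q i` is reached, it is the direction of the refolding at time `i - 1`. -/
theorem exists_bounces {p : ℤ → Prop} {x : Plane × Plane} (hx : ‖x.2‖ = 1)
    (h : ∀ i, p i → act (T.frame F i)⁻¹ x ∈ T.C (F i) (F (i + 1))) :
    ∃ q d : ℤ → Plane, ‖d 1‖ = 1 ∧ ∀ i, p i → T.Bounces F q d i := by
  set y := fun i => act (T.frame F i)⁻¹ x with hy
  have hys : ∀ i, y (i + 1) = act (T.refl (F (i + 1))) (y i) := fun i => act_frame_succ_inv F i x
  refine ⟨fun i => (y i).1 + T.param (F i) (y i) • (y i).2, fun i => (y (i - 1)).2, ?_,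
    fun i hi => ?_⟩
  · simp [hy, act, hx]
  · have hC := mem_C_iff.1 (h i hi)
    change T.param (F i) (y i) < T.param (F (i + 1)) (y i) ∧ _ at hC
    obtain ⟨h1, h2, h3, h4⟩ := hC
    have hp : T.param (F (i + 1)) (y (i + 1)) = T.param (F (i + 1)) (y i) := by
      rw [hys, act, param, param, T.l_refl, linear_refl, neg_neg, div_neg, neg_div]
    have hq : (y (i + 1)).1 + T.param (F (i + 1)) (y (i + 1)) • (y (i + 1)).2 =
        (y i).1 + T.param (F (i + 1)) (y i) • (y i).2 := by
      rw [hp, hys, act, ← map_add_smul']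
      exact refl_seg (openSegment_subset_segment ℝ _ _ h4.2.1)
    refine ⟨?_, ⟨T.param (F (i + 1)) (y i) - T.param (F i) (y i), by linarith, ?_⟩, ?_⟩
    · have := hys (i - 1)
      rw [sub_add_cancel] at this
      simp only [add_sub_cancel_right]
      rw [this, act]
    · simp only [add_sub_cancel_right]
      rw [hq, add_assoc, ← add_smul, add_sub_cancel]
    · simp only []
      rw [hq]; exact h4

theorem orb_iff_bounces : T.Orb F ↔
    ∃ q d : ℤ → Plane, ‖d 1‖ = 1 ∧ ∀ i, T.Bounces F q d i := by
  constructor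
  · rintro ⟨x, hx, h⟩
    obtain ⟨q, d, hd, hb⟩ := exists_bounces (p := fun _ => True) hx fun i _ =>
      h i (i + 1) i le_rfl (by omega)
    exact ⟨q, d, hd, fun i => hb i trivial⟩
  · rintro ⟨q, d, hd, h⟩
    refine ⟨(q 0, d 1), hd, fun m n i hi hn => ?_⟩
    exact mem_R_of_bounces (min_le_right m 0) (fun i _ => h i) n i ((min_le_left m 0).trans hi) hn

theorem fOrb_iff_bounces : T.FOrb F ↔
    ∃ q d : ℤ → Plane, ‖d 1‖ = 1 ∧ ∀ i, 0 ≤ i → T.Bounces F q d i := by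
  constructor
  · rintro ⟨x, hx, h⟩
    exact exists_bounces hx fun i hi => h (i + 1) i hi (by omega)
  · rintro ⟨q, d, hd, h⟩
    exact ⟨(q 0, d 1), hd, mem_R_of_bounces le_rfl h⟩

theorem fOrb_congr {F' : ℤ → ι} (h : ∀ k : ℕ, F k = F' k) : T.FOrb F ↔ T.FOrb F' := by
  have : ∀ n, T.R F 0 n = T.R F' 0 n := fun n => R_congr fun j h1 _ => by
    obtain ⟨k, rfl⟩ := Int.eq_ofNat_of_zero_le (show 0 ≤ j by simpa using h1)
    exact h k
  simp only [FOrb, this]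

end Billiard

/-! ### The spectra in terms of orbits; the theorem -/

namespace PolygonalTable

variable {V 𝒜 : Type*} {P : PolygonalTable V 𝒜} {ι : Type*} (φ : ι ≃ P.BoundaryEdge)

theorem flies_iff {x u y : Plane} {a : ι} : P.Flies x u (φ a) y ↔
    (∃ t : ℝ, 0 < t ∧ y = x + t • u) ∧ openSegment ℝ x y ⊆ (P.billiard φ).region ∧
      y ∈ (P.billiard φ).E a ∧ 0 < (P.billiard φ).l a x := by
  rw [Flies, BoundaryEdge.innerSide_iff, BoundaryEdge.openEdge]
  rfl

theorem reflect_eq (a : ι) (u : Plane) :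
    P.reflect (φ a) u = ((P.billiard φ).refl a).linearIsometryEquiv u :=
  (BoundaryEdge.reflection_linear _ _).symm

/-- Two consecutive flights make a bounce. -/
theorem chord_of_flies {x y z u : Plane} {a b : ι} (h : P.Flies x u (φ a) y)
    (h' : P.Flies y (P.reflect (φ a) u) (φ b) z) : (P.billiard φ).Chord a b y z := by
  obtain ⟨⟨s, hs, hy⟩, -, hya, hx⟩ := (flies_iff φ).1 h
  obtain ⟨⟨t, ht, hz⟩, hseg, hzb, hyb⟩ := (flies_iff φ).1 h'
  rw [reflect_eq] at hz
  exact ⟨hya, hzb, hseg, hyb, Billiard.l_pos_of_reflected hs ht hx (Billiard.l_of_mem hya) hy hz⟩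

theorem flies_of_bounces {F : ℤ → ι} {q d : ℤ → Plane} {i : ℤ}
    (h : (P.billiard φ).Bounces F q d i) : d (i + 1) = P.reflect (φ (F i)) (d i) ∧
      P.Flies (q i) (d (i + 1)) (φ (F (i + 1))) (q (i + 1)) := by
  obtain ⟨h1, h2, h3⟩ := h
  rw [reflect_eq, flies_iff]
  exact ⟨h1, h2, h3.2.2.1, h3.2.1, h3.2.2.2.1⟩

/-- The base point only marks a place between bounces 0 and 1, and it can always be moved to the
bounce point `q 0`. -/
theorem mem_bounceSpectrum {E : ℤ → 𝒜} : E ∈ P.bounceSpectrum ↔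
    ∃ F, (P.billiard φ).Orb F ∧ ∀ i, E i = P.label (φ (F i)) := by
  simp only [Billiard.orb_iff_bounces]
  constructor
  · rintro ⟨p, u, hu, e, q, d, hd, -, -, h, hE⟩
    refine ⟨fun i => φ.symm (e i), ⟨q, d, hd ▸ hu, fun i => ?_⟩, fun i => by simp [hE]⟩
    have h1 := (h i).1
    have h2 := (h i).2
    have h3 := (h (i - 1)).2
    rw [sub_add_cancel] at h3
    rw [← φ.apply_symm_apply (e i)] at h1 h3
    rw [← φ.apply_symm_apply (e (i + 1))] at h2
    refine ⟨by rw [h1, reflect_eq], h2.1, ?_⟩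
    rw [h1] at h2
    exact chord_of_flies φ h3 h2
  · rintro ⟨F, ⟨q, d, hd, h⟩, hE⟩
    refine ⟨q 0, d 1, hd, fun i => φ (F i), q, d, rfl, left_mem_segment ℝ _ _, ?_,
      fun i => flies_of_bounces φ (h i), hE⟩
    obtain ⟨-, ⟨t, ht, hq⟩, -⟩ := h 0
    rw [zero_add] at hq
    intro h0
    rw [← h0] at hq
    have : t • d 1 = 0 := by simpa using hq.symm
    rcases smul_eq_zero.1 this with h2 | h2
    · exact ht.ne' h2
    · rw [h2, norm_zero] at hd; exact zero_ne_one hd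

/-- A bounce is preceded by a short flight. -/
theorem exists_flies {F : ℤ → ι} {q d : ℤ → Plane} (hd : ‖d 0‖ = 1)
    (h : (P.billiard φ).Bounces F q d 0) : ∃ p ∈ P.region, P.Flies p (d 0) (φ (F 0)) (q 0) := by
  obtain ⟨h1, ⟨t, ht, h2⟩, h3⟩ := h
  set T := P.billiard φ
  obtain ⟨ε, hε, hh⟩ := T.half (F 0) (q 0) h3.1
  have hl : (T.l (F 0)).linear (d 0) < 0 := by
    have h4 := h3.2.2.2.2
    rw [h2, AffineMap.apply_add_smul, Billiard.l_of_mem h3.1, h1, Billiard.linear_refl] at h4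
    by_contra hn
    nlinarith
  have hin : ∀ s : ℝ, 0 < s → 0 < T.l (F 0) (q 0 + (-s) • d 0) := fun s hs => by
    rw [AffineMap.apply_add_smul, Billiard.l_of_mem h3.1]
    nlinarith
  have hreg : ∀ s : ℝ, 0 < s → s < ε → q 0 + (-s) • d 0 ∈ P.region := fun s hs hse => by
    refine hh _ ?_ (hin s hs)
    rw [dist_eq_norm, add_sub_cancel_left, norm_smul, hd, mul_one, norm_neg, Real.norm_of_nonneg hs.le]
    exact hse
  refine ⟨q 0 + (-(ε / 2)) • d 0, hreg _ (by linarith) (by linarith), (flies_iff φ).2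
    ⟨⟨ε / 2, by linarith, by module⟩, ?_, h3.1, hin _ (by linarith)⟩⟩
  intro z hz
  obtain ⟨r, r0, r1, rfl⟩ := mem_openSegment_iff.1 hz
  have : q 0 + (-(ε / 2)) • d 0 + r • (q 0 - (q 0 + (-(ε / 2)) • d 0)) =
      q 0 + (-((1 - r) * (ε / 2))) • d 0 := by module
  rw [this]
  exact hreg _ (mul_pos (by linarith) (by linarith)) (by nlinarith)

/-- The flight from the base point to the first bounce imposes no further condition on the sequence:
conversely, by `exists_flies`, an orbit starting on the edge `F 0` can be prolonged backward by a
short flight inside the table, whose starting point serves as base point. -/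
theorem mem_forwardBounceSpectrum {E : ℕ → 𝒜} : E ∈ P.forwardBounceSpectrum ↔
    ∃ F, (P.billiard φ).FOrb F ∧ ∀ k : ℕ, E k = P.label (φ (F k)) := by
  simp only [Billiard.fOrb_iff_bounces]
  constructor
  · rintro ⟨p, u, hu, -, e, q, d, hd, h0, h, hE⟩
    refine ⟨fun i => φ.symm (e i.toNat), ⟨fun i => q i.toNat, fun i => d i.toNat, ?_, ?_⟩,
      fun k => by simp [hE]⟩
    · change ‖d 1‖ = 1
      rw [(h 0).1, ← φ.apply_symm_apply (e 0), reflect_eq, norm_linear, hd, hu]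
    · intro i hi
      obtain ⟨k, rfl⟩ := Int.eq_ofNat_of_zero_le hi
      change d (k + 1) = _ ∧ (∃ t : ℝ, 0 < t ∧ q (k + 1) = q k + t • d (k + 1)) ∧
        Billiard.Chord _ (φ.symm (e k)) (φ.symm (e (k + 1))) (q k) (q (k + 1))
      have h1 := (h k).1
      have h2 := (h k).2
      have h3 : ∃ x, P.Flies x (d k) (e k) (q k) := by
        cases k with
        | zero => exact ⟨p, h0⟩
        | succ k => exact ⟨q k, (h k).2⟩
      obtain ⟨x, h3⟩ := h3
      rw [← φ.apply_symm_apply (e k)] at h1 h3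
      rw [← φ.apply_symm_apply (e (k + 1))] at h2
      refine ⟨by rw [h1, reflect_eq]; rfl, h2.1, ?_⟩
      rw [h1] at h2
      exact chord_of_flies φ h3 h2
  · rintro ⟨F, ⟨q, d, hd, h⟩, hE⟩
    have hd0 : ‖d 0‖ = 1 := by
      have h1 := (h 0 le_rfl).1
      rw [zero_add] at h1
      rwa [h1, norm_linear] at hd
    obtain ⟨p, hp, hfl⟩ := exists_flies φ hd0 (h 0 le_rfl)
    refine ⟨p, d 0, hd0, Or.inl hp, fun k => φ (F k), fun k => q k, fun k => d k, rfl, hfl,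
      fun k => ?_, hE⟩
    have := flies_of_bounces φ (h k (Int.natCast_nonneg k))
    exact_mod_cast this

/-- The labels are visible in the bounce spectrum. -/
theorem range_label_eq : Set.range P.label = {a | ∃ E ∈ P.bounceSpectrum, E 0 = a} := by
  ext a
  constructor
  · rintro ⟨e, rfl⟩
    obtain ⟨F, h0, hF⟩ := (P.billiard (Equiv.refl _)).exists_orb e
    exact ⟨fun i => P.label (F i), (mem_bounceSpectrum (Equiv.refl _)).2 ⟨F, hF, fun i => rfl⟩,
      congrArg P.label h0⟩
  · rintro ⟨E, hE, rfl⟩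
    obtain ⟨F, -, h⟩ := (mem_bounceSpectrum (Equiv.refl _)).1 hE
    exact ⟨_, (h 0).symm⟩

/-- The labels are visible in the forward bounce spectrum. -/
theorem range_label_eq' : Set.range P.label = {a | ∃ E ∈ P.forwardBounceSpectrum, E 0 = a} := by
  ext a
  constructor
  · rintro ⟨e, rfl⟩
    obtain ⟨F, h0, x, hx, hF⟩ := (P.billiard (Equiv.refl _)).exists_orb e
    exact ⟨fun k => P.label (F k), (mem_forwardBounceSpectrum (Equiv.refl _)).2
      ⟨F, ⟨x, hx, hF 0⟩, fun i => rfl⟩, congrArg P.label h0⟩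
  · rintro ⟨E, hE, rfl⟩
    obtain ⟨F, -, h⟩ := (mem_forwardBounceSpectrum (Equiv.refl _)).1 hE
    exact ⟨_, (h 0).symm⟩

/-- The boundary edges indexed by their labels. -/
noncomputable def edgeOfLabel (P : PolygonalTable V 𝒜) {L : Set 𝒜} (h : L = Set.range P.label) :
    L ≃ P.BoundaryEdge :=
  (Equiv.setCongr h).trans (Equiv.ofInjective _ P.label.injective).symm

theorem label_edgeOfLabel {L : Set 𝒜} (h : L = Set.range P.label) (a : L) :
    P.label (P.edgeOfLabel h a) = a :=
  Equiv.apply_ofInjective_symm P.label.injective (Equiv.setCongr h a)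

theorem orb_iff_mem {L : Set 𝒜} (h : L = Set.range P.label) {F : ℤ → L} :
    (P.billiard (P.edgeOfLabel h)).Orb F ↔ (fun i => (F i : 𝒜)) ∈ P.bounceSpectrum := by
  rw [mem_bounceSpectrum (P.edgeOfLabel h)]
  constructor
  · exact fun hF => ⟨F, hF, fun i => (label_edgeOfLabel h _).symm⟩
  · rintro ⟨F', hF', he⟩
    obtain rfl : F = F' := funext fun i => Subtype.ext ((he i).trans (label_edgeOfLabel h _))
    exact hF'

theorem fOrb_iff_mem {L : Set 𝒜} (h : L = Set.range P.label) {F : ℤ → L} :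
    (P.billiard (P.edgeOfLabel h)).FOrb F ↔
      (fun k : ℕ => (F k : 𝒜)) ∈ P.forwardBounceSpectrum := by
  rw [mem_forwardBounceSpectrum (P.edgeOfLabel h)]
  constructor
  · exact fun hF => ⟨F, hF, fun i => (label_edgeOfLabel h _).symm⟩
  · rintro ⟨F', hF', he⟩
    exact (Billiard.fOrb_congr fun k =>
      Subtype.ext ((he k).trans (label_edgeOfLabel h _))).2 hF'

theorem bounceSpectrum_subset {V' : Type*} {P' : PolygonalTable V' 𝒜} {L : Set 𝒜}
    (h : L = Set.range P.label) (h' : L = Set.range P'.label)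
    (hO : ∀ F, (P.billiard (P.edgeOfLabel h)).Orb F → (P'.billiard (P'.edgeOfLabel h')).Orb F) :
    P.bounceSpectrum ⊆ P'.bounceSpectrum := by
  intro E hE
  obtain ⟨F, hF, he⟩ := (mem_bounceSpectrum (P.edgeOfLabel h)).1 hE
  obtain rfl : E = fun i => (F i : 𝒜) := funext fun i => (he i).trans (label_edgeOfLabel h _)
  exact (orb_iff_mem h').1 (hO F hF)

theorem forwardBounceSpectrum_subset {V' : Type*} {P' : PolygonalTable V' 𝒜} {L : Set 𝒜}
    (h : L = Set.range P.label) (h' : L = Set.range P'.label)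
    (hO : ∀ F, (P.billiard (P.edgeOfLabel h)).FOrb F → (P'.billiard (P'.edgeOfLabel h')).FOrb F) :
    P.forwardBounceSpectrum ⊆ P'.forwardBounceSpectrum := by
  intro E hE
  obtain ⟨F, hF, he⟩ := (mem_forwardBounceSpectrum (P.edgeOfLabel h)).1 hE
  obtain rfl : E = fun k : ℕ => (F k : 𝒜) := funext fun i => (he i).trans (label_edgeOfLabel h _)
  exact (fOrb_iff_mem h').1 (hO F hF)

/-- Tables with the same labels have the same bounce spectra if and only if they have the same
forward bounce spectra. -/
theorem bounceSpectrum_eq_iff {V' : Type*} {P' : PolygonalTable V' 𝒜}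
    (hL : Set.range P.label = Set.range P'.label) : P.bounceSpectrum = P'.bounceSpectrum ↔
      P.forwardBounceSpectrum = P'.forwardBounceSpectrum := by
  have : Finite (Set.range P.label) := Finite.of_equiv _ (P.edgeOfLabel rfl).symm
  have hiff := Billiard.orb_iff_fOrb (T := P.billiard (P.edgeOfLabel rfl))
    (T' := P'.billiard (P'.edgeOfLabel hL))
  constructor
  · intro h
    have h1 := hiff.1 fun F => by rw [orb_iff_mem, orb_iff_mem, h]
    exact (forwardBounceSpectrum_subset rfl hL fun F => (h1 F).1).antisymm
      (forwardBounceSpectrum_subset hL rfl fun F => (h1 F).2)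
  · intro h
    have h1 := hiff.2 fun F => by rw [fOrb_iff_mem, fOrb_iff_mem, h]
    exact (bounceSpectrum_subset rfl hL fun F => (h1 F).1).antisymm
      (bounceSpectrum_subset hL rfl fun F => (h1 F).2)

end PolygonalTable

/-- Equality of either spectrum gives equality of the sets of labels, since every edge is hit at
time 0 by some orbit. This is what `bounceSpectrum_eq_iff` needs to index both tables by one type.
-/
theorem mainTheorem8 {𝒜 V V' : Type*} (P : PolygonalTable V 𝒜) (P' : PolygonalTable V' 𝒜) :
    P.bounceSpectrum = P'.bounceSpectrum ↔
      P.forwardBounceSpectrum = P'.forwardBounceSpectrum := by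
  constructor
  · exact fun h => (PolygonalTable.bounceSpectrum_eq_iff (by
      rw [PolygonalTable.range_label_eq, PolygonalTable.range_label_eq, h])).1 h
  · exact fun h => (PolygonalTable.bounceSpectrum_eq_iff (by
      rw [PolygonalTable.range_label_eq', PolygonalTable.range_label_eq', h])).2 h
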